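/- Let $X=\{x_0,x_1\}$ and $Y=\{y_k\}_{k\ge1}$. For an alphabet $\mathcal X$, $\mathbb C\langle\mathcal X\rangle$ (resp. $\mathbb C\langle\langle\mathcal X\rangle\rangle$) denotes the noncommutative polynomials (resp. series) over $\mathcal X$, and $S^*=\sum_{n\ge0}S^n$ (powers for concatenation) the Kleene star of a series $S$ without constant term. A series $S$ is called rationally exchangeable if $\langle S\mid w\rangle=\beta\mu(w)\eta$ for all words $w$, for some $n$, some row vector $\beta$ and column vector $\eta$ of size $n$, and some multiplicative family $\mu$ of complex $n\times n$ matrices such that the $\mu(x)$, $x\in\mathcal X$, commute pairwise; $\mathbb C^{\mathrm{rat}}_{\mathrm{exc}}\langle\langle\mathcal X\rangle\rangle$ is the set of these series. Let ${\sqcup\!\sqcup}$ be the shuffle product and let $\uplus $ be the quasi-shuffle product on series over $Y$, given on words by $y_iu\uplus y_jv=y_i(u\uplus y_jv)+y_j(y_iu\uplus v)+y_{i+j}(u\uplus v)$. For a word $w$ over $X$ let $\mathrm{Li}_w$ be the polylogarithm: the iterated integral from $0$ of $\omega_0=dz/z$ and $\omega_1=dz/(1-z)$ (the first letter being integrated last),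 with $\mathrm{Li}_{x_0^n}(z)=\log^n(z)/n!$. For a word $w=y_{s_1}\cdots y_{s_r}$ let $\mathrm H_w(n)=\sum_{n\ge n_1>\dots>n_r>0}n_1^{-s_1}\cdots n_r^{-s_r}$. The character $\zeta_{\sqcup\!\sqcup}$ of $(\mathbb C\langle X\rangle,{\sqcup\!\sqcup})$ maps a word $w$ to the finite part of $\mathrm{Li}_w(z)$ as $z\to1$ in the scale $\{(1-z)^a\log^b(1-z)\}_{a\in\mathbb Z,b\in\mathbb N}$, and the character $\gamma_\bullet$ of $(\mathbb C\langle Y\rangle,\uplus )$ maps a word $w$ to the finite part of $\mathrm H_w(n)$ as $n\to\infty$ in the scale $\{n^a\log^b n\}_{a\in\mathbb Z,b\in\mathbb N}$; both finite parts exist for every word. For $|z|<1$ put $$\ell_1(z)=\gamma z-\sum_{k\ge2}\zeta(k)\frac{(-z)^k}{k},\qquad \ell_r(z)=-\sum_{k\ge1}\zeta(kr)\frac{(-z^r)^k}{k}\quad(r\ge2),\qquad \Gamma_{y_r}(1+z)=e^{-\ell_r(z)}\quad(r\ge1),$$ where $\gamma$ is Euler's constant. Let $E$ be the $\mathbb C$-linear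 span of the functions $e^{\ell_r}$, i.e. $z\mapsto\Gamma_{y_r}^{-1}(1+z)$, $r\ge1$, on the open unit disc, and $\mathbb C[E]$ the algebra of functions generated by $E$. **Theorem.** 1. $\zeta_{\sqcup\!\sqcup}$ extends to a character (unital $\mathbb C$-algebra morphism to $\mathbb C$) of $(\mathbb C\langle X\rangle{\sqcup\!\sqcup}\,\mathbb C^{\mathrm{rat}}_{\mathrm{exc}}\langle\langle X\rangle\rangle,{\sqcup\!\sqcup})$ such that $(tx_0)^*\mapsto1$ and $(tx_1)^*\mapsto1$ for all $t\in\mathbb C$ with $|t|<1$. 2. $\gamma_\bullet$ extends to a character of $(\mathbb C\langle Y\rangle\uplus \,\mathbb C^{\mathrm{rat}}_{\mathrm{exc}}\langle\langle Y\rangle\rangle,\uplus )$ such that $(t^ry_r)^*\mapsto\Gamma_{y_r}^{-1}(1+t)$ for all $r\ge1$ and all $t\in\mathbb C$ with $|t|<1$. 3. There is an algebra morphism $(\mathbb C[\{y_r^*\}_{r\ge1}],{\sqcup\!\sqcup})\to\mathbb C[E]$, where $\mathbb C[\{y_r^*\}_{r\ge1}]$ is the shuffle subalgebra generated by the $y_r^*$,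 mapping $y_r^*$ to the function $z\mapsto\Gamma_{y_r}^{-1}(1+z)$ for every $r\ge1$, and it is injective. 4. For every $r\ge1$, every $\xi\in\mathbb C$ with $\xi^{2r}=-1$, every $\eta\in\mathbb C$ with $\eta^r=-1$ and every $t\in\mathbb C$ with $|t|<1$, $$\Gamma_{y_{2r}}(1+\xi t)=\Gamma_{y_r}(1+t)\,\Gamma_{y_r}(1+\eta t).$$ -/

import Mathlib

open Filter Topology
open scoped BigOperators

noncomputable section

/-! ### Noncommutative series and the (quasi-)shuffle products -/

/-- Contraction rule of a quasi-shuffle product: `split s` lists the pairs `(i, j)` of letters whose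
contraction is the letter `s`.  The two laws make the product commutative and associative. -/
structure Contraction (α : Type) where
  split : α → Finset (α × α)
  split_comm : ∀ (s : α) (f : α → α → ℂ),
    ∑ p ∈ split s, f p.1 p.2 = ∑ p ∈ split s, f p.2 p.1
  split_assoc : ∀ (s : α) (f : α → α → α → ℂ),
    ∑ p ∈ split s, ∑ q ∈ split p.1, f q.1 q.2 p.2 =
      ∑ p ∈ split s, ∑ q ∈ split p.2, f p.1 q.1 q.2

/-- No contraction at all: the corresponding product is the shuffle product. -/
def noContraction (α : Type) : Contraction α where
  split _ := ∅
  split_comm _ _ := rfl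
  split_assoc _ _ := rfl

/-- The pairs `(i, j)` of positive integers with `i + j = s`. -/
def addPairs (s : ℕ+) : Finset (ℕ+ × ℕ+) :=
  (Finset.Icc 1 s ×ˢ Finset.Icc 1 s).filter fun p => p.1 + p.2 = s

theorem mem_addPairs (s i j : ℕ+) : (i, j) ∈ addPairs s ↔ i + j = s := by
  simp only [addPairs, Finset.mem_filter, Finset.mem_product, Finset.mem_Icc]
  have hi := i.pos
  have hj := j.pos
  simp only [← PNat.coe_le_coe, ← PNat.coe_inj, PNat.add_coe, PNat.one_coe]
  omega

/-- The letters `y_i` and `y_j` (`i, j ≥ 1`) contract to `y_(i+j)`. -/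
def addContraction : Contraction ℕ+ where
  split := addPairs
  split_comm s f := by
    refine Finset.sum_nbij' Prod.swap Prod.swap ?_ ?_ ?_ ?_ ?_ <;>
      simp +contextual [mem_addPairs, add_comm]
  split_assoc s f := by
    rw [Finset.sum_sigma', Finset.sum_sigma']
    refine Finset.sum_nbij' (fun x => ⟨(x.2.1, x.2.2 + x.1.2), (x.2.2, x.1.2)⟩)
      (fun x => ⟨(x.1.1 + x.2.1, x.2.2), (x.1.1, x.2.1)⟩) ?_ ?_ ?_ ?_ ?_
    · rintro ⟨⟨a, b⟩, ⟨c, d⟩⟩ h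
      simp only [Finset.mem_sigma, mem_addPairs] at h ⊢
      exact ⟨by rw [← add_assoc, h.2, h.1], trivial⟩
    · rintro ⟨⟨a, b⟩, ⟨c, d⟩⟩ h
      simp only [Finset.mem_sigma, mem_addPairs] at h ⊢
      exact ⟨by rw [add_assoc, h.2, h.1], trivial⟩
    · rintro ⟨⟨a, b⟩, ⟨c, d⟩⟩ h
      simp only [Finset.mem_sigma, mem_addPairs] at h
      simp [h.2]
    · rintro ⟨⟨a, b⟩, ⟨c, d⟩⟩ h
      simp only [Finset.mem_sigma, mem_addPairs] at h
      simp [h.2]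
    · rintro ⟨⟨a, b⟩, ⟨c, d⟩⟩ h
      rfl

/-- The noncommutative series `ℂ⟨⟨α⟩⟩` (the value at a word is the coefficient of that word),
equipped with the quasi-shuffle product attached to the contraction rule `D`. -/
def QSeries {α : Type} (_D : Contraction α) : Type := List α → ℂ

/-- A series, seen in the algebra attached to `D`. -/
def QSeries.of {α : Type} (D : Contraction α) (S : List α → ℂ) : QSeries D := S

namespace QSeries

variable {α : Type} {D : Contraction α}

instance : AddCommGroup (QSeries D) := inferInstanceAs (AddCommGroup (List α → ℂ))
instance : Module ℂ (QSeries D) := inferInstanceAs (Module ℂ (List α → ℂ))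

/-- The coefficient of a word in the quasi-shuffle product of two series, by recursion on the word:
with `x⁻¹S` denoting the series `w ↦ ⟨S, xw⟩`,
`x⁻¹(S ∗ T) = x⁻¹S ∗ T + S ∗ x⁻¹T + ∑ i⁻¹S ∗ j⁻¹T` over the pairs `(i, j)` contracting to `x`.
On words this is `au ∗ bv = a(u ∗ bv) + b(au ∗ v) + [a,b](u ∗ v)`. -/
def prodCoeff (D : Contraction α) : List α → (List α → ℂ) → (List α → ℂ) → ℂ
  | [], S, T => S [] * T []
  | x :: w, S, T =>
      prodCoeff D w (fun u => S (x :: u)) T + prodCoeff D w S (fun u => T (x :: u)) +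
        ∑ p ∈ D.split x, prodCoeff D w (fun u => S (p.1 :: u)) (fun u => T (p.2 :: u))

instance : Mul (QSeries D) := ⟨fun S T w => prodCoeff D w S T⟩

/-- The series reduced to the empty word. -/
instance : One (QSeries D) := ⟨fun w => match w with | [] => 1 | _ :: _ => 0⟩

theorem prodCoeff_add_left (w : List α) : ∀ S S' T : List α → ℂ,
    prodCoeff D w (fun u => S u + S' u) T = prodCoeff D w S T + prodCoeff D w S' T := by
  induction w with
  | nil => intro S S' T; simp [prodCoeff, add_mul]
  | cons x w ih =>
    intro S S' T
    simp only [prodCoeff, ih, Finset.sum_add_distrib]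
    ring

theorem prodCoeff_smul_left (c : ℂ) (w : List α) : ∀ S T : List α → ℂ,
    prodCoeff D w (fun u => c * S u) T = c * prodCoeff D w S T := by
  induction w with
  | nil => intro S T; simp [prodCoeff, mul_assoc]
  | cons x w ih =>
    intro S T
    simp only [prodCoeff, ih, mul_add, Finset.mul_sum]

theorem prodCoeff_zero_left (w : List α) (T : List α → ℂ) :
    prodCoeff D w (fun _ => 0) T = 0 := by
  simpa using prodCoeff_smul_left (D := D) 0 w (fun _ => 0) T

theorem prodCoeff_sum_left {ι : Type} (s : Finset ι) (w : List α) (F : ι → List α → ℂ)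
    (T : List α → ℂ) :
    prodCoeff D w (fun u => ∑ i ∈ s, F i u) T = ∑ i ∈ s, prodCoeff D w (F i) T := by
  classical
  induction s using Finset.induction_on with
  | empty => simp [prodCoeff_zero_left]
  | insert a s ha ih =>
    simp only [Finset.sum_insert ha]
    rw [prodCoeff_add_left w (F a) (fun u => ∑ i ∈ s, F i u) T, ih]

theorem prodCoeff_comm (w : List α) : ∀ S T : List α → ℂ,
    prodCoeff D w S T = prodCoeff D w T S := by
  induction w with
  | nil => intro S T; simp [prodCoeff, mul_comm]
  | cons x w ih =>
    intro S T
    simp only [prodCoeff]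
    rw [D.split_comm x
      (fun i j => prodCoeff D w (fun u => S (i :: u)) (fun u => T (j :: u)))]
    rw [ih (fun u => S (x :: u)) T, ih S (fun u => T (x :: u)), add_comm (prodCoeff D w T _)]
    congr 1
    exact Finset.sum_congr rfl fun p _ => ih _ _

theorem prodCoeff_add_right (w : List α) (S T T' : List α → ℂ) :
    prodCoeff D w S (fun u => T u + T' u) = prodCoeff D w S T + prodCoeff D w S T' := by
  rw [prodCoeff_comm, prodCoeff_add_left, prodCoeff_comm w T, prodCoeff_comm w T']

theorem prodCoeff_sum_right {ι : Type} (s : Finset ι) (w : List α) (F : ι → List α → ℂ)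
    (S : List α → ℂ) :
    prodCoeff D w S (fun u => ∑ i ∈ s, F i u) = ∑ i ∈ s, prodCoeff D w S (F i) := by
  rw [prodCoeff_comm, prodCoeff_sum_left]
  exact Finset.sum_congr rfl fun i _ => prodCoeff_comm w _ _

theorem prodCoeff_assoc (w : List α) : ∀ S T U : List α → ℂ,
    prodCoeff D w (fun v => prodCoeff D v S T) U =
      prodCoeff D w S (fun v => prodCoeff D v T U) := by
  induction w with
  | nil => intro S T U; simp [prodCoeff, mul_assoc]
  | cons x w ih =>
    intro S T U
    simp only [prodCoeff, prodCoeff_add_left, prodCoeff_add_right, prodCoeff_sum_left,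
      prodCoeff_sum_right, ih, Finset.sum_add_distrib]
    rw [D.split_assoc x (fun i j k => prodCoeff D w (fun u => S (i :: u))
      (fun v => prodCoeff D v (fun u => T (j :: u)) (fun u => U (k :: u))))]
    ring

theorem prodCoeff_one_left (w : List α) : ∀ T : List α → ℂ,
    prodCoeff D w (1 : QSeries D) T = T w := by
  induction w with
  | nil => intro T; exact one_mul (T [])
  | cons x w ih =>
    intro T
    have h : ∀ y : α, (fun u => (1 : QSeries D) (y :: u)) = fun _ => (0 : ℂ) := fun _ => rfl
    simp only [prodCoeff, h, prodCoeff_zero_left, ih, Finset.sum_const_zero]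
    ring

instance : CommRing (QSeries D) :=
  { (inferInstance : AddCommGroup (QSeries D)) with
    mul := (· * ·)
    one := 1
    mul_assoc := fun S T U => funext fun w => prodCoeff_assoc w S T U
    mul_comm := fun S T => funext fun w => prodCoeff_comm w S T
    one_mul := fun T => funext fun w => prodCoeff_one_left w T
    mul_one := fun T => funext fun w => (prodCoeff_comm w T _).trans (prodCoeff_one_left w T)
    left_distrib := fun S T U => funext fun w => prodCoeff_add_right w S T U
    right_distrib := fun S T U => funext fun w => prodCoeff_add_left w S T U
    zero_mul := fun T => funext fun w => prodCoeff_zero_left w T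
    mul_zero := fun T => funext fun w => (prodCoeff_comm w T _).trans (prodCoeff_zero_left w T) }

instance : Algebra ℂ (QSeries D) :=
  Algebra.ofModule (fun c S T => funext fun w => prodCoeff_smul_left c w S T)
    (fun c S T => funext fun w => (prodCoeff_comm w S _).trans
      ((prodCoeff_smul_left c w T S).trans (congrArg (c * ·) (prodCoeff_comm w T S))))

end QSeries

/-- `(ℂ⟨⟨α⟩⟩, ⧢, 1)`. -/
abbrev ShuffleSeries (α : Type) : Type := QSeries (noContraction α)

/-- `(ℂ⟨⟨Y⟩⟩, quasi-shuffle, 1)` with `Y = {y_k}_{k ≥ 1}`; the letter `y_k` is `k : ℕ+`. -/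
abbrev StuffleSeries : Type := QSeries addContraction

/-! ### Words, Kleene stars, polynomials, rationally exchangeable series -/

section Series

variable {α : Type}

open Classical in
/-- The word `w` as a series. -/
def wordSeries (w : List α) : List α → ℂ := fun u => if u = w then 1 else 0

/-- Concatenation (Cauchy) product of series. -/
def concMul (S T : List α → ℂ) : List α → ℂ := fun w =>
  ∑ i ∈ Finset.range (w.length + 1), S (w.take i) * T (w.drop i)

/-- Powers for the concatenation product. -/
def concPow (S : List α → ℂ) : ℕ → List α → ℂ
  | 0 => wordSeries []
  | n + 1 => concMul S (concPow S n)

/-- Kleene star `S^* = 1 + S + S² + ⋯` of a series without constant term; the powers of exponent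
larger than the length of `w` do not contribute to the coefficient of `w`. -/
def kleeneStar (S : List α → ℂ) : List α → ℂ := fun w =>
  ∑ n ∈ Finset.range (w.length + 1), concPow S n w

/-- The series `(c x)^*` for a letter `x` and a scalar `c`. -/
def letterStar (c : ℂ) (x : α) : List α → ℂ := kleeneStar (c • wordSeries [x])

/-- Noncommutative polynomials `ℂ⟨α⟩`: series with finite support. -/
def polynomials (α : Type) : Set (List α → ℂ) := {S | {w | S w ≠ 0}.Finite}

/-- Rationally exchangeable series: those with a linear representation `(β, μ, η)`,
`⟨S, w⟩ = β μ(w) η`, whose matrices `μ(x)` commute pairwise. -/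
def ratExchangeable (α : Type) : Set (List α → ℂ) :=
  {S | ∃ (n : ℕ) (β η : Fin n → ℂ) (μ : α → Matrix (Fin n) (Fin n) ℂ),
    (∀ x y, μ x * μ y = μ y * μ x) ∧
      ∀ w : List α, S w = β ⬝ᵥ ((w.map μ).prod.mulVec η)}

/-- The algebra `ℂ⟨α⟩ ∗ ℂ_exc^rat⟨⟨α⟩⟩` generated, for the product `∗` attached to `D`, by the
polynomials and the rationally exchangeable series. -/
def extendedDomain (D : Contraction α) : Subalgebra ℂ (QSeries D) :=
  Algebra.adjoin ℂ (QSeries.of D '' (polynomials α ∪ ratExchangeable α))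

theorem wordSeries_mem (D : Contraction α) (w : List α) :
    QSeries.of D (wordSeries w) ∈ extendedDomain D := by
  refine Algebra.subset_adjoin ⟨wordSeries w, Or.inl ?_, rfl⟩
  refine (Set.finite_singleton w).subset fun u hu => ?_
  by_contra h
  exact hu (if_neg h)

open Classical in
theorem concPow_letter (c : ℂ) (x : α) (n : ℕ) : ∀ w : List α,
    concPow (c • wordSeries [x]) n w =
      if w.length = n then (w.map fun y => if y = x then c else 0).prod else 0 := by
  induction n with
  | zero =>
    intro w
    cases w <;> simp [concPow, wordSeries]
  | succ n ih =>
    intro w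
    simp only [concPow, concMul, ih, Pi.smul_apply, smul_eq_mul]
    cases w with
    | nil => simp [wordSeries]
    | cons y w =>
      rw [Finset.sum_eq_single 1]
      · by_cases h : w.length = n <;> by_cases hy : y = x <;> simp [h, hy, wordSeries]
      · intro i hi h1
        have hlen : (List.take i (y :: w)).length ≠ 1 := by
          simp only [Finset.mem_range] at hi
          rw [List.length_take]
          omega
        have : List.take i (y :: w) ≠ [x] := fun h => hlen (by simp [h])
        simp [wordSeries, this]
      · intro h
        simp at h

open Classical in
theorem letterStar_apply (c : ℂ) (x : α) (w : List α) :
    letterStar c x w = (w.map fun y => if y = x then c else 0).prod := by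
  simp only [letterStar, kleeneStar, concPow_letter]
  simp

theorem letterStar_mem (D : Contraction α) (c : ℂ) (x : α) :
    QSeries.of D (letterStar c x) ∈ extendedDomain D := by
  classical
  refine Algebra.subset_adjoin ⟨letterStar c x, Or.inr ⟨1, 1, 1,
    fun y => Matrix.scalar _ (if y = x then c else 0), fun y z => ?_, fun w => ?_⟩, rfl⟩
  · rw [← map_mul, ← map_mul, mul_comm]
  · rw [letterStar_apply]
    have : (w.map fun y => Matrix.scalar (Fin 1) (if y = x then c else 0)).prod =
        Matrix.scalar (Fin 1) (w.map fun y => if y = x then c else 0).prod := by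
      rw [map_list_prod, List.map_map]
      rfl
    rw [this]
    simp [Matrix.mulVec, dotProduct]

/-- The word `w` as an element of the extended domain. -/
def wordElt (D : Contraction α) (w : List α) : extendedDomain D :=
  ⟨QSeries.of D (wordSeries w), wordSeries_mem D w⟩

/-- `(c x)^*` as an element of the extended domain. -/
def starElt (D : Contraction α) (c : ℂ) (x : α) : extendedDomain D :=
  ⟨QSeries.of D (letterStar c x), letterStar_mem D c x⟩

end Series

/-! ### Finite parts, polylogarithms and harmonic sums -/

/-- `L` is the finite part of `f` along `l` in the scale `{p^a q^b}`, `a ∈ ℤ`, `b ∈ ℕ`: up to a term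
tending to `0`, `f` is a finite combination of the `p^a q^b` in which `p^0 q^0` has coefficient
`L`. -/
def HasFinitePart {ι : Type} (l : Filter ι) (p q : ι → ℝ) (f : ι → ℝ) (L : ℂ) : Prop :=
  ∃ c : ℤ × ℕ →₀ ℂ,
    Tendsto (fun i => (f i : ℂ) - c.sum fun ab k => k * ((p i ^ ab.1 * q i ^ ab.2 : ℝ) : ℂ)) l
      (𝓝 0) ∧ c (0, 0) = L

/-- Polylogarithms `Li_w(z)`, `0 < z < 1`, indexed by words in `x_0, x_1` (the letter `x_i` is
`i : Fin 2`): iterated integrals from `0` of `ω_0 = dz/z` and `ω_1 = dz/(1-z)`, the first letter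
being integrated last, with `Li_{x_0^n}(z) = log(z)^n / n!`. -/
def Li : List (Fin 2) → ℝ → ℝ
  | [] => fun _ => 1
  | i :: w => fun z =>
      if i = 0 then
        if ∀ j ∈ w, j = 0 then Real.log z ^ (w.length + 1) / (Nat.factorial (w.length + 1) : ℝ)
        else ∫ s in (0 : ℝ)..z, Li w s / s
      else ∫ s in (0 : ℝ)..z, Li w s / (1 - s)

/-- Harmonic sums `H_{s_1,…,s_r}(n) = ∑_{n ≥ n_1 > ⋯ > n_r > 0} n_1^{-s_1} ⋯ n_r^{-s_r}`. -/
def harmonicSum : List ℕ+ → ℕ → ℝ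
  | [], _ => 1
  | s :: w, n => ∑ m ∈ Finset.Icc 1 n, ((m : ℝ) ^ (s : ℕ))⁻¹ * harmonicSum w (m - 1)

/-- `L` is the finite part of `Li_w(z)` as `z → 1` in the scale `{(1-z)^a log^b(1-z)}`;
this is the value of the character `ζ_⧢` at the word `w`. -/
def IsZetaShuffleValue (w : List (Fin 2)) (L : ℂ) : Prop :=
  HasFinitePart (𝓝[<] (1 : ℝ)) (fun z => 1 - z) (fun z => Real.log (1 - z)) (Li w) L

/-- `L` is the finite part of `H_w(n)` as `n → ∞` in the scale `{n^a log^b n}`;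
this is the value of the character `γ_•` at the word `w`. -/
def IsGammaValue (w : List ℕ+) (L : ℂ) : Prop :=
  HasFinitePart (atTop : Filter ℕ) (fun n => (n : ℝ)) (fun n => Real.log n) (harmonicSum w) L

/-! ### Eulerian functions -/

/-- For `|z| < 1`: `ℓ_1(z) = γ z - ∑_{k ≥ 2} ζ(k) (-z)^k / k` and, for `r ≥ 2`,
`ℓ_r(z) = - ∑_{k ≥ 1} ζ(kr) (-z^r)^k / k`. -/
def ell (r : ℕ+) (z : ℂ) : ℂ :=
  if r = 1 then
    (Real.eulerMascheroniConstant : ℂ) * z -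
      ∑' k : ℕ, riemannZeta ((k + 2 : ℕ) : ℂ) * (-z) ^ (k + 2) / ((k + 2 : ℕ) : ℂ)
  else
    -∑' k : ℕ, riemannZeta (((k + 1) * (r : ℕ) : ℕ) : ℂ) * (-z ^ (r : ℕ)) ^ (k + 1) /
      ((k + 1 : ℕ) : ℂ)

/-- `Γ_{y_r}(1 + z) = exp(-ℓ_r(z))` for `|z| < 1`. -/
def GammaY (r : ℕ+) (w : ℂ) : ℂ := Complex.exp (-ell r (w - 1))

/-- The function `z ↦ Γ_{y_r}^{-1}(1 + z) = exp(ℓ_r(z))` on the open unit disc. -/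
def invGammaY (r : ℕ+) : Metric.ball (0 : ℂ) 1 → ℂ := fun z => (GammaY r (1 + z))⁻¹

/-- `E`, the linear span of the functions `exp(ℓ_r)`, `r ≥ 1`. -/
def spanE : Submodule ℂ (Metric.ball (0 : ℂ) 1 → ℂ) :=
  Submodule.span ℂ (Set.range invGammaY)

/-- `ℂ[E]`, the algebra of functions generated by `E`. -/
def algE : Subalgebra ℂ (Metric.ball (0 : ℂ) 1 → ℂ) := Algebra.adjoin ℂ (spanE : Set _)

theorem invGammaY_mem (r : ℕ+) : invGammaY r ∈ algE :=
  Algebra.subset_adjoin (Submodule.subset_span ⟨r, rfl⟩)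

/-- `y_r^*` in the shuffle algebra `(ℂ⟨⟨Y⟩⟩, ⧢, 1)`. -/
def yStar (r : ℕ+) : ShuffleSeries ℕ+ := QSeries.of _ (letterStar 1 r)

/-- `(ℂ[{y_r^*}_{r ≥ 1}], ⧢, 1)`. -/
def yStarAlgebra : Subalgebra ℂ (ShuffleSeries ℕ+) := Algebra.adjoin ℂ (Set.range yStar)

theorem yStar_mem (r : ℕ+) : yStar r ∈ yStarAlgebra := Algebra.subset_adjoin ⟨r, rfl⟩

end

/-! Assertions 1 and 2 rest on the structure of the algebra generated, under shuffle, by polynomials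
and rationally exchangeable series. Commuting matrices over ℂ split the space into simultaneous
generalized eigenspaces, on each of which μ(x) is a scalar χ(x) plus a nilpotent part. Hence every
rationally exchangeable series is a combination of shuffle products of letter series ∑ a(x) x and
multiplicative series (∑ χ(x) x)^* (`Shuffle.ratExchangeable_subset`). The multiplicative series are
linearly independent over series of bounded length (`Shuffle.charSeries_independent`). Letter series
that are independent modulo finitely supported ones are algebraically independent over the
polynomials (`Shuffle.letterEval_injective`). The algebra therefore embeds in a group algebra over a
polynomial ring over the algebra of polynomials, and a character of the polynomials and a
homomorphism on the group of all χ can be prescribed independently (`Shuffle.exists_character`). The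
character on polynomials is the constant term of an asymptotic expansion: polylogarithms at 1 and
harmonic sums at infinity are polynomials in a logarithm up to a power-small error, such expansions
are unique, and products of words correspond to products of functions.

For ζ the homomorphism on the χ is trivial. For γ the quasi-shuffle algebra is first mapped to the
shuffle algebra. The left derivatives are group-like rather than primitive for the quasi-shuffle;
Newton's identities turn them into derivations (`Stuffle.prim_mul`), and reading these as left
derivatives gives the morphism `Stuffle.toShuffle`. It is bijective on polynomials and sends (t^r
y_r)^* to the multiplicative series of the power sums p_s. The homomorphism is the exponential of a
linear functional that extends c ↦ γ c_1 + ∑ ζ(k) c_k / k, and this series at p sums to ℓ_r(t)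
(`hasSum_gammaCoeff`). The same series proves assertion 4, because the power sums of both sides
agree.

Assertion 3 says that two families are algebraically independent. Distinct monomials in the y_r^*
are distinct multiplicative series, so the first family is settled by
`Shuffle.charSeries_independent`. For the second, exp ℓ_r extends to the entire function ∏ 1/Γ(1+ρz)
over ρ^r = (-1)^(r-1) (`invGammaY_eq_eulerian`), and there are three layers.

Even r: the reflection formula gives products of sin(πρz)/(πρz), which are exponential polynomials.
A formal relation between them survives every additive substitution of the frequencies. Galois
conjugations w ↦ w^b combined with free parameters, and z → 0, yield polynomials with triangular
Jacobian (`algebraicIndependent_evenPoly`).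

Odd r > 1: these functions are independent over all exponential polynomials. Along a generic
direction Stirling's formula makes each of them, up to sinc factors, an exponential times a function
of polynomial growth, so a relation splits according to exponential rates. Turning the direction
across one wall multiplies coefficients by powers of a sinc, and counting frequencies forces the
exponents of all monomials to agree (`EulerRelation.eq_zero`).

r = 1: 1/Γ(1+z) decays faster than any exponential in the right half-plane, hence is transcendental
over all the rest (`expSum_eq_zero_of_polynomial`). -/

noncomputable section

/-! ### Left derivatives of series -/

namespace QSeries

variable {α : Type} {D : Contraction α}

/-- The left derivative `x⁻¹S` of a series. -/
def delta (x : α) : QSeries D →ₗ[ℂ] QSeries D where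
  toFun S := fun w => S (x :: w)
  map_add' _ _ := rfl
  map_smul' _ _ := rfl

theorem delta_apply (x : α) (S : QSeries D) (w : List α) : delta x S w = S (x :: w) := rfl

theorem add_apply' (S T : QSeries D) (w : List α) : (S + T) w = S w + T w := rfl

theorem sub_apply' (S T : QSeries D) (w : List α) : (S - T) w = S w - T w := rfl

theorem smul_apply' (c : ℂ) (S : QSeries D) (w : List α) : (c • S) w = c * S w := rfl

theorem zero_apply' (w : List α) : (0 : QSeries D) w = 0 := rfl

theorem sum_apply' {ι : Type*} (s : Finset ι) (F : ι → QSeries D) (w : List α) :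
    (∑ i ∈ s, F i) w = ∑ i ∈ s, F i w := by
  classical
  induction s using Finset.induction_on with
  | empty => rfl
  | insert a s ha ih => rw [Finset.sum_insert ha, Finset.sum_insert ha, add_apply', ih]

theorem mul_nil (S T : QSeries D) : (S * T) [] = S [] * T [] := rfl

theorem delta_one (x : α) : delta x (1 : QSeries D) = 0 := rfl

theorem delta_mul (x : α) (S T : QSeries D) :
    delta x (S * T) = delta x S * T + S * delta x T +
      ∑ p ∈ D.split x, delta p.1 S * delta p.2 T := by
  funext w
  rw [add_apply', add_apply', sum_apply']
  rfl

theorem ext_delta {S T : QSeries D} (h0 : S [] = T []) (h : ∀ x, delta x S = delta x T) :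
    S = T := by
  funext w
  cases w with
  | nil => exact h0
  | cons x w => exact congrFun (h x) w

theorem algebraMap_apply' (c : ℂ) : algebraMap ℂ (QSeries D) c = c • (1 : QSeries D) :=
  Algebra.algebraMap_eq_smul_one c

theorem delta_algebraMap (x : α) (c : ℂ) : delta x (algebraMap ℂ (QSeries D) c) = 0 := by
  rw [algebraMap_apply', map_smul, delta_one, smul_zero]

/-- The evaluation at the empty word, an algebra morphism. -/
def augmentation (D : Contraction α) : QSeries D →ₐ[ℂ] ℂ :=
  AlgHom.ofLinearMap { toFun := fun S => S [], map_add' := fun _ _ => rfl,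
                       map_smul' := fun _ _ => rfl } rfl (fun _ _ => rfl)

/-! ### Series with bounded word length -/

/-- The coefficients of all words of length at least `n` vanish. -/
def LengthLT (S : QSeries D) (n : ℕ) : Prop := ∀ w : List α, n ≤ w.length → S w = 0

theorem LengthLT.mono {S : QSeries D} {m n : ℕ} (h : LengthLT S m) (hmn : m ≤ n) :
    LengthLT S n := fun w hw => h w (hmn.trans hw)

theorem LengthLT.eq_zero {S : QSeries D} (h : LengthLT S 0) : S = 0 :=
  funext fun w => h w (Nat.zero_le _)

theorem LengthLT.delta {S : QSeries D} {n : ℕ} (h : LengthLT S (n + 1)) (x : α) :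
    LengthLT (delta x S) n := fun w hw => h (x :: w) (by simpa using hw)

theorem LengthLT.of_delta {S : QSeries D} {n : ℕ} (h : ∀ x, LengthLT (QSeries.delta x S) n) :
    LengthLT S (n + 1) := by
  intro w hw
  cases w with
  | nil => simp at hw
  | cons x w => exact h x w (by simpa using hw)

theorem LengthLT.zero (n : ℕ) : LengthLT (0 : QSeries D) n := fun _ _ => rfl

theorem LengthLT.one {n : ℕ} (hn : 0 < n) : LengthLT (1 : QSeries D) n := by
  intro w hw
  cases w with
  | nil => simp at hw; omega
  | cons x w => rfl

theorem LengthLT.add {S T : QSeries D} {n : ℕ} (hS : LengthLT S n) (hT : LengthLT T n) :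
    LengthLT (S + T) n := fun w hw => by rw [add_apply', hS w hw, hT w hw, add_zero]

theorem LengthLT.smul {S : QSeries D} {n : ℕ} (c : ℂ) (hS : LengthLT S n) :
    LengthLT (c • S) n := fun w hw => by rw [smul_apply', hS w hw, mul_zero]

theorem LengthLT.sum {ι : Type*} {s : Finset ι} {F : ι → QSeries D} {n : ℕ}
    (h : ∀ i ∈ s, LengthLT (F i) n) : LengthLT (∑ i ∈ s, F i) n := fun w hw => by
  rw [sum_apply']; exact Finset.sum_eq_zero fun i hi => h i hi w hw

theorem LengthLT.mul {m n : ℕ} : ∀ {S T : QSeries D}, LengthLT S m → LengthLT T n →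
    LengthLT (S * T) (m + n) := by
  induction h : m + n generalizing m n with
  | zero =>
    intro S T hS _
    obtain rfl : m = 0 := by omega
    rw [hS.eq_zero, zero_mul]; exact .zero _
  | succ k ih =>
    intro S T hS hT
    rcases m with _ | m
    · rw [hS.eq_zero, zero_mul]; exact .zero _
    rcases n with _ | n
    · rw [hT.eq_zero, mul_zero]; exact .zero _
    refine .of_delta fun x => ?_
    rw [delta_mul]
    refine .add (.add (ih (by omega) (hS.delta x) hT) (ih (by omega) hS (hT.delta x))) ?_
    -- A contraction shortens both factors; one of the two gains is given away so that the total is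
    -- exactly k.
    exact .sum fun p _ => (ih (m := m) (n := n + 1) (by omega) (hS.delta p.1)
      ((hT.delta p.2).mono (Nat.le_succ n)))

/-- The subalgebra of series whose words have bounded length. -/
def boundedLength (D : Contraction α) : Subalgebra ℂ (QSeries D) where
  carrier := {S | ∃ n, LengthLT S n}
  mul_mem' := fun ⟨m, hm⟩ ⟨n, hn⟩ => ⟨m + n, hm.mul hn⟩
  add_mem' := fun ⟨m, hm⟩ ⟨n, hn⟩ =>
    ⟨m + n, (hm.mono (Nat.le_add_right m n)).add (hn.mono (Nat.le_add_left n m))⟩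
  algebraMap_mem' c := ⟨1, by rw [algebraMap_apply']; exact (LengthLT.one one_pos).smul c⟩

/-! ### Polynomials -/

/-- Every pair of letters takes part in finitely many contractions. -/
def _root_.Contraction.Locally (D : Contraction α) : Prop :=
  ∀ i j, {s | (i, j) ∈ D.split s}.Finite

theorem finite_support_of_delta {S : QSeries D} (h0 : {x | delta x S ≠ 0}.Finite)
    (h : ∀ x, delta x S ∈ polynomials α) : S ∈ polynomials α := by
  refine Set.Finite.subset ((Set.finite_singleton []).union
    (h0.biUnion fun x _ => (h x).image (List.cons x))) fun w hw => ?_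
  cases w with
  | nil => exact Or.inl rfl
  | cons x w =>
    refine Or.inr (Set.mem_biUnion (x := x) (fun h => hw ?_) ⟨w, hw, rfl⟩)
    exact congrFun h w

theorem delta_mem_polynomials {S : QSeries D} (h : S ∈ polynomials α) (x : α) :
    delta x S ∈ polynomials α :=
  Set.Finite.preimage (f := List.cons x) (List.cons_injective.injOn) h

theorem finite_delta_ne_zero {S : QSeries D} (h : S ∈ polynomials α) :
    {x | delta x S ≠ 0}.Finite := by
  refine Set.Finite.subset ((h.biUnion fun w _ => (List.finite_toSet w))) fun x hx => ?_
  obtain ⟨w, hw⟩ := Function.ne_iff.1 hx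
  exact Set.mem_biUnion (x := x :: w) hw List.mem_cons_self

theorem lengthLT_of_mem_polynomials {S : QSeries D} (h : S ∈ polynomials α) :
    ∃ n, LengthLT S n := by
  obtain ⟨n, hn⟩ := (h.image List.length).bddAbove
  refine ⟨n + 1, fun w hw => ?_⟩
  by_contra h'
  have := hn ⟨w, h', rfl⟩
  omega

theorem add_mem_polynomials {S T : QSeries D} (hS : S ∈ polynomials α) (hT : T ∈ polynomials α) :
    S + T ∈ polynomials α := by
  refine Set.Finite.subset (hS.union hT) fun w hw => ?_
  by_contra h
  simp only [Set.mem_union, Set.mem_ofPred_eq, not_or, not_not] at h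
  exact hw (by rw [add_apply', h.1, h.2, add_zero])

theorem zero_mem_polynomials : (0 : QSeries D) ∈ polynomials α :=
  Set.Finite.subset Set.finite_empty fun w (hw : (0 : QSeries D) w ≠ 0) => hw rfl

theorem sum_mem_polynomials {ι : Type*} {s : Finset ι} {F : ι → QSeries D}
    (h : ∀ i ∈ s, F i ∈ polynomials α) : ∑ i ∈ s, F i ∈ polynomials α := by
  classical
  induction s using Finset.induction_on with
  | empty => exact zero_mem_polynomials
  | insert a s ha ih =>
    rw [Finset.sum_insert ha]
    exact add_mem_polynomials (h a (Finset.mem_insert_self a s))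
      (ih fun i hi => h i (Finset.mem_insert_of_mem hi))

theorem smul_mem_polynomials {S : QSeries D} (c : ℂ) (hS : S ∈ polynomials α) :
    c • S ∈ polynomials α :=
  Set.Finite.subset hS fun w hw h => hw (by rw [smul_apply', h, mul_zero])

theorem one_mem_polynomials : (1 : QSeries D) ∈ polynomials α := by
  refine Set.Finite.subset (Set.finite_singleton []) fun w hw => ?_
  cases w with
  | nil => rfl
  | cons x w => exact absurd rfl hw

/-- Left derivatives shorten the factors, so induction on the total length applies to every x⁻¹(S
T). It remains to see that only finitely many of these are nonzero; for the contraction terms this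
is where `Locally` enters. -/
theorem mul_mem_polynomials (hD : D.Locally) {m n : ℕ} : ∀ {S T : QSeries D}, LengthLT S m →
    LengthLT T n → S ∈ polynomials α → T ∈ polynomials α → S * T ∈ polynomials α := by
  induction h : m + n generalizing m n with
  | zero =>
    intro S T hS _ _ _
    obtain rfl : m = 0 := by omega
    rw [hS.eq_zero, zero_mul]; exact zero_mem_polynomials
  | succ k ih =>
    intro S T hS hT pS pT
    rcases m with _ | m
    · rw [hS.eq_zero, zero_mul]; exact zero_mem_polynomials
    rcases n with _ | n
    · rw [hT.eq_zero, mul_zero]; exact zero_mem_polynomials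
    refine finite_support_of_delta ?_ fun x => ?_
    · refine Set.Finite.subset (((finite_delta_ne_zero pS).union (finite_delta_ne_zero pT)).union
        ((finite_delta_ne_zero pS).biUnion fun i _ =>
          (finite_delta_ne_zero pT).biUnion fun j _ => hD i j)) fun x hx => ?_
      by_contra hx'
      simp only [Set.mem_union, Set.mem_iUnion, Set.mem_ofPred_eq, not_or, not_not, not_exists]
        at hx'
      refine hx ?_
      rw [delta_mul, hx'.1.1, hx'.1.2, zero_mul, mul_zero, zero_add, zero_add]
      refine Finset.sum_eq_zero fun p hp => ?_
      by_cases h1 : delta p.1 S = 0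
      · rw [h1, zero_mul]
      by_cases h2 : delta p.2 T = 0
      · rw [h2, mul_zero]
      exact absurd hp (hx'.2 p.1 h1 p.2 h2)
    · rw [delta_mul]
      refine add_mem_polynomials (add_mem_polynomials
        (ih (m := m) (n := n + 1) (by omega) (hS.delta x) hT (delta_mem_polynomials pS x) pT)
        (ih (m := m + 1) (n := n) (by omega) hS (hT.delta x) pS (delta_mem_polynomials pT x)))
        (sum_mem_polynomials fun p _ => ?_)
      exact ih (m := m) (n := n + 1) (by omega) (hS.delta p.1)
        ((hT.delta p.2).mono (Nat.le_succ n)) (delta_mem_polynomials pS _)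
        (delta_mem_polynomials pT _)

/-- The subalgebra of polynomials. -/
def polySub (D : Contraction α) (hD : D.Locally) : Subalgebra ℂ (QSeries D) where
  carrier := {S | S ∈ polynomials α}
  mul_mem' := fun {S T} hS hT => by
    obtain ⟨m, hm⟩ := lengthLT_of_mem_polynomials (D := D) hS
    obtain ⟨n, hn⟩ := lengthLT_of_mem_polynomials (D := D) hT
    exact mul_mem_polynomials hD hm hn hS hT
  add_mem' := fun hS hT => add_mem_polynomials hS hT
  algebraMap_mem' c := by
    rw [algebraMap_apply']
    exact smul_mem_polynomials c one_mem_polynomials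

theorem wordSeries_mem_polynomials (w : List α) : of D (wordSeries w) ∈ polynomials α :=
  (Set.finite_singleton w).subset fun u hu => by
    by_contra h
    exact hu (if_neg h)

open Classical in
theorem wordSeries_apply (w u : List α) :
    of D (wordSeries w) u = if u = w then 1 else 0 := rfl

open Classical in
theorem delta_wordSeries_cons (x y : α) (w : List α) :
    delta x (of D (wordSeries (y :: w))) = if x = y then of D (wordSeries w) else 0 := by
  funext u
  rw [delta_apply, wordSeries_apply]
  by_cases h : x = y
  · rw [if_pos h, wordSeries_apply]
    simp [h]
  · rw [if_neg h, zero_apply', if_neg (by simp [h])]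

theorem eq_sum_wordSeries {S : QSeries D} (h : S ∈ polynomials α) :
    S = ∑ w ∈ Set.Finite.toFinset h, S w • of D (wordSeries w) := by
  classical
  funext u
  rw [sum_apply']
  rw [Finset.sum_eq_single u]
  · rw [smul_apply', wordSeries_apply, if_pos rfl, mul_one]
  · intro w _ hw
    rw [smul_apply', wordSeries_apply, if_neg (Ne.symm hw), mul_zero]
  · intro hu
    by_contra h'
    refine hu ((Set.Finite.mem_toFinset h).2 fun h0 => h' ?_)
    rw [smul_apply', h0, zero_mul]

/-! ### Multiplicative series -/

/-- The series `(∑ χ(x) x)^*`: the word `w` has coefficient the product of the `χ(w_i)`. -/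
def charSeries (D : Contraction α) (χ : α → ℂ) : QSeries D := fun w => (w.map χ).prod

theorem charSeries_nil (χ : α → ℂ) : charSeries D χ [] = 1 := rfl

theorem delta_charSeries (χ : α → ℂ) (x : α) :
    delta x (charSeries D χ) = χ x • charSeries D χ := by
  funext w
  rw [delta_apply, smul_apply']
  simp [charSeries]

open Classical in
theorem of_letterStar (c : ℂ) (x : α) :
    of D (letterStar c x) = charSeries D (fun y => if y = x then c else 0) :=
  funext fun w => letterStar_apply c x w

end QSeries

namespace Shuffle

open QSeries

variable {α : Type}

theorem locally_noContraction : (noContraction α).Locally := fun _ _ =>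
  Set.finite_empty.subset fun _ hs => by simp [noContraction] at hs

theorem delta_mul (x : α) (S T : ShuffleSeries α) :
    delta x (S * T) = delta x S * T + S * delta x T := by
  rw [QSeries.delta_mul]
  exact (add_zero _)

/-- For the shuffle product x⁻¹ is a derivation, so a product of eigenvectors with eigenvalues χ(x)
and χ'(x) is an eigenvector with eigenvalue χ(x) + χ'(x). -/
theorem charSeries_add (χ χ' : α → ℂ) :
    charSeries (noContraction α) (χ + χ') =
      charSeries (noContraction α) χ * charSeries (noContraction α) χ' := by
  have key : ∀ w : List α, charSeries (noContraction α) (χ + χ') w =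
      (charSeries (noContraction α) χ * charSeries (noContraction α) χ') w := by
    intro w
    induction w with
    | nil => rw [mul_nil, charSeries_nil, charSeries_nil, charSeries_nil, mul_one]
    | cons x w ih =>
      have h := congrFun (delta_mul x (charSeries (noContraction α) χ)
        (charSeries (noContraction α) χ')) w
      rw [delta_charSeries, delta_charSeries, smul_mul_assoc, mul_smul_comm, ← add_smul,
        smul_apply', ← ih] at h
      refine Eq.trans ?_ h.symm
      exact congrFun (delta_charSeries (D := noContraction α) (χ + χ') x) w
  exact funext key

theorem charSeries_zero : charSeries (noContraction α) (0 : α → ℂ) = 1 := by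
  refine ext_delta rfl fun x => ?_
  rw [delta_charSeries, delta_one, Pi.zero_apply, zero_smul]

/-- Multiplicative series are units; this lets the last remaining term be cancelled in
`charSeries_independent`. -/
theorem charSeries_mul_neg (χ : α → ℂ) :
    charSeries (noContraction α) χ * charSeries (noContraction α) (-χ) = 1 := by
  rw [← charSeries_add, add_neg_cancel, charSeries_zero]

end Shuffle

/-! ### Derivations of polynomial rings -/

theorem MvPolynomial.mkDerivation_C_mul {A σ : Type*} [CommRing A] (f : σ → MvPolynomial σ A)
    (a : A) (p : MvPolynomial σ A) :
    mkDerivation A f (C a * p) = C a * mkDerivation A f p := by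
  rw [C_mul', C_mul', Derivation.map_smul]

theorem MvPolynomial.mkDerivation_eq_sum {A σ : Type*} [CommRing A] (f : σ → MvPolynomial σ A)
    (p : MvPolynomial σ A) : mkDerivation A f p = ∑ i ∈ p.vars, f i * pderiv i p := by
  classical
  have hs : ∀ (s : Finset σ) (q : MvPolynomial σ A), (∑ i ∈ s, f i • pderiv i :
      Derivation A (MvPolynomial σ A) (MvPolynomial σ A)) q = ∑ i ∈ s, f i * pderiv i q := by
    intro s q
    induction s using Finset.induction_on with
    | empty => rfl
    | insert i s hi ih =>
      rw [Finset.sum_insert hi, Finset.sum_insert hi, Derivation.add_apply, ih]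
      rfl
  have h := derivation_eq_of_forall_mem_vars (f := p) (D₁ := mkDerivation A f)
    (D₂ := ∑ i ∈ p.vars, f i • pderiv i) ?_
  · rw [h, hs]
  · intro j hj
    rw [hs, Finset.sum_eq_single j]
    · rw [mkDerivation_X, pderiv_X_self, mul_one]
    · intro i _ hij
      rw [pderiv_X_of_ne hij.symm, mul_zero]
    · exact fun h => absurd hj h

namespace Shuffle

open QSeries

variable {α : Type}

/-! ### Independence of the multiplicative series over the series of bounded length -/

/-- Conjugation by the unit χ^* translates the derivation x⁻¹ by the scalar χ(x). -/
theorem delta_sub_pow_mul_charSeries (x : α) (c : ℂ) (χ : α → ℂ) (n : ℕ) (d : ShuffleSeries α) :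
    ((delta x - c • 1 : Module.End ℂ (ShuffleSeries α)) ^ n) (d * charSeries _ χ) =
      ((delta x + (χ x - c) • 1 : Module.End ℂ (ShuffleSeries α)) ^ n) d * charSeries _ χ := by
  induction n generalizing d with
  | zero => rfl
  | succ n ih =>
    rw [pow_succ, pow_succ, Module.End.mul_apply, Module.End.mul_apply, ← ih]
    congr 1
    simp only [LinearMap.sub_apply, LinearMap.add_apply, LinearMap.smul_apply,
      Module.End.one_apply]
    rw [delta_mul, delta_charSeries, mul_smul_comm, add_mul, smul_mul_assoc, sub_smul]
    abel

theorem delta_add_pow_lengthLT {n : ℕ} (x : α) (c : ℂ) (m : ℕ) {d : ShuffleSeries α}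
    (hd : LengthLT d n) :
    LengthLT (((delta x + c • 1 : Module.End ℂ (ShuffleSeries α)) ^ m) d) n := by
  induction m generalizing d with
  | zero => exact hd
  | succ m ih =>
    rw [pow_succ, Module.End.mul_apply]
    refine ih (LengthLT.add (S := delta x d) ?_ (hd.smul c))
    cases n with
    | zero => rw [hd.eq_zero, map_zero]; exact .zero _
    | succ n => exact (hd.delta x).mono (Nat.le_succ n)

theorem delta_pow_eq_zero (x : α) (n : ℕ) {d : ShuffleSeries α} (hd : LengthLT d n) :
    ((delta x : Module.End ℂ (ShuffleSeries α)) ^ n) d = 0 := by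
  induction n generalizing d with
  | zero => exact hd.eq_zero
  | succ n ih => rw [pow_succ, Module.End.mul_apply]; exact ih (hd.delta x)

/-- On series of bounded length x⁻¹ is nilpotent, so adding a nonzero scalar makes it injective: at
the longest admissible words the equation reduces to c d(w) = 0, which lowers the length bound. -/
theorem eq_zero_of_delta_add_smul {n : ℕ} {x : α} {c : ℂ} (hc : c ≠ 0) {d : ShuffleSeries α}
    (hd : LengthLT d n) (h : delta x d + c • d = 0) : d = 0 := by
  induction n with
  | zero => exact hd.eq_zero
  | succ n ih =>
    refine ih fun w hw => ?_
    have h1 : delta x d w + c * d w = 0 := congrFun h w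
    rw [hd.delta x w hw, zero_add] at h1
    exact (mul_eq_zero.1 h1).resolve_left hc

theorem eq_zero_of_delta_add_smul_pow {n : ℕ} {x : α} {c : ℂ} (hc : c ≠ 0) (m : ℕ)
    {d : ShuffleSeries α} (hd : LengthLT d n)
    (h : ((delta x + c • 1 : Module.End ℂ (ShuffleSeries α)) ^ m) d = 0) : d = 0 := by
  induction m with
  | zero => exact h
  | succ m ih =>
    rw [pow_succ', Module.End.mul_apply] at h
    exact ih (eq_zero_of_delta_add_smul hc (delta_add_pow_lengthLT x c m hd) h)

/-- As in Dedekind's independence of characters, one term χ₀ is eliminated with a letter x at which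
χ₁ and χ₀ differ. A power of x⁻¹ - χ₀(x) kills the χ₀ term and acts on the coefficient of χ₁ as an
injective operator, so the induction hypothesis gives d χ₁ = 0. The letter x depends on χ₁. -/
theorem charSeries_independent (S : Finset (α → ℂ)) (d : (α → ℂ) → ShuffleSeries α)
    (hd : ∀ χ, d χ ∈ boundedLength (noContraction α))
    (h : ∑ χ ∈ S, d χ * charSeries _ χ = 0) : ∀ χ ∈ S, d χ = 0 := by
  classical
  induction S using Finset.induction_on generalizing d with
  | empty => simp
  | insert χ₀ S h0 ih =>
    have hS : ∀ χ ∈ S, d χ = 0 := by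
      intro χ₁ h1
      have hne : χ₁ ≠ χ₀ := fun h => h0 (h ▸ h1)
      obtain ⟨x, hx⟩ := Function.ne_iff.1 hne
      obtain ⟨n, hn⟩ := hd χ₀
      have h' := congrArg ((delta x - χ₀ x • 1 : Module.End ℂ (ShuffleSeries α)) ^ n) h
      rw [map_sum, Finset.sum_insert h0, map_zero] at h'
      simp only [delta_sub_pow_mul_charSeries] at h'
      rw [sub_self, zero_smul, add_zero, delta_pow_eq_zero x n hn, zero_mul, zero_add] at h'
      have := ih (fun χ => ((delta x + (χ x - χ₀ x) • 1 :
        Module.End ℂ (ShuffleSeries α)) ^ n) (d χ))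
        (fun χ => (hd χ).imp fun m hm => delta_add_pow_lengthLT x _ n hm) h' χ₁ h1
      obtain ⟨m, hm⟩ := hd χ₁
      exact eq_zero_of_delta_add_smul_pow (sub_ne_zero.2 hx) n hm this
    intro χ hχ
    rcases Finset.mem_insert.1 hχ with rfl | hχ
    · rw [Finset.sum_insert h0, Finset.sum_eq_zero fun χ' h' => by rw [hS χ' h', zero_mul],
        add_zero] at h
      rw [← mul_one (d χ), ← charSeries_mul_neg χ, ← mul_assoc, h, zero_mul]
    · exact hS χ hχ

/-! ### Series supported on letters -/

/-- The series `∑ a(x) x`. -/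
def letterSeries (α : Type) : (α → ℂ) →ₗ[ℂ] ShuffleSeries α where
  toFun a := fun w => match w with
    | [x] => a x
    | _ => 0
  map_add' a b := by
    refine ext_delta (add_zero (0 : ℂ)).symm fun x => ext_delta rfl fun y => ?_
    exact (add_zero (0 : ShuffleSeries α)).symm
  map_smul' c a := by
    refine ext_delta (mul_zero c).symm fun x => ext_delta rfl fun y => ?_
    exact (smul_zero (A := ShuffleSeries α) c).symm

theorem letterSeries_nil (a : α → ℂ) : letterSeries α a [] = 0 := rfl

theorem delta_letterSeries (a : α → ℂ) (x : α) : delta x (letterSeries α a) = a x • 1 := by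
  refine ext_delta (mul_one (a x)).symm fun y => ?_
  rw [map_smul, delta_one, smul_zero]
  rfl

theorem letterSeries_mem_boundedLength (a : α → ℂ) :
    letterSeries α a ∈ boundedLength (noContraction α) :=
  ⟨2, .of_delta fun x => by rw [delta_letterSeries]; exact (LengthLT.one one_pos).smul _⟩

/-- The algebra of polynomials, for the shuffle product. -/
abbrev Poly (α : Type) : Subalgebra ℂ (ShuffleSeries α) :=
  polySub (noContraction α) locally_noContraction

theorem poly_le_boundedLength : Poly α ≤ boundedLength (noContraction α) :=
  fun _ hS => lengthLT_of_mem_polynomials (D := noContraction α) hS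

/-- The letters' coefficients with finite support. -/
def finiteLetters (α : Type) : Submodule ℂ (α → ℂ) where
  carrier := {a | {x | a x ≠ 0}.Finite}
  add_mem' {a b} ha hb := (ha.union hb).subset fun x hx => by
    by_contra h
    simp only [Set.mem_union, Set.mem_ofPred_eq, not_or, not_not] at h
    exact hx (by rw [Pi.add_apply, h.1, h.2, add_zero])
  zero_mem' := Set.finite_empty.subset fun x hx => hx rfl
  smul_mem' c a ha := Set.Finite.subset ha fun x hx h => hx (by
    rw [Pi.smul_apply, h, smul_zero])

theorem letterSeries_mem_poly {a : α → ℂ} (ha : a ∈ finiteLetters α) :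
    letterSeries α a ∈ Poly α := by
  refine finite_support_of_delta (Set.Finite.subset ha fun x hx h => hx ?_) fun x => ?_
  · rw [delta_letterSeries, h, zero_smul]
  · rw [delta_letterSeries]
    exact smul_mem_polynomials _ one_mem_polynomials

/-! ### Algebraic independence over the polynomials -/

section Transcendence

variable {ι : Type} (b : ι → α → ℂ)

/-- Substitution of letter series for the variables. -/
def letterEval : MvPolynomial ι (Poly α) →ₐ[Poly α] ShuffleSeries α :=
  MvPolynomial.aeval fun i => letterSeries α (b i)

/-- The derivation of polynomials induced by the left derivative `x⁻¹`. -/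
def letterDerivation (x : α) :
    Derivation (Poly α) (MvPolynomial ι (Poly α)) (MvPolynomial ι (Poly α)) :=
  MvPolynomial.mkDerivation (Poly α) fun i => MvPolynomial.C (algebraMap ℂ _ (b i x))

theorem delta_letterEval_map (x : α) (r : MvPolynomial ι ℂ) :
    delta x (letterEval b (MvPolynomial.map (algebraMap ℂ (Poly α)) r)) =
      letterEval b (letterDerivation b x (MvPolynomial.map (algebraMap ℂ (Poly α)) r)) := by
  induction r using MvPolynomial.induction_on with
  | C c =>
    rw [MvPolynomial.map_C, MvPolynomial.derivation_C, map_zero, letterEval, MvPolynomial.aeval_C]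
    exact delta_algebraMap x c
  | add p q hp hq => simp only [map_add, hp, hq]
  | mul_X p i hp =>
    rw [map_mul, MvPolynomial.map_X, map_mul, delta_mul, hp, Derivation.leibniz, map_add,
      smul_eq_mul, smul_eq_mul, map_mul, map_mul, add_comm]
    congr 1
    · congr 1
      rw [letterDerivation, MvPolynomial.mkDerivation_X, letterEval, MvPolynomial.aeval_X,
        MvPolynomial.aeval_C, delta_letterSeries]
      exact (algebraMap_apply' _).symm
    · rw [mul_comm]

/-- In general the Leibniz rule adds a term in which x⁻¹ acts on the coefficients of p; the
hypothesis says that this term vanishes. -/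
theorem delta_letterEval {x : α} {p : MvPolynomial ι (Poly α)}
    (hp : ∀ s, delta x (p.coeff s).1 = 0) :
    delta x (letterEval b p) = letterEval b (letterDerivation b x p) := by
  have key : p = ∑ s ∈ p.support, MvPolynomial.C (p.coeff s) *
      MvPolynomial.map (algebraMap ℂ (Poly α)) (MvPolynomial.monomial s 1) := by
    conv_lhs => rw [p.as_sum]
    refine Finset.sum_congr rfl fun s _ => ?_
    rw [MvPolynomial.map_monomial, MvPolynomial.C_mul_monomial, map_one, mul_one]
  rw [key]
  simp only [map_sum]
  refine Finset.sum_congr rfl fun s _ => ?_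
  rw [map_mul, delta_mul, delta_letterEval_map, letterDerivation,
    MvPolynomial.mkDerivation_C_mul, map_mul]
  have : letterEval b (MvPolynomial.C (p.coeff s)) = (p.coeff s).1 :=
    MvPolynomial.aeval_C _ _
  rw [this, hp s, zero_mul, zero_add]

theorem letterDerivation_eq_sum (x : α) (p : MvPolynomial ι (Poly α)) :
    letterDerivation b x p =
      ∑ i ∈ p.vars, MvPolynomial.C (algebraMap ℂ _ (b i x)) * MvPolynomial.pderiv i p :=
  MvPolynomial.mkDerivation_eq_sum _ p

theorem coeff_letterDerivation (x : α) (p : MvPolynomial ι (Poly α)) (m : ι →₀ ℕ) (w : List α) :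
    ((letterDerivation b x p).coeff m).1 w =
      ∑ i ∈ p.vars, b i x * ((MvPolynomial.pderiv i p).coeff m).1 w := by
  rw [letterDerivation_eq_sum, MvPolynomial.coeff_sum, AddSubmonoidClass.coe_finsetSum,
    sum_apply']
  refine Finset.sum_congr rfl fun i _ => ?_
  rw [MvPolynomial.coeff_C_mul, Subalgebra.coe_mul, Subalgebra.coe_algebraMap,
    ← Algebra.smul_def, smul_apply']

/-- Induction on the degree. For x outside a finite set of letters, x⁻¹ kills every coefficient of
p, so ∑ b_i(x) ∂_i p is again in the kernel and has smaller degree, hence is zero. Reading one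
coefficient of one word at a time, the combination of the b_i with scalars taken from ∂_i p is
supported on that finite set. Independence modulo finitely supported families then gives ∂_i p = 0
for all i, so p is a constant, and constants are evaluated faithfully. -/
theorem letterEval_injective
    (hb : ∀ (s : Finset ι) (c : ι → ℂ), ∑ i ∈ s, c i • b i ∈ finiteLetters α → ∀ i ∈ s, c i = 0)
    (n : ℕ) (p : MvPolynomial ι (Poly α)) (hn : ∀ s, p.coeff s ≠ 0 → s.degree < n)
    (hp : letterEval b p = 0) : p = 0 := by
  classical
  induction n generalizing p with
  | zero =>
    refine MvPolynomial.ext _ _ fun s => ?_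
    by_contra h
    exact absurd (hn s h) (by omega)
  | succ n ih =>
    set F : Set α := ⋃ s ∈ p.support, {x | delta x (p.coeff s).1 ≠ 0} with hF
    have hfin : F.Finite := p.support.finite_toSet.biUnion fun s _ =>
      finite_delta_ne_zero (p.coeff s).2
    have hkill : ∀ x ∉ F, letterDerivation b x p = 0 := by
      intro x hx
      refine ih _ (fun s hs => ?_) ?_
      · by_contra hlt
        refine hs (Subtype.ext (funext fun w => ?_))
        rw [coeff_letterDerivation]
        refine Finset.sum_eq_zero fun i _ => ?_
        rw [MvPolynomial.coeff_pderiv]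
        have h0 : p.coeff (s + Finsupp.single i 1) = 0 := by
          by_contra h1
          have := hn _ h1
          rw [map_add, Finsupp.degree_single] at this
          omega
        rw [h0, zero_mul]
        exact mul_zero _
      · rw [← delta_letterEval, hp, map_zero]
        intro s
        by_contra h
        refine hx (Set.mem_biUnion (x := s) ?_ h)
        refine MvPolynomial.mem_support_iff.2 fun h0 => h ?_
        rw [h0]
        exact map_zero _
    have hpd : ∀ i ∈ p.vars, MvPolynomial.pderiv i p = 0 := by
      intro i hi
      refine MvPolynomial.ext _ _ fun m => Subtype.ext (funext fun w => ?_)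
      refine hb p.vars (fun i => ((MvPolynomial.pderiv i p).coeff m).1 w) ?_ i hi
      refine Set.Finite.subset hfin fun x hx => ?_
      by_contra hxF
      refine hx ?_
      have h1 := coeff_letterDerivation b x p m w
      rw [hkill x hxF] at h1
      rw [Finset.sum_apply]
      refine Eq.trans (Finset.sum_congr rfl fun i _ => ?_) h1.symm
      rw [Pi.smul_apply, smul_eq_mul, mul_comm]
    have hconst : ∀ s, s ≠ 0 → p.coeff s = 0 := by
      intro s hs
      by_contra hne
      obtain ⟨i, hi⟩ := Finsupp.ne_iff.1 hs
      rw [Finsupp.zero_apply] at hi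
      have hv : i ∈ p.vars := (MvPolynomial.mem_vars_iff_mem_support i).2
        ⟨s, MvPolynomial.mem_support_iff.2 hne, Finsupp.mem_support_iff.2 hi⟩
      have h1 := congrArg (MvPolynomial.coeff (s - Finsupp.single i 1)) (hpd i hv)
      rw [MvPolynomial.coeff_pderiv, MvPolynomial.coeff_zero] at h1
      have h2 : s - Finsupp.single i 1 + Finsupp.single i 1 = s :=
        tsub_add_cancel_of_le (Finsupp.single_le_iff.2 (Nat.one_le_iff_ne_zero.2 hi))
      rw [h2] at h1
      have hu := (IsUnit.mk0 _ (Nat.cast_add_one_ne_zero (R := ℂ)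
        ((s - Finsupp.single i 1 : ι →₀ ℕ) i))).map (algebraMap ℂ (Poly α))
      rw [map_add, map_natCast, map_one] at hu
      exact hne (hu.mul_left_eq_zero.1 h1)
    have hC : p = MvPolynomial.C (p.coeff 0) := MvPolynomial.ext _ _ fun s => by
      rw [MvPolynomial.coeff_C]
      split_ifs with h
      · rw [h]
      · exact hconst s (Ne.symm h)
    have h0 : p.coeff 0 = 0 := by
      rw [hC] at hp
      exact Subtype.ext ((MvPolynomial.aeval_C (fun i => letterSeries α (b i))
        (p.coeff 0)).symm.trans hp)
    rw [hC, h0, map_zero]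

end Transcendence

end Shuffle

/-! ### Products of commuting nilpotent elements -/

open scoped IsMulCommutative in
/-- In a finite-dimensional algebra, long products of commuting nilpotent elements vanish. -/
theorem exists_list_prod_eq_zero {α A : Type*} [Ring A] [Algebra ℂ A] [Module.Finite ℂ A]
    (g : α → A) (hcomm : ∀ x y, g x * g y = g y * g x) (hnil : ∀ x, IsNilpotent (g x)) :
    ∃ N : ℕ, ∀ w : List α, N ≤ w.length → (w.map g).prod = 0 := by
  -- The generated algebra is commutative and finite-dimensional, hence Noetherian, and its
  -- nilradical is nilpotent. This bounds all words uniformly even if α is infinite.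
  let R := Algebra.adjoin ℂ (Set.range g)
  have : IsMulCommutative R := Algebra.isMulCommutative_adjoin ℂ (by
    rintro _ ⟨x, rfl⟩ _ ⟨y, rfl⟩; exact hcomm x y)
  have : IsNoetherianRing R := IsNoetherianRing.of_finite ℂ R
  obtain ⟨N, hN⟩ := IsNoetherianRing.isNilpotent_nilradical R
  let g' : α → R := fun x => ⟨g x, Algebra.subset_adjoin ⟨x, rfl⟩⟩
  have hg' : ∀ x, g' x ∈ nilradical R := fun x => by
    obtain ⟨k, hk⟩ := hnil x
    exact ⟨k, Subtype.ext hk⟩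
  have hprod : ∀ w : List α, (w.map g').prod ∈ nilradical R ^ w.length := by
    intro w
    induction w with
    | nil => simp
    | cons x w ih =>
      rw [List.map_cons, List.prod_cons, List.length_cons, pow_succ']
      exact Ideal.mul_mem_mul (hg' x) ih
  refine ⟨N, fun w hw => ?_⟩
  have h := Ideal.pow_le_pow_right hw (hprod w)
  rw [hN] at h
  have h0 : (w.map g').prod = 0 := h
  have h1 := congrArg (fun r : R => (r : A)) h0
  have h2 : ((w.map g').prod : A) = (w.map g).prod := by
    rw [← Subalgebra.coe_val, map_list_prod, List.map_map]
    rfl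
  exact h2.symm.trans h1

namespace Shuffle

open QSeries

variable {α : Type}

/-! ### Rationally exchangeable series -/

section Rational

variable {n : ℕ}

/-- The series `w ↦ φ(f(w) η)`. -/
def repSeries (f : α → Module.End ℂ (Fin n → ℂ)) (φ : (Fin n → ℂ) →ₗ[ℂ] ℂ) (η : Fin n → ℂ) :
    ShuffleSeries α := fun w => φ ((w.map f).prod η)

theorem delta_repSeries (f : α → Module.End ℂ (Fin n → ℂ)) (φ : (Fin n → ℂ) →ₗ[ℂ] ℂ)
    (η : Fin n → ℂ) (x : α) : delta x (repSeries f φ η) = repSeries f (φ ∘ₗ f x) η := by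
  funext w
  rw [delta_apply]
  simp only [repSeries, List.map_cons, List.prod_cons, Module.End.mul_apply,
    LinearMap.comp_apply]

/-- Shuffling with χ^* is twisting by a character, so a family with single eigenvalue χ(x) can be
replaced by its nilpotent part. -/
theorem charSeries_mul_repSeries (f : α → Module.End ℂ (Fin n → ℂ)) (χ : α → ℂ)
    (φ : (Fin n → ℂ) →ₗ[ℂ] ℂ) (η : Fin n → ℂ) :
    charSeries _ χ * repSeries f φ η = repSeries (fun x => f x + χ x • 1) φ η := by
  funext w
  induction w generalizing φ with
  | nil => exact one_mul _
  | cons x w ih =>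
    have h1 := congrFun (delta_mul x (charSeries (noContraction α) χ) (repSeries f φ η)) w
    rw [delta_charSeries, smul_mul_assoc, delta_repSeries, add_apply', smul_apply', ih, ih] at h1
    refine Eq.trans h1 ?_
    simp only [repSeries, List.map_cons, List.prod_cons, Module.End.mul_apply,
      LinearMap.comp_apply, LinearMap.add_apply, LinearMap.smul_apply, Module.End.one_apply,
      map_add, map_smul, smul_eq_mul]
    rw [add_comm]

/-- The part of `repSeries f φ η` supported on the words of length `m`. -/
def repSeriesHomog (f : α → Module.End ℂ (Fin n → ℂ)) (φ : (Fin n → ℂ) →ₗ[ℂ] ℂ) (η : Fin n → ℂ)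
    (m : ℕ) : ShuffleSeries α := fun w => if w.length = m then φ ((w.map f).prod η) else 0

theorem repSeriesHomog_zero (f : α → Module.End ℂ (Fin n → ℂ)) (φ : (Fin n → ℂ) →ₗ[ℂ] ℂ)
    (η : Fin n → ℂ) : repSeriesHomog f φ η 0 = φ η • (1 : ShuffleSeries α) := by
  refine ext_delta (mul_one (φ η)).symm fun x => ?_
  rw [map_smul, delta_one, smul_zero]
  rfl

theorem delta_repSeriesHomog_zero (f : α → Module.End ℂ (Fin n → ℂ)) (φ : (Fin n → ℂ) →ₗ[ℂ] ℂ)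
    (η : Fin n → ℂ) (x : α) : delta x (repSeriesHomog f φ η 0) = 0 := by
  rw [repSeriesHomog_zero, map_smul, delta_one, smul_zero]

theorem delta_repSeriesHomog_succ (f : α → Module.End ℂ (Fin n → ℂ)) (φ : (Fin n → ℂ) →ₗ[ℂ] ℂ)
    (η : Fin n → ℂ) (m : ℕ) (x : α) :
    delta x (repSeriesHomog f φ η (m + 1)) = repSeriesHomog f (φ ∘ₗ f x) η m := by
  funext w
  rw [delta_apply]
  simp only [repSeriesHomog, List.map_cons, List.prod_cons, Module.End.mul_apply,
    LinearMap.comp_apply, List.length_cons, Nat.add_right_cancel_iff]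

theorem functional_eq_sum (φ : (Fin n → ℂ) →ₗ[ℂ] ℂ) (v : Fin n → ℂ) :
    φ v = ∑ k, φ (Pi.single k 1) * v k := by
  conv_lhs => rw [← (Pi.basisFun ℂ (Fin n)).sum_repr v]
  rw [map_sum]
  refine Finset.sum_congr rfl fun k _ => ?_
  rw [map_smul, Pi.basisFun_apply, Pi.basisFun_repr, smul_eq_mul, mul_comm]

theorem repSeriesHomog_linear (f : α → Module.End ℂ (Fin n → ℂ)) (φ : (Fin n → ℂ) →ₗ[ℂ] ℂ)
    (η : Fin n → ℂ) (m : ℕ) : repSeriesHomog f φ η m =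
      ∑ k, φ (Pi.single k 1) • repSeriesHomog f (LinearMap.proj k) η m := by
  funext w
  rw [sum_apply']
  simp only [smul_apply', repSeriesHomog]
  split_ifs with h
  · exact functional_eq_sum φ _
  · simp

/-- An Euler identity. Shuffling with a letter series sums over the ways to delete one letter from
the word. Since the f x commute, moving the deleted letter to the front does not change the
coefficient, so the m + 1 deletions contribute equally. -/
theorem repSeriesHomog_succ (f : α → Module.End ℂ (Fin n → ℂ)) (hf : ∀ x y, f x * f y = f y * f x)
    (φ : (Fin n → ℂ) →ₗ[ℂ] ℂ) (η : Fin n → ℂ) (m : ℕ) :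
    ((m : ℂ) + 1) • repSeriesHomog f φ η (m + 1) =
      ∑ k, letterSeries α (fun x => φ (f x (Pi.single k 1))) *
        repSeriesHomog f (LinearMap.proj k) η m := by
  have hcomp : ∀ x y, φ ∘ₗ f x ∘ₗ f y = φ ∘ₗ f y ∘ₗ f x := fun x y => by
    have := hf x y
    rw [Module.End.mul_eq_comp, Module.End.mul_eq_comp] at this
    rw [this]
  induction m generalizing φ with
  | zero =>
    refine ext_delta ?_ fun y => ?_
    · rw [sum_apply', smul_apply', Finset.sum_eq_zero fun k _ => by
        rw [mul_nil, letterSeries_nil, zero_mul]]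
      exact mul_zero _
    · rw [map_smul, delta_repSeriesHomog_succ, map_sum, Nat.cast_zero, zero_add, one_smul,
        repSeriesHomog_linear]
      refine Finset.sum_congr rfl fun k _ => ?_
      rw [delta_mul, delta_letterSeries, delta_repSeriesHomog_zero, mul_zero, add_zero,
        smul_mul_assoc, one_mul, LinearMap.comp_apply]
  | succ m ih =>
    refine ext_delta ?_ fun y => ?_
    · rw [sum_apply', smul_apply', Finset.sum_eq_zero fun k _ => by
        rw [mul_nil, letterSeries_nil, zero_mul]]
      exact mul_zero _
    · have h1 : delta y (∑ k, letterSeries α (fun x => φ (f x (Pi.single k 1))) *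
          repSeriesHomog f (LinearMap.proj k) η (m + 1)) =
          repSeriesHomog f (φ ∘ₗ f y) η (m + 1) +
          ∑ k, letterSeries α (fun x => φ (f x (Pi.single k 1))) *
            repSeriesHomog f (LinearMap.proj k ∘ₗ f y) η m := by
        rw [repSeriesHomog_linear f (φ ∘ₗ f y), map_sum, ← Finset.sum_add_distrib]
        refine Finset.sum_congr rfl fun k _ => ?_
        rw [delta_mul, delta_letterSeries, delta_repSeriesHomog_succ, smul_mul_assoc, one_mul,
          LinearMap.comp_apply]
      -- This is the induction hypothesis for φ ∘ f y; after expansion in coordinates, commutativity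
      -- moves f y from the functional to the basis vectors.
      have h2 : ∑ k, letterSeries α (fun x => φ (f x (Pi.single k 1))) *
            repSeriesHomog f (LinearMap.proj k ∘ₗ f y) η m =
          ((m : ℂ) + 1) • repSeriesHomog f (φ ∘ₗ f y) η (m + 1) := by
        rw [ih (φ ∘ₗ f y) fun x z => by
          have := hf x z
          rw [Module.End.mul_eq_comp, Module.End.mul_eq_comp] at this
          rw [this]]
        simp only [repSeriesHomog_linear f (LinearMap.proj _ ∘ₗ f y) η m, Finset.mul_sum,
          mul_smul_comm, ← smul_mul_assoc]
        rw [Finset.sum_comm]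
        refine Finset.sum_congr rfl fun l _ => ?_
        rw [← Finset.sum_mul]
        congr 1
        simp only [← map_smul, ← map_sum]
        congr 1
        funext x
        rw [Finset.sum_apply]
        have h3 : (φ ∘ₗ f y) (f x (Pi.single l 1)) = φ (f x (f y (Pi.single l 1))) :=
          LinearMap.congr_fun (hcomp y x) _
        rw [h3]
        refine Eq.trans (Finset.sum_congr rfl fun k _ => ?_)
          (functional_eq_sum (φ ∘ₗ f x) (f y (Pi.single l 1))).symm
        rw [Pi.smul_apply, smul_eq_mul, mul_comm]
        rfl
      rw [map_smul, delta_repSeriesHomog_succ, h1, h2, Nat.cast_succ, add_smul, one_smul,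
        add_comm]

/-- Division by m + 1 in `repSeriesHomog_succ` expresses each homogeneous part through letter
series. -/
theorem repSeriesHomog_mem (B : Subalgebra ℂ (ShuffleSeries α))
    (h1 : ∀ a, letterSeries α a ∈ B) (f : α → Module.End ℂ (Fin n → ℂ))
    (hf : ∀ x y, f x * f y = f y * f x) (η : Fin n → ℂ) (m : ℕ) :
    ∀ φ : (Fin n → ℂ) →ₗ[ℂ] ℂ, repSeriesHomog f φ η m ∈ B := by
  induction m with
  | zero =>
    intro φ
    rw [repSeriesHomog_zero]
    exact B.smul_mem B.one_mem _
  | succ m ih =>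
    intro φ
    have h := repSeriesHomog_succ f hf φ η m
    have h0 : ((m : ℂ) + 1) ≠ 0 := by exact_mod_cast Nat.succ_ne_zero m
    rw [← inv_smul_smul₀ h0 (repSeriesHomog f φ η (m + 1)), h]
    exact B.smul_mem (B.sum_mem fun k _ => B.mul_mem (h1 _) (ih _)) _

theorem repSeries_mem_of_bounded (B : Subalgebra ℂ (ShuffleSeries α))
    (h1 : ∀ a, letterSeries α a ∈ B) (f : α → Module.End ℂ (Fin n → ℂ))
    (hf : ∀ x y, f x * f y = f y * f x) (η : Fin n → ℂ) (N : ℕ)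
    (hN : ∀ w : List α, N ≤ w.length → (w.map f).prod η = 0) (φ : (Fin n → ℂ) →ₗ[ℂ] ℂ) :
    repSeries f φ η ∈ B := by
  have h : repSeries f φ η = ∑ m ∈ Finset.range N, repSeriesHomog f φ η m := by
    funext w
    rw [sum_apply']
    simp only [repSeriesHomog, Finset.sum_ite_eq, Finset.mem_range]
    split_ifs with hw
    · rfl
    · change φ _ = 0
      rw [hN w (not_lt.1 hw), map_zero]
  rw [h]
  exact B.sum_mem fun m _ => repSeriesHomog_mem B h1 f hf η m φ

/-- On a simultaneous generalized eigenspace, long products of the `f x - χ x` vanish. -/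
theorem exists_prod_sub_apply_eq_zero (f : α → Module.End ℂ (Fin n → ℂ))
    (hf : ∀ x y, f x * f y = f y * f x) (χ : α → ℂ) {η : Fin n → ℂ}
    (hη : η ∈ ⨅ x, (f x).maxGenEigenspace (χ x)) :
    ∃ N : ℕ, ∀ w : List α, N ≤ w.length → (w.map fun x => f x - χ x • 1).prod η = 0 := by
  let W := ⨅ x, (f x).maxGenEigenspace (χ x)
  let ν : α → Module.End ℂ (Fin n → ℂ) := fun x => f x - χ x • 1
  have hν : ∀ x y, Commute (ν x) (ν y) := fun x y => by
    have hxy : Commute (f x) (f y) := hf x y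
    exact ((hxy.sub_left ((Commute.one_left _).smul_left _)).sub_right
      ((Commute.one_right _).smul_right _))
  have hmaps : ∀ x, ∀ v ∈ W, ν x v ∈ W := by
    intro x v hv
    rw [Submodule.mem_iInf] at hv ⊢
    intro y
    refine Module.End.mapsTo_maxGenEigenspace_of_comm (f := f y) (g := ν x) ?_ (χ y) (hv y)
    have hxy : Commute (f y) (f x) := hf y x
    exact hxy.sub_right ((Commute.one_right _).smul_right _)
  -- Nilpotency holds only on W, which is stable because the family commutes; the products are
  -- therefore taken in End(W).
  let g : α → Module.End ℂ W := fun x => (ν x).restrict (hmaps x)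
  have hgv : ∀ x (v : W), ((g x v : W) : Fin n → ℂ) = ν x v := fun x v => rfl
  have hpow : ∀ x k (v : W), (((g x ^ k) v : W) : Fin n → ℂ) = (ν x ^ k) v := by
    intro x k
    induction k with
    | zero => intro v; rfl
    | succ k ih => intro v; rw [pow_succ, pow_succ, Module.End.mul_apply, Module.End.mul_apply, ih]; rfl
  obtain ⟨N, hN⟩ := exists_list_prod_eq_zero g (fun x y => by
    ext1 v
    refine Subtype.ext ?_
    exact LinearMap.congr_fun (hν x y) (v : Fin n → ℂ)) (fun x => by
    refine ⟨Module.finrank ℂ (Fin n → ℂ), ?_⟩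
    ext1 v
    refine Subtype.ext ?_
    rw [hpow]
    have hv := (Submodule.mem_iInf _).1 v.2 x
    rw [Module.End.maxGenEigenspace_eq_genEigenspace_finrank, Module.End.mem_genEigenspace_nat] at hv
    exact hv)
  refine ⟨N, fun w hw => ?_⟩
  have h2 : ∀ (w : List α) (v : W), (((w.map g).prod v : W) : Fin n → ℂ) = (w.map ν).prod v := by
    intro w
    induction w with
    | nil => intro v; rfl
    | cons x w ih =>
      intro v
      rw [List.map_cons, List.map_cons, List.prod_cons, List.prod_cons, Module.End.mul_apply,
        Module.End.mul_apply, ← ih, hgv]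
  have h3 := h2 w ⟨η, hη⟩
  rw [hN w hw] at h3
  exact h3.symm

/-- A subalgebra of the shuffle algebra that contains the series supported on the letters and the
characters contains the rationally exchangeable series. -/
theorem ratExchangeable_subset (B : Subalgebra ℂ (ShuffleSeries α))
    (h1 : ∀ a, letterSeries α a ∈ B) (h2 : ∀ χ, charSeries _ χ ∈ B) {S : List α → ℂ}
    (hS : S ∈ ratExchangeable α) : of (noContraction α) S ∈ B := by
  obtain ⟨n, β, η, μ, hμ, hS⟩ := hS
  let f : α → Module.End ℂ (Fin n → ℂ) := fun x => Matrix.toLin' (μ x)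
  have hf : ∀ x y, f x * f y = f y * f x := fun x y => by
    simp only [f, Module.End.mul_eq_comp, ← Matrix.toLin'_mul, hμ x y]
  let φ : (Fin n → ℂ) →ₗ[ℂ] ℂ := LinearMap.mk ⟨fun v => β ⬝ᵥ v, dotProduct_add β⟩
    (fun c v => dotProduct_smul c β v)
  -- The vectors whose series lies in B form a subspace, so it suffices to treat the simultaneous
  -- generalized eigenspaces, which span the space over ℂ.
  let U : Submodule ℂ (Fin n → ℂ) :=
    { carrier := {v | repSeries f φ v ∈ B}
      add_mem' := fun {v w} hv hw => by
        have : repSeries f φ (v + w) = repSeries f φ v + repSeries f φ w := by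
          funext u
          rw [add_apply']
          simp only [repSeries, map_add]
        change repSeries f φ (v + w) ∈ B
        rw [this]; exact B.add_mem hv hw
      zero_mem' := by
        have : repSeries f φ 0 = 0 := by
          funext u
          simp only [repSeries, map_zero]
          rfl
        change repSeries f φ 0 ∈ B
        rw [this]; exact B.zero_mem
      smul_mem' := fun c v hv => by
        have : repSeries f φ (c • v) = c • repSeries f φ v := by
          funext u
          rw [smul_apply']
          simp only [repSeries, map_smul, smul_eq_mul]
        change repSeries f φ (c • v) ∈ B
        rw [this]; exact B.smul_mem hv c }
  have hU : ⨆ χ : α → ℂ, ⨅ x, (f x).maxGenEigenspace (χ x) ≤ U := by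
    refine iSup_le fun χ v hv => ?_
    obtain ⟨N, hN⟩ := exists_prod_sub_apply_eq_zero f hf χ hv
    -- With χ^* split off, the family f x - χ x has vanishing long products on v, and its series is
    -- a finite sum of homogeneous parts.
    have h3 := charSeries_mul_repSeries (fun x => f x - χ x • 1) χ φ v
    simp only [sub_add_cancel] at h3
    change repSeries f φ v ∈ B
    rw [← h3]
    refine B.mul_mem (h2 χ) (repSeries_mem_of_bounded B h1 _ (fun x y => ?_) v N hN φ)
    have hxy : Commute (f x) (f y) := hf x y
    exact ((hxy.sub_left ((Commute.one_left _).smul_left _)).sub_right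
      ((Commute.one_right _).smul_right _))
  rw [Module.End.iSup_iInf_maxGenEigenspace_eq_top_of_iSup_maxGenEigenspace_eq_top_of_commute f
    (fun x y _ => hf x y) (fun x => Module.End.iSup_maxGenEigenspace_eq_top (f x))] at hU
  have h4 : repSeries f φ η ∈ B := hU (Submodule.mem_top (x := η))
  have h5 : of (noContraction α) S = repSeries f φ η := by
    funext w
    refine (hS w).trans ?_
    change _ = β ⬝ᵥ _
    congr 1
    rw [← Matrix.toLin'_apply]
    congr 1
    induction w with
    | nil => exact Matrix.toLin'_one
    | cons x w ih =>
      rw [List.map_cons, List.map_cons, List.prod_cons, List.prod_cons, Matrix.toLin'_mul, ih]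
      rfl
  rw [h5]
  exact h4

end Rational

end Shuffle

namespace Shuffle

open QSeries

variable {α : Type}

/-! ### Extension of characters -/

section Extension

variable {ι : Type} (b : ι → α → ℂ)

theorem letterEval_mem_boundedLength (p : MvPolynomial ι (Poly α)) :
    letterEval b p ∈ boundedLength (noContraction α) := by
  induction p using MvPolynomial.induction_on with
  | C a =>
    rw [letterEval, MvPolynomial.aeval_C]
    exact poly_le_boundedLength a.2
  | add p q hp hq => rw [map_add]; exact Subalgebra.add_mem _ hp hq
  | mul_X p i hp =>
    rw [map_mul, letterEval, MvPolynomial.aeval_X]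
    exact Subalgebra.mul_mem _ hp (letterSeries_mem_boundedLength _)

/-- `χ ↦ charSeries χ` as a monoid morphism. -/
def charHom (α : Type) : Multiplicative (α → ℂ) →* ShuffleSeries α where
  toFun χ := charSeries _ χ.toAdd
  map_one' := charSeries_zero
  map_mul' χ χ' := charSeries_add χ.toAdd χ'.toAdd

/-- The evaluation `∑ p_χ e^χ ↦ ∑ p_χ ⧢ χ^*`. -/
def expEval : AddMonoidAlgebra (MvPolynomial ι (Poly α)) (α → ℂ) →ₐ[ℂ] ShuffleSeries α :=
  AddMonoidAlgebra.liftNCAlgHom ((letterEval b).restrictScalars ℂ) (charHom α)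
    fun _ _ => Commute.all _ _

theorem expEval_single (χ : α → ℂ) (p : MvPolynomial ι (Poly α)) :
    expEval b (AddMonoidAlgebra.single χ p) = letterEval b p * charSeries _ χ := by
  rw [expEval, AddMonoidAlgebra.coe_liftNCAlgHom, AddMonoidAlgebra.liftNC_single]
  rfl

theorem expEval_eq_sum (p : AddMonoidAlgebra (MvPolynomial ι (Poly α)) (α → ℂ)) :
    expEval b p = ∑ χ ∈ p.coeff.support, letterEval b (p.coeff χ) * charSeries _ χ := by
  conv_lhs => rw [← AddMonoidAlgebra.sum_coeff_single p]
  rw [Finsupp.sum, map_sum]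
  exact Finset.sum_congr rfl fun χ _ => expEval_single b χ _

/-- The coefficient of each χ^* has bounded length, so `charSeries_independent` separates the χ, and
`letterEval_injective` treats each coefficient. -/
theorem expEval_injective
    (hb : ∀ (s : Finset ι) (c : ι → ℂ), ∑ i ∈ s, c i • b i ∈ finiteLetters α → ∀ i ∈ s, c i = 0) :
    Function.Injective (expEval b) := by
  refine (injective_iff_map_eq_zero _).2 fun p hp => ?_
  rw [expEval_eq_sum] at hp
  have h := charSeries_independent p.coeff.support (fun χ => letterEval b (p.coeff χ))
    (fun χ => letterEval_mem_boundedLength b _) hp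
  refine AddMonoidAlgebra.coeff_injective (Finsupp.ext fun χ => ?_)
  by_contra hχ
  refine hχ (letterEval_injective b hb ((p.coeff χ).totalDegree + 1) _ (fun s hs => ?_)
    (h χ (Finsupp.mem_support_iff.2 hχ)))
  exact Nat.lt_succ_of_le (MvPolynomial.le_totalDegree (MvPolynomial.mem_support_iff.2 hs))

/-- The range contains the polynomials and the multiplicative series. It contains every letter
series because modulo a polynomial such a series is a finite combination of those of the b_i.
`ratExchangeable_subset` does the rest. -/
theorem extendedDomain_le_range
    (hb : ∀ a : α → ℂ, ∃ c : ι →₀ ℂ, a - c.sum (fun i k => k • b i) ∈ finiteLetters α) :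
    extendedDomain (noContraction α) ≤ (expEval b).range := by
  have hpoly : ∀ q : Poly α, q.1 ∈ (expEval b).range := fun q => by
    refine ⟨AddMonoidAlgebra.single 0 (MvPolynomial.C q), ?_⟩
    refine (expEval_single b _ _).trans ?_
    rw [charSeries_zero, mul_one, letterEval, MvPolynomial.aeval_C]
    rfl
  refine Algebra.adjoin_le ?_
  rintro _ ⟨S, hS | hS, rfl⟩
  · exact hpoly ⟨S, hS⟩
  · refine ratExchangeable_subset _ (fun a => ?_) (fun χ => ?_) hS
    · obtain ⟨c, hc⟩ := hb a
      have h1 : letterSeries α a = letterSeries α (a - c.sum fun i k => k • b i) +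
          c.sum fun i k => k • letterSeries α (b i) := by
        rw [map_sub, Finsupp.sum, map_sum, Finsupp.sum]
        simp only [map_smul, sub_add_cancel]
      rw [h1]
      refine Subalgebra.add_mem _ (hpoly ⟨_, letterSeries_mem_poly hc⟩)
        (Subalgebra.sum_mem _ fun i _ => Subalgebra.smul_mem _ ?_ _)
      refine ⟨AddMonoidAlgebra.single 0 (MvPolynomial.X i), ?_⟩
      refine (expEval_single b _ _).trans ?_
      rw [charSeries_zero, mul_one, letterEval, MvPolynomial.aeval_X]
    · refine ⟨AddMonoidAlgebra.single χ 1, ?_⟩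
      refine (expEval_single b _ _).trans ?_
      rw [map_one, one_mul]

end Extension

/-- Lifts of a basis of the quotient of all families by the finitely supported ones; the quotient is
zero when the alphabet is finite. -/
theorem exists_letter_basis (α : Type) : ∃ (ι : Type) (b : ι → α → ℂ),
    (∀ (s : Finset ι) (c : ι → ℂ), ∑ i ∈ s, c i • b i ∈ finiteLetters α → ∀ i ∈ s, c i = 0) ∧
    ∀ a : α → ℂ, ∃ c : ι →₀ ℂ, a - c.sum (fun i k => k • b i) ∈ finiteLetters α := by
  let B := Module.Basis.ofVectorSpace ℂ ((α → ℂ) ⧸ finiteLetters α)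
  choose b hb using fun i => Submodule.mkQ_surjective (finiteLetters α) (B i)
  refine ⟨_, b, fun s c h => ?_, fun a => ?_⟩
  · refine linearIndependent_iff'.1 B.linearIndependent s c ?_
    rw [← Submodule.Quotient.mk_eq_zero, ← Submodule.mkQ_apply, map_sum] at h
    simpa only [map_smul, hb] using h
  · refine ⟨B.repr ((finiteLetters α).mkQ a), ?_⟩
    rw [← Submodule.Quotient.mk_eq_zero, ← Submodule.mkQ_apply, map_sub, Finsupp.sum, map_sum,
      sub_eq_zero]
    conv_lhs => rw [← B.linearCombination_repr ((finiteLetters α).mkQ a),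
      Finsupp.linearCombination_apply, Finsupp.sum]
    simp only [map_smul, hb]

/-- A character of the shuffle algebra of polynomials and a character of the group of characters
have a common extension to the algebra generated by the polynomials and the rationally exchangeable
series. -/
theorem exists_character (ψ : Poly α →ₐ[ℂ] ℂ) (h : Multiplicative (α → ℂ) →* ℂ) :
    ∃ Z : extendedDomain (noContraction α) →ₐ[ℂ] ℂ,
      (∀ p : extendedDomain (noContraction α), ∀ hp : p.1 ∈ Poly α, Z p = ψ ⟨p.1, hp⟩) ∧
      ∀ (p : extendedDomain (noContraction α)) (χ : α → ℂ), p.1 = charSeries _ χ →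
        Z p = h (.ofAdd χ) := by
  obtain ⟨ι, b, hb1, hb2⟩ := exists_letter_basis α
  let e := AlgEquiv.ofInjective (expEval b) (expEval_injective b hb1)
  -- Nothing constrains the values on the extra letter series, and they are set to 0.
  let ev : AddMonoidAlgebra (MvPolynomial ι (Poly α)) (α → ℂ) →ₐ[ℂ] ℂ :=
    AddMonoidAlgebra.liftNCAlgHom (ψ.comp
      ((MvPolynomial.aeval (R := Poly α) (fun _ : ι => (0 : Poly α))).restrictScalars ℂ)) h
      fun _ _ => Commute.all _ _
  let inc := Subalgebra.inclusion (extendedDomain_le_range b hb2)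
  have key : ∀ (p : extendedDomain (noContraction α)) χ q,
      p.1 = letterEval b q * charSeries _ χ →
      ev (e.symm (inc p)) = ψ (MvPolynomial.aeval (fun _ : ι => (0 : Poly α)) q) * h (.ofAdd χ) := by
    intro p χ q hp
    have : e.symm (inc p) = AddMonoidAlgebra.single χ q := by
      rw [AlgEquiv.symm_apply_eq]
      refine Subtype.ext ?_
      exact hp.trans (expEval_single b χ q).symm
    rw [this]
    simp only [ev]
    rw [AddMonoidAlgebra.coe_liftNCAlgHom, AddMonoidAlgebra.liftNC_single]
    rfl
  refine ⟨ev.comp ((e.symm : _ →ₐ[ℂ] _).comp inc), fun p hp => ?_, fun p χ hp => ?_⟩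
  · refine (key p 0 (MvPolynomial.C ⟨p.1, hp⟩) ?_).trans ?_
    · rw [charSeries_zero, mul_one, letterEval, MvPolynomial.aeval_C]
      rfl
    · rw [MvPolynomial.aeval_C, ofAdd_zero, map_one, mul_one]
      rfl
  · refine (key p χ 1 ?_).trans ?_
    · rw [map_one, one_mul, hp]
    · rw [map_one, map_one, one_mul]

end Shuffle

/-! ### Linear maps on polynomials given by their values on words -/

namespace QSeries

section Pairing

variable {α : Type} {D : Contraction α} (hD : D.Locally)

/-- The word `w` as a polynomial. -/
def wordPoly (w : List α) : polySub D hD := ⟨of D (wordSeries w), wordSeries_mem_polynomials w⟩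

open Classical in
theorem wordPoly_nil : wordPoly hD [] = 1 := by
  refine Subtype.ext (funext fun u => ?_)
  cases u with
  | nil => exact (wordSeries_apply (D := D) [] []).trans (if_pos rfl)
  | cons x u => exact (wordSeries_apply (D := D) [] _).trans (if_neg (List.cons_ne_nil x u))

/-- The left derivative on polynomials. -/
def polyDelta (x : α) : polySub D hD →ₗ[ℂ] polySub D hD where
  toFun p := ⟨delta x p.1, delta_mem_polynomials p.2 x⟩
  map_add' p q := Subtype.ext (map_add (delta x) p.1 q.1)
  map_smul' c p := Subtype.ext (map_smul (delta x) c p.1)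

theorem polyDelta_nil (x : α) : polyDelta hD x (wordPoly hD []) = 0 := by
  rw [wordPoly_nil]; exact Subtype.ext (delta_one x)

open Classical in
theorem polyDelta_cons (x y : α) (w : List α) :
    polyDelta hD x (wordPoly hD (y :: w)) = if x = y then wordPoly hD w else 0 := by
  refine Subtype.ext ((delta_wordSeries_cons x y w).trans ?_)
  split_ifs <;> rfl

variable {hD}

theorem poly_induction {C : polySub D hD → Prop} (hw : ∀ w, C (wordPoly hD w))
    (hadd : ∀ p q, C p → C q → C (p + q)) (hsmul : ∀ (c : ℂ) p, C p → C (c • p))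
    (p : polySub D hD) : C p := by
  have h : p = ∑ w ∈ Set.Finite.toFinset p.2, p.1 w • wordPoly hD w := by
    refine Subtype.ext ((eq_sum_wordSeries p.2).trans ?_)
    exact (map_sum (polySub D hD).val (fun w => p.1 w • wordPoly hD w) _).symm
  rw [h]
  refine Finset.sum_induction _ C hadd ?_ fun w _ => hsmul _ _ (hw w)
  simpa using hsmul 0 _ (hw [])

theorem polyHom_ext {M : Type*} [AddCommMonoid M] [Module ℂ M] {f g : polySub D hD →ₗ[ℂ] M}
    (h : ∀ w, f (wordPoly hD w) = g (wordPoly hD w)) : f = g :=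
  LinearMap.ext (poly_induction h (fun p q hp hq => by rw [map_add, map_add, hp, hq])
    fun c p hp => by rw [map_smul, map_smul, hp])

variable (hD)

/-- The coefficients of a polynomial. -/
def polyCoeff : polySub D hD →ₗ[ℂ] (List α →₀ ℂ) where
  toFun p := Finsupp.ofSupportFinite (fun w => p.1 w) p.2
  map_add' p q := Finsupp.ext fun w => add_apply' p.1 q.1 w
  map_smul' c p := Finsupp.ext fun w => smul_apply' c p.1 w

theorem polyCoeff_apply (p : polySub D hD) (w : List α) : polyCoeff hD p w = p.1 w := rfl

/-- The linear map on polynomials that maps the word `w` to `F w`. -/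
def polyPair {M : Type*} [AddCommGroup M] [Module ℂ M] (F : List α → M) :
    polySub D hD →ₗ[ℂ] M :=
  (Finsupp.linearCombination ℂ F).comp (polyCoeff hD)

theorem polyPair_word {M : Type*} [AddCommGroup M] [Module ℂ M] (F : List α → M) (w : List α) :
    polyPair hD F (wordPoly hD w) = F w := by
  classical
  have : polyCoeff hD (wordPoly hD w) = Finsupp.single w 1 := Finsupp.ext fun u => by
    rw [Finsupp.single_apply, polyCoeff_apply]
    refine (wordSeries_apply (D := D) w u).trans ?_
    simp only [eq_comm]
  rw [polyPair, LinearMap.comp_apply, this]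
  rw [Finsupp.linearCombination_single, one_smul]

/-- Induction on pairs of polynomials through their left derivatives. -/
theorem poly_pair_induction {C : polySub D hD → polySub D hD → Prop} (h0 : ∀ q, C 0 q)
    (h0' : ∀ p, C p 0) (step : ∀ p q, (∀ x, C (polyDelta hD x p) q) →
      (∀ x, C p (polyDelta hD x q)) → C p q) (p q : polySub D hD) : C p q := by
  obtain ⟨m, hm⟩ := lengthLT_of_mem_polynomials (D := D) p.2
  obtain ⟨n, hn⟩ := lengthLT_of_mem_polynomials (D := D) q.2
  induction h : m + n generalizing m n p q with
  | zero =>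
    obtain rfl : m = 0 := by omega
    rw [show p = 0 from Subtype.ext hm.eq_zero]
    exact h0 q
  | succ k ih =>
    rcases m with _ | m
    · rw [show p = 0 from Subtype.ext hm.eq_zero]
      exact h0 q
    rcases n with _ | n
    · rw [show q = 0 from Subtype.ext hn.eq_zero]
      exact h0' p
    exact step p q (fun x => ih _ _ m (hm.delta x) (n + 1) hn (by omega))
      fun x => ih _ _ (m + 1) hm n (hn.delta x) (by omega)

end Pairing

end QSeries

/-! ### Asymptotic expansions in powers of a logarithm -/

section Expansion

open Polynomial

variable {ι : Type} {l : Filter ι} {L : ι → ℝ}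

/-- `f - P(L)` tends to zero faster than any power of `L⁻¹`. -/
def HasLogExpansion (l : Filter ι) (L : ι → ℝ) (f : ι → ℂ) (P : ℂ[X]) : Prop :=
  ∀ k : ℕ, Tendsto (fun i => (f i - P.eval (L i : ℂ)) * (L i : ℂ) ^ k) l (𝓝 0)

theorem tendsto_mul_eval {r : ι → ℂ} (hr : ∀ k : ℕ, Tendsto (fun i => r i * (L i : ℂ) ^ k) l (𝓝 0))
    (Q : ℂ[X]) (k : ℕ) : Tendsto (fun i => r i * Q.eval (L i : ℂ) * (L i : ℂ) ^ k) l (𝓝 0) := by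
  induction Q using Polynomial.induction_on' with
  | add p q hp hq =>
    simpa only [eval_add, mul_add, add_mul, add_zero] using hp.add hq
  | monomial n a =>
    have := (hr (n + k)).const_mul a
    rw [mul_zero] at this
    refine this.congr fun i => ?_
    rw [eval_monomial, pow_add]; ring

namespace HasLogExpansion

variable {f g : ι → ℂ} {P Q : ℂ[X]}

theorem add (hf : HasLogExpansion l L f P) (hg : HasLogExpansion l L g Q) :
    HasLogExpansion l L (fun i => f i + g i) (P + Q) := fun k => by
  have := (hf k).add (hg k)
  rw [add_zero] at this
  refine this.congr fun i => ?_
  rw [eval_add]; ring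

theorem smul (c : ℂ) (hf : HasLogExpansion l L f P) :
    HasLogExpansion l L (fun i => c * f i) (c • P) := fun k => by
  have := (hf k).const_mul c
  rw [mul_zero] at this
  refine this.congr fun i => ?_
  rw [eval_smul, smul_eq_mul]; ring

theorem mul (hf : HasLogExpansion l L f P) (hg : HasLogExpansion l L g Q) :
    HasLogExpansion l L (fun i => f i * g i) (P * Q) := fun k => by
  have h0 := (hg 0)
  simp only [pow_zero, mul_one] at h0
  -- f g - P Q = (f - P)(g - Q) + (f - P) Q + (g - Q) P.
  have := (((hf k).mul h0).add (tendsto_mul_eval hf Q k)).add (tendsto_mul_eval hg P k)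
  rw [mul_zero, add_zero, add_zero] at this
  refine this.congr fun i => ?_
  rw [eval_mul]; ring

theorem const (c : ℂ) : HasLogExpansion l L (fun _ => c) (C c) := fun k => by
  simp only [eval_C, sub_self, zero_mul]
  exact tendsto_const_nhds

theorem congr' (hf : HasLogExpansion l L f P) (h : f =ᶠ[l] g) : HasLogExpansion l L g P := fun k =>
  (hf k).congr' (h.mono fun i hi => by simp only [hi])

/-- P - Q tends to 0 along |L| → ∞, which a nonconstant polynomial cannot do. -/
theorem unique [l.NeBot] (hL : Tendsto (fun i => |L i|) l atTop) (hf : HasLogExpansion l L f P)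
    (hg : HasLogExpansion l L f Q) : P = Q := by
  by_contra hPQ
  have hne : P - Q ≠ 0 := sub_ne_zero.2 hPQ
  have h0 : Tendsto (fun i => ‖(P - Q).eval (L i : ℂ)‖) l (𝓝 0) := by
    have := ((hg 0).sub (hf 0)).norm
    rw [sub_zero, norm_zero] at this
    refine this.congr fun i => ?_
    rw [eval_sub]; congr 1; ring
  rcases Nat.eq_zero_or_pos (P - Q).natDegree with hd | hd
  · rw [eq_C_of_natDegree_eq_zero hd] at h0 hne
    simp only [eval_C] at h0
    have := tendsto_nhds_unique h0 tendsto_const_nhds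
    exact hne (by rw [norm_eq_zero.1 this.symm, map_zero])
  · refine not_tendsto_nhds_of_tendsto_atTop (tendsto_norm_atTop (P - Q)
      (natDegree_pos_iff_degree_pos.1 hd) (z := fun i => (L i : ℂ)) ?_) 0 h0
    simpa using hL

end HasLogExpansion

open QSeries

theorem HasLogExpansion.polyPair {α : Type} {D : Contraction α} (hD : D.Locally)
    {F : List α → ι → ℂ} {P : List α → ℂ[X]} (hFP : ∀ w, HasLogExpansion l L (F w) (P w))
    (p : polySub D hD) :
    HasLogExpansion l L (fun i => QSeries.polyPair hD (fun w => F w i) p)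
      (QSeries.polyPair hD P p) := by
  induction p using poly_induction with
  | hw w => simpa only [polyPair_word] using hFP w
  | hadd p q hp hq => simpa only [map_add] using hp.add hq
  | hsmul c p hp => simpa only [map_smul, smul_eq_mul] using hp.smul c

/-- Regularized values of a multiplicative family of functions form a character. -/
theorem exists_regularized_character [l.NeBot] (hL : Tendsto (fun i => |L i|) l atTop)
    {α : Type} {D : Contraction α} (hD : D.Locally)
    {F : List α → ι → ℂ} {P : List α → ℂ[X]} (hFP : ∀ w, HasLogExpansion l L (F w) (P w))
    (h1 : ∀ i, F [] i = 1)
    (hmul : ∀ p q : polySub D hD, ∀ᶠ i in l, QSeries.polyPair hD (fun w => F w i) (p * q) =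
      QSeries.polyPair hD (fun w => F w i) p * QSeries.polyPair hD (fun w => F w i) q) :
    ∃ ψ : polySub D hD →ₐ[ℂ] ℂ, ∀ w, ψ (wordPoly hD w) = (P w).coeff 0 := by
  -- Uniqueness of expansions makes the passage from a polynomial to its expansion multiplicative;
  -- the character is the value of the expansion at 0.
  let R : polySub D hD →ₐ[ℂ] ℂ[X] := AlgHom.ofLinearMap (QSeries.polyPair hD P)
    (by
      rw [← wordPoly_nil, polyPair_word]
      refine (hFP []).unique hL ?_
      have := HasLogExpansion.const (l := l) (L := L) 1
      rw [show F [] = fun _ => 1 from funext h1, ← Polynomial.C_1]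
      exact this)
    (fun p q => ((HasLogExpansion.polyPair hD hFP (p * q)).congr' (hmul p q)).unique hL
        ((HasLogExpansion.polyPair hD hFP p).mul (HasLogExpansion.polyPair hD hFP q)))
  refine ⟨(Polynomial.aeval (0 : ℂ)).comp R, fun w => ?_⟩
  have : R (wordPoly hD w) = P w := polyPair_word hD P w
  rw [AlgHom.comp_apply, this, Polynomial.coe_aeval_eq_eval, Polynomial.coeff_zero_eq_eval_zero]

theorem HasLogExpansion.hasFinitePart {f : ι → ℝ} {P : ℂ[X]} (p : ι → ℝ)
    (h : HasLogExpansion l L (fun i => (f i : ℂ)) P) :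
    HasFinitePart l p L f (P.coeff 0) := by
  classical
  have hinj : Function.Injective fun b : ℕ => ((0 : ℤ), b) := fun a b h => (Prod.ext_iff.1 h).2
  refine ⟨Finsupp.mapDomain (fun b : ℕ => ((0 : ℤ), b)) P.toFinsupp.coeff, ?_,
    Finsupp.mapDomain_apply hinj _ 0⟩
  have h0 := h 0
  simp only [pow_zero, mul_one] at h0
  refine h0.congr fun i => ?_
  rw [Finsupp.sum_mapDomain_index (fun _ => zero_mul _) (fun _ _ _ => add_mul _ _ _),
    Polynomial.eval_eq_sum]
  simp only [zpow_zero, one_mul, Complex.ofReal_pow]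
  rfl

/-- An expansion with an error term that is a power of `e`, where `log e = ± L`. -/
theorem HasLogExpansion.of_bound {e : ι → ℝ} (he : Tendsto e l (𝓝[>] 0))
    (hLe : ∀ i, |L i| = |Real.log (e i)|) {f : ι → ℝ} {P : ℝ[X]} {K : ℝ}
    (h : ∀ᶠ i in l, |f i - P.eval (L i)| ≤ K * e i ^ (1 / 2 : ℝ)) :
    HasLogExpansion l L (fun i => (f i : ℂ)) (P.map (algebraMap ℝ ℂ)) := fun k => by
  have h1 : Tendsto (fun x : ℝ => K * (|Real.log x| ^ (k : ℝ) * x ^ (1 / 2 : ℝ))) (𝓝[>] 0) (𝓝 0) := by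
    have h2 := isLittleO_abs_log_rpow_rpow_nhdsGT_zero (s := -(1 / 2)) (k : ℝ) (by norm_num)
    have h3 := h2.tendsto_div_nhds_zero.const_mul K
    rw [mul_zero] at h3
    refine h3.congr' (eventually_nhdsWithin_of_forall fun x hx => ?_)
    simp only
    rw [Real.rpow_neg (le_of_lt hx), div_inv_eq_mul]
  refine squeeze_zero_norm' ?_ (h1.comp he)
  filter_upwards [h] with i hi
  have : ((f i : ℂ) - (P.map (algebraMap ℝ ℂ)).eval (L i : ℂ)) * (L i : ℂ) ^ k =
      (((f i - P.eval (L i)) * L i ^ k : ℝ) : ℂ) := by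
    push_cast
    congr 2
    exact Polynomial.eval_map_apply (algebraMap ℝ ℂ) (L i)
  rw [this, Complex.norm_real, Real.norm_eq_abs, abs_mul, abs_pow, hLe i]
  refine (mul_le_mul_of_nonneg_right hi (by positivity)).trans (le_of_eq ?_)
  simp only [Function.comp_apply, Real.rpow_natCast]
  ring

/-- Polynomials in the logarithm are bounded by negative powers. -/
theorem exists_eval_log_le (P : ℝ[X]) : ∃ K : ℝ, 0 ≤ K ∧ ∀ x : ℝ, 0 < x → x ≤ 1 →
    |P.eval (Real.log x)| ≤ K * x ^ (-(1 / 2) : ℝ) := by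
  induction P using Polynomial.induction_on' with
  | add p q hp hq =>
    obtain ⟨K, hK, h⟩ := hp
    obtain ⟨K', hK', h'⟩ := hq
    refine ⟨K + K', add_nonneg hK hK', fun x hx hx1 => ?_⟩
    rw [eval_add, add_mul]
    exact (abs_add_le _ _).trans (add_le_add (h x hx hx1) (h' x hx hx1))
  | monomial n a =>
    refine ⟨|a| * (2 * (n + 1)) ^ n, by positivity, fun x hx hx1 => ?_⟩
    -- Each of the n logarithms costs a power 1/(2(n + 1)), in total less than 1/2.
    have hn : (0 : ℝ) < 1 / (2 * (n + 1)) := by positivity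
    have h1 := (Real.abs_log_mul_self_rpow_lt x _ hx hx1 hn).le
    rw [one_div_one_div, abs_mul, abs_of_pos (Real.rpow_pos_of_pos hx _)] at h1
    have h2 : |Real.log x| ^ n * x ^ (1 / 2 : ℝ) ≤ (2 * (n + 1)) ^ n := by
      refine le_trans ?_ (pow_le_pow_left₀ (by positivity) h1 n)
      rw [mul_pow, ← Real.rpow_natCast (x ^ _), ← Real.rpow_mul hx.le]
      refine mul_le_mul_of_nonneg_left (Real.rpow_le_rpow_of_exponent_ge hx hx1 ?_) (by positivity)
      rw [div_mul_eq_mul_div, one_mul, div_le_div_iff₀ (by positivity) (by positivity)]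
      linarith
    rw [eval_monomial, abs_mul, abs_pow, mul_assoc]
    refine mul_le_mul_of_nonneg_left ?_ (abs_nonneg a)
    rw [Real.rpow_neg hx.le, ← div_eq_mul_inv, le_div_iff₀ (Real.rpow_pos_of_pos hx _)]
    exact h2

end Expansion

/-! ### Polylogarithms -/

namespace Polylog

open MeasureTheory Set

/-- The majorant s^(-1/2) is integrable at 0 with primitive 2 s^(1/2). -/
theorem integral_of_bound {f : ℝ → ℝ} (hf : ContinuousOn f (Ioo 0 1)) {C : ℝ}
    (hC : ∀ s ∈ Ioc (0 : ℝ) (1 / 2), |f s| ≤ C * s ^ (-(1 / 2) : ℝ)) :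
    (∀ z ∈ Ioo (0 : ℝ) 1, HasDerivAt (fun z => ∫ s in (0 : ℝ)..z, f s) (f z) z) ∧
    ∀ z ∈ Ioc (0 : ℝ) (1 / 2), |∫ s in (0 : ℝ)..z, f s| ≤ 2 * C * z ^ (1 / 2 : ℝ) := by
  have hg : ∀ a b : ℝ, IntervalIntegrable (fun s : ℝ => C * s ^ (-(1 / 2) : ℝ)) volume a b :=
    fun a b => (intervalIntegral.intervalIntegrable_rpow' (by norm_num)).const_mul C
  have hhalf : IntervalIntegrable f volume 0 (1 / 2) := by
    refine (hg 0 (1 / 2)).mono_fun' ?_ ?_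
    · rw [uIoc_of_le (by norm_num)]
      exact (hf.mono fun s hs => ⟨hs.1, hs.2.trans_lt (by norm_num)⟩).aestronglyMeasurable
        measurableSet_Ioc
    · rw [uIoc_of_le (by norm_num)]
      exact (ae_restrict_mem measurableSet_Ioc).mono hC
  have hint : ∀ z ∈ Ioo (0 : ℝ) 1, IntervalIntegrable f volume 0 z := fun z hz => by
    refine hhalf.trans (ContinuousOn.intervalIntegrable (hf.mono fun s hs => ?_))
    rw [mem_uIcc] at hs
    rcases hs with hs | hs
    · exact ⟨lt_of_lt_of_le (by norm_num) hs.1, hs.2.trans_lt hz.2⟩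
    · exact ⟨hz.1.trans_le hs.1, hs.2.trans_lt (by norm_num)⟩
  refine ⟨fun z hz => intervalIntegral.integral_hasDerivAt_right (hint z hz)
    (hf.stronglyMeasurableAtFilter isOpen_Ioo z hz) (hf.continuousAt (Ioo_mem_nhds hz.1 hz.2)),
    fun z hz => ?_⟩
  have h1 := intervalIntegral.norm_integral_le_of_norm_le hz.1.le
    (Eventually.of_forall fun t ht => hC t ⟨ht.1, ht.2.trans hz.2⟩ :
      ∀ᵐ t ∂volume, t ∈ Ioc 0 z → ‖f t‖ ≤ C * t ^ (-(1 / 2) : ℝ)) (hg 0 z)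
  refine h1.trans (le_of_eq ?_)
  rw [intervalIntegral.integral_const_mul, integral_rpow (Or.inl (by norm_num)),
    Real.zero_rpow (by norm_num)]
  norm_num
  ring

/-- The density of the differential form `ω_i`. -/
def form (i : Fin 2) (z : ℝ) : ℝ := if i = 0 then 1 / z else 1 / (1 - z)

/-- Powers of the logarithm satisfy only the weaker bound. Words containing x_1 satisfy the stronger
one, which keeps the integral against dz/z convergent at 0. -/
def LocalBound (w : List (Fin 2)) : Prop :=
  ContinuousOn (Li w) (Ioo 0 1) ∧ ∃ C : ℝ, 0 ≤ C ∧
    (∀ s ∈ Ioc (0 : ℝ) (1 / 2), |Li w s| ≤ C * s ^ (-(1 / 2) : ℝ)) ∧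
    ((∃ j ∈ w, j ≠ 0) → ∀ s ∈ Ioc (0 : ℝ) (1 / 2), |Li w s| ≤ C * s ^ (1 / 2 : ℝ))

theorem rpow_half_le {s : ℝ} (hs : s ∈ Ioc (0 : ℝ) (1 / 2)) :
    s ^ (1 / 2 : ℝ) ≤ s ^ (-(1 / 2) : ℝ) :=
  Real.rpow_le_rpow_of_exponent_ge hs.1 (hs.2.trans (by norm_num)) (by norm_num)

theorem Li_cons_zeros {w : List (Fin 2)} (h : ∀ j ∈ w, j = 0) :
    Li (0 :: w) =
      fun z => Real.log z ^ (w.length + 1) / (Nat.factorial (w.length + 1) : ℝ) := by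
  funext z
  simp only [Li, if_pos h, if_true]

theorem Li_zeros {w : List (Fin 2)} (h : ∀ j ∈ w, j = 0) :
    Li w = fun z => Real.log z ^ w.length / (Nat.factorial w.length : ℝ) := by
  cases w with
  | nil => funext z; simp [Li]
  | cons i w =>
    obtain rfl := h i List.mem_cons_self
    exact Li_cons_zeros fun j hj => h j (List.mem_cons_of_mem _ hj)

theorem Li_cons_integral {i : Fin 2} {w : List (Fin 2)} (h : ∃ j ∈ i :: w, j ≠ 0) :
    Li (i :: w) = fun z => ∫ s in (0 : ℝ)..z, form i s * Li w s := by
  funext z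
  by_cases hi : i = 0
  · have hw : ¬ ∀ j ∈ w, j = 0 := by
      obtain ⟨j, hj, hj0⟩ := h
      rcases List.mem_cons.1 hj with rfl | hj
      · exact absurd hi hj0
      · exact fun h' => hj0 (h' j hj)
    simp only [Li, if_pos hi, if_neg hw, form]
    simp only [one_div, inv_mul_eq_div]
  · simp only [Li, if_neg hi, form]
    simp only [one_div, inv_mul_eq_div]

theorem continuousOn_form (i : Fin 2) : ContinuousOn (form i) (Ioo 0 1) := by
  unfold form
  split_ifs
  · exact continuousOn_const.div continuousOn_id fun x hx => hx.1.ne'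
  · exact continuousOn_const.div (continuousOn_const.sub continuousOn_id)
      fun x hx => (sub_pos.2 hx.2).ne'

/-- The bounds for w make the integrand O(s^(-1/2)), hence the integral differentiable and
O(z^(1/2)). Words without x_1 are powers of the logarithm and are treated by hand. -/
theorem hasDerivAt_and_localBound {w : List (Fin 2)} (hw : LocalBound w) (i : Fin 2) :
    (∀ z ∈ Ioo (0 : ℝ) 1, HasDerivAt (Li (i :: w)) (form i z * Li w z) z) ∧
      LocalBound (i :: w) := by
  suffices h : (∀ z ∈ Ioo (0 : ℝ) 1, HasDerivAt (Li (i :: w)) (form i z * Li w z) z) ∧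
      ∃ C : ℝ, 0 ≤ C ∧ (∀ s ∈ Ioc (0 : ℝ) (1 / 2), |Li (i :: w) s| ≤ C * s ^ (-(1 / 2) : ℝ)) ∧
        ((∃ j ∈ i :: w, j ≠ 0) → ∀ s ∈ Ioc (0 : ℝ) (1 / 2),
          |Li (i :: w) s| ≤ C * s ^ (1 / 2 : ℝ)) from
    ⟨h.1, fun z hz => (h.1 z hz).continuousAt.continuousWithinAt, h.2⟩
  obtain ⟨hcont, C, hC, h1, h2⟩ := hw
  by_cases hz : ∃ j ∈ i :: w, j ≠ 0
  · have hb : ∀ s ∈ Ioc (0 : ℝ) (1 / 2),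
        |form i s * Li w s| ≤ (2 * C) * s ^ (-(1 / 2) : ℝ) := by
      intro s hs
      rw [abs_mul]
      by_cases hi : i = 0
      · have hw : ∃ j ∈ w, j ≠ 0 := by
          obtain ⟨j, hj, hj0⟩ := hz
          rcases List.mem_cons.1 hj with rfl | hj
          · exact absurd hi hj0
          · exact ⟨j, hj, hj0⟩
        have h3 : |form i s| = s⁻¹ := by
          rw [form, if_pos hi, one_div, abs_of_pos (inv_pos.2 hs.1)]
        rw [h3]
        have h4 : s⁻¹ * s ^ (1 / 2 : ℝ) = s ^ (-(1 / 2) : ℝ) := by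
          rw [← Real.rpow_neg_one, ← Real.rpow_add hs.1]; norm_num
        calc s⁻¹ * |Li w s| ≤ s⁻¹ * (C * s ^ (1 / 2 : ℝ)) :=
              mul_le_mul_of_nonneg_left (h2 hw s hs) (inv_pos.2 hs.1).le
          _ = C * s ^ (-(1 / 2) : ℝ) := by rw [← h4]; ring
          _ ≤ _ := by
            have : 0 ≤ C * s ^ (-(1 / 2) : ℝ) := mul_nonneg hC (Real.rpow_nonneg hs.1.le _)
            linarith
      · have h5 : 0 < 1 - s := by linarith [hs.2]
        have h3 : |form i s| ≤ 2 := by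
          rw [form, if_neg hi, abs_of_pos (by positivity), div_le_iff₀ h5]
          linarith [hs.2]
        rw [mul_assoc]
        exact mul_le_mul h3 (h1 s hs) (abs_nonneg _) (by norm_num)
    obtain ⟨hd, hbd⟩ := integral_of_bound ((continuousOn_form i).mul hcont) hb
    rw [Li_cons_integral hz]
    have h6 : ∀ s ∈ Ioc (0 : ℝ) (1 / 2), |∫ s in (0 : ℝ)..s, form i s * Li w s| ≤
      2 * (2 * C) * s ^ (1 / 2 : ℝ) := hbd
    exact ⟨hd, 2 * (2 * C), by positivity, fun s hs => (h6 s hs).trans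
      (mul_le_mul_of_nonneg_left (rpow_half_le hs) (by positivity)), fun _ => h6⟩
  · push Not at hz
    obtain rfl := hz i List.mem_cons_self
    have hw : ∀ j ∈ w, j = 0 := fun j hj => hz j (List.mem_cons_of_mem _ hj)
    have hne : ((w.length + 1).factorial : ℝ) ≠ 0 := by positivity
    rw [Li_cons_zeros hw]
    refine ⟨fun z hz0 => ?_, ?_⟩
    · have h3 := ((Real.hasDerivAt_log hz0.1.ne').pow (w.length + 1)).div_const
        ((w.length + 1).factorial : ℝ)
      refine h3.congr_deriv ?_
      rw [Li_zeros hw, form, if_pos rfl, Nat.factorial_succ]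
      have : (w.length.factorial : ℝ) ≠ 0 := by positivity
      have := hz0.1.ne'
      push_cast
      field_simp
    · obtain ⟨K, hK, h⟩ := exists_eval_log_le
        (Polynomial.C ((w.length + 1).factorial : ℝ)⁻¹ * Polynomial.X ^ (w.length + 1))
      refine ⟨K, hK, fun s hs => ?_, fun ⟨j, hj, hj0⟩ => absurd (hz j hj) hj0⟩
      have := h s hs.1 (hs.2.trans (by norm_num))
      rwa [Polynomial.eval_mul, Polynomial.eval_C, Polynomial.eval_pow, Polynomial.eval_X,
        inv_mul_eq_div] at this

theorem localBound (w : List (Fin 2)) : LocalBound w := by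
  induction w with
  | nil =>
    refine ⟨continuousOn_const, 1, zero_le_one, fun s hs => ?_, fun ⟨j, hj, _⟩ => by simp at hj⟩
    rw [one_mul, Li, abs_one]
    exact Real.one_le_rpow_of_pos_of_le_one_of_nonpos hs.1 (hs.2.trans (by norm_num)) (by norm_num)
  | cons i w ih => exact (hasDerivAt_and_localBound ih i).2

theorem hasDerivAt_Li_cons (i : Fin 2) (w : List (Fin 2)) {z : ℝ} (hz : z ∈ Ioo (0 : ℝ) 1) :
    HasDerivAt (Li (i :: w)) (form i z * Li w z) z :=
  (hasDerivAt_and_localBound (localBound w) i).1 z hz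

/-! #### Expansion at the origin -/

open Polynomial in
/-- The expansion of `Li_w` at `0`, a polynomial in `log z`. -/
def zeroExpansion (w : List (Fin 2)) : ℝ[X] :=
  if ∀ j ∈ w, j = 0 then C ((w.length.factorial : ℝ)⁻¹) * X ^ w.length else 0

theorem hasLogExpansion_zero (w : List (Fin 2)) :
    HasLogExpansion (𝓝[>] (0 : ℝ)) Real.log (fun z => (Li w z : ℂ))
      ((zeroExpansion w).map (algebraMap ℝ ℂ)) := by
  obtain ⟨_, C, _, _, h⟩ := localBound w
  refine HasLogExpansion.of_bound (e := fun z => z) tendsto_id (fun _ => rfl) (K := C) ?_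
  have h0 : ∀ᶠ z : ℝ in 𝓝[>] 0, z ∈ Ioc (0 : ℝ) (1 / 2) := Ioc_mem_nhdsGT (by norm_num)
  filter_upwards [h0] with z hz
  unfold zeroExpansion
  split_ifs with hw
  · rw [Li_zeros hw, Polynomial.eval_mul, Polynomial.eval_C, Polynomial.eval_pow,
      Polynomial.eval_X, inv_mul_eq_div, sub_self, abs_zero]
    have hC' : 0 ≤ C := by assumption
    exact mul_nonneg hC' (Real.rpow_nonneg hz.1.le _)
  · push Not at hw
    rw [Polynomial.eval_zero, sub_zero]
    exact h hw z hz

theorem polyDelta_mul {α : Type} (x : α) (p q : Shuffle.Poly α) :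
    QSeries.polyDelta _ x (p * q) =
      QSeries.polyDelta _ x p * q + p * QSeries.polyDelta _ x q :=
  Subtype.ext (Shuffle.delta_mul x p.1 q.1)

open Polynomial QSeries

/-- The expansion at the origin of a linear combination of polylogarithms. -/
def zeroHom : Shuffle.Poly (Fin 2) →ₗ[ℂ] ℂ[X] :=
  polyPair _ fun w => (zeroExpansion w).map (algebraMap ℝ ℂ)

/-- At the origin only pure powers of x_0 survive, and for them x_0⁻¹ is differentiation with
respect to log z. -/
theorem derivative_zeroHom (p : Shuffle.Poly (Fin 2)) :
    derivative (zeroHom p) = zeroHom (polyDelta _ 0 p) := by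
  refine LinearMap.congr_fun (f := (derivative (R := ℂ)).comp zeroHom)
    (g := zeroHom.comp (polyDelta _ 0)) (polyHom_ext fun w => ?_) p
  rw [LinearMap.comp_apply, LinearMap.comp_apply, zeroHom, polyPair_word]
  cases w with
  | nil => rw [polyDelta_nil, map_zero]; simp [zeroExpansion]
  | cons i w =>
    rw [polyDelta_cons, apply_ite (polyPair _ _), polyPair_word, map_zero]
    by_cases hi : i = 0
    · subst hi
      rw [if_pos rfl]
      by_cases hw : ∀ j ∈ w, j = 0
      · have hw' : ∀ j ∈ (0 : Fin 2) :: w, j = 0 := fun j hj =>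
          (List.mem_cons.1 hj).elim id (hw j)
        rw [zeroExpansion, zeroExpansion, if_pos hw, if_pos hw']
        simp only [Polynomial.map_mul, map_C, Polynomial.map_pow, map_X, derivative_C_mul,
          derivative_X_pow, List.length_cons, Nat.add_sub_cancel, Nat.factorial_succ]
        rw [← mul_assoc, ← map_mul]
        congr 2
        have : (w.length.factorial : ℂ) ≠ 0 := by exact_mod_cast w.length.factorial_ne_zero
        have : (w.length : ℂ) + 1 ≠ 0 := by exact_mod_cast w.length.succ_ne_zero
        push_cast
        field_simp
      · have hw' : ¬ ∀ j ∈ (0 : Fin 2) :: w, j = 0 := fun h => hw fun j hj =>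
          h j (List.mem_cons_of_mem _ hj)
        rw [zeroExpansion, zeroExpansion, if_neg hw, if_neg hw']
        simp
    · have hw' : ¬ ∀ j ∈ i :: w, j = 0 := fun h => hi (h i List.mem_cons_self)
      rw [zeroExpansion, if_neg hw', if_neg (Ne.symm hi)]
      simp

theorem eval_zeroHom (p : Shuffle.Poly (Fin 2)) : (zeroHom p).eval 0 = p.1 [] := by
  refine LinearMap.congr_fun (f := (leval (0 : ℂ)).comp zeroHom)
    (g := (augmentation (noContraction (Fin 2))).toLinearMap.comp (Shuffle.Poly _).val.toLinearMap)
    (polyHom_ext fun w => ?_) p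
  rw [LinearMap.comp_apply, zeroHom, polyPair_word]
  cases w with
  | nil =>
    rw [wordPoly_nil]
    simp [zeroExpansion]
  | cons i w =>
    have h0 : (wordPoly Shuffle.locally_noContraction (i :: w)).1 [] = 0 :=
      (wordSeries_apply (D := noContraction (Fin 2)) (i :: w) []).trans (if_neg (by simp))
    refine Eq.trans ?_ h0.symm
    rw [zeroExpansion]
    split_ifs <;> simp

/-- Both sides have the same derivative, by induction through left derivatives, and the same value
at 0. -/
theorem zeroHom_mul (p q : Shuffle.Poly (Fin 2)) : zeroHom (p * q) = zeroHom p * zeroHom q := by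
  induction p, q using poly_pair_induction with
  | h0 q => rw [zero_mul, map_zero, zero_mul]
  | h0' p => rw [mul_zero, map_zero, mul_zero]
  | step p q hp hq =>
    rw [← sub_eq_zero]
    have h1 : derivative (zeroHom (p * q) - zeroHom p * zeroHom q) = 0 := by
      rw [derivative_sub, derivative_mul, derivative_zeroHom, derivative_zeroHom,
        derivative_zeroHom, polyDelta_mul, map_add, hp, hq, sub_self]
    have h2 := eq_C_of_natDegree_eq_zero (derivative_eq_zero.1 h1)
    have h3 : (zeroHom (p * q) - zeroHom p * zeroHom q).eval 0 = 0 := by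
      rw [eval_sub, eval_mul, eval_zeroHom, eval_zeroHom, eval_zeroHom, sub_eq_zero]
      rfl
    rw [h2, eval_C] at h3
    rw [h2, h3, map_zero]

/-! #### Multiplicativity -/

/-- Linear combinations of polylogarithms. -/
def liHom (z : ℝ) : Shuffle.Poly (Fin 2) →ₗ[ℂ] ℂ := polyPair _ fun w => (Li w z : ℂ)

theorem hasDerivAt_liHom (p : Shuffle.Poly (Fin 2)) {z : ℝ} (hz : z ∈ Ioo (0 : ℝ) 1) :
    HasDerivAt (fun z => liHom z p) (∑ i, (form i z : ℂ) * liHom z (polyDelta _ i p)) z := by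
  induction p using poly_induction with
  | hw w =>
    unfold liHom
    simp only [polyPair_word]
    cases w with
    | nil =>
      simp only [polyDelta_nil, map_zero, mul_zero, Finset.sum_const_zero, Li]
      exact hasDerivAt_const _ _
    | cons i w =>
      refine ((hasDerivAt_Li_cons i w hz).ofReal_comp).congr_deriv ?_
      rw [Finset.sum_eq_single i]
      · rw [polyDelta_cons, if_pos rfl, polyPair_word]
        push_cast; rfl
      · intro j _ hj
        rw [polyDelta_cons, if_neg hj, map_zero, mul_zero]
      · simp
  | hadd p q hp hq =>
    simp only [map_add, mul_add, Finset.sum_add_distrib]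
    exact hp.add hq
  | hsmul c p hp =>
    have := hp.const_mul c
    simp only [map_smul, smul_eq_mul]
    refine this.congr_deriv ?_
    rw [Finset.mul_sum]
    exact Finset.sum_congr rfl fun i _ => by ring

/-- By the Leibniz rule and induction, the difference of the two sides has derivative zero on (0,
1). The constant is its limit at 0, which vanishes because the expansions there are multiplicative.
-/
theorem liHom_mul (p q : Shuffle.Poly (Fin 2)) :
    ∀ z ∈ Ioo (0 : ℝ) 1, liHom z (p * q) = liHom z p * liHom z q := by
  induction p, q using poly_pair_induction with
  | h0 q => intro z _; rw [zero_mul, map_zero, zero_mul]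
  | h0' p => intro z _; rw [mul_zero, map_zero, mul_zero]
  | step p q hp hq =>
    let g : ℝ → ℂ := fun z => liHom z (p * q) - liHom z p * liHom z q
    have hg : ∀ z ∈ Ioo (0 : ℝ) 1, HasDerivAt g 0 z := fun z hz => by
      refine ((hasDerivAt_liHom (p * q) hz).sub
        ((hasDerivAt_liHom p hz).mul (hasDerivAt_liHom q hz))).congr_deriv ?_
      rw [Finset.sum_mul, Finset.mul_sum, ← Finset.sum_add_distrib, ← Finset.sum_sub_distrib]
      refine Finset.sum_eq_zero fun i _ => ?_
      rw [polyDelta_mul, map_add, hp i z hz, hq i z hz]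
      ring
    have hexp : ∀ r, HasLogExpansion (𝓝[>] (0 : ℝ)) Real.log (fun z => liHom z r) (zeroHom r) :=
      HasLogExpansion.polyPair _ hasLogExpansion_zero
    have hlim : Tendsto g (𝓝[>] 0) (𝓝 0) := by
      have h := ((hexp (p * q)).add (((hexp p).mul (hexp q)).smul (-1))) 0
      refine h.congr fun z => ?_
      simp only [zeroHom_mul, eval_add, eval_smul, smul_eq_mul, g]
      ring
    intro z hz
    have hconst : Tendsto g (𝓝[>] 0) (𝓝 (g z)) := by
      refine tendsto_const_nhds.congr' ?_
      filter_upwards [Ioo_mem_nhdsGT (zero_lt_one' ℝ)] with y hy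
      exact isOpen_Ioo.is_const_of_deriv_eq_zero isPreconnected_Ioo
        (fun x hx => (hg x hx).differentiableAt.differentiableWithinAt)
        (fun x hx => (hg x hx).deriv) hz hy
    exact sub_eq_zero.1 (tendsto_nhds_unique hconst hlim)

/-! #### Expansion at `1` -/

/-- A function on `[1/2, 1)` whose derivative is `O((1-z)^{-1/2})` converges at `1`. -/
theorem exists_limit_of_deriv_bound {f f' : ℝ → ℝ} {C : ℝ}
    (hf : ∀ z ∈ Ico (1 / 2 : ℝ) 1, HasDerivAt f (f' z) z)
    (hC : ∀ z ∈ Ico (1 / 2 : ℝ) 1, |f' z| ≤ C * (1 - z) ^ (-(1 / 2) : ℝ)) :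
    ∃ c : ℝ, ∀ z ∈ Ico (1 / 2 : ℝ) 1, |f z - c| ≤ 2 * C * (1 - z) ^ (1 / 2 : ℝ) := by
  -- h' is minus the bound on |f'|, so f - h increases, f + h decreases, and c is the supremum of f
  -- - h.
  let h : ℝ → ℝ := fun z => 2 * C * (1 - z) ^ (1 / 2 : ℝ)
  have hh : ∀ z ∈ Ico (1 / 2 : ℝ) 1, HasDerivAt h (-(C * (1 - z) ^ (-(1 / 2) : ℝ))) z := by
    intro z hz
    have h1 : HasDerivAt (fun z : ℝ => 1 - z) (-1) z := by
      simpa using (hasDerivAt_id z).const_sub 1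
    refine ((h1.rpow_const (p := 1 / 2) (Or.inl (sub_pos.2 hz.2).ne')).const_mul
      (2 * C)).congr_deriv ?_
    norm_num
    ring
  have hint : interior (Ico (1 / 2 : ℝ) 1) ⊆ Ico (1 / 2 : ℝ) 1 := interior_subset
  have hmono : MonotoneOn (fun z => f z - h z) (Ico (1 / 2 : ℝ) 1) := by
    refine monotoneOn_of_deriv_nonneg (convex_Ico _ _)
      (fun z hz => ((hf z hz).sub (hh z hz)).continuousAt.continuousWithinAt)
      (fun z hz => ((hf z (hint hz)).sub (hh z (hint hz))).differentiableAt.differentiableWithinAt)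
      fun z hz => ?_
    have := ((hf z (hint hz)).sub (hh z (hint hz))).deriv
    refine le_of_le_of_eq ?_ this.symm
    linarith [neg_le_of_abs_le (hC z (hint hz))]
  have hanti : AntitoneOn (fun z => f z + h z) (Ico (1 / 2 : ℝ) 1) := by
    refine antitoneOn_of_deriv_nonpos (convex_Ico _ _)
      (fun z hz => ((hf z hz).add (hh z hz)).continuousAt.continuousWithinAt)
      (fun z hz => ((hf z (hint hz)).add (hh z (hint hz))).differentiableAt.differentiableWithinAt)
      fun z hz => ?_
    have := ((hf z (hint hz)).add (hh z (hint hz))).deriv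
    refine le_of_eq_of_le this ?_
    linarith [le_of_abs_le (hC z (hint hz))]
  have hC0 : 0 ≤ C := by
    have := (abs_nonneg _).trans (hC (1 / 2) ⟨le_rfl, by norm_num⟩)
    exact nonneg_of_mul_nonneg_left this (Real.rpow_pos_of_pos (by norm_num) _)
  have hpos : ∀ z ∈ Ico (1 / 2 : ℝ) 1, 0 ≤ h z := fun z hz =>
    mul_nonneg (by positivity) (Real.rpow_nonneg (sub_pos.2 hz.2).le _)
  have hcross : ∀ z ∈ Ico (1 / 2 : ℝ) 1, ∀ z' ∈ Ico (1 / 2 : ℝ) 1, f z - h z ≤ f z' + h z' := by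
    intro z hz z' hz'
    rcases le_total z z' with hzz | hzz
    · have := hmono hz hz' hzz
      simp only at this
      linarith [hpos z' hz']
    · have := hanti hz' hz hzz
      simp only at this
      linarith [hpos z hz]
  refine ⟨sSup ((fun z => f z - h z) '' Ico (1 / 2 : ℝ) 1), fun z hz => ?_⟩
  have hle := le_csSup ⟨f (1 / 2) + h (1 / 2), by
    rintro _ ⟨y, hy, rfl⟩; exact hcross y hy _ ⟨le_rfl, by norm_num⟩⟩ (mem_image_of_mem _ hz)
  have hge : sSup ((fun z => f z - h z) '' Ico (1 / 2 : ℝ) 1) ≤ f z + h z :=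
    csSup_le ⟨_, mem_image_of_mem _ hz⟩ (by rintro _ ⟨y, hy, rfl⟩; exact hcross y hy z hz)
  rw [abs_le]
  constructor <;> linarith

/-- Induction on the word. After prepending x_0 the derivative is O((1-z)^(-1/2)) and the function
has a limit. After prepending x_1, with Q' = P, adding Q(log(1-z)) cancels the main part of the
derivative and leaves (1-z)⁻¹ O((1-z)^(1/2)), so the new expansion is c - Q. -/
theorem exists_expansion_one (w : List (Fin 2)) : ∃ (P : ℝ[X]) (K : ℝ), 0 ≤ K ∧
    ∀ z ∈ Ico (1 / 2 : ℝ) 1,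
      |Li w z - P.eval (Real.log (1 - z))| ≤ K * (1 - z) ^ (1 / 2 : ℝ) := by
  induction w with
  | nil => exact ⟨1, 0, le_rfl, fun z _ => by simp [Li]⟩
  | cons i w ih =>
    obtain ⟨P, K, hK, h⟩ := ih
    have hIoo : ∀ z ∈ Ico (1 / 2 : ℝ) 1, z ∈ Ioo (0 : ℝ) 1 := fun z hz =>
      ⟨lt_of_lt_of_le (by norm_num) hz.1, hz.2⟩
    by_cases hi : i = 0
    · obtain ⟨K', hK', h'⟩ := exists_eval_log_le P
      obtain ⟨c, hc⟩ := exists_limit_of_deriv_bound (f := Li (i :: w)) (C := 2 * (K + K'))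
        (fun z hz => hasDerivAt_Li_cons i w (hIoo z hz)) fun z hz => by
          have hz1 : 0 < 1 - z := sub_pos.2 hz.2
          have hz2 : 1 - z ≤ 1 := by linarith [hz.1]
          have hz0 := (hIoo z hz).1
          rw [abs_mul, mul_assoc]
          refine mul_le_mul ?_ ?_ (abs_nonneg _) (by norm_num)
          · rw [form, if_pos hi, abs_of_pos (by positivity), div_le_iff₀ hz0]
            linarith [hz.1]
          · have h1 := h z hz
            have h2 := h' (1 - z) hz1 hz2
            have h3 : (1 - z) ^ (1 / 2 : ℝ) ≤ (1 - z) ^ (-(1 / 2) : ℝ) :=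
              Real.rpow_le_rpow_of_exponent_ge hz1 hz2 (by norm_num)
            have h4 := mul_le_mul_of_nonneg_left h3 hK
            have h5 := abs_sub_abs_le_abs_sub (Li w z) (P.eval (Real.log (1 - z)))
            rw [add_mul]
            linarith
      exact ⟨Polynomial.C c, 2 * (2 * (K + K')), by positivity, fun z hz => by
        rw [eval_C]; exact hc z hz⟩
    · obtain ⟨Q, hQ⟩ : ∃ Q : ℝ[X], derivative Q = P := by
        refine Polynomial.induction_on' P ?_ fun n a => ?_
        · rintro p q ⟨Q, rfl⟩ ⟨Q', rfl⟩
          exact ⟨Q + Q', derivative_add⟩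
        · refine ⟨monomial (n + 1) (a / (n + 1)), ?_⟩
          have : (n : ℝ) + 1 ≠ 0 := by positivity
          rw [derivative_monomial]
          push_cast
          rw [div_mul_cancel₀ _ this]
      have hlog : ∀ z ∈ Ico (1 / 2 : ℝ) 1,
          HasDerivAt (fun z => Real.log (1 - z)) (-(1 - z)⁻¹) z := fun z hz => by
        have h1 : HasDerivAt (fun z : ℝ => 1 - z) (-1) z := by
          simpa using (hasDerivAt_id z).const_sub 1
        refine (h1.log (sub_pos.2 hz.2).ne').congr_deriv ?_
        rw [neg_div, one_div]
      obtain ⟨c, hc⟩ := exists_limit_of_deriv_bound (C := K)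
        (f := fun z => Li (i :: w) z + Q.eval (Real.log (1 - z)))
        (f' := fun z => (1 - z)⁻¹ * (Li w z - P.eval (Real.log (1 - z))))
        (fun z hz => by
          refine ((hasDerivAt_Li_cons i w (hIoo z hz)).add
            ((Q.hasDerivAt _).comp z (hlog z hz))).congr_deriv ?_
          rw [hQ, form, if_neg hi, one_div]
          ring) fun z hz => by
          have hz1 : 0 < 1 - z := sub_pos.2 hz.2
          rw [abs_mul, abs_of_pos (inv_pos.2 hz1)]
          refine (mul_le_mul_of_nonneg_left (h z hz) (inv_pos.2 hz1).le).trans (le_of_eq ?_)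
          rw [mul_left_comm, ← Real.rpow_neg_one, ← Real.rpow_add hz1]
          norm_num
      refine ⟨Polynomial.C c - Q, 2 * K, by positivity, fun z hz => ?_⟩
      have h1 := hc z hz
      rw [eval_sub, eval_C]
      rwa [show Li (i :: w) z - (c - Q.eval (Real.log (1 - z))) =
        Li (i :: w) z + Q.eval (Real.log (1 - z)) - c by ring]

theorem exists_zeta_character : ∃ ψ : Shuffle.Poly (Fin 2) →ₐ[ℂ] ℂ,
    ∀ w, IsZetaShuffleValue w (ψ (wordPoly _ w)) := by
  choose P K hK h using exists_expansion_one
  have hlim : Tendsto (fun z : ℝ => 1 - z) (𝓝[<] 1) (𝓝[>] 0) := by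
    refine tendsto_nhdsWithin_iff.2 ⟨?_, eventually_nhdsWithin_of_forall fun z hz =>
      show 0 < 1 - z from sub_pos.2 hz⟩
    have : Tendsto (fun z : ℝ => 1 - z) (𝓝 1) (𝓝 (1 - 1)) := tendsto_const_nhds.sub tendsto_id
    rw [sub_self] at this
    exact this.mono_left nhdsWithin_le_nhds
  have hL : Tendsto (fun z : ℝ => |Real.log (1 - z)|) (𝓝[<] 1) atTop :=
    tendsto_abs_atBot_atTop.comp (Real.tendsto_log_nhdsGT_zero.comp hlim)
  have hF : ∀ w, HasLogExpansion (𝓝[<] (1 : ℝ)) (fun z => Real.log (1 - z))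
      (fun z => (Li w z : ℂ)) ((P w).map (algebraMap ℝ ℂ)) := fun w => by
    refine HasLogExpansion.of_bound hlim (fun _ => rfl) (K := K w) ?_
    filter_upwards [Ico_mem_nhdsLT (show (1 / 2 : ℝ) < 1 by norm_num)] with z hz
    exact h w z hz
  obtain ⟨ψ, hψ⟩ := exists_regularized_character hL Shuffle.locally_noContraction hF
    (fun z => by simp [Li]) fun p q => by
      filter_upwards [Ioo_mem_nhdsLT (zero_lt_one' ℝ)] with z hz
      exact liHom_mul p q z hz
  refine ⟨ψ, fun w => ?_⟩
  rw [hψ]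
  exact (hF w).hasFinitePart _

end Polylog

/-- With the trivial homomorphism on multiplicative series, every (t x)^* receives the value 1. -/
theorem exists_zeta_extension : ∃ Z : extendedDomain (noContraction (Fin 2)) →ₐ[ℂ] ℂ,
    (∀ w : List (Fin 2), IsZetaShuffleValue w (Z (wordElt _ w))) ∧
    ∀ t : ℂ, ‖t‖ < 1 → Z (starElt _ t 0) = 1 ∧ Z (starElt _ t 1) = 1 := by
  classical
  obtain ⟨ψ, hψ⟩ := Polylog.exists_zeta_character
  obtain ⟨Z, hZ1, hZ2⟩ := Shuffle.exists_character ψ 1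
  refine ⟨Z, fun w => ?_, fun t _ => ⟨?_, ?_⟩⟩
  · rw [hZ1 (wordElt _ w) (QSeries.wordSeries_mem_polynomials (D := noContraction _) w)]
    exact hψ w
  · exact hZ2 _ _ (QSeries.of_letterStar t 0)
  · exact hZ2 _ _ (QSeries.of_letterStar t 1)

/-! ### Harmonic sums -/

namespace Harmonic

open QSeries Polynomial

theorem locally_addContraction : addContraction.Locally := fun i j =>
  (Set.finite_singleton (i + j)).subset fun s hs => ((mem_addPairs s i j).1 hs).symm

/-- The product of sums is grouped according to the value of i + j; pairs outside A × B contribute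
zero. -/
theorem sum_addPairs_eq_mul {A B S : Finset ℕ+} (hS : ∀ a ∈ A, ∀ b ∈ B, a + b ∈ S)
    {f g : ℕ+ → ℂ} (hf : ∀ i, f i ≠ 0 → i ∈ A) (hg : ∀ i, g i ≠ 0 → i ∈ B) :
    ∑ s ∈ S, ∑ p ∈ addPairs s, f p.1 * g p.2 = (∑ i ∈ A, f i) * ∑ j ∈ B, g j := by
  classical
  rw [Finset.sum_mul_sum, ← Finset.sum_product', ← Finset.sum_fiberwise_of_maps_to
    (s := A ×ˢ B) (t := S) (g := fun p => p.1 + p.2)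
    (fun p hp => hS _ (Finset.mem_product.1 hp).1 _ (Finset.mem_product.1 hp).2)]
  refine Finset.sum_congr rfl fun s _ => (Finset.sum_subset ?_ ?_).symm
  · intro p hp
    exact (mem_addPairs s p.1 p.2).2 (Finset.mem_filter.1 hp).2
  · intro p hp hp'
    by_contra h
    exact hp' (Finset.mem_filter.2 ⟨Finset.mem_product.2 ⟨hf _ (left_ne_zero_of_mul h),
      hg _ (right_ne_zero_of_mul h)⟩, (mem_addPairs s p.1 p.2).1 hp⟩)

theorem harmonicSum_cons_succ (s : ℕ+) (w : List ℕ+) (n : ℕ) :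
    harmonicSum (s :: w) (n + 1) =
      harmonicSum (s :: w) n + (((n + 1 : ℕ) : ℝ) ^ (s : ℕ))⁻¹ * harmonicSum w n := by
  rw [harmonicSum, Finset.sum_Icc_succ_top (Nat.le_add_left 1 n), harmonicSum, Nat.add_sub_cancel]

/-- Linear combinations of harmonic sums. -/
def harmonicHom (n : ℕ) : polySub addContraction locally_addContraction →ₗ[ℂ] ℂ :=
  polyPair _ fun w => (harmonicSum w n : ℂ)

theorem polyDelta_support (p : polySub addContraction locally_addContraction) :
    {s | polyDelta locally_addContraction s p ≠ 0}.Finite :=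
  (finite_delta_ne_zero p.2).subset fun _ hs h => hs (Subtype.ext h)

theorem harmonicHom_succ (n : ℕ) (p : polySub addContraction locally_addContraction)
    (S : Finset ℕ+) (hS : ∀ s, polyDelta locally_addContraction s p ≠ 0 → s ∈ S) :
    harmonicHom (n + 1) p = harmonicHom n p +
      ∑ s ∈ S, (((n + 1 : ℕ) : ℂ)⁻¹) ^ (s : ℕ) * harmonicHom n (polyDelta _ s p) := by
  -- A sum over all letters, with finite support, makes the identity linear in p, so that it can be
  -- checked on words.
  have key : harmonicHom (n + 1) p = harmonicHom n p +
      ∑ᶠ s : ℕ+, (((n + 1 : ℕ) : ℂ)⁻¹) ^ (s : ℕ) * harmonicHom n (polyDelta _ s p) := by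
    have hfin : ∀ p : polySub addContraction locally_addContraction,
        (Function.support fun s : ℕ+ =>
          (((n + 1 : ℕ) : ℂ)⁻¹) ^ (s : ℕ) * harmonicHom n (polyDelta _ s p)).Finite := fun p =>
      (polyDelta_support p).subset fun s hs h => hs (by
        change _ * harmonicHom n _ = 0
        rw [h, map_zero, mul_zero])
    clear hS
    induction p using poly_induction with
    | hw w =>
      unfold harmonicHom
      rw [polyPair_word, polyPair_word]
      cases w with
      | nil => simp [harmonicSum, polyDelta_nil]
      | cons s w =>
        rw [finsum_eq_single _ s, polyDelta_cons, if_pos rfl, polyPair_word,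
          harmonicSum_cons_succ]
        · push_cast
          rw [inv_pow]
        · intro j hj
          rw [polyDelta_cons, if_neg hj, map_zero, mul_zero]
    | hadd p q hp hq =>
      simp only [map_add, mul_add]
      rw [hp, hq, finsum_add_distrib (hfin p) (hfin q)]
      ring
    | hsmul c p hp =>
      simp only [map_smul, smul_eq_mul, mul_left_comm _ c]
      rw [hp, mul_add, ← mul_finsum]
  rw [key, finsum_eq_sum_of_support_subset]
  intro s hs
  refine hS s fun h => hs ?_
  change _ * harmonicHom n _ = 0
  rw [h, map_zero, mul_zero]

/-- Induction on n. With c = 1/(n+1), going from n to n + 1 adds ∑ c^s H_n(s⁻¹p). In the product of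
two such expressions the cross terms c^i c^j H_n(i⁻¹p) H_n(j⁻¹q) are exactly the contraction terms
of (i+j)⁻¹ applied to the quasi-shuffle. -/
theorem harmonicHom_mul (n : ℕ) : ∀ p q : polySub addContraction locally_addContraction,
    harmonicHom n (p * q) = harmonicHom n p * harmonicHom n q := by
  induction n with
  | zero =>
    have h : ∀ p : polySub addContraction locally_addContraction,
        harmonicHom 0 p = p.1 [] := fun p => by
      refine LinearMap.congr_fun (f := harmonicHom 0)
        (g := (augmentation addContraction).toLinearMap.comp (polySub _ _).val.toLinearMap)
        (polyHom_ext fun w => ?_) p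
      rw [harmonicHom, polyPair_word]
      cases w with
      | nil =>
        rw [wordPoly_nil]
        simp only [harmonicSum, Complex.ofReal_one]
        rfl
      | cons i w =>
        have h0 : (wordPoly locally_addContraction (i :: w)).1 [] = 0 :=
          (wordSeries_apply (D := addContraction) (i :: w) []).trans (if_neg (by simp))
        refine Eq.trans ?_ h0.symm
        simp [harmonicSum]
    intro p q
    rw [h, h, h]
    rfl
  | succ n ih =>
    intro p q
    classical
    obtain ⟨A, hA⟩ := (polyDelta_support p).exists_finset
    obtain ⟨B, hB⟩ := (polyDelta_support q).exists_finset
    obtain ⟨C, hC⟩ := (polyDelta_support (p * q)).exists_finset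
    let S := A ∪ B ∪ C ∪ (A ×ˢ B).image fun x => x.1 + x.2
    have hp := harmonicHom_succ n p S fun s hs => by
      have := (hA s).2 hs
      simp only [S, Finset.mem_union]; tauto
    have hq := harmonicHom_succ n q S fun s hs => by
      have := (hB s).2 hs
      simp only [S, Finset.mem_union]; tauto
    have hpq := harmonicHom_succ n (p * q) S fun s hs => by
      have := (hC s).2 hs
      simp only [S, Finset.mem_union]; tauto
    have hp' := harmonicHom_succ n p A fun s hs => (hA s).2 hs
    have hq' := harmonicHom_succ n q B fun s hs => (hB s).2 hs
    have hdelta : ∀ s, polyDelta locally_addContraction s (p * q) =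
        polyDelta _ s p * q + p * polyDelta _ s q +
          ∑ x ∈ addPairs s, polyDelta _ x.1 p * polyDelta _ x.2 q := fun s => by
      refine Subtype.ext ((delta_mul s p.1 q.1).trans ?_)
      change _ = delta s p.1 * q.1 + p.1 * delta s q.1 + (polySub _ _).val _
      rw [map_sum]
      rfl
    let c : ℂ := ((n + 1 : ℕ) : ℂ)⁻¹
    have hsum := sum_addPairs_eq_mul (A := A) (B := B) (S := S)
      (fun a ha b hb => Finset.mem_union_right _
        (Finset.mem_image.2 ⟨(a, b), Finset.mem_product.2 ⟨ha, hb⟩, rfl⟩))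
      (f := fun s => c ^ (s : ℕ) * harmonicHom n (polyDelta _ s p))
      (g := fun s => c ^ (s : ℕ) * harmonicHom n (polyDelta _ s q))
      (fun s hs => (hA s).2 fun h => hs (by simp only [h, map_zero, mul_zero]))
      (fun s hs => (hB s).2 fun h => hs (by simp only [h, map_zero, mul_zero]))
    have hexp : ∑ s ∈ S, c ^ (s : ℕ) * harmonicHom n (polyDelta _ s (p * q)) =
        (∑ s ∈ S, c ^ (s : ℕ) * harmonicHom n (polyDelta _ s p)) * harmonicHom n q +
        harmonicHom n p * (∑ s ∈ S, c ^ (s : ℕ) * harmonicHom n (polyDelta _ s q)) +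
        ∑ s ∈ S, ∑ x ∈ addPairs s, (c ^ (x.1 : ℕ) * harmonicHom n (polyDelta _ x.1 p)) *
          (c ^ (x.2 : ℕ) * harmonicHom n (polyDelta _ x.2 q)) := by
      rw [Finset.sum_mul, Finset.mul_sum, ← Finset.sum_add_distrib, ← Finset.sum_add_distrib]
      refine Finset.sum_congr rfl fun s _ => ?_
      rw [hdelta, map_add, map_add, map_sum, ih, ih, mul_add, mul_add, Finset.mul_sum]
      congr 1
      · ring
      · refine Finset.sum_congr rfl fun x hx => ?_
        rw [ih, ← (mem_addPairs s x.1 x.2).1 hx, PNat.add_coe, pow_add]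
        ring
    rw [hpq, hexp, hsum, ih, hp]
    have e1 := add_left_cancel (hp.symm.trans hp')
    have e2 := add_left_cancel (hq.symm.trans hq')
    rw [hq, ← e1, ← e2]
    ring

/-! #### Asymptotic expansion -/

/-- A sequence whose increments are `O(n^{-3/2})` converges with an error `O(n^{-1/2})`. -/
theorem exists_limit_of_increment_bound {a : ℕ → ℝ} {C : ℝ} (hC : 0 ≤ C)
    (h : ∀ n : ℕ, 1 ≤ n → |a (n + 1) - a n| ≤ C / √n ^ 3) :
    ∃ c : ℝ, ∀ n : ℕ, 1 ≤ n → |a n - c| ≤ 6 * C / √n := by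
  -- With x = √n and y = √(n+1) ≤ 2x, 1/x - 1/y = 1/(x y (x + y)) ≥ 1/(6 x³); this is the origin of
  -- 6. Then a - r increases, a + r decreases, and c is the supremum of a - r.
  let r : ℕ → ℝ := fun n => 6 * C / √n
  have hr : ∀ n : ℕ, 1 ≤ n → C / √n ^ 3 ≤ r n - r (n + 1) := by
    intro n hn
    have hn' : (1 : ℝ) ≤ n := by exact_mod_cast hn
    have ha : 0 < √(n : ℝ) := Real.sqrt_pos.2 (by linarith)
    have hb : 0 < √((n + 1 : ℕ) : ℝ) := Real.sqrt_pos.2 (by positivity)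
    have ha2 : √(n : ℝ) ^ 2 = n := Real.sq_sqrt (by linarith)
    have hb2 : √((n + 1 : ℕ) : ℝ) ^ 2 = n + 1 := by
      rw [Real.sq_sqrt (by positivity)]; push_cast; ring
    have hba : √((n + 1 : ℕ) : ℝ) ≤ 2 * √(n : ℝ) := by
      refine abs_le_of_sq_le_sq' ?_ (by positivity) |>.2
      rw [mul_pow, ha2, hb2]; linarith
    simp only [r]
    generalize √(n : ℝ) = x at *
    generalize √((n + 1 : ℕ) : ℝ) = y at *
    have hxy : (y - x) * (y + x) = 1 := by nlinarith
    have h1 : 6 * C / x - 6 * C / y = 6 * C / (x * y * (x + y)) := by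
      rw [div_sub_div _ _ ha.ne' hb.ne', div_eq_div_iff (by positivity) (by positivity)]
      linear_combination 6 * C * x * y * hxy
    rw [h1, div_le_div_iff₀ (by positivity) (by positivity)]
    have h2 : x * y * (x + y) ≤ 6 * x ^ 3 := by
      have : y * (x + y) ≤ (2 * x) * (3 * x) := mul_le_mul hba (by linarith) (by positivity)
        (by positivity)
      nlinarith
    nlinarith [mul_le_mul_of_nonneg_left h2 hC]
  have hpos : ∀ n, 0 ≤ r n := fun n => by positivity
  have hmono : ∀ m n, 1 ≤ m → m ≤ n → a m - r m ≤ a n - r n := by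
    intro m n hm hmn
    induction n, hmn using Nat.le_induction with
    | base => exact le_rfl
    | succ n hmn ih =>
      have h1 := hr n (hm.trans hmn)
      have h2 := (abs_le.1 (h n (hm.trans hmn))).1
      linarith
  have hanti : ∀ m n, 1 ≤ m → m ≤ n → a n + r n ≤ a m + r m := by
    intro m n hm hmn
    induction n, hmn using Nat.le_induction with
    | base => exact le_rfl
    | succ n hmn ih =>
      have h1 := hr n (hm.trans hmn)
      have h2 := (abs_le.1 (h n (hm.trans hmn))).2
      linarith
  have hcross : ∀ m n, 1 ≤ m → 1 ≤ n → a m - r m ≤ a n + r n := by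
    intro m n hm hn
    rcases le_total m n with hmn | hmn
    · linarith [hmono m n hm hmn, hpos n]
    · linarith [hanti n m hn hmn, hpos m]
  refine ⟨sSup ((fun n => a n - r n) '' Set.Ici 1), fun n hn => ?_⟩
  have hle := le_csSup ⟨a 1 + r 1, by
    rintro _ ⟨m, hm, rfl⟩; exact hcross m 1 hm le_rfl⟩
    (Set.mem_image_of_mem (fun n => a n - r n) (show n ∈ Set.Ici 1 from hn))
  have hge : sSup ((fun n => a n - r n) '' Set.Ici 1) ≤ a n + r n :=
    csSup_le ⟨_, Set.mem_image_of_mem _ (show n ∈ Set.Ici 1 from hn)⟩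
      (by rintro _ ⟨m, hm, rfl⟩; exact hcross m n hm hn)
  rw [abs_le]
  constructor <;> linarith

theorem exists_eval_log_le_sqrt (P : ℝ[X]) : ∃ K : ℝ, 0 ≤ K ∧ ∀ x : ℝ, 1 ≤ x →
    |P.eval (Real.log x)| ≤ K * √x := by
  obtain ⟨K, hK, h⟩ := exists_eval_log_le (P.comp (-X))
  refine ⟨K, hK, fun x hx => ?_⟩
  have hx0 : 0 < x := by linarith
  have := h x⁻¹ (inv_pos.2 hx0) (inv_le_one_of_one_le₀ hx)
  rwa [eval_comp, eval_neg, eval_X, Real.log_inv, neg_neg, Real.inv_rpow hx0.le,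
    Real.rpow_neg hx0.le, inv_inv, ← Real.sqrt_eq_rpow] at this

/-- First order Taylor estimate for a polynomial in the logarithm. -/
theorem exists_taylor_log (Q : ℝ[X]) : ∃ K : ℝ, 0 ≤ K ∧ ∀ n : ℕ, 1 ≤ n →
    |Q.eval (Real.log (n + 1)) - Q.eval (Real.log n) -
      (derivative Q).eval (Real.log n) / n| ≤ K / √n ^ 3 := by
  obtain ⟨K, hK, h⟩ := exists_eval_log_le_sqrt (derivative (derivative Q) - derivative Q)
  refine ⟨2 * K, by positivity, fun n hn => ?_⟩
  have hn' : (1 : ℝ) ≤ n := by exact_mod_cast hn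
  have hn0 : (0 : ℝ) < n := by linarith
  let f : ℝ → ℝ := fun x => Q.eval (Real.log x)
  let g : ℝ → ℝ := fun x => (derivative Q).eval (Real.log x) / x
  have hf : ∀ x, 0 < x → HasDerivAt f (g x) x := fun x hx => by
    refine ((Q.hasDerivAt _).comp x (Real.hasDerivAt_log hx.ne')).congr_deriv ?_
    rw [← div_eq_mul_inv]
  have hg : ∀ x, 0 < x → HasDerivAt g
      ((derivative (derivative Q) - derivative Q).eval (Real.log x) / x ^ 2) x := fun x hx => by
    refine ((((derivative Q).hasDerivAt _).comp x (Real.hasDerivAt_log hx.ne')).div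
      (hasDerivAt_id x) hx.ne').congr_deriv ?_
    simp only [id, Function.comp_apply, eval_sub]
    field_simp
  have hs0 : 0 < √(n : ℝ) := Real.sqrt_pos.2 hn0
  have hs2 : √(n : ℝ) ^ 2 = n := Real.sq_sqrt hn0.le
  have hgb : ∀ x ∈ Set.Icc (n : ℝ) (n + 1),
      ‖(derivative (derivative Q) - derivative Q).eval (Real.log x) / x ^ 2‖ ≤
        2 * K / √n ^ 3 := by
    intro x hx
    have hx0 : 0 < x := hn0.trans_le hx.1
    rw [norm_div, Real.norm_eq_abs, Real.norm_eq_abs, abs_of_pos (pow_pos hx0 2)]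
    have h1 := h x (hn'.trans hx.1)
    have h2 : √x ≤ 2 * √(n : ℝ) := by
      refine (abs_le_of_sq_le_sq' ?_ (by positivity)).2
      rw [mul_pow, hs2, Real.sq_sqrt hx0.le]; linarith [hx.2]
    have h3 : √(n : ℝ) ^ 4 ≤ x ^ 2 := by
      rw [show √(n : ℝ) ^ 4 = (√(n : ℝ) ^ 2) ^ 2 by ring, hs2]
      exact pow_le_pow_left₀ hn0.le hx.1 2
    rw [div_le_div_iff₀ (by positivity) (by positivity)]
    calc _ ≤ (K * (2 * √(n : ℝ))) * √(n : ℝ) ^ 3 := by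
          refine mul_le_mul_of_nonneg_right (h1.trans ?_) (by positivity)
          exact mul_le_mul_of_nonneg_left h2 hK
      _ = 2 * K * √(n : ℝ) ^ 4 := by ring
      _ ≤ _ := mul_le_mul_of_nonneg_left h3 (by positivity)
  -- The mean value inequality is used twice: here for g, and then for x ↦ f x - g(n) x.
  have hg' : ∀ x ∈ Set.Icc (n : ℝ) (n + 1), ‖g x - g n‖ ≤ 2 * K / √n ^ 3 := by
    intro x hx
    have := (convex_Icc (n : ℝ) (n + 1)).norm_image_sub_le_of_norm_hasDerivWithin_le
      (fun y hy => (hg y (hn0.trans_le hy.1)).hasDerivWithinAt) hgb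
      (show (n : ℝ) ∈ Set.Icc (n : ℝ) (n + 1) from ⟨le_rfl, by linarith⟩) hx
    refine this.trans (mul_le_of_le_one_right (by positivity) ?_)
    rw [Real.norm_eq_abs, abs_le]
    constructor <;> linarith [hx.1, hx.2]
  have hf' := (convex_Icc (n : ℝ) (n + 1)).norm_image_sub_le_of_norm_hasDerivWithin_le
    (f := fun x => f x - g n * x) (f' := fun x => g x - g n)
    (fun y hy => ((hf y (hn0.trans_le hy.1)).sub
      ((hasDerivAt_id y).const_mul (g n))).hasDerivWithinAt.congr_deriv (by simp)) hg'
    (show (n : ℝ) ∈ Set.Icc (n : ℝ) (n + 1) from ⟨le_rfl, by linarith⟩)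
    (show (n : ℝ) + 1 ∈ Set.Icc (n : ℝ) (n + 1) from ⟨by linarith, le_rfl⟩)
  rw [add_sub_cancel_left, norm_one, mul_one, Real.norm_eq_abs] at hf'
  refine le_of_eq_of_le (congrArg _ ?_) hf'
  simp only [f, g]
  ring

/-- Discrete counterpart of `Polylog.exists_expansion_one`. Since the inner sum is O(√n), a first
letter s ≥ 2 gives increments O(n^(-3/2)) and a limit. For s = 1 one subtracts Q(log n) with Q' = P;
three errors of that order remain, from the expansion of the inner sum, from replacing n + 1 by n,
and from the Taylor estimate. -/
theorem exists_expansion (w : List ℕ+) : ∃ (P : ℝ[X]) (K : ℝ), 0 ≤ K ∧ ∀ n : ℕ, 1 ≤ n →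
    |harmonicSum w n - P.eval (Real.log n)| ≤ K / √n := by
  induction w with
  | nil => exact ⟨1, 0, le_rfl, fun n _ => by simp [harmonicSum]⟩
  | cons s w ih =>
    obtain ⟨P, K, hK, h⟩ := ih
    obtain ⟨K1, hK1, h1⟩ := exists_eval_log_le_sqrt P
    have hbound : ∀ n : ℕ, 1 ≤ n → |harmonicSum w n| ≤ (K + K1) * √n := fun n hn => by
      have hn' : (1 : ℝ) ≤ n := by exact_mod_cast hn
      have hs : 1 ≤ √(n : ℝ) := Real.one_le_sqrt.2 hn'
      have h2 := h n hn
      have h3 := h1 n hn'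
      have h4 := abs_sub_abs_le_abs_sub (harmonicSum w n) (P.eval (Real.log n))
      have h5 : K / √(n : ℝ) ≤ K * √n :=
        (div_le_self hK hs).trans (le_mul_of_one_le_right hK hs)
      rw [add_mul]
      linarith
    have hsq : ∀ n : ℕ, √(n : ℝ) ^ 2 = n := fun n => Real.sq_sqrt (Nat.cast_nonneg n)
    by_cases hs : s = 1
    · subst hs
      obtain ⟨Q, hQ⟩ : ∃ Q : ℝ[X], derivative Q = P := by
        refine Polynomial.induction_on' P ?_ fun n a => ?_
        · rintro p q ⟨Q, rfl⟩ ⟨Q', rfl⟩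
          exact ⟨Q + Q', derivative_add⟩
        · refine ⟨monomial (n + 1) (a / (n + 1)), ?_⟩
          have : (n : ℝ) + 1 ≠ 0 := by positivity
          rw [derivative_monomial]
          push_cast
          rw [div_mul_cancel₀ _ this]
      obtain ⟨K2, hK2, h2⟩ := exists_taylor_log Q
      obtain ⟨c, hc⟩ := exists_limit_of_increment_bound
        (a := fun n => harmonicSum (1 :: w) n - Q.eval (Real.log n))
        (C := (K + K1) + K + K2) (by positivity) fun n hn => by
          have hn0 : (0 : ℝ) < n := by exact_mod_cast hn
          have hx : 0 < √(n : ℝ) := Real.sqrt_pos.2 hn0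
          have e1 := h2 n hn
          have e2 := h n hn
          have e3 := hbound n hn
          rw [hQ] at e1
          have f1 : |(harmonicSum w n - P.eval (Real.log n)) / n| ≤ K / √n ^ 3 := by
            rw [abs_div, abs_of_pos hn0, div_le_div_iff₀ hn0 (by positivity)]
            rw [le_div_iff₀ hx] at e2
            calc _ = (|harmonicSum w n - P.eval (Real.log n)| * √n) * √n ^ 2 := by ring
              _ ≤ K * √n ^ 2 := mul_le_mul_of_nonneg_right e2 (by positivity)
              _ = _ := by rw [hsq]
          have f2 : |harmonicSum w n / n - harmonicSum w n / (n + 1)| ≤ (K + K1) / √n ^ 3 := by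
            have : harmonicSum w n / n - harmonicSum w n / (n + 1) =
              harmonicSum w n / (n * (n + 1)) := by field_simp; ring
            rw [this, abs_div, abs_of_pos (show (0 : ℝ) < n * (n + 1) by positivity),
              div_le_div_iff₀ (by positivity) (by positivity)]
            calc _ ≤ ((K + K1) * √n) * √n ^ 3 :=
                  mul_le_mul_of_nonneg_right e3 (by positivity)
              _ = (K + K1) * ((√n ^ 2) * (√n ^ 2)) := by ring
              _ ≤ _ := by
                rw [hsq]
                exact mul_le_mul_of_nonneg_left (by nlinarith) (by positivity)
          have : harmonicSum (1 :: w) (n + 1) - Q.eval (Real.log ((n + 1 : ℕ) : ℝ)) -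
              (harmonicSum (1 :: w) n - Q.eval (Real.log n)) =
              -(harmonicSum w n / n - harmonicSum w n / (n + 1)) +
                (harmonicSum w n - P.eval (Real.log n)) / n -
              (Q.eval (Real.log (n + 1)) - Q.eval (Real.log n) - P.eval (Real.log n) / n) := by
            rw [harmonicSum_cons_succ]
            push_cast
            simp only [pow_one]
            ring
          rw [this, add_div, add_div]
          refine (abs_sub _ _).trans (add_le_add ((abs_add_le _ _).trans (add_le_add ?_ f1)) e1)
          rwa [abs_neg]
      refine ⟨Polynomial.C c + Q, 6 * ((K + K1) + K + K2), by positivity, fun n hn => ?_⟩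
      have := hc n hn
      rwa [eval_add, eval_C, ← sub_sub, sub_right_comm]
    · have hs2 : 2 ≤ (s : ℕ) := by
        have h2 : (s : ℕ) ≠ 1 := fun h => hs (PNat.coe_eq_one_iff.1 h)
        have h3 : 1 ≤ (s : ℕ) := s.2
        omega
      obtain ⟨c, hc⟩ := exists_limit_of_increment_bound (a := harmonicSum (s :: w))
        (C := K + K1) (by positivity) fun n hn => by
          have hn0 : (0 : ℝ) < n := by exact_mod_cast hn
          have hn1 : (1 : ℝ) ≤ n := by exact_mod_cast hn
          have hx : 0 < √(n : ℝ) := Real.sqrt_pos.2 hn0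
          rw [harmonicSum_cons_succ, add_sub_cancel_left, abs_mul,
            abs_of_pos (by positivity), inv_mul_le_iff₀ (by positivity), mul_div_assoc',
            le_div_iff₀ (by positivity)]
          have e4 : (n : ℝ) ^ 2 ≤ ((n + 1 : ℕ) : ℝ) ^ (s : ℕ) := by
            push_cast
            exact (pow_le_pow_left₀ hn0.le (by linarith) 2).trans
              (pow_le_pow_right₀ (by linarith) hs2)
          calc _ ≤ ((K + K1) * √n) * √n ^ 3 :=
                mul_le_mul_of_nonneg_right (hbound n hn) (by positivity)
            _ = (√n ^ 2) ^ 2 * (K + K1) := by ring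
            _ ≤ _ := by
              rw [hsq]
              exact mul_le_mul_of_nonneg_right e4 (by positivity)
      exact ⟨Polynomial.C c, 6 * (K + K1), by positivity, fun n hn => by
        rw [eval_C]; exact hc n hn⟩

theorem exists_gamma_character :
    ∃ ψ : polySub addContraction locally_addContraction →ₐ[ℂ] ℂ,
      ∀ w, IsGammaValue w (ψ (wordPoly _ w)) := by
  choose P K hK h using exists_expansion
  have hlim : Tendsto (fun n : ℕ => (n : ℝ)⁻¹) atTop (𝓝[>] 0) :=
    tendsto_inv_atTop_nhdsGT_zero.comp tendsto_natCast_atTop_atTop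
  have hL : Tendsto (fun n : ℕ => |Real.log n|) atTop atTop :=
    tendsto_abs_atTop_atTop.comp (Real.tendsto_log_atTop.comp tendsto_natCast_atTop_atTop)
  have hF : ∀ w, HasLogExpansion (atTop : Filter ℕ) (fun n => Real.log n)
      (fun n => (harmonicSum w n : ℂ)) ((P w).map (algebraMap ℝ ℂ)) := fun w => by
    refine HasLogExpansion.of_bound hlim (fun n => by rw [Real.log_inv, abs_neg]) (K := K w) ?_
    filter_upwards [eventually_ge_atTop 1] with n hn
    rw [Real.inv_rpow (Nat.cast_nonneg n), ← Real.sqrt_eq_rpow, ← div_eq_mul_inv]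
    exact h w n hn
  obtain ⟨ψ, hψ⟩ := exists_regularized_character hL locally_addContraction hF
    (fun n => by simp [harmonicSum]) fun p q => Eventually.of_forall fun n => harmonicHom_mul n p q
  refine ⟨ψ, fun w => ?_⟩
  rw [hψ]
  exact (hF w).hasFinitePart _

end Harmonic

/-! ### The isomorphism from the quasi-shuffle algebra to the shuffle algebra -/

section Newton

variable {A : Type*} [Ring A]

/-- The power sums attached to the elementary functions `f_s` by Newton's identities
`s f_s = p_s + ∑_{i + j = s} f_i p_j`. -/
def newton (f : ℕ+ → A) (s : ℕ+) : A :=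
  (s : ℕ) • f s - ∑ p ∈ (addPairs s).attach, f p.1.1 * newton f p.1.2
termination_by (s : ℕ)
decreasing_by
  have h : (p.1.1 : ℕ) + p.1.2 = s := by
    rw [← PNat.add_coe, (mem_addPairs s p.1.1 p.1.2).1 p.2]
  have h1 := p.1.1.pos
  omega

theorem newton_eq (f : ℕ+ → A) (s : ℕ+) :
    newton f s = (s : ℕ) • f s - ∑ p ∈ addPairs s, f p.1 * newton f p.2 := by
  rw [newton, Finset.sum_attach (addPairs s) fun p => f p.1 * newton f p.2]

theorem snd_lt_of_mem_addPairs {s : ℕ+} {p : ℕ+ × ℕ+} (hp : p ∈ addPairs s) : p.2 < s := by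
  have h := (mem_addPairs s p.1 p.2).1 hp
  rw [← h]
  exact PNat.lt_add_left p.2 p.1

theorem commute_newton {f : ℕ+ → A} {z : A} (h : ∀ i, Commute z (f i)) (s : ℕ+) :
    Commute z (newton f s) := by
  induction s using PNat.strongInductionOn with
  | _ s ih =>
    rw [newton_eq]
    exact ((h s).smul_right _).sub_right (Commute.sum_right _ _ _ fun p hp =>
      (h p.1).mul_right (ih p.2 (snd_lt_of_mem_addPairs hp)))

end Newton

namespace Stuffle

open QSeries

/-- The derivations of the quasi-shuffle algebra attached to the left derivatives. -/
def prim (s : ℕ+) : StuffleSeries →ₗ[ℂ] StuffleSeries :=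
  newton (A := Module.End ℂ StuffleSeries) delta s

theorem prim_apply (s : ℕ+) (S : StuffleSeries) :
    prim s S = ((s : ℕ) : ℂ) • delta s S - ∑ p ∈ addPairs s, delta p.1 (prim p.2 S) := by
  rw [prim, newton_eq, LinearMap.sub_apply, LinearMap.sum_apply, LinearMap.smul_apply,
    Nat.cast_smul_eq_nsmul]
  rfl

/-- The rule for δ_s on products says that F(u) = 1 + ∑ δ_s u^s is group-like. Newton's identities
define P(u) by u F'(u) = F(u) P(u), and a logarithmic derivative of a group-like element is
primitive, that is, a derivation. The proof runs this argument coefficient by coefficient. -/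
theorem prim_mul (s : ℕ+) : ∀ S T : StuffleSeries,
    prim s (S * T) = prim s S * T + S * prim s T := by
  induction s using PNat.strongInductionOn with
  | _ s ih =>
    intro S T
    have hexp : ∀ p ∈ addPairs s, delta p.1 (prim p.2 (S * T)) =
        (delta p.1 (prim p.2 S) * T + S * delta p.1 (prim p.2 T)) +
        ((prim p.2 S * delta p.1 T + ∑ q ∈ addPairs p.1, delta q.1 (prim p.2 S) * delta q.2 T) +
        (delta p.1 S * prim p.2 T + ∑ q ∈ addPairs p.1, delta q.1 S * delta q.2 (prim p.2 T))) := by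
      intro p hp
      rw [ih p.2 (snd_lt_of_mem_addPairs hp), map_add, delta_mul, delta_mul]
      change _ + ∑ q ∈ addPairs p.1, _ + (_ + ∑ q ∈ addPairs p.1, _) = _
      abel
    -- Associativity of contractions regroups the triple sum so that Newton's recursion for S
    -- collapses it to ∑ i δ_i S · δ_j T. The mirror image gives the weight j, and i + j = s in `h5`
    -- closes the computation.
    have hT : ∀ S T : StuffleSeries, ∑ p ∈ addPairs s, (prim p.2 S * delta p.1 T +
        ∑ q ∈ addPairs p.1, delta q.1 (prim p.2 S) * delta q.2 T) =
        ∑ p ∈ addPairs s, ((p.1 : ℕ) : ℂ) • (delta p.1 S * delta p.2 T) := by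
      intro S T
      have h1 : ∀ (w : List ℕ+), (∑ p ∈ addPairs s,
          ∑ q ∈ addPairs p.1, delta q.1 (prim p.2 S) * delta q.2 T) w =
          (∑ p ∈ addPairs s, ∑ q ∈ addPairs p.1, delta q.1 (prim q.2 S) * delta p.2 T) w := by
        intro w
        simp only [sum_apply']
        have e1 := addContraction.split_assoc s
          fun i j k => (delta i (prim k S) * delta j T : StuffleSeries) w
        have e2 := addContraction.split_assoc s
          fun i j k => (delta i (prim j S) * delta k T : StuffleSeries) w
        refine e1.trans (Eq.trans ?_ e2.symm)
        exact Finset.sum_congr rfl fun p _ => addContraction.split_comm p.2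
          fun j k => (delta p.1 (prim k S) * delta j T : StuffleSeries) w
      have h2 : ∑ p ∈ addPairs s, prim p.2 S * delta p.1 T =
          ∑ p ∈ addPairs s, prim p.1 S * delta p.2 T := by
        funext w
        rw [sum_apply', sum_apply']
        exact addContraction.split_comm s fun i j => (prim j S * delta i T : StuffleSeries) w
      rw [Finset.sum_add_distrib, h2, show (∑ p ∈ addPairs s,
          ∑ q ∈ addPairs p.1, delta q.1 (prim p.2 S) * delta q.2 T) = _ from funext h1,
        ← Finset.sum_add_distrib]
      refine Finset.sum_congr rfl fun p _ => ?_
      rw [← Finset.sum_mul, ← add_mul, prim_apply p.1 S, sub_add_cancel, smul_mul_assoc]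
    have hT2 : ∑ p ∈ addPairs s, (delta p.1 S * prim p.2 T +
        ∑ q ∈ addPairs p.1, delta q.1 S * delta q.2 (prim p.2 T)) =
        ∑ p ∈ addPairs s, ((p.2 : ℕ) : ℂ) • (delta p.1 S * delta p.2 T) := by
      have h3 := hT T S
      have h4 : ∑ p ∈ addPairs s, ((p.1 : ℕ) : ℂ) • (delta p.1 T * delta p.2 S) =
          ∑ p ∈ addPairs s, ((p.2 : ℕ) : ℂ) • (delta p.1 S * delta p.2 T) := by
        funext w
        rw [sum_apply', sum_apply']
        refine (addContraction.split_comm s fun i j =>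
          (((i : ℕ) : ℂ) • (delta i T * delta j S) : StuffleSeries) w).trans ?_
        exact Finset.sum_congr rfl fun p _ => by rw [mul_comm (delta p.2 T)]
      rw [← h4, ← h3]
      refine Finset.sum_congr rfl fun p _ => ?_
      rw [mul_comm (delta p.1 S)]
      congr 1
      funext w
      rw [sum_apply', sum_apply']
      refine (addContraction.split_comm p.1 fun i j =>
          (delta i S * delta j (prim p.2 T) : StuffleSeries) w).trans ?_
      exact Finset.sum_congr rfl fun q _ => by rw [mul_comm (delta q.2 S)]
    rw [prim_apply s (S * T), Finset.sum_congr rfl hexp, Finset.sum_add_distrib,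
      Finset.sum_add_distrib, Finset.sum_add_distrib, hT, hT2,
      ← Finset.sum_mul, ← Finset.mul_sum, delta_mul, prim_apply s S, prim_apply s T]
    change (_ : ℂ) • (_ + _ + ∑ p ∈ addPairs s, _) - _ = _
    have h5 : ((s : ℕ) : ℂ) • ∑ p ∈ addPairs s, delta p.1 S * delta p.2 T =
        ∑ p ∈ addPairs s, (((p.1 : ℕ) : ℂ) • (delta p.1 S * delta p.2 T) +
          ((p.2 : ℕ) : ℂ) • (delta p.1 S * delta p.2 T)) := by
      rw [Finset.smul_sum]
      refine Finset.sum_congr rfl fun p hp => ?_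
      rw [← add_smul, ← Nat.cast_add, ← PNat.add_coe, (mem_addPairs s p.1 p.2).1 hp]
    rw [smul_add, h5, Finset.sum_add_distrib, smul_add, sub_mul, mul_sub, smul_mul_assoc, mul_smul_comm]
    abel

theorem prim_one (s : ℕ+) : prim s 1 = 0 := by
  have h := prim_mul s 1 1
  rw [one_mul, mul_one, one_mul] at h
  exact left_eq_add.1 h

/-- The coefficients of the image of a series in the shuffle algebra. -/
def toShuffleCoeff : List ℕ+ → StuffleSeries → ℂ
  | [], S => S []
  | s :: w, S => toShuffleCoeff w (prim s S)

/-- The isomorphism from the quasi-shuffle algebra to the shuffle algebra. -/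
def toShuffleFun (S : StuffleSeries) : ShuffleSeries ℕ+ := fun w => toShuffleCoeff w S

theorem delta_toShuffleFun (s : ℕ+) (S : StuffleSeries) :
    delta s (toShuffleFun S) = toShuffleFun (prim s S) := rfl

theorem toShuffleCoeff_add (w : List ℕ+) : ∀ S T : StuffleSeries,
    toShuffleCoeff w (S + T) = toShuffleCoeff w S + toShuffleCoeff w T := by
  induction w with
  | nil => intro S T; rfl
  | cons s w ih => intro S T; simp only [toShuffleCoeff, map_add, ih]

theorem toShuffleCoeff_smul (c : ℂ) (w : List ℕ+) : ∀ S : StuffleSeries,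
    toShuffleCoeff w (c • S) = c * toShuffleCoeff w S := by
  induction w with
  | nil => intro S; rfl
  | cons s w ih => intro S; simp only [toShuffleCoeff, map_smul, ih]

theorem toShuffleFun_add (S T : StuffleSeries) :
    toShuffleFun (S + T) = toShuffleFun S + toShuffleFun T :=
  funext fun w => toShuffleCoeff_add w S T

/-- `prim s` corresponds to s⁻¹ on the shuffle side and both are derivations, so the two products
obey the same recursion. -/
theorem toShuffleFun_mul (S T : StuffleSeries) :
    toShuffleFun (S * T) = toShuffleFun S * toShuffleFun T := by
  funext w
  induction w generalizing S T with
  | nil => rfl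
  | cons s w ih =>
    have h := congrFun (Shuffle.delta_mul s (toShuffleFun S) (toShuffleFun T)) w
    rw [add_apply', delta_toShuffleFun, delta_toShuffleFun, ← ih, ← ih, ← add_apply',
      ← toShuffleFun_add, ← prim_mul] at h
    exact h.symm

theorem toShuffleFun_one : toShuffleFun 1 = 1 := by
  refine ext_delta rfl fun s => ?_
  rw [delta_toShuffleFun, prim_one, delta_one]
  funext w
  have h := toShuffleCoeff_smul 0 w 0
  rw [zero_smul, zero_mul] at h
  exact h

/-- The algebra morphism from the quasi-shuffle algebra to the shuffle algebra. -/
def toShuffle : StuffleSeries →ₐ[ℂ] ShuffleSeries ℕ+ :=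
  AlgHom.ofLinearMap
    { toFun := toShuffleFun
      map_add' := toShuffleFun_add
      map_smul' := fun c S => funext fun w => toShuffleCoeff_smul c w S }
    toShuffleFun_one toShuffleFun_mul

theorem toShuffle_nil (S : StuffleSeries) : toShuffle S [] = S [] := rfl

/-! #### Action on polynomials -/

theorem lengthLT_delta {n : ℕ} {S : StuffleSeries} (h : LengthLT S n) (s : ℕ+) :
    LengthLT (delta s S) n := fun w hw => h (s :: w) (hw.trans (Nat.le_succ _))

theorem lengthLT_prim {n : ℕ} (s : ℕ+) {S : StuffleSeries} (h : LengthLT S (n + 1)) :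
    LengthLT (prim s S) n := by
  induction s using PNat.strongInductionOn with
  | _ s ih =>
    rw [prim_apply, sub_eq_add_neg, ← neg_one_smul ℂ]
    exact ((h.delta s).smul _).add (LengthLT.smul _ (.sum fun p hp =>
      lengthLT_delta (ih p.2 (snd_lt_of_mem_addPairs hp)) _))

/-- At maximal length only the term s δ_s of `prim s` survives, the others removing at least two
letters. The morphism is therefore triangular for the length, with nonzero diagonal. -/
theorem toShuffle_top (w : List ℕ+) : ∀ S : StuffleSeries, LengthLT S (w.length + 1) →
    toShuffle S w = (w.map fun s : ℕ+ => ((s : ℕ) : ℂ)).prod * S w := by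
  induction w with
  | nil => intro S _; rw [toShuffle_nil]; simp
  | cons s w ih =>
    intro S hS
    have h1 : prim s S w = ((s : ℕ) : ℂ) * S (s :: w) := by
      rw [prim_apply, sub_apply', sum_apply', Finset.sum_eq_zero, sub_zero]
      · rfl
      · intro p _
        exact lengthLT_prim p.2 hS (p.1 :: w) le_rfl
    refine (ih (prim s S) (lengthLT_prim s hS)).trans ?_
    rw [h1, List.map_cons, List.prod_cons]
    ring

theorem lengthLT_toShuffle {n : ℕ} : ∀ {S : StuffleSeries}, LengthLT S n →
    LengthLT (toShuffle S) n := by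
  induction n with
  | zero =>
    intro S hS
    rw [hS.eq_zero, map_zero]
    exact .zero _
  | succ n ih =>
    intro S hS
    exact .of_delta fun s => ih (lengthLT_prim s hS)

/-- Every term of `prim s` removes letters of total weight s. Weight is used rather than length
because only finitely many words have bounded weight, which is what preserves polynomials. -/
theorem prim_weight {n : ℕ} {S : StuffleSeries}
    (h : ∀ w : List ℕ+, n < (w.map PNat.val).sum → S w = 0) (s : ℕ+) :
    ∀ w : List ℕ+, n < s + (w.map PNat.val).sum → prim s S w = 0 := by
  induction s using PNat.strongInductionOn with
  | _ s ih =>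
    intro w hw
    rw [prim_apply, sub_apply', sum_apply', Finset.sum_eq_zero, sub_zero]
    · change _ * S (s :: w) = 0
      rw [h (s :: w) (by rw [List.map_cons, List.sum_cons]; exact hw), mul_zero]
    · intro p hp
      refine ih p.2 (snd_lt_of_mem_addPairs hp) (p.1 :: w) ?_
      have := congrArg PNat.val ((mem_addPairs s p.1 p.2).1 hp)
      rw [PNat.add_coe] at this
      rw [List.map_cons, List.sum_cons]
      change n < (p.2 : ℕ) + ((p.1 : ℕ) + _)
      have h' : (s : ℕ) = p.1 + p.2 := this.symm
      omega

theorem toShuffle_weight (w : List ℕ+) : ∀ {n : ℕ} {S : StuffleSeries},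
    (∀ w : List ℕ+, n < (w.map PNat.val).sum → S w = 0) → n < (w.map PNat.val).sum →
      toShuffle S w = 0 := by
  induction w with
  | nil => intro n S h hw; exact h [] hw
  | cons s w ih =>
    intro n S h hw
    rw [List.map_cons, List.sum_cons] at hw
    have hs := prim_weight h s
    by_cases hn : n < (s : ℕ)
    · have : prim s S = 0 := funext fun u => hs u (by omega)
      change toShuffle (prim s S) w = 0
      rw [this, map_zero]
      rfl
    · refine ih (n := n - s) (S := prim s S) (fun u hu => hs u (by omega)) ?_
      change n < (s : ℕ) + _ at hw
      omega

theorem finite_weight_le (n : ℕ) : {w : List ℕ+ | (w.map PNat.val).sum ≤ n}.Finite := by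
  induction n with
  | zero =>
    refine (Set.finite_singleton []).subset fun w hw => ?_
    cases w with
    | nil => rfl
    | cons s w =>
      have h1 : (s : ℕ) + (w.map PNat.val).sum ≤ 0 := by simp at hw
      have := s.pos
      omega
  | succ n ih =>
    refine ((Set.finite_singleton []).union (((Set.finite_Iic
      (⟨n + 1, n.succ_pos⟩ : ℕ+)).prod ih).image fun x => x.1 :: x.2)).subset fun w hw => ?_
    cases w with
    | nil => exact Or.inl rfl
    | cons s w =>
      have h1 : (s : ℕ) + (w.map PNat.val).sum ≤ n + 1 := by simpa using hw
      have := s.pos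
      refine Or.inr ⟨(s, w), ⟨?_, ?_⟩, rfl⟩
      · change s ≤ _
        exact PNat.coe_le_coe _ _ |>.1 (show (s : ℕ) ≤ n + 1 by omega)
      · change (w.map PNat.val).sum ≤ n
        omega

theorem toShuffle_mem_polynomials {S : StuffleSeries} (hS : S ∈ polynomials ℕ+) :
    toShuffle S ∈ polynomials ℕ+ := by
  obtain ⟨n, hn⟩ := (Set.Finite.image (fun w : List ℕ+ => (w.map PNat.val).sum) hS).bddAbove
  refine (finite_weight_le n).subset fun w hw => ?_
  by_contra h
  refine hw (toShuffle_weight w (n := n) (fun u hu => ?_) (not_le.1 h))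
  by_contra hu'
  exact absurd (hn ⟨u, hu', rfl⟩) (not_le.2 hu)

/-- The restriction of `toShuffle` to polynomials. -/
def toShufflePoly :
    polySub addContraction Harmonic.locally_addContraction →ₐ[ℂ] Shuffle.Poly ℕ+ :=
  (toShuffle.comp (polySub _ _).val).codRestrict _ fun p => toShuffle_mem_polynomials p.2

theorem prod_cast_ne_zero (w : List ℕ+) : (w.map fun s : ℕ+ => ((s : ℕ) : ℂ)).prod ≠ 0 := by
  refine List.prod_ne_zero fun h => ?_
  obtain ⟨s, _, hs⟩ := List.mem_map.1 h
  exact PNat.ne_zero s (by exact_mod_cast hs)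

/-- Triangularity with respect to the length: the top-length part of a preimage is found by dividing
by the products of the indices of the letters, and the remainder is shorter. -/
theorem toShufflePoly_bijective : Function.Bijective toShufflePoly := by
  constructor
  · refine (injective_iff_map_eq_zero _).2 fun p hp => ?_
    have hp' : toShuffle p.1 = 0 := congrArg Subtype.val hp
    obtain ⟨n, hn⟩ := lengthLT_of_mem_polynomials (D := addContraction) p.2
    suffices h : ∀ n, LengthLT p.1 n → p.1 = 0 from Subtype.ext (h n hn)
    intro n
    induction n with
    | zero => exact fun h => h.eq_zero
    | succ n ih =>
      refine fun h => ih fun w hw => ?_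
      rcases hw.eq_or_lt with rfl | hw
      · have h1 := toShuffle_top w p.1 h
        rw [hp'] at h1
        exact (mul_eq_zero.1 h1.symm).resolve_left (prod_cast_ne_zero w)
      · exact h w hw
  · intro q
    obtain ⟨n, hn⟩ := lengthLT_of_mem_polynomials (D := noContraction ℕ+) q.2
    induction n generalizing q with
    | zero => exact ⟨0, (map_zero _).trans (Subtype.ext hn.eq_zero).symm⟩
    | succ n ih =>
      let S : StuffleSeries := fun w => ((w.map fun s : ℕ+ => ((s : ℕ) : ℂ)).prod)⁻¹ * q.1 w
      have hS : S ∈ polynomials ℕ+ := Set.Finite.subset q.2 fun w hw h => hw (by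
        simp only [S, h, mul_zero])
      have hSn : LengthLT S (n + 1) := fun w hw => by simp only [S, hn w hw, mul_zero]
      obtain ⟨p, hp⟩ := ih (q - toShufflePoly ⟨S, hS⟩) fun w hw => by
        have h0 : (q - toShufflePoly ⟨S, hS⟩).1 w = q.1 w - toShuffle S w := rfl
        rw [h0, sub_eq_zero]
        rcases hw.eq_or_lt with rfl | hw
        · rw [toShuffle_top w S hSn]
          exact (mul_inv_cancel_left₀ (prod_cast_ne_zero w) _).symm
        · rw [hn w hw, lengthLT_toShuffle hSn w hw]
      exact ⟨p + ⟨S, hS⟩, by rw [map_add, hp, sub_add_cancel]⟩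

/-! #### Action on rationally exchangeable series -/

/-- A common eigenvector of the δ_s is an eigenvector of the operators built from them, with
eigenvalue given by the same Newton recursion. -/
theorem prim_charSeries (χ : ℕ+ → ℂ) (s : ℕ+) :
    prim s (charSeries _ χ) = newton χ s • charSeries _ χ := by
  induction s using PNat.strongInductionOn with
  | _ s ih =>
    rw [prim_apply, newton_eq, delta_charSeries, sub_smul, Finset.sum_smul, smul_smul,
      nsmul_eq_mul]
    congr 1
    refine Finset.sum_congr rfl fun p hp => ?_
    rw [ih p.2 (snd_lt_of_mem_addPairs hp), map_smul, delta_charSeries, smul_smul, mul_comm]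

theorem toShuffle_charSeries (χ : ℕ+ → ℂ) :
    toShuffle (charSeries _ χ) = charSeries _ (newton χ) := by
  have : ∀ (w : List ℕ+) (c : ℂ), toShuffle (c • charSeries _ χ) w =
      c * charSeries (noContraction ℕ+) (newton χ) w := by
    intro w
    induction w with
    | nil => intro c; rfl
    | cons s w ih =>
      intro c
      change toShuffle (prim s (c • charSeries _ χ)) w = _
      rw [map_smul, prim_charSeries, smul_smul, ih, mul_assoc]
      rfl
  funext w
  have h := this w 1
  rwa [one_smul, one_mul] at h

section Matrices

variable {n : ℕ} (μ : ℕ+ → Matrix (Fin n) (Fin n) ℂ) (η : Fin n → ℂ)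

/-- The series with linear representation `(β, μ, η)`. -/
def matSeries (β : Fin n → ℂ) : StuffleSeries := fun w => β ⬝ᵥ ((w.map μ).prod.mulVec η)

theorem delta_matSeries (s : ℕ+) (β : Fin n → ℂ) :
    delta s (matSeries μ η β) = matSeries μ η (Matrix.vecMul β (μ s)) := by
  funext w
  rw [delta_apply]
  simp only [matSeries, List.map_cons, List.prod_cons]
  rw [← Matrix.mulVec_mulVec, Matrix.dotProduct_mulVec]

theorem matSeries_smul (c : ℂ) (β : Fin n → ℂ) :
    matSeries μ η (c • β) = c • matSeries μ η β := by
  funext w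
  rw [smul_apply']
  exact smul_dotProduct c β _

theorem matSeries_sub (β β' : Fin n → ℂ) :
    matSeries μ η (β - β') = matSeries μ η β - matSeries μ η β' := by
  funext w
  rw [sub_apply']
  exact sub_dotProduct β β' _

theorem matSeries_sum {ι : Type} (t : Finset ι) (β : ι → Fin n → ℂ) :
    matSeries μ η (∑ i ∈ t, β i) = ∑ i ∈ t, matSeries μ η (β i) := by
  funext w
  rw [sum_apply']
  exact sum_dotProduct t β _

/-- Acting on row vectors reverses the order of the factors in Newton's recursion; commutativity
restores it. -/
theorem prim_matSeries (hμ : ∀ x y, μ x * μ y = μ y * μ x) (s : ℕ+) (β : Fin n → ℂ) :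
    prim s (matSeries μ η β) = matSeries μ η (Matrix.vecMul β (newton μ s)) := by
  induction s using PNat.strongInductionOn with
  | _ s ih =>
    rw [prim_apply, newton_eq, Matrix.vecMul_sub, matSeries_sub, delta_matSeries,
      ← Nat.cast_smul_eq_nsmul ℂ, Matrix.vecMul_smul, matSeries_smul, Matrix.vecMul_sum,
      matSeries_sum]
    congr 1
    refine Finset.sum_congr rfl fun p hp => ?_
    rw [ih p.2 (snd_lt_of_mem_addPairs hp), delta_matSeries, Matrix.vecMul_vecMul,
      (commute_newton (fun i => hμ p.1 i) p.2).eq]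

theorem toShuffle_matSeries (hμ : ∀ x y, μ x * μ y = μ y * μ x) (w : List ℕ+) :
    ∀ β : Fin n → ℂ, toShuffle (matSeries μ η β) w =
      β ⬝ᵥ ((w.map (newton μ)).prod.mulVec η) := by
  induction w with
  | nil => intro β; rfl
  | cons s w ih =>
    intro β
    change toShuffle (prim s (matSeries μ η β)) w = _
    rw [prim_matSeries μ η hμ, ih, List.map_cons, List.prod_cons, ← Matrix.mulVec_mulVec,
      Matrix.dotProduct_mulVec β]

end Matrices

/-- Polynomials stay polynomials, and a representation (β, μ, η) becomes (β, `newton μ`, η), whose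
matrices still commute. -/
theorem toShuffle_mem_extendedDomain {S : StuffleSeries} (hS : S ∈ extendedDomain addContraction) :
    toShuffle S ∈ extendedDomain (noContraction ℕ+) := by
  suffices h : extendedDomain addContraction ≤ (extendedDomain (noContraction ℕ+)).comap toShuffle
    from h hS
  refine Algebra.adjoin_le ?_
  rintro _ ⟨S, hS | ⟨n, β, η, μ, hμ, hS⟩, rfl⟩
  · exact Algebra.subset_adjoin ⟨_, Or.inl (toShuffle_mem_polynomials hS), rfl⟩
  · refine Algebra.subset_adjoin ⟨_, Or.inr ⟨n, β, η, newton μ, fun x y => ?_, fun w => ?_⟩, rfl⟩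
    · exact (commute_newton (fun i => (commute_newton (fun j => hμ i j) x).symm) y).eq
    · have : of addContraction S = matSeries μ η β := funext hS
      rw [this]
      exact toShuffle_matSeries μ η hμ w β

end Stuffle

/-! ### The extension of the character `γ_•` -/

/-- The coefficients `γ, ζ(2)/2, ζ(3)/3, …`. -/
def gammaCoeff (k : ℕ+) : ℂ :=
  if k = 1 then (Real.eulerMascheroniConstant : ℂ) else riemannZeta ((k : ℕ) : ℂ) / ((k : ℕ) : ℂ)

theorem exists_norm_riemannZeta_le : ∃ C : ℝ, ∀ k : ℕ, 2 ≤ k → ‖riemannZeta (k : ℂ)‖ ≤ C := by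
  refine ⟨∑' n : ℕ, 1 / (n : ℝ) ^ 2, fun k hk => ?_⟩
  rw [zeta_nat_eq_tsum_of_gt_one (by omega)]
  have h2 : Summable fun n : ℕ => 1 / (n : ℝ) ^ 2 := Real.summable_one_div_nat_pow.2 (by norm_num)
  refine tsum_of_norm_bounded h2.hasSum fun n => ?_
  rw [norm_div, norm_one, norm_pow, Complex.norm_natCast]
  rcases Nat.eq_zero_or_pos n with rfl | hn
  · simp [show k ≠ 0 by omega]
  · exact one_div_le_one_div_of_le (by positivity)
      (pow_le_pow_right₀ (by exact_mod_cast hn) hk)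

/-- The power sums `p_{rm} = r (-1)^{m-1} t^{rm}` of `(t^r y_r)^*`. -/
theorem newton_single (r : ℕ+) (t : ℂ) (s : ℕ+) :
    newton (fun y => if y = r then t ^ (r : ℕ) else 0) s =
      if (r : ℕ) ∣ s then -((r : ℕ) * (-t ^ (r : ℕ)) ^ ((s : ℕ) / r)) else 0 := by
  induction s using PNat.strongInductionOn with
  | _ s ih =>
    rw [newton_eq]
    have hr := r.pos
    rcases lt_trichotomy s r with h | rfl | h
    · rw [if_neg h.ne, smul_zero, Finset.sum_eq_zero, sub_zero, if_neg]
      · exact fun hd => absurd (Nat.le_of_dvd s.pos hd) (not_le.2 h)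
      · intro p hp
        rw [if_neg, zero_mul]
        rintro rfl
        have := (mem_addPairs s p.1 p.2).1 hp
        exact absurd (this ▸ PNat.lt_add_right p.1 p.2 : p.1 < s) (not_lt.2 h.le)
    · rw [if_pos rfl, Finset.sum_eq_zero, sub_zero, if_pos dvd_rfl, Nat.div_self hr, pow_one,
        nsmul_eq_mul, mul_neg, neg_neg]
      intro p hp
      rw [if_neg, zero_mul]
      rintro h
      have := (mem_addPairs s p.1 p.2).1 hp
      exact absurd (this ▸ PNat.lt_add_right p.1 p.2 : p.1 < s) (not_lt.2 h.ge)
    -- Past r only the pair (r, u) survives: p_{r+u} = -t^r p_u.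
    · obtain ⟨u, rfl⟩ : ∃ u, s = r + u := ⟨s - r, (PNat.add_sub_of_lt h).symm⟩
      rw [if_neg h.ne', smul_zero, Finset.sum_eq_single (r, u), if_pos rfl, zero_sub,
        ih u (PNat.lt_add_left u r), PNat.add_coe]
      · by_cases hd : (r : ℕ) ∣ u
        · rw [if_pos hd, if_pos ((Nat.dvd_add_right dvd_rfl).2 hd),
            Nat.add_div_of_dvd_right dvd_rfl, Nat.div_self hr, pow_add, pow_one]
          ring
        · rw [if_neg hd, if_neg (fun h => hd ((Nat.dvd_add_right dvd_rfl).1 h)), mul_zero, neg_zero]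
      · intro p hp hne
        rw [if_neg, zero_mul]
        rintro h
        have h2 := (mem_addPairs _ p.1 p.2).1 hp
        rw [h] at h2
        exact hne (Prod.ext h (add_left_cancel h2))
      · intro hne
        exact absurd ((mem_addPairs _ _ _).2 rfl) hne

theorem summable_zeta_pow {r : ℕ} {x : ℂ} (hx : ‖x‖ < 1) (a : ℕ) (ha : 2 ≤ (a + 1) * r) :
    Summable fun k : ℕ => riemannZeta (((k + a + 1) * r : ℕ) : ℂ) * x ^ (k + a + 1) /
      ((k + a + 1 : ℕ) : ℂ) := by
  obtain ⟨C, hC⟩ := exists_norm_riemannZeta_le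
  refine Summable.of_norm_bounded (g := fun k => C * ‖x‖ ^ k)
    ((summable_geometric_of_lt_one (norm_nonneg _) hx).mul_left _) fun k => ?_
  have h1 : 2 ≤ (k + a + 1) * r := ha.trans (Nat.mul_le_mul_right r (by omega))
  have h2 := hC _ h1
  have h3 : (1 : ℝ) ≤ ((k + a + 1 : ℕ) : ℝ) := by exact_mod_cast Nat.le_add_left 1 (k + a)
  rw [norm_div, norm_mul, norm_pow, Complex.norm_natCast]
  refine (div_le_self (by positivity) h3).trans (mul_le_mul h2 ?_ (by positivity)
    ((norm_nonneg _).trans h2))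
  exact pow_le_pow_of_le_one (norm_nonneg _) hx.le (by omega)

/-- Only s = rm contributes, and ζ(rm)/(rm) times the power sum -r(-t^r)^m is the m-th term of ℓ_r;
for r = m = 1 the coefficient is γ instead. Writing every ℓ_r as the same linear functional of power
sums reduces later identities between them to identities between power sums. -/
theorem hasSum_gammaCoeff (r : ℕ+) {t : ℂ} (ht : ‖t‖ < 1) :
    HasSum (fun s : ℕ+ => gammaCoeff s *
      newton (fun y => if y = r then t ^ (r : ℕ) else 0) s) (ell r t) := by
  have hr := r.pos
  let ι : ℕ → ℕ+ := fun k => ⟨(k + 1) * r, Nat.mul_pos k.succ_pos hr⟩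
  have hι : Function.Injective ι := fun k l h => by
    have h1 : (k + 1) * (r : ℕ) = (l + 1) * r := congrArg PNat.val h
    have := Nat.eq_of_mul_eq_mul_right hr h1
    omega
  have hzero : ∀ s ∉ Set.range ι, gammaCoeff s *
      newton (fun y => if y = r then t ^ (r : ℕ) else 0) s = 0 := by
    intro s hs
    rw [newton_single, if_neg, mul_zero]
    rintro ⟨m, hm⟩
    have hm0 : m ≠ 0 := by
      rintro rfl
      simp at hm
    refine hs ⟨m - 1, PNat.eq ?_⟩
    change (m - 1 + 1) * (r : ℕ) = s
    rw [Nat.sub_add_cancel (Nat.one_le_iff_ne_zero.2 hm0), hm, mul_comm]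
  refine (hι.hasSum_iff hzero).1 ?_
  have hval : ∀ k, newton (fun y => if y = r then t ^ (r : ℕ) else 0) (ι k) =
      -((r : ℕ) * (-t ^ (r : ℕ)) ^ (k + 1)) := fun k => by
    rw [newton_single]
    change (if (r : ℕ) ∣ (k + 1) * r then -(((r : ℕ) : ℂ) *
      (-t ^ (r : ℕ)) ^ ((k + 1) * (r : ℕ) / r)) else 0) = _
    rw [if_pos (Dvd.intro_left _ rfl), Nat.mul_div_cancel _ hr]
  have hrC : ((r : ℕ) : ℂ) ≠ 0 := by exact_mod_cast hr.ne'
  have hterm : ∀ k, ι k ≠ 1 → ((fun s : ℕ+ => gammaCoeff s *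
      newton (fun y => if y = r then t ^ (r : ℕ) else 0) s) ∘ ι) k =
      -(riemannZeta (((k + 1) * (r : ℕ) : ℕ) : ℂ) * (-t ^ (r : ℕ)) ^ (k + 1) /
        ((k + 1 : ℕ) : ℂ)) := by
    intro k hk
    simp only [Function.comp_apply]
    rw [hval, gammaCoeff, if_neg hk]
    change riemannZeta (((k + 1) * (r : ℕ) : ℕ) : ℂ) / (((k + 1) * (r : ℕ) : ℕ) : ℂ) * _ = _
    have : ((k + 1 : ℕ) : ℂ) ≠ 0 := by exact_mod_cast k.succ_ne_zero
    rw [Nat.cast_mul (k + 1)]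
    field_simp
  have htr : ‖-t ^ (r : ℕ)‖ < 1 := by
    rw [norm_neg, norm_pow]
    exact pow_lt_one₀ (norm_nonneg _) ht hr.ne'
  by_cases h1 : r = 1
  · subst h1
    rw [ell, if_pos rfl, ← hasSum_nat_add_iff' 1]
    have hs := (summable_zeta_pow (r := 1) (x := -t) (by rwa [norm_neg]) 1 le_rfl).hasSum.neg
    simp only [mul_one, add_assoc, Nat.reduceAdd] at hs
    have e0 : ((fun s : ℕ+ => gammaCoeff s *
      newton (fun y => if y = 1 then t ^ ((1 : ℕ+) : ℕ) else 0) s) ∘ ι) 0 =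
        (Real.eulerMascheroniConstant : ℂ) * t := by
      simp only [Function.comp_apply]
      rw [hval, gammaCoeff, if_pos (show ι 0 = 1 from PNat.eq (by simp [ι]))]
      simp
    rw [Finset.sum_range_one, e0, sub_sub_cancel_left]
    refine hs.congr_fun fun k => ?_
    rw [hterm (k + 1) fun h => by
      have h1 : (k + 1 + 1) * ((1 : ℕ+) : ℕ) = 1 := congrArg PNat.val h
      rw [PNat.one_coe] at h1
      omega]
    simp only [PNat.one_coe, mul_one, pow_one]
  · rw [ell, if_neg h1]
    have hr2 : 2 ≤ (r : ℕ) := by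
      have : (r : ℕ) ≠ 1 := fun h => h1 (PNat.coe_eq_one_iff.1 h)
      have h2 : 1 ≤ (r : ℕ) := hr
      omega
    have hs := (summable_zeta_pow (r := r) htr 0 (by omega)).hasSum.neg
    simp only [add_zero] at hs
    refine hs.congr_fun fun k => ?_
    exact hterm k fun h => by
      have h1 : (k + 1) * (r : ℕ) = 1 := congrArg PNat.val h
      nlinarith

/-- The sequences `c` for which `∑ a_k c_k` converges. -/
def summableSubmodule : Submodule ℂ (ℕ+ → ℂ) where
  carrier := {c | Summable fun k => gammaCoeff k * c k}
  add_mem' {c c'} h h' := by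
    change Summable fun k => gammaCoeff k * (c k + c' k)
    simp only [mul_add]
    exact Summable.add h h'
  zero_mem' := by
    change Summable fun k => gammaCoeff k * (0 : ℂ)
    simp only [mul_zero]
    exact summable_zero
  smul_mem' a c h := by
    change Summable fun k => gammaCoeff k * (a * c k)
    simp only [mul_left_comm _ a]
    exact Summable.mul_left a h

/-- A homomorphism is needed on all coefficient families, while the series converges only on a
subspace; it is extended linearly through an arbitrary complement. -/
theorem exists_linear_extension : ∃ Λ : (ℕ+ → ℂ) →ₗ[ℂ] ℂ, ∀ (c : ℕ+ → ℂ) (v : ℂ),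
    HasSum (fun k => gammaCoeff k * c k) v → Λ c = v := by
  let f : summableSubmodule →ₗ[ℂ] ℂ :=
    { toFun := fun c => ∑' k, gammaCoeff k * c.1 k
      map_add' := fun c c' => by
        rw [← Summable.tsum_add c.2 c'.2]
        exact tsum_congr fun k => mul_add _ _ _
      map_smul' := fun a c => by
        rw [RingHom.id_apply, smul_eq_mul, ← tsum_mul_left]
        exact tsum_congr fun k => mul_left_comm _ _ _ }
  obtain ⟨Λ, hΛ⟩ := f.exists_extend
  refine ⟨Λ, fun c v h => ?_⟩
  have h1 : Λ c = f ⟨c, h.summable⟩ := LinearMap.congr_fun hΛ ⟨c, h.summable⟩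
  exact h1.trans h.tsum_eq

theorem exists_gamma_extension : ∃ G : extendedDomain addContraction →ₐ[ℂ] ℂ,
    (∀ w : List ℕ+, IsGammaValue w (G (wordElt _ w))) ∧
    ∀ (r : ℕ+) (t : ℂ), ‖t‖ < 1 →
      G (starElt _ (t ^ (r : ℕ)) r) = (GammaY r (1 + t))⁻¹ := by
  obtain ⟨γ, hγ⟩ := Harmonic.exists_gamma_character
  obtain ⟨Λ, hΛ⟩ := exists_linear_extension
  let e := AlgEquiv.ofBijective Stuffle.toShufflePoly Stuffle.toShufflePoly_bijective
  -- The value at (t^r y_r)^* is then exp Λ of its power sums, that is, exp ℓ_r(t).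
  let h : Multiplicative (ℕ+ → ℂ) →* ℂ :=
    { toFun := fun c => Complex.exp (Λ c.toAdd)
      map_one' := by rw [toAdd_one, map_zero, Complex.exp_zero]
      map_mul' := fun c c' => by rw [toAdd_mul, map_add, Complex.exp_add] }
  obtain ⟨Z, hZ1, hZ2⟩ := Shuffle.exists_character (γ.comp (e.symm : _ →ₐ[ℂ] _)) h
  let T : extendedDomain addContraction →ₐ[ℂ] extendedDomain (noContraction ℕ+) :=
    (Stuffle.toShuffle.comp (extendedDomain addContraction).val).codRestrict _
      fun p => Stuffle.toShuffle_mem_extendedDomain p.2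
  refine ⟨Z.comp T, fun w => ?_, fun r t ht => ?_⟩
  · have h1 := hZ1 (T (wordElt _ w))
      (Stuffle.toShufflePoly (QSeries.wordPoly Harmonic.locally_addContraction w)).2
    have h2 : (Z.comp T) (wordElt _ w) =
        γ (e.symm (e (QSeries.wordPoly Harmonic.locally_addContraction w))) := h1
    rw [h2, AlgEquiv.symm_apply_apply]
    exact hγ w
  · classical
    have h1 : (T (starElt _ (t ^ (r : ℕ)) r)).1 = QSeries.charSeries _
        (newton fun y => if y = r then t ^ (r : ℕ) else 0) := by
      change Stuffle.toShuffle (QSeries.of addContraction (letterStar (t ^ (r : ℕ)) r)) = _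
      rw [QSeries.of_letterStar, ← Stuffle.toShuffle_charSeries]
      congr!
    have h2 : (Z.comp T) (starElt _ (t ^ (r : ℕ)) r) = Complex.exp (Λ _) := hZ2 _ _ h1
    rw [h2, toAdd_ofAdd, hΛ _ _ (hasSum_gammaCoeff r ht), GammaY, add_sub_cancel_left, ← Complex.exp_neg,
      neg_neg]

/-! ### The multiplication formula -/

theorem norm_eq_one_of_pow_eq_neg_one {η : ℂ} {r : ℕ} (hr : r ≠ 0) (h : η ^ r = -1) : ‖η‖ = 1 := by
  refine Complex.norm_eq_one_of_pow_eq_one (n := r * 2) ?_ (by omega)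
  rw [pow_mul, h]
  norm_num

/-- The power sums agree termwise. At s = rm those of t and ηt are -r(-t^r)^m and -r(t^r)^m: they
cancel for odd m, and for even m = 2k they add up to the power sum -2r(t^(2r))^k of ξt. -/
theorem ell_two_mul (r : ℕ+) {ξ η t : ℂ} (hξ : ξ ^ (2 * (r : ℕ)) = -1) (hη : η ^ (r : ℕ) = -1)
    (ht : ‖t‖ < 1) : ell (2 * r) (ξ * t) = ell r t + ell r (η * t) := by
  have hr := r.pos
  have h1 := hasSum_gammaCoeff r ht
  have h2 := hasSum_gammaCoeff r (t := η * t) (by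
    rwa [norm_mul, norm_eq_one_of_pow_eq_neg_one hr.ne' hη, one_mul])
  have h3 := hasSum_gammaCoeff (2 * r) (t := ξ * t) (by
    rwa [norm_mul, norm_eq_one_of_pow_eq_neg_one (by omega) hξ, one_mul])
  refine h3.unique ((h1.add h2).congr_fun fun s => ?_)
  rw [← mul_add, newton_single, newton_single, newton_single]
  congr 1
  have hcoe : ((2 * r : ℕ+) : ℕ) = 2 * r := rfl
  rw [hcoe, mul_pow, mul_pow, hξ, hη]
  by_cases hd : (r : ℕ) ∣ s
  · obtain ⟨m, hm⟩ := hd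
    rw [hm, if_pos (Dvd.intro _ rfl), if_pos (Dvd.intro _ rfl), Nat.mul_div_cancel_left _ hr]
    rcases Nat.even_or_odd m with ⟨k, rfl⟩ | hodd
    · rw [if_pos ⟨k, by ring⟩, show (r : ℕ) * (k + k) / (2 * r) = k by
        rw [show (r : ℕ) * (k + k) = 2 * r * k by ring, Nat.mul_div_cancel_left _ (by omega)]]
      rw [← two_mul, pow_mul (-t ^ (r : ℕ)), pow_mul (-(-1 * t ^ (r : ℕ)))]
      push_cast
      ring
    · rw [if_neg]
      · rw [hodd.neg_pow, neg_mul, one_mul, neg_neg]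
        ring
      · rintro ⟨k, hk⟩
        have : m = 2 * k := Nat.eq_of_mul_eq_mul_left hr (by rw [hk]; ring)
        exact (Nat.not_even_iff_odd.2 hodd) ⟨k, by omega⟩
  · rw [if_neg hd, if_neg hd, if_neg fun h => hd ((Dvd.intro_left 2 rfl).trans h), add_zero]

theorem GammaY_two_mul (r : ℕ+) (ξ η t : ℂ) (hξ : ξ ^ (2 * (r : ℕ)) = -1)
    (hη : η ^ (r : ℕ) = -1) (ht : ‖t‖ < 1) :
    GammaY (2 * r) (1 + ξ * t) = GammaY r (1 + t) * GammaY r (1 + η * t) := by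
  rw [GammaY, GammaY, GammaY, add_sub_cancel_left, add_sub_cancel_left, add_sub_cancel_left,
    ell_two_mul r hξ hη ht, ← Complex.exp_add, neg_add]

/-! ### Stirling's formula -/

namespace Stirling

open Complex

/-- The main term of Stirling's formula for `log Γ`. -/
def psi (w : ℂ) : ℂ := (w - 1 / 2) * log w - w

/-- The defect of `psi` in the functional equation `log Γ(w + 1) = log Γ(w) + log w`. -/
def eps (w : ℂ) : ℂ := psi (w + 1) - psi w - log w

theorem add_mem_slitPlane {w : ℂ} (hw : w ∈ slitPlane) {s : ℝ} (hs : 0 ≤ s) :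
    w + s ∈ slitPlane := by
  rw [mem_slitPlane_iff] at hw ⊢
  rw [add_re, add_im, ofReal_re, ofReal_im, add_zero]
  exact hw.imp (fun h => by linarith) id

/-- The defect equals a(1), where a(s) = (w + s/2)(log(w+s) - log w) - s vanishes at 0 together with
its derivative b, and b' = (s/2)/(w+s)². Two mean value estimates give the bound. -/
theorem norm_eps_le {w : ℂ} (hw : w ∈ slitPlane) {M : ℝ} (hM0 : 0 ≤ M)
    (hM : ∀ s : ℝ, 0 ≤ s → 1 ≤ M * ‖w + s‖ ^ 2) : ‖eps w‖ ≤ M := by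
  have hne : ∀ s ∈ Set.Icc (0 : ℝ) 1, w + s ≠ 0 := fun s hs =>
    slitPlane_ne_zero (add_mem_slitPlane hw hs.1)
  have hlin : ∀ s : ℝ, HasDerivAt (fun s : ℝ => w + (s : ℂ)) 1 s := fun s =>
    (ofRealCLM.hasDerivAt (x := s)).const_add w
  have hlog : ∀ s ∈ Set.Icc (0 : ℝ) 1,
      HasDerivAt (fun s : ℝ => log (w + s)) (1 / (w + s)) s := fun s hs =>
    (hlin s).clog_real (add_mem_slitPlane hw hs.1)
  have hid : ∀ s : ℝ, HasDerivAt (fun s : ℝ => (s : ℂ)) 1 s := fun s =>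
    ofRealCLM.hasDerivAt (x := s)
  let b : ℝ → ℂ := fun s => (1 / 2) * (log (w + s) - log w) - s / 2 * (1 / (w + s))
  have hb : ∀ s ∈ Set.Icc (0 : ℝ) 1, HasDerivAt b (s / 2 * (1 / (w + s)) ^ 2) s := by
    intro s hs
    have h1 := hne s hs
    refine ((((hlog s hs).sub_const (log w)).const_mul (1 / 2)).sub
      (((hid s).div_const 2).mul ((hasDerivAt_const s (1 : ℂ)).div (hlin s) h1))).congr_deriv ?_
    simp only [Pi.div_apply]
    field_simp
    ring
  have hb' : ∀ s ∈ Set.Icc (0 : ℝ) 1, ‖(s / 2 * (1 / (w + s)) ^ 2 : ℂ)‖ ≤ M := by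
    intro s hs
    have h1 : 0 < ‖w + s‖ := norm_pos_iff.2 (hne s hs)
    rw [norm_mul, norm_div, norm_pow, norm_div, norm_one, norm_real, norm_ofNat,
      Real.norm_of_nonneg hs.1, div_pow, one_pow]
    have h2 : 1 / ‖w + s‖ ^ 2 ≤ M := by
      rw [div_le_iff₀ (by positivity)]; exact hM s hs.1
    calc s / 2 * (1 / ‖w + s‖ ^ 2) ≤ 1 * M :=
          mul_le_mul (by linarith [hs.2]) h2 (by positivity) zero_le_one
      _ = M := one_mul M
  have hbb : ∀ s ∈ Set.Icc (0 : ℝ) 1, ‖b s‖ ≤ M := by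
    intro s hs
    have h := (convex_Icc (0 : ℝ) 1).norm_image_sub_le_of_norm_hasDerivWithin_le
      (fun y hy => (hb y hy).hasDerivWithinAt) hb' (show (0 : ℝ) ∈ Set.Icc (0 : ℝ) 1 by simp) hs
    have h0 : b 0 = 0 := by simp [b]
    rw [h0, sub_zero, sub_zero, Real.norm_of_nonneg hs.1] at h
    exact h.trans (mul_le_of_le_one_right hM0 hs.2)
  let a : ℝ → ℂ := fun s => (w + s / 2) * (log (w + s) - log w) - s
  have ha : ∀ s ∈ Set.Icc (0 : ℝ) 1, HasDerivAt a (b s) s := by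
    intro s hs
    have h1 := hne s hs
    refine ((((hid s).div_const 2).const_add w).mul ((hlog s hs).sub_const (log w))).sub
      (hid s) |>.congr_deriv ?_
    simp only [b]
    field_simp
    ring
  have h := (convex_Icc (0 : ℝ) 1).norm_image_sub_le_of_norm_hasDerivWithin_le
      (fun y hy => (ha y hy).hasDerivWithinAt) hbb (show (0 : ℝ) ∈ Set.Icc (0 : ℝ) 1 by simp)
      (show (1 : ℝ) ∈ Set.Icc (0 : ℝ) 1 by simp)
  have h0 : a 0 = 0 := by simp [a]
  have h1 : a 1 = eps w := by
    simp only [a, eps, psi, ofReal_one]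
    ring
  rw [h0, h1, sub_zero, sub_zero, norm_one, mul_one] at h
  exact h

theorem mem_slitPlane_of_sector {c : ℝ} (hc1 : c < 1) {u : ℂ} (hu : 0 < ‖u‖)
    (hre : -c * ‖u‖ ≤ u.re) : u ∈ slitPlane := by
  rw [mem_slitPlane_iff]
  by_contra! h
  have h2 : ‖u‖ = |u.re| := by
    have := abs_re_eq_norm.2 h.2
    exact this.symm
  rw [abs_of_nonpos h.1] at h2
  nlinarith

/-- |u + t|² ≥ |u|² - 2ct|u| + t², and 2t|u| ≤ t² + |u|². -/
theorem sector_add_bound {c : ℝ} (hc0 : 0 ≤ c) (hc1 : c < 1) {u : ℂ} (hu : 1 ≤ ‖u‖)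
    (hre : -c * ‖u‖ ≤ u.re) {t : ℝ} (ht : 0 ≤ t) : (1 - c) * (1 + t ^ 2) ≤ ‖u + t‖ ^ 2 := by
  have h1 : ‖u + t‖ ^ 2 = ‖u‖ ^ 2 + 2 * t * u.re + t ^ 2 := by
    rw [← normSq_eq_norm_sq, ← normSq_eq_norm_sq, normSq_apply, normSq_apply, add_re, add_im,
      ofReal_re, ofReal_im]
    ring
  rw [h1]
  have h2 : 2 * t * (-c * ‖u‖) ≤ 2 * t * u.re := mul_le_mul_of_nonneg_left hre (by positivity)
  nlinarith [mul_nonneg hc0 (sq_nonneg (‖u‖ - t)), mul_nonneg (sub_nonneg.2 hc1.le)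
    (show 0 ≤ ‖u‖ ^ 2 - 1 by nlinarith)]

/-- The defects along u, u + 1, … are dominated by a convergent series that depends only on the
sector. -/
theorem norm_sum_eps_le {c : ℝ} (hc0 : 0 ≤ c) (hc1 : c < 1) {u : ℂ} (hu : 1 ≤ ‖u‖)
    (hre : -c * ‖u‖ ≤ u.re) (n : ℕ) :
    ‖∑ j ∈ Finset.range n, eps (u + j)‖ ≤ (1 - c)⁻¹ * ∑' j : ℕ, (1 + (j : ℝ) ^ 2)⁻¹ := by
  have hslit := mem_slitPlane_of_sector hc1 (by linarith) hre
  have hsum : Summable fun j : ℕ => (1 + (j : ℝ) ^ 2)⁻¹ := by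
    refine Summable.of_norm_bounded_eventually_nat
      (Real.summable_one_div_nat_pow.2 (one_lt_two)) ?_
    filter_upwards [eventually_gt_atTop 0] with j hj
    have : (0 : ℝ) < j := by exact_mod_cast hj
    rw [Real.norm_of_nonneg (by positivity), one_div]
    exact inv_anti₀ (by positivity) (by linarith)
  rw [← tsum_mul_left]
  refine (norm_sum_le _ _).trans ((Finset.sum_le_sum fun j _ => ?_).trans
    ((hsum.mul_left _).sum_le_tsum _ fun j _ => ?_))
  · have hj : (0 : ℝ) ≤ j := Nat.cast_nonneg j
    have hslit' : u + j ∈ slitPlane := by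
      have := add_mem_slitPlane hslit hj
      rwa [ofReal_natCast] at this
    have hc : 0 < 1 - c := by linarith
    refine norm_eps_le hslit' (by positivity) fun s hs => ?_
    have h1 := sector_add_bound hc0 hc1 hu hre (add_nonneg hj hs)
    rw [ofReal_add, ofReal_natCast, ← add_assoc] at h1
    rw [← mul_inv, inv_mul_eq_div, le_div_iff₀ (by positivity), one_mul]
    refine le_trans (mul_le_mul_of_nonneg_left ?_ hc.le) h1
    nlinarith
  · have hc : 0 < 1 - c := by linarith
    positivity

theorem prod_eq_exp {u : ℂ} (hu : u ∈ slitPlane) (n : ℕ) : ∏ j ∈ Finset.range n, (u + j) =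
    exp (psi (u + n) - psi u - ∑ j ∈ Finset.range n, eps (u + j)) := by
  induction n with
  | zero => simp
  | succ n ih =>
    have h1 : u + n ≠ 0 := by
      have := add_mem_slitPlane hu (Nat.cast_nonneg n)
      rw [ofReal_natCast] at this
      exact slitPlane_ne_zero this
    rw [Finset.prod_range_succ, ih, Finset.sum_range_succ, ← exp_log h1, ← exp_add, exp_log h1, eps]
    congr 1
    push_cast
    rw [← add_assoc]
    ring

/-- Follows from n log(1 + a/n) → a and log(1 + a/n) → 0 after writing log(n + a) = log n + log(1 +
a/n). -/
theorem tendsto_psi_add (a : ℂ) :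
    Tendsto (fun n : ℕ => psi (n + a) - (n + a - 1 / 2) * log n + n) atTop (𝓝 0) := by
  have hg : Tendsto (fun n : ℕ => (n : ℂ) * (a / n)) atTop (𝓝 a) := by
    refine tendsto_const_nhds.congr' ?_
    filter_upwards [eventually_ne_atTop 0] with n hn
    rw [mul_div_cancel₀ a (by exact_mod_cast hn)]
  have h1 := tendsto_nat_mul_log_one_add_of_tendsto hg
  have hdiv : Tendsto (fun n : ℕ => a / (n : ℂ)) atTop (𝓝 0) :=
    tendsto_const_div_atTop_nhds_zero_nat a
  have h2 : Tendsto (fun n : ℕ => log (1 + a / n)) atTop (𝓝 0) := by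
    have h3 : Tendsto (fun n : ℕ => 1 + a / (n : ℂ)) atTop (𝓝 1) := by
      simpa using hdiv.const_add 1
    have := (continuousAt_clog one_mem_slitPlane).tendsto.comp h3
    rwa [log_one] at this
  have h4 := (h1.sub_const a).add (h2.const_mul (a - 1 / 2))
  rw [sub_self, mul_zero, add_zero] at h4
  have hne : ∀ᶠ n : ℕ in atTop, 1 + a / (n : ℂ) ≠ 0 := by
    have h3 : Tendsto (fun n : ℕ => 1 + a / (n : ℂ)) atTop (𝓝 1) := by
      simpa using hdiv.const_add 1
    exact h3.eventually_ne one_ne_zero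
  refine h4.congr' ?_
  filter_upwards [hne, eventually_gt_atTop 0] with n hn hn0
  have hn1 : (n : ℂ) ≠ 0 := by exact_mod_cast hn0.ne'
  have h5 : (n : ℂ) + a = ((n : ℝ) : ℂ) * (1 + a / n) := by
    rw [ofReal_natCast, mul_add, mul_div_cancel₀ a hn1, mul_one]
  have h6 : log (n + a) = log n + log (1 + a / n) := by
    rw [h5, log_ofReal_mul (by exact_mod_cast hn0) hn, ofReal_log (Nat.cast_nonneg n),
      ofReal_natCast]
  rw [psi, h6]
  ring

/-- Stirling's formula, up to a bounded factor, in a sector around the positive axis. -/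
theorem exists_norm_Gamma_bounds {c : ℝ} (hc0 : 0 ≤ c) (hc1 : c < 1) :
    ∃ K : ℝ, 0 < K ∧ ∀ u : ℂ, 1 ≤ ‖u‖ → -c * ‖u‖ ≤ u.re →
      ‖Gamma u‖ ≤ K * ‖exp (psi u)‖ ∧ ‖exp (psi u)‖ ≤ K * ‖Gamma u‖ := by
  let E := (1 - c)⁻¹ * ∑' j : ℕ, (1 + (j : ℝ) ^ 2)⁻¹
  have hseq : ∀ u : ℂ, u ∈ slitPlane → ∀ n : ℕ, n ≠ 0 → GammaSeq u n * exp (-psi u) =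
      n.factorial * exp (u * log n - psi (n + (1 + u)) +
        ∑ j ∈ Finset.range (n + 1), eps (u + j)) := by
    intro u hu n hn
    have hn' : (n : ℂ) ≠ 0 := by exact_mod_cast hn
    rw [GammaSeq, prod_eq_exp hu, cpow_def_of_ne_zero hn', mul_comm (log _), div_mul_eq_mul_div,
      div_eq_mul_inv, ← exp_neg, mul_comm (exp (u * log n)), mul_assoc, mul_assoc, ← exp_add,
      ← exp_add]
    congr 2
    push_cast
    rw [show u + ((n : ℂ) + 1) = n + (1 + u) by ring]
    ring
  refine ⟨Real.exp (2 * E + 1), Real.exp_pos _, fun u hu hre => ?_⟩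
  have hus := mem_slitPlane_of_sector hc1 (by linarith) hre
  have h1s : (1 : ℂ) ∈ slitPlane := one_mem_slitPlane
  have hlim : ∀ v : ℂ, Tendsto (fun n => GammaSeq v n * exp (-psi v)) atTop
      (𝓝 (Gamma v * exp (-psi v))) := fun v => (GammaSeq_tendsto_Gamma v).mul_const _
  have hpsi1 : psi 1 = -1 := by simp [psi]
  have h1 := hlim 1
  rw [Gamma_one, hpsi1, neg_neg, one_mul] at h1
  have hD : Tendsto (fun n : ℕ => exp ((psi (n + (1 + 1)) - (n + (1 + 1) - 1 / 2) * log n + n) -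
      (psi (n + (1 + u)) - (n + (1 + u) - 1 / 2) * log n + n))) atTop (𝓝 1) := by
    have := ((tendsto_psi_add (1 + 1)).sub (tendsto_psi_add (1 + u))).cexp
    rwa [sub_zero, exp_zero] at this
  -- Euler's product at u is compared with the one at 1: the factorial cancels, the main terms tend
  -- to 1, and a difference of two defect sums remains, each at most E in norm.
  have hratio : ∀ᶠ n : ℕ in atTop, GammaSeq u n * exp (-psi u) =
      GammaSeq 1 n * exp 1 * exp ((psi (n + (1 + 1)) - (n + (1 + 1) - 1 / 2) * log n + n) -
        (psi (n + (1 + u)) - (n + (1 + u) - 1 / 2) * log n + n)) *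
        exp (∑ j ∈ Finset.range (n + 1), eps (u + j) - ∑ j ∈ Finset.range (n + 1), eps (1 + j)) := by
    filter_upwards [eventually_ne_atTop 0] with n hn
    have h2 := hseq 1 h1s n hn
    rw [hpsi1, neg_neg] at h2
    rw [hseq u hus n hn, h2, mul_assoc, mul_assoc, ← exp_add, ← exp_add]
    congr 2
    ring
  have hexp : ∀ n : ℕ, ‖∑ j ∈ Finset.range (n + 1), eps (u + j) -
      ∑ j ∈ Finset.range (n + 1), eps (1 + j)‖ ≤ 2 * E := fun n => by
    have e1 := norm_sum_eps_le hc0 hc1 hu hre (n + 1)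
    have e2 := norm_sum_eps_le (u := 1) hc0 hc1 (by simp)
      (by simp only [norm_one, one_re]; linarith) (n + 1)
    refine (norm_sub_le _ _).trans ?_
    rw [two_mul]
    exact add_le_add e1 e2
  have hmain : Tendsto (fun n : ℕ => ‖GammaSeq 1 n * exp 1 *
      exp ((psi (n + (1 + 1)) - (n + (1 + 1) - 1 / 2) * log n + n) -
        (psi (n + (1 + u)) - (n + (1 + u) - 1 / 2) * log n + n))‖) atTop (𝓝 (Real.exp 1)) := by
    have := (h1.mul hD).norm
    rwa [mul_one, ← ofReal_one, norm_exp_ofReal, ofReal_one] at this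
  have hG : ‖Gamma u * exp (-psi u)‖ = ‖Gamma u‖ * ‖exp (psi u)‖⁻¹ := by
    rw [norm_mul, exp_neg, norm_inv]
  have hpos : 0 < ‖exp (psi u)‖ := norm_pos_iff.2 (exp_ne_zero _)
  have hup : ‖Gamma u * exp (-psi u)‖ ≤ Real.exp 1 * Real.exp (2 * E) := by
    refine le_of_tendsto_of_tendsto (hlim u).norm (hmain.mul_const _) ?_
    filter_upwards [hratio] with n hn
    rw [hn, norm_mul]
    refine mul_le_mul_of_nonneg_left ?_ (norm_nonneg _)
    rw [norm_exp]
    exact Real.exp_le_exp.2 ((re_le_norm _).trans (hexp n))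
  have hlow : Real.exp 1 * Real.exp (-(2 * E)) ≤ ‖Gamma u * exp (-psi u)‖ := by
    refine le_of_tendsto_of_tendsto (hmain.mul_const _) (hlim u).norm ?_
    filter_upwards [hratio] with n hn
    rw [hn]
    refine (mul_le_mul_of_nonneg_left ?_ (norm_nonneg _)).trans_eq (norm_mul _ _).symm
    rw [norm_exp]
    exact Real.exp_le_exp.2 (neg_le_of_abs_le ((abs_re_le_norm _).trans (hexp n)))
  rw [hG, mul_inv_le_iff₀ hpos, ← Real.exp_add, add_comm 1] at hup
  rw [hG, ← div_eq_mul_inv, le_div_iff₀ hpos] at hlow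
  refine ⟨hup, ?_⟩
  have h3 : Real.exp (2 * E + 1) * (Real.exp 1 * Real.exp (-(2 * E))) = Real.exp 1 * Real.exp 1 := by
    rw [← Real.exp_add, ← Real.exp_add, ← Real.exp_add]
    congr 1; ring
  have h4 := mul_le_mul_of_nonneg_left hlow (Real.exp_pos (2 * E + 1)).le
  rw [← mul_assoc, h3] at h4
  refine le_trans ?_ h4
  refine le_mul_of_one_le_left hpos.le ?_
  rw [← Real.exp_add]
  exact Real.one_le_exp (by norm_num)

end Stirling

/-! ### The Eulerian functions as entire functions -/

/-- The entire function `1 / Γ(1 + z)`. -/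
def rGamma (z : ℂ) : ℂ := (Complex.Gamma (1 + z))⁻¹

theorem differentiable_rGamma : Differentiable ℂ rGamma :=
  Complex.differentiable_one_div_Gamma.comp ((differentiable_const 1).add differentiable_id)

theorem hasSum_log_one_add_div {z : ℂ} (hz : ‖z‖ < 1) (k : ℕ) :
    HasSum (fun m : ℕ => -((-z) ^ (m + 2) / ((m + 2 : ℕ) : ℂ)) * (1 / ((k : ℂ) + 1) ^ (m + 2)))
      (Complex.log (1 + z / (k + 1)) - z / (k + 1)) := by
  have hk : (1 : ℝ) ≤ ‖(k : ℂ) + 1‖ := by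
    have : ((k : ℂ) + 1) = ((k + 1 : ℕ) : ℂ) := by push_cast; ring
    rw [this, Complex.norm_natCast]
    exact_mod_cast Nat.le_add_left 1 k
  have hw : ‖z / (k + 1)‖ < 1 := by
    rw [norm_div]
    exact (div_le_self (norm_nonneg _) hk).trans_lt hz
  have h := (hasSum_nat_add_iff' 2).2 (Complex.hasSum_taylorSeries_log hw)
  rw [Finset.sum_range_succ, Finset.sum_range_one] at h
  simp only [Nat.cast_zero, div_zero, zero_add, Nat.cast_one, pow_one, div_one] at h
  norm_num at h
  refine h.congr_fun fun m => ?_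
  have hk0 : (k : ℂ) + 1 ≠ 0 := by exact_mod_cast k.succ_ne_zero
  have hm0 : (m : ℂ) + 2 ≠ 0 := by exact_mod_cast (m + 1).succ_ne_zero
  push_cast
  rw [div_pow, neg_pow z, pow_succ (-1 : ℂ) (m + 2)]
  field_simp

/-- The double Taylor series is dominated by (k+1)^(-2) |z|^m, so it may be summed over k first,
which produces ζ(m+2). -/
theorem hasSum_log_sub {z : ℂ} (hz : ‖z‖ < 1) :
    HasSum (fun k : ℕ => Complex.log (1 + z / (k + 1)) - z / (k + 1))
      (-∑' m : ℕ, riemannZeta ((m + 2 : ℕ) : ℂ) * (-z) ^ (m + 2) / ((m + 2 : ℕ) : ℂ)) := by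
  let a : ℕ × ℕ → ℂ := fun x =>
    -((-z) ^ (x.2 + 2) / ((x.2 + 2 : ℕ) : ℂ)) * (1 / ((x.1 : ℂ) + 1) ^ (x.2 + 2))
  have hsum : Summable a := by
    have h1 : Summable fun k : ℕ => 1 / ((k : ℝ) + 1) ^ 2 := by
      have := (summable_nat_add_iff 1).2 (Real.summable_one_div_nat_pow.2 one_lt_two)
      simpa using this
    have h2 : Summable fun m : ℕ => ‖z‖ ^ m := summable_geometric_of_lt_one (norm_nonneg _) hz
    refine Summable.of_norm_bounded (h1.mul_of_nonneg h2 (fun k => by positivity)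
      (fun m => by positivity)) fun x => ?_
    have e1 : ‖((x.1 : ℂ) + 1)‖ = (x.1 : ℝ) + 1 := by
      have : ((x.1 : ℂ) + 1) = ((x.1 + 1 : ℕ) : ℂ) := by push_cast; ring
      rw [this, Complex.norm_natCast]
      push_cast; ring
    simp only [a]
    rw [norm_mul, norm_neg, norm_div, norm_div, norm_pow, norm_pow, norm_neg, e1, norm_one,
      Complex.norm_natCast, mul_comm]
    have hx : (1 : ℝ) ≤ x.1 + 1 := le_add_of_nonneg_left (Nat.cast_nonneg _)
    refine mul_le_mul ?_ ?_ (by positivity) (by positivity)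
    · exact one_div_le_one_div_of_le (by positivity) (pow_le_pow_right₀ hx (by omega))
    · refine (div_le_self (by positivity) (by exact_mod_cast Nat.le_add_left 1 (x.2 + 1))).trans ?_
      exact pow_le_pow_of_le_one (norm_nonneg _) hz.le (by omega)
  have h1 := hsum.hasSum.prod_fiberwise (fun k => hasSum_log_one_add_div hz k)
  have h2 : ∑' x, a x =
      -∑' m : ℕ, riemannZeta ((m + 2 : ℕ) : ℂ) * (-z) ^ (m + 2) / ((m + 2 : ℕ) : ℂ) := by
    rw [hsum.tsum_prod]
    have h3 := Summable.tsum_comm (f := fun k m => a (k, m)) hsum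
    rw [← h3, ← tsum_neg]
    refine tsum_congr fun m => ?_
    simp only [a]
    rw [tsum_mul_left, zeta_eq_tsum_one_div_nat_add_one_cpow (by
      rw [Complex.natCast_re]; exact_mod_cast Nat.lt_add_left m one_lt_two)]
    simp only [Complex.cpow_natCast]
    ring
  rwa [h2] at h1

/-- This is Weierstrass's product 1/Γ(1+z) = e^{γz} ∏ (1 + z/k) e^{-z/k}, obtained by rewriting
Euler's sequence for Γ(1+z) with harmonic numbers. -/
theorem exp_ell_one {z : ℂ} (hz : ‖z‖ < 1) : Complex.exp (ell 1 z) = rGamma z := by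
  have hne : ∀ k : ℕ, 1 + z / ((k : ℂ) + 1) ≠ 0 := by
    intro k h
    have hk : (1 : ℝ) ≤ ‖(k : ℂ) + 1‖ := by
      have : ((k : ℂ) + 1) = ((k + 1 : ℕ) : ℂ) := by push_cast; ring
      rw [this, Complex.norm_natCast]
      exact_mod_cast Nat.le_add_left 1 k
    have h1 : ‖z / ((k : ℂ) + 1)‖ = 1 := by
      rw [show z / ((k : ℂ) + 1) = -1 from (eq_neg_of_add_eq_zero_right h), norm_neg, norm_one]
    rw [norm_div] at h1
    exact absurd ((div_le_self (norm_nonneg _) hk).trans_lt hz) (by rw [h1]; exact lt_irrefl _)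
  have h1 := (hasSum_log_sub hz).tendsto_sum_nat
  have h2 := Real.tendsto_harmonic_sub_log
  have h3 : Tendsto (fun n : ℕ => (((harmonic n : ℝ) - Real.log n : ℝ) : ℂ)) atTop
      (𝓝 (Real.eulerMascheroniConstant : ℂ)) :=
    (Complex.continuous_ofReal.tendsto _).comp h2
  have h4 : Tendsto (fun n : ℕ => (1 : ℂ) / ((n : ℂ) + 1)) atTop (𝓝 0) :=
    tendsto_one_div_add_atTop_nhds_zero_nat
  -- Euler's product at n has n + 1 factors, so the partial sum is shifted by one and 1/(n+1)
  -- completes the harmonic number. The factor in `h6` is the ratio of (n+1)! to n · n!.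
  have h5 := ((h1.comp (tendsto_add_atTop_nat 1)).add ((h3.add h4).mul_const z)).cexp
  have h6 : Tendsto (fun n : ℕ => 1 + (1 : ℂ) / n) atTop (𝓝 1) := by
    simpa using (tendsto_const_div_atTop_nhds_zero_nat (1 : ℂ)).const_add 1
  have h7 := (Complex.GammaSeq_tendsto_Gamma (1 + z)).inv₀ (by
    refine Complex.Gamma_ne_zero fun m hm => ?_
    have : z = -((m + 1 : ℕ) : ℂ) := by
      push_cast
      linear_combination hm
    rw [this, norm_neg, Complex.norm_natCast] at hz
    exact absurd hz (not_lt.2 (by exact_mod_cast Nat.le_add_left 1 m)))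
  have h8 := h6.mul h5
  rw [add_zero, one_mul] at h8
  have h9 : ell 1 z = -∑' m : ℕ, riemannZeta ((m + 2 : ℕ) : ℂ) * (-z) ^ (m + 2) /
      ((m + 2 : ℕ) : ℂ) + (Real.eulerMascheroniConstant : ℂ) * z := by
    rw [ell, if_pos rfl]
    ring
  rw [h9]
  refine tendsto_nhds_unique h8 (h7.congr' ?_)
  filter_upwards [eventually_ne_atTop 0] with n hn
  have hn' : (n : ℂ) ≠ 0 := by exact_mod_cast hn
  have hprod : ∏ j ∈ Finset.range (n + 1), (1 + z + j) = (n + 1).factorial *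
      Complex.exp (∑ j ∈ Finset.range (n + 1), Complex.log (1 + z / (j + 1))) := by
    rw [Complex.exp_sum, ← Finset.prod_range_add_one_eq_factorial, Nat.cast_prod,
      ← Finset.prod_mul_distrib]
    refine Finset.prod_congr rfl fun j _ => ?_
    have hj : (j : ℂ) + 1 ≠ 0 := by exact_mod_cast j.succ_ne_zero
    rw [Complex.exp_log (hne j)]
    push_cast
    field_simp
    ring
  have hharm : ((harmonic n : ℝ) : ℂ) + 1 / ((n : ℂ) + 1) =
      ∑ j ∈ Finset.range (n + 1), 1 / ((j : ℂ) + 1) := by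
    rw [Finset.sum_range_succ, harmonic]
    push_cast
    simp only [one_div]
  rw [Complex.GammaSeq, hprod, Complex.cpow_add _ _ hn', Complex.cpow_one,
    Complex.cpow_def_of_ne_zero hn', inv_div, Nat.factorial_succ]
  have hfac : (n.factorial : ℂ) ≠ 0 := by exact_mod_cast n.factorial_ne_zero
  simp only [Function.comp_apply]
  rw [Finset.sum_sub_distrib]
  have hexp : Complex.exp (∑ j ∈ Finset.range (n + 1), Complex.log (1 + z / (j + 1)) -
      ∑ j ∈ Finset.range (n + 1), z / ((j : ℂ) + 1) +
      ((((harmonic n : ℝ) - Real.log n : ℝ) : ℂ) + 1 / ((n : ℂ) + 1)) * z) =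
      Complex.exp (∑ j ∈ Finset.range (n + 1), Complex.log (1 + z / (j + 1))) /
        Complex.exp (Complex.log n * z) := by
    rw [← Complex.exp_sub]
    congr 1
    have e1 : ∑ j ∈ Finset.range (n + 1), z / ((j : ℂ) + 1) =
        (((harmonic n : ℝ) : ℂ) + 1 / ((n : ℂ) + 1)) * z := by
      rw [hharm, Finset.sum_mul]
      exact Finset.sum_congr rfl fun j _ => by ring
    rw [e1, Complex.ofReal_sub, Complex.ofReal_log (Nat.cast_nonneg n), Complex.ofReal_natCast]
    ring
  rw [hexp]
  have := Complex.exp_ne_zero (Complex.log n * z)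
  push_cast
  field_simp

/-- The complex numbers `ρ` with `ρ ^ r = (-1) ^ (r - 1)`. -/
def signedRoots (r : ℕ+) : Finset ℂ := Polynomial.nthRootsFinset (r : ℕ) ((-1) ^ ((r : ℕ) - 1) : ℂ)

theorem mem_signedRoots {r : ℕ+} {ρ : ℂ} :
    ρ ∈ signedRoots r ↔ ρ ^ (r : ℕ) = (-1) ^ ((r : ℕ) - 1) :=
  Polynomial.mem_nthRootsFinset r.pos _

theorem card_signedRoots (r : ℕ+) : (signedRoots r).card = r := by
  classical
  have hζ := Complex.isPrimitiveRoot_exp (r : ℕ) r.ne_zero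
  have h0 : ((-1) ^ ((r : ℕ) - 1) : ℂ) ≠ 0 := pow_ne_zero _ (by norm_num)
  have hex : ∃ α : ℂ, α ^ (r : ℕ) = (-1) ^ ((r : ℕ) - 1) :=
    IsAlgClosed.exists_pow_nat_eq _ r.pos
  rw [signedRoots, Polynomial.nthRootsFinset, Multiset.toFinset_card_of_nodup (hζ.nthRoots_nodup h0),
    hζ.card_nthRoots, if_pos hex]

/-- The set is stable under multiplication by a primitive r-th root of unity ζ, so the sum is fixed
by ζ^s and vanishes unless r divides s. -/
theorem sum_pow_signedRoots (r : ℕ+) (s : ℕ) : ∑ ρ ∈ signedRoots r, ρ ^ s =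
    if (r : ℕ) ∣ s then ((r : ℕ) : ℂ) * ((-1 : ℂ) ^ ((r : ℕ) - 1)) ^ (s / (r : ℕ)) else 0 := by
  split_ifs with h
  · obtain ⟨m, rfl⟩ := h
    rw [Nat.mul_div_cancel_left _ r.pos, Finset.sum_congr rfl fun ρ hρ => by
      rw [pow_mul, mem_signedRoots.1 hρ], Finset.sum_const, card_signedRoots, nsmul_eq_mul]
  · have hζ := Complex.isPrimitiveRoot_exp (r : ℕ) r.ne_zero
    set ζ := Complex.exp (2 * Real.pi * Complex.I / (r : ℕ)) with hζdef
    have hζ0 : ζ ≠ 0 := Complex.exp_ne_zero _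
    have h1 : ∑ ρ ∈ signedRoots r, ρ ^ s = ζ ^ s * ∑ ρ ∈ signedRoots r, ρ ^ s := by
      rw [Finset.mul_sum]
      symm
      refine Finset.sum_nbij' (fun ρ => ζ * ρ) (fun ρ => ζ⁻¹ * ρ) ?_ ?_ ?_ ?_ ?_
      · intro ρ hρ
        rw [mem_signedRoots] at hρ ⊢
        rw [mul_pow, hζ.pow_eq_one, one_mul, hρ]
      · intro ρ hρ
        rw [mem_signedRoots] at hρ ⊢
        rw [mul_pow, inv_pow, hζ.pow_eq_one, inv_one, one_mul, hρ]
      · intro ρ _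
        exact inv_mul_cancel_left₀ hζ0 ρ
      · intro ρ _
        exact mul_inv_cancel_left₀ hζ0 ρ
      · intro ρ _
        exact (mul_pow _ _ _).symm
    have h2 : ζ ^ s ≠ 1 := fun h3 => h ((hζ.pow_eq_one_iff_dvd s).1 h3)
    have h3 : (1 - ζ ^ s) * ∑ ρ ∈ signedRoots r, ρ ^ s = 0 := by
      rw [sub_mul, one_mul, ← h1, sub_self]
    exact (mul_eq_zero.1 h3).resolve_left (sub_ne_zero.2 (Ne.symm h2))

theorem norm_of_mem_signedRoots {r : ℕ+} {ρ : ℂ} (h : ρ ∈ signedRoots r) : ‖ρ‖ = 1 := by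
  refine Complex.norm_eq_one_of_pow_eq_one (n := (r : ℕ) * 2) ?_ (by have := r.pos; omega)
  rw [pow_mul, mem_signedRoots.1 h, ← pow_mul, mul_comm, pow_mul]
  norm_num

/-- By `hasSum_gammaCoeff` it is enough that the power sums attached to r at z be the sum over ρ of
those attached to 1 at ρz. -/
theorem ell_eq_sum (r : ℕ+) {z : ℂ} (hz : ‖z‖ < 1) :
    ell r z = ∑ ρ ∈ signedRoots r, ell 1 (ρ * z) := by
  have h1 := hasSum_gammaCoeff r hz
  have h2 : HasSum (fun s : ℕ+ => ∑ ρ ∈ signedRoots r, gammaCoeff s *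
      newton (fun y => if y = 1 then (ρ * z) ^ ((1 : ℕ+) : ℕ) else 0) s)
      (∑ ρ ∈ signedRoots r, ell 1 (ρ * z)) :=
    hasSum_sum fun ρ hρ => hasSum_gammaCoeff 1 (by
      rwa [norm_mul, norm_of_mem_signedRoots hρ, one_mul])
  refine h1.unique (h2.congr_fun fun s => ?_)
  rw [← Finset.mul_sum, newton_single]
  congr 1
  have h3 : ∀ ρ : ℂ, newton (fun y => if y = 1 then (ρ * z) ^ ((1 : ℕ+) : ℕ) else 0) s =
      -(-z) ^ (s : ℕ) * ρ ^ (s : ℕ) := fun ρ => by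
    rw [newton_single, PNat.one_coe, if_pos (one_dvd _), pow_one, Nat.div_one, Nat.cast_one, one_mul,
      ← mul_neg, mul_pow]
    ring
  simp only [h3]
  rw [← Finset.mul_sum, sum_pow_signedRoots]
  split_ifs with hd
  · obtain ⟨m, hm⟩ := hd
    rw [hm, Nat.mul_div_cancel_left _ r.pos]
    -- This is the reason for the sign (-1)^(r-1) in `signedRoots`.
    have e : -z ^ (r : ℕ) = (-z) ^ (r : ℕ) * (-1) ^ ((r : ℕ) - 1) := by
      obtain ⟨k, hk⟩ : ∃ k, (r : ℕ) = k + 1 := ⟨(r : ℕ) - 1, by have := r.pos; omega⟩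
      rw [hk, Nat.add_sub_cancel, neg_pow z, mul_right_comm, ← pow_add, show k + 1 + k = 2 * k + 1 by
        ring, pow_succ (-1 : ℂ), pow_mul (-1 : ℂ)]
      norm_num
    rw [e, mul_pow, ← pow_mul]
    ring
  · rw [mul_zero]

/-- The entire function that extends `exp ℓ_r`. -/
def eulerian (r : ℕ+) (z : ℂ) : ℂ := ∏ ρ ∈ signedRoots r, rGamma (ρ * z)

theorem differentiable_eulerian (r : ℕ+) : Differentiable ℂ (eulerian r) := by
  unfold eulerian
  exact Differentiable.fun_finsetProd fun ρ _ =>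
    differentiable_rGamma.comp (differentiable_id.const_mul ρ)

theorem invGammaY_eq_eulerian (r : ℕ+) (z : Metric.ball (0 : ℂ) 1) :
    invGammaY r z = eulerian r z := by
  have hz : ‖(z : ℂ)‖ < 1 := mem_ball_zero_iff.1 z.2
  rw [invGammaY, GammaY, add_sub_cancel_left, ← Complex.exp_neg, neg_neg, ell_eq_sum r hz,
    Complex.exp_sum, eulerian]
  refine Finset.prod_congr rfl fun ρ hρ => exp_ell_one ?_
  rwa [norm_mul, norm_of_mem_signedRoots hρ, one_mul]

/-! ### Tame functions and exponential sums with tame coefficients -/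

/-- The open half-plane around the direction `κ`. -/
def halfPlane (κ : ℂ) : Set ℂ := {z | 0 < (z / κ).re}

theorem mem_halfPlane {κ z : ℂ} : z ∈ halfPlane κ ↔ 0 < (z / κ).re := Iff.rfl

theorem ne_zero_of_mem_halfPlane {κ z : ℂ} (hz : z ∈ halfPlane κ) : z ≠ 0 := by
  rintro rfl
  simp [mem_halfPlane] at hz

theorem isOpen_halfPlane (κ : ℂ) : IsOpen (halfPlane κ) :=
  isOpen_lt continuous_const (Complex.continuous_re.comp (continuous_id.div_const κ))

theorem convex_halfPlane (κ : ℂ) : Convex ℝ (halfPlane κ) := by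
  have : halfPlane κ = (LinearMap.mulRight ℝ κ⁻¹) ⁻¹' {z | 0 < z.re} := by
    ext z
    simp [mem_halfPlane, div_eq_mul_inv]
  rw [this]
  exact (convex_halfSpace_re_gt 0).linear_preimage _

theorem norm_div_sub_div {κ κ' : ℂ} (hκ : ‖κ‖ = 1) (hκ' : ‖κ'‖ = 1) (z : ℂ) :
    ‖z / κ - z / κ'‖ = ‖z‖ * ‖κ' - κ‖ := by
  have h0 : κ ≠ 0 := norm_ne_zero_iff.1 (by rw [hκ]; exact one_ne_zero)
  have h0' : κ' ≠ 0 := norm_ne_zero_iff.1 (by rw [hκ']; exact one_ne_zero)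
  have : z / κ - z / κ' = z * (κ' - κ) / (κ * κ') := by
    field_simp
  rw [this, norm_div, norm_mul, norm_mul, hκ, hκ', mul_one, div_one]

theorem sector_of_near {κ κ' : ℂ} (hκ : ‖κ‖ = 1) (hκ' : ‖κ'‖ = 1) {c d : ℝ} {z : ℂ}
    (hz : -c * ‖z‖ ≤ (z / κ').re) (hd : c + ‖κ' - κ‖ ≤ d) : -d * ‖z‖ ≤ (z / κ).re := by
  have h1 := (Complex.abs_re_le_norm (z / κ - z / κ')).trans_eq (norm_div_sub_div hκ hκ' z)
  rw [Complex.sub_re] at h1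
  have h2 := neg_le_of_abs_le h1
  have h3 := mul_le_mul_of_nonneg_right hd (norm_nonneg z)
  nlinarith

theorem ray_mem_halfPlane {κ κ' : ℂ} (hκ : ‖κ‖ = 1) (hκ' : ‖κ'‖ = 1) (hd : ‖κ' - κ‖ < 1)
    {x : ℝ} (hx : 0 < x) : (x : ℂ) * κ' ∈ halfPlane κ := by
  have h0' : κ' ≠ 0 := norm_ne_zero_iff.1 (by rw [hκ']; exact one_ne_zero)
  have h1 := (Complex.abs_re_le_norm ((x : ℂ) * κ' / κ - (x : ℂ) * κ' / κ')).trans_eq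
    (norm_div_sub_div hκ hκ' _)
  rw [mul_div_cancel_right₀ _ h0', Complex.sub_re, Complex.ofReal_re, norm_mul, hκ', mul_one,
    Complex.norm_real, Real.norm_of_nonneg hx.le] at h1
  have h2 := neg_le_of_abs_le h1
  rw [mem_halfPlane]
  nlinarith

/-- Holomorphy and polynomial growth on a sector around the direction `κ` that is larger than a
half-plane. -/
def IsTame (κ : ℂ) (B : ℂ → ℂ) : Prop :=
  ∃ c > 0, ∃ C : ℝ, ∃ k : ℕ, ∀ z : ℂ, z ≠ 0 → -c * ‖z‖ ≤ (z / κ).re →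
    DifferentiableAt ℂ B z ∧ (1 ≤ ‖z‖ → ‖B z‖ ≤ C * ‖z‖ ^ k)

namespace IsTame

variable {κ : ℂ} {A B : ℂ → ℂ}

theorem const (κ a : ℂ) : IsTame κ fun _ => a :=
  ⟨1, one_pos, ‖a‖, 0, fun _ _ _ => ⟨differentiableAt_const _, fun _ => by simp⟩⟩

theorem sector_mono {c d : ℝ} (hcd : c ≤ d) {z : ℂ} (h : -c * ‖z‖ ≤ (z / κ).re) :
    -d * ‖z‖ ≤ (z / κ).re := by
  refine le_trans ?_ h
  nlinarith [norm_nonneg z]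

theorem add (hA : IsTame κ A) (hB : IsTame κ B) : IsTame κ (A + B) := by
  obtain ⟨c, hc, C, k, h⟩ := hA
  obtain ⟨c', hc', C', k', h'⟩ := hB
  refine ⟨min c c', lt_min hc hc', |C| + |C'|, k + k', fun z hz0 hz => ?_⟩
  obtain ⟨h1, h2⟩ := h z hz0 (sector_mono (min_le_left _ _) hz)
  obtain ⟨h1', h2'⟩ := h' z hz0 (sector_mono (min_le_right _ _) hz)
  refine ⟨h1.add h1', fun h3 => (norm_add_le _ _).trans ?_⟩
  rw [add_mul]
  refine add_le_add ((h2 h3).trans ?_) ((h2' h3).trans ?_)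
  · exact mul_le_mul (le_abs_self _) (pow_le_pow_right₀ h3 (by omega)) (by positivity)
      (abs_nonneg _)
  · exact mul_le_mul (le_abs_self _) (pow_le_pow_right₀ h3 (by omega)) (by positivity)
      (abs_nonneg _)

theorem mul (hA : IsTame κ A) (hB : IsTame κ B) : IsTame κ (A * B) := by
  obtain ⟨c, hc, C, k, h⟩ := hA
  obtain ⟨c', hc', C', k', h'⟩ := hB
  refine ⟨min c c', lt_min hc hc', C * C', k + k', fun z hz0 hz => ?_⟩
  obtain ⟨h1, h2⟩ := h z hz0 (sector_mono (min_le_left _ _) hz)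
  obtain ⟨h1', h2'⟩ := h' z hz0 (sector_mono (min_le_right _ _) hz)
  refine ⟨h1.mul h1', fun h3 => ?_⟩
  calc ‖(A * B) z‖ = ‖A z‖ * ‖B z‖ := norm_mul _ _
    _ ≤ (C * ‖z‖ ^ k) * (C' * ‖z‖ ^ k') :=
      mul_le_mul (h2 h3) (h2' h3) (norm_nonneg _) ((norm_nonneg _).trans (h2 h3))
    _ = _ := by ring

theorem zpow (κ : ℂ) (n : ℤ) : IsTame κ fun z => z ^ n := by
  refine ⟨1, one_pos, 1, n.toNat, fun z hz0 _ => ⟨differentiableAt_zpow.2 (Or.inl hz0), fun h => ?_⟩⟩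
  rw [norm_zpow, one_mul, ← zpow_natCast]
  exact zpow_le_zpow_right₀ h (Int.self_le_toNat n)

theorem congr (hA : IsTame κ A) (h : ∀ z, z ≠ 0 → A z = B z) : IsTame κ B := by
  obtain ⟨c, hc, C, k, hA⟩ := hA
  refine ⟨c, hc, C, k, fun z hz0 hz => ⟨(hA z hz0 hz).1.congr_of_eventuallyEq ?_, fun h3 => ?_⟩⟩
  · filter_upwards [isOpen_ne.mem_nhds hz0] with w hw using (h w hw).symm
  · rw [← h z hz0]
    exact (hA z hz0 hz).2 h3

theorem differentiableOn (hB : IsTame κ B) : DifferentiableOn ℂ B (halfPlane κ) := by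
  obtain ⟨c, hc, C, k, h⟩ := hB
  intro z hz
  refine (h z (ne_zero_of_mem_halfPlane hz) ?_).1.differentiableWithinAt
  have := mem_halfPlane.1 hz
  nlinarith [norm_nonneg z]

end IsTame

/-- Identity theorem: the ray lies in the half-plane and zeros accumulate at its point 2κ'. -/
theorem eqOn_zero_of_ray {κ κ' : ℂ} (hκ : ‖κ‖ = 1) (hκ' : ‖κ'‖ = 1) (hd : ‖κ' - κ‖ < 1) {B : ℂ → ℂ}
    (hB : DifferentiableOn ℂ B (halfPlane κ)) (h0 : ∀ x : ℝ, 1 ≤ x → B (x * κ') = 0) :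
    ∀ z ∈ halfPlane κ, B z = 0 := by
  have h0' : κ' ≠ 0 := norm_ne_zero_iff.1 (by rw [hκ']; exact one_ne_zero)
  have hfreq : ∃ᶠ z in 𝓝[≠] (((2 : ℝ) : ℂ) * κ'), B z = 0 := by
    have ht : Tendsto (fun x : ℝ => (x : ℂ) * κ') (𝓝[>] 2) (𝓝[≠] (((2 : ℝ) : ℂ) * κ')) := by
      refine tendsto_nhdsWithin_iff.2 ⟨?_, ?_⟩
      · exact ((Complex.continuous_ofReal.mul continuous_const).tendsto _).mono_left
          nhdsWithin_le_nhds
      · filter_upwards [self_mem_nhdsWithin] with x hx h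
        have := mul_right_cancel₀ h0' h
        rw [Complex.ofReal_inj] at this
        exact absurd this (ne_of_gt hx)
    refine ht.frequently (Eventually.frequently ?_)
    filter_upwards [self_mem_nhdsWithin] with x hx
    exact h0 x (by have : (2 : ℝ) < x := hx; linarith)
  exact (hB.analyticOnNhd (isOpen_halfPlane κ)).eqOn_zero_of_preconnected_of_frequently_eq_zero
    (convex_halfPlane κ).isPreconnected (ray_mem_halfPlane hκ hκ' hd two_pos) hfreq

/-- A sector of opening pπ with p slightly above 1 still fits in the given one; the room gained over
a half-plane drives the Phragmén–Lindelöf argument. -/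
theorem exists_cos_ge {c : ℝ} (hc : 0 < c) :
    ∃ p : ℝ, 1 < p ∧ p < 2 ∧ -c ≤ Real.cos (p * (Real.pi / 2)) := by
  have h1 : Tendsto (fun p : ℝ => Real.cos (p * (Real.pi / 2))) (𝓝 1) (𝓝 0) := by
    have : Continuous fun p : ℝ => Real.cos (p * (Real.pi / 2)) := by fun_prop
    simpa using this.tendsto 1
  have h2 : ∀ᶠ p : ℝ in 𝓝[>] 1, -c < Real.cos (p * (Real.pi / 2)) :=
    nhdsWithin_le_nhds (h1.eventually_const_lt (by linarith))
  have h3 : ∀ᶠ p : ℝ in 𝓝[>] 1, p < 2 := nhdsWithin_le_nhds (eventually_lt_nhds (by norm_num))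
  obtain ⟨p, ⟨hp, hp3⟩, hp1⟩ := ((h2.and h3).and self_mem_nhdsWithin).exists
  exact ⟨p, hp1, hp3, hp.le⟩

/-- A function of polynomial growth on a sector larger than a half-plane that decays exponentially
on the axis of the sector vanishes on that axis. -/
theorem eq_zero_on_ray_of_exponential_decay {κ : ℂ} (hκ : ‖κ‖ = 1) {B : ℂ → ℂ} {c C : ℝ} {k : ℕ}
    (hc : 0 < c) (hB : ∀ z : ℂ, 1 ≤ ‖z‖ → -c * ‖z‖ ≤ (z / κ).re →
      DifferentiableAt ℂ B z ∧ ‖B z‖ ≤ C * ‖z‖ ^ k) {δ D : ℝ} (hδ : 0 < δ)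
    (hdec : ∀ x : ℝ, 1 ≤ x → ‖B (x * κ)‖ ≤ D * Real.exp (-δ * x)) :
    ∀ x : ℝ, 1 ≤ x → B (x * κ) = 0 := by
  obtain ⟨p, hp1, hp2, hp⟩ := exists_cos_ge hc
  have h0 : κ ≠ 0 := norm_ne_zero_iff.1 (by rw [hκ]; exact one_ne_zero)
  -- φ(w) = (1+w)^p carries the right half-plane into the sector. Exponential decay in φ becomes
  -- decay exp(-δ(1+x)^p) with p > 1, which is superexponential, and division by (1+w)^(2k) makes f
  -- bounded because p < 2.
  set φ : ℂ → ℂ := fun w => Complex.exp (p * Complex.log (1 + w)) with hφ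
  set f : ℂ → ℂ := fun w => B (φ w * κ) * ((1 + w) ^ (2 * k))⁻¹ with hf
  have hre : ∀ w : ℂ, 0 ≤ w.re → 1 ≤ ‖1 + w‖ := fun w hw => by
    refine le_trans ?_ (Complex.re_le_norm _)
    simpa using hw
  have hslit : ∀ w : ℂ, 0 ≤ w.re → 1 + w ∈ Complex.slitPlane := fun w hw => by
    refine Or.inl ?_
    rw [Complex.add_re, Complex.one_re]
    linarith
  have hφn : ∀ w, ‖φ w‖ = Real.exp (p * Real.log ‖1 + w‖) := fun w => by
    rw [hφ, Complex.norm_exp, Complex.re_ofReal_mul, Complex.log_re]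
  have hφ1 : ∀ w : ℂ, 0 ≤ w.re → 1 ≤ ‖φ w‖ := fun w hw => by
    rw [hφn]
    exact Real.one_le_exp (mul_nonneg (by linarith) (Real.log_nonneg (hre w hw)))
  have hφ2 : ∀ w : ℂ, 0 ≤ w.re → ‖φ w‖ ≤ ‖1 + w‖ ^ 2 := fun w hw => by
    have h1 : 0 < ‖1 + w‖ := by linarith [hre w hw]
    rw [hφn]
    calc Real.exp (p * Real.log ‖1 + w‖) ≤ Real.exp (2 * Real.log ‖1 + w‖) :=
          Real.exp_le_exp.2 (mul_le_mul_of_nonneg_right hp2.le (Real.log_nonneg (hre w hw)))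
      _ = ‖1 + w‖ ^ 2 := by
        rw [two_mul, Real.exp_add, Real.exp_log h1, sq]
  have hφs : ∀ w : ℂ, 0 ≤ w.re → -c * ‖φ w * κ‖ ≤ (φ w * κ / κ).re := fun w hw => by
    rw [mul_div_cancel_right₀ _ h0, norm_mul, hκ, mul_one, hφn, hφ, Complex.exp_re,
      Complex.re_ofReal_mul, Complex.im_ofReal_mul, Complex.log_re, Complex.log_im, mul_comm]
    refine mul_le_mul_of_nonneg_left (hp.trans ?_) (Real.exp_pos _).le
    have h1 : |Complex.arg (1 + w)| ≤ Real.pi / 2 := by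
      rw [Complex.abs_arg_le_pi_div_two_iff, Complex.add_re, Complex.one_re]
      linarith
    rw [← Real.cos_abs (p * Complex.arg _), abs_mul, abs_of_pos (by linarith : 0 < p)]
    refine Real.cos_le_cos_of_nonneg_of_le_pi (by positivity) ?_ ?_
    · nlinarith [Real.pi_pos]
    · exact mul_le_mul_of_nonneg_left h1 (by linarith)
  have hval : ∀ w : ℂ, 0 ≤ w.re → DifferentiableAt ℂ B (φ w * κ) ∧
      ‖B (φ w * κ)‖ ≤ C * ‖φ w * κ‖ ^ k := fun w hw =>
    hB _ (by rw [norm_mul, hκ, mul_one]; exact hφ1 w hw) (hφs w hw)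
  have hfd : ∀ w : ℂ, 0 ≤ w.re → DifferentiableAt ℂ f w := fun w hw => by
    have hne : 1 + w ≠ 0 := Complex.slitPlane_ne_zero (hslit w hw)
    have h1 : DifferentiableAt ℂ φ w := by
      refine DifferentiableAt.cexp (DifferentiableAt.const_mul ?_ _)
      exact ((differentiableAt_const _).add differentiableAt_id).clog (hslit w hw)
    have h2 : DifferentiableAt ℂ (fun w => φ w * κ) w := h1.mul_const κ
    have h3 : DifferentiableAt ℂ (fun w => B (φ w * κ)) w :=
      DifferentiableAt.comp w (hval w hw).1 h2
    refine h3.mul (DifferentiableAt.inv ?_ (pow_ne_zero _ hne))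
    exact ((differentiableAt_const _).add differentiableAt_id).pow _
  have hC0 : 0 ≤ C := by
    have := (norm_nonneg _).trans (hval 0 le_rfl).2
    have h2 : 0 < ‖φ 0 * κ‖ ^ k := by
      refine pow_pos ?_ _
      rw [norm_mul, hκ, mul_one]
      linarith [hφ1 0 le_rfl]
    exact nonneg_of_mul_nonneg_left this h2
  have hfb : ∀ w : ℂ, 0 ≤ w.re → ‖f w‖ ≤ C := fun w hw => by
    have h1 : 0 < ‖1 + w‖ := by linarith [hre w hw]
    rw [hf, norm_mul, norm_inv, norm_pow, ← div_eq_mul_inv, div_le_iff₀ (by positivity)]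
    refine (hval w hw).2.trans ?_
    rw [norm_mul, hκ, mul_one, pow_mul]
    exact mul_le_mul_of_nonneg_left (pow_le_pow_left₀ (norm_nonneg _) (hφ2 w hw) _) hC0
  have hφr : ∀ x : ℝ, 0 ≤ x → φ x = ((1 + x) ^ p : ℝ) := fun x hx => by
    rw [hφ, Real.rpow_def_of_pos (by linarith)]
    push_cast
    rw [Complex.ofReal_log (by linarith), mul_comm]
    push_cast
    rfl
  have hzero := PhragmenLindelof.eq_zero_on_right_half_plane_of_superexponential_decay (f := f)
    (DifferentiableOn.diffContOnCl fun w hw => by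
      rw [Complex.closure_setOfPred_lt_re] at hw
      exact (hfd w hw).differentiableWithinAt)
    ⟨0, two_pos, 0, by
      refine Asymptotics.IsBigO.of_bound C ?_
      filter_upwards [mem_inf_of_right (mem_principal_self _)] with w hw
      have hw' : 0 < w.re := hw
      simpa using hfb w hw'.le⟩
    (fun n => by
      have hlim : Tendsto (fun x : ℝ => |D| * Real.exp (x * (n - δ * (1 + x) ^ (p - 1)))) atTop
          (𝓝 0) := by
        rw [← mul_zero |D|]
        refine Tendsto.const_mul _ (Real.tendsto_exp_atBot.comp ?_)
        refine tendsto_id.atTop_mul_atBot₀ ?_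
        refine tendsto_atBot_add_const_left _ (n : ℝ) ?_ |>.congr fun x => (sub_eq_add_neg _ _).symm
        refine tendsto_neg_atTop_atBot.comp (Tendsto.const_mul_atTop hδ ?_)
        exact (tendsto_rpow_atTop (by linarith)).comp (tendsto_atTop_add_const_left _ _ tendsto_id)
      refine squeeze_zero' (Eventually.of_forall fun x => by positivity) ?_ hlim
      filter_upwards [eventually_ge_atTop (0 : ℝ)] with x hx
      have h1 : (1 : ℝ) ≤ (1 + x) ^ p := Real.one_le_rpow (by linarith) (by linarith)
      have h2 := hdec _ h1
      have h3 : ‖f x‖ ≤ |D| * Real.exp (-δ * (1 + x) ^ p) := by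
        rw [hf, norm_mul, norm_inv, norm_pow, hφr x hx]
        refine (mul_le_of_le_one_right (norm_nonneg _) ?_).trans (h2.trans ?_)
        · refine inv_le_one_of_one_le₀ (one_le_pow₀ (hre _ (by simpa using hx)))
        · exact mul_le_mul_of_nonneg_right (le_abs_self D) (Real.exp_pos _).le
      have h4 : (1 + x) ^ p = (1 + x) * (1 + x) ^ (p - 1) := by
        rw [Real.rpow_sub_one (by linarith), mul_div_cancel₀ _ (by linarith)]
      calc Real.exp x ^ n * ‖f x‖ ≤ Real.exp x ^ n * (|D| * Real.exp (-δ * (1 + x) ^ p)) :=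
            mul_le_mul_of_nonneg_left h3 (by positivity)
        _ = |D| * Real.exp (n * x + -δ * (1 + x) ^ p) := by
          rw [Real.exp_add, Real.exp_nat_mul]; ring
        _ ≤ _ := by
          refine mul_le_mul_of_nonneg_left (Real.exp_le_exp.2 ?_) (abs_nonneg _)
          rw [h4]
          have h5 : 0 ≤ (1 + x) ^ (p - 1) := Real.rpow_nonneg (by linarith) _
          nlinarith [mul_nonneg hδ.le h5])
    ⟨C, fun x => hfb _ (by simp)⟩
  intro x hx
  have hx0 : 0 < x := by linarith
  have hy : (1 : ℝ) ≤ x ^ p⁻¹ := Real.one_le_rpow hx (inv_nonneg.2 (by linarith))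
  have h1 : f ((x ^ p⁻¹ - 1 : ℝ) : ℂ) = 0 := hzero (by
    rw [Set.mem_ofPred_eq, Complex.ofReal_re]; linarith)
  have h2 : φ ((x ^ p⁻¹ - 1 : ℝ) : ℂ) = x := by
    rw [hφr _ (by linarith), add_sub_cancel, Real.rpow_inv_rpow hx0.le (by linarith)]
  rw [hf] at h1
  simp only [h2] at h1
  refine (mul_eq_zero.1 h1).resolve_right (inv_ne_zero (pow_ne_zero _ ?_))
  rw [← Complex.ofReal_one, ← Complex.ofReal_add, add_sub_cancel]
  exact Complex.ofReal_ne_zero.2 (by linarith)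

/-! ### Uniqueness of exponential sums with tame coefficients -/

theorem eventually_re_mul_exp_ne_zero {d : ℂ} (hd : d ≠ 0) :
    ∀ᶠ θ : ℝ in 𝓝[>] 0, (d * Complex.exp (θ * Complex.I)).re ≠ 0 := by
  have hre : ∀ θ : ℝ, (d * Complex.exp (θ * Complex.I)).re =
      d.re * Real.cos θ - d.im * Real.sin θ := fun θ => by
    rw [Complex.mul_re, Complex.exp_ofReal_mul_I_re, Complex.exp_ofReal_mul_I_im]
  simp only [hre]
  by_cases h : d.re = 0
  · have him : d.im ≠ 0 := fun h' => hd (Complex.ext h h')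
    filter_upwards [Ioo_mem_nhdsGT Real.pi_pos] with θ hθ
    rw [h, zero_mul, zero_sub]
    exact neg_ne_zero.2 (mul_ne_zero him (Real.sin_pos_of_pos_of_lt_pi hθ.1 hθ.2).ne')
  · have hc : Continuous fun θ : ℝ => d.re * Real.cos θ - d.im * Real.sin θ := by fun_prop
    have := hc.continuousAt.eventually_ne (x := (0 : ℝ)) (y := (0 : ℝ)) (by simpa using h)
    exact nhdsWithin_le_nhds this

theorem tendsto_rotate (κ : ℂ) :
    Tendsto (fun θ : ℝ => ‖κ * Complex.exp (θ * Complex.I) - κ‖) (𝓝 0) (𝓝 0) := by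
  have hc : Continuous fun θ : ℝ => ‖κ * Complex.exp (θ * Complex.I) - κ‖ := by fun_prop
  simpa using hc.tendsto 0

/-- Exponential decay of a function on `[1, ∞)`. -/
def ExpDecay (h : ℝ → ℂ) : Prop :=
  ∃ δ > 0, ∃ D : ℝ, ∀ x : ℝ, 1 ≤ x → ‖h x‖ ≤ D * Real.exp (-δ * x)

theorem ExpDecay.add {f g : ℝ → ℂ} (hf : ExpDecay f) (hg : ExpDecay g) :
    ExpDecay fun x => f x + g x := by
  obtain ⟨δ, hδ, D, h⟩ := hf
  obtain ⟨δ', hδ', D', h'⟩ := hg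
  refine ⟨min δ δ', lt_min hδ hδ', |D| + |D'|, fun x hx => (norm_add_le _ _).trans ?_⟩
  rw [add_mul]
  refine add_le_add ((h x hx).trans ?_) ((h' x hx).trans ?_)
  · refine mul_le_mul (le_abs_self _) (Real.exp_le_exp.2 ?_) (Real.exp_pos _).le (abs_nonneg _)
    nlinarith [min_le_left δ δ']
  · refine mul_le_mul (le_abs_self _) (Real.exp_le_exp.2 ?_) (Real.exp_pos _).le (abs_nonneg _)
    nlinarith [min_le_right δ δ']

theorem ExpDecay.sum {ι : Type*} (s : Finset ι) {f : ι → ℝ → ℂ} (hf : ∀ i ∈ s, ExpDecay (f i)) :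
    ExpDecay fun x => ∑ i ∈ s, f i x := by
  classical
  induction s using Finset.induction_on with
  | empty => exact ⟨1, one_pos, 0, fun x _ => by simp⟩
  | insert a s ha ih =>
    simp only [Finset.sum_insert ha]
    exact (hf a (Finset.mem_insert_self _ _)).add (ih fun i hi => hf i (Finset.mem_insert_of_mem hi))

theorem pow_le_mul_exp {δ : ℝ} (hδ : 0 < δ) (k : ℕ) {x : ℝ} (hx : 0 ≤ x) :
    x ^ k ≤ (Nat.factorial k / δ ^ k) * Real.exp (δ * x) := by
  have h := Real.pow_div_factorial_le_exp (δ * x) (by positivity) k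
  rw [div_le_iff₀ (by positivity), mul_pow] at h
  rw [div_mul_eq_mul_div, le_div_iff₀ (by positivity)]
  linarith

theorem expDecay_of_poly {f : ℝ → ℂ} {δ C : ℝ} {k : ℕ} (hδ : 0 < δ)
    (h : ∀ x : ℝ, 1 ≤ x → ‖f x‖ ≤ C * x ^ k * Real.exp (-δ * x)) : ExpDecay f := by
  refine ⟨δ / 2, by positivity, |C| * (Nat.factorial k / (δ / 2) ^ k), fun x hx => (h x hx).trans ?_⟩
  have h1 := pow_le_mul_exp (half_pos hδ) k (by linarith : 0 ≤ x)
  have h2 : -(δ / 2) * x = δ / 2 * x + -δ * x := by ring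
  rw [h2, Real.exp_add, ← mul_assoc]
  refine mul_le_mul_of_nonneg_right ?_ (Real.exp_pos _).le
  rw [mul_assoc]
  exact mul_le_mul (le_abs_self C) h1 (by positivity) (abs_nonneg _)

/-- `f` is smaller than any exponential, on all rays close to the direction `κ`. -/
def SuperDecay (κ : ℂ) (f : ℂ → ℂ) : Prop :=
  ∃ ε > 0, ∀ κ' : ℂ, ‖κ'‖ = 1 → ‖κ' - κ‖ < ε → ∀ M : ℝ, ∃ D : ℝ, ∀ x : ℝ, 1 ≤ x →
    ‖f (x * κ')‖ ≤ D * Real.exp (-M * x)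

/-- After a small rotation of κ the exponents have distinct real parts on the ray. Dividing by the
dominant exponential shows that its coefficient decays exponentially there, so it vanishes by
`eq_zero_on_ray_of_exponential_decay` and the identity theorem. Removing that term preserves the
hypotheses. -/
theorem IsTame.eq_zero_of_superDecay {κ : ℂ} (hκ : ‖κ‖ = 1) (B : ℂ → ℂ → ℂ) (F : Finset ℂ)
    (hB : ∀ e ∈ F, IsTame κ (B e))
    (hdec : SuperDecay κ fun z => ∑ e ∈ F, Complex.exp (e * z) * B e z) :
    ∀ e ∈ F, ∀ z ∈ halfPlane κ, B e z = 0 := by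
  classical
  induction F using Finset.strongInduction with
  | H F ih =>
    rcases F.eq_empty_or_nonempty with rfl | hne
    · simp
    obtain ⟨ε, hε, hdec⟩ := hdec
    have hB' : ∀ e, ∃ c > 0, ∃ C : ℝ, ∃ k : ℕ, e ∈ F → ∀ z : ℂ, z ≠ 0 → -c * ‖z‖ ≤ (z / κ).re →
        DifferentiableAt ℂ (B e) z ∧ (1 ≤ ‖z‖ → ‖B e z‖ ≤ C * ‖z‖ ^ k) := fun e => by
      by_cases he : e ∈ F
      · obtain ⟨c, hc, C, k, h⟩ := hB e he
        exact ⟨c, hc, C, k, fun _ => h⟩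
      · exact ⟨1, one_pos, 0, 0, fun h => absurd h he⟩
    choose c hc C k hb using hB'
    -- The angle must separate the exponents, stay inside every sector of tameness so that part of
    -- it remains beyond the half-plane of κ', and keep the ray where the decay is known.
    have hev : ∀ᶠ θ : ℝ in 𝓝[>] 0,
        (∀ e ∈ F, ∀ e' ∈ F, e ≠ e' → ((e - e') * κ * Complex.exp (θ * Complex.I)).re ≠ 0) ∧
        (∀ e ∈ F, ‖κ * Complex.exp (θ * Complex.I) - κ‖ < c e) ∧
        ‖κ * Complex.exp (θ * Complex.I) - κ‖ < min ε 1 := by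
      have h0 : κ ≠ 0 := norm_ne_zero_iff.1 (by rw [hκ]; exact one_ne_zero)
      refine Eventually.and ?_ (Eventually.and ?_ ?_)
      · rw [eventually_all_finset]
        intro e _
        rw [eventually_all_finset]
        intro e' _
        by_cases h : e = e'
        · exact Eventually.of_forall fun _ h' => absurd h h'
        · filter_upwards [eventually_re_mul_exp_ne_zero (mul_ne_zero (sub_ne_zero.2 h) h0)] with θ hθ _
            using hθ
      · rw [eventually_all_finset]
        exact fun e _ => nhdsWithin_le_nhds ((tendsto_rotate κ).eventually_lt_const (hc e))
      · exact nhdsWithin_le_nhds ((tendsto_rotate κ).eventually_lt_const (lt_min hε one_pos))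
    obtain ⟨θ, hdist, hcc, hεθ⟩ := hev.exists
    set κ' := κ * Complex.exp (θ * Complex.I) with hκdef
    have hκ' : ‖κ'‖ = 1 := by rw [hκdef, norm_mul, hκ, Complex.norm_exp_ofReal_mul_I, one_mul]
    obtain ⟨e₀, he₀, hmax⟩ := F.exists_max_image (fun e => (e * κ').re) hne
    have hlt : ∀ e ∈ F.erase e₀, (e * κ').re < (e₀ * κ').re := fun e he => by
      refine lt_of_le_of_ne (hmax e (Finset.mem_of_mem_erase he)) fun h => ?_
      refine hdist e (Finset.mem_of_mem_erase he) e₀ he₀ (Finset.ne_of_mem_erase he) ?_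
      rw [mul_assoc, sub_mul, Complex.sub_re, h, sub_self]
    obtain ⟨D, hD⟩ := hdec κ' hκ' (hεθ.trans_le (min_le_left _ _)) (1 - (e₀ * κ').re)
    have hexp : ∀ (e : ℂ) (x : ℝ), ‖Complex.exp (e * (x * κ'))‖ = Real.exp ((e * κ').re * x) := by
      intro e x
      rw [Complex.norm_exp, mul_left_comm, Complex.re_ofReal_mul, mul_comm]
    have hdecay : ExpDecay fun x => B e₀ (x * κ') := by
      have h1 : ExpDecay fun x : ℝ => Complex.exp (-e₀ * (x * κ')) *
          ∑ e ∈ F, Complex.exp (e * (x * κ')) * B e (x * κ') := by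
        refine ⟨1, one_pos, D, fun x hx => ?_⟩
        rw [norm_mul, hexp]
        refine (mul_le_mul_of_nonneg_left (hD x hx) (Real.exp_pos _).le).trans_eq ?_
        rw [mul_left_comm, ← Real.exp_add, neg_mul e₀, Complex.neg_re]
        congr 2
        ring
      have h2 : ExpDecay fun x : ℝ => ∑ e ∈ F.erase e₀,
          -(Complex.exp (-e₀ * (x * κ')) * (Complex.exp (e * (x * κ')) * B e (x * κ'))) := by
        refine ExpDecay.sum _ fun e he => ?_
        have heF := Finset.mem_of_mem_erase he
        refine expDecay_of_poly (C := C e) (k := k e) (sub_pos.2 (hlt e he)) fun x hx => ?_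
        have hx0 : 0 < x := by linarith
        have hnorm : ‖(x : ℂ) * κ'‖ = x := by
          rw [norm_mul, hκ', mul_one, Complex.norm_real, Real.norm_of_nonneg hx0.le]
        have hray := ray_mem_halfPlane hκ hκ' (hεθ.trans_le (min_le_right _ _)) hx0
        have h3 := (hb e heF _ (ne_zero_of_mem_halfPlane hray)
          (by
            have h4 := mem_halfPlane.1 hray
            have h5 := mul_nonneg (hc e).le (norm_nonneg ((x : ℂ) * κ'))
            linarith)).2 (by rw [hnorm]; exact hx)
        rw [hnorm] at h3
        rw [norm_neg, norm_mul, norm_mul, hexp, hexp]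
        calc Real.exp ((-e₀ * κ').re * x) * (Real.exp ((e * κ').re * x) * ‖B e (x * κ')‖)
            ≤ Real.exp ((-e₀ * κ').re * x) * (Real.exp ((e * κ').re * x) * (C e * x ^ k e)) := by
              gcongr
          _ = C e * x ^ k e * Real.exp (-((e₀ * κ').re - (e * κ').re) * x) := by
            rw [← mul_assoc, ← Real.exp_add, mul_comm, neg_mul e₀, Complex.neg_re]
            congr 2
            ring
      have h3 : (fun x : ℝ => B e₀ (x * κ')) = fun x : ℝ => Complex.exp (-e₀ * (x * κ')) *
          ∑ e ∈ F, Complex.exp (e * (x * κ')) * B e (x * κ') + ∑ e ∈ F.erase e₀,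
          -(Complex.exp (-e₀ * (x * κ')) * (Complex.exp (e * (x * κ')) * B e (x * κ'))) := by
        funext x
        rw [Finset.sum_neg_distrib, ← Finset.mul_sum, ← sub_eq_add_neg, ← mul_sub,
          Finset.sum_erase_eq_sub he₀, sub_sub_cancel, ← mul_assoc (Complex.exp _) (Complex.exp _), ← Complex.exp_add, neg_mul,
          neg_add_cancel, Complex.exp_zero, one_mul]
      rw [h3]
      exact h1.add h2
    obtain ⟨δ, hδ, D', hD'⟩ := hdecay
    have hray0 := eq_zero_on_ray_of_exponential_decay hκ' (B := B e₀) (k := k e₀) (C := C e₀)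
      (sub_pos.2 (hcc e₀ he₀)) (fun z hz hs => by
        obtain ⟨h1, h2⟩ := hb e₀ he₀ z (norm_pos_iff.1 (by linarith))
          (sector_of_near hκ hκ' hs (by rw [sub_add_cancel]))
        exact ⟨h1, h2 hz⟩) hδ hD'
    have hzero : ∀ z ∈ halfPlane κ, B e₀ z = 0 :=
      eqOn_zero_of_ray hκ hκ' (hεθ.trans_le (min_le_right _ _)) (hB e₀ he₀).differentiableOn hray0
    have hrest := ih (F.erase e₀) (Finset.erase_ssubset he₀)
      (fun e he => hB e (Finset.mem_of_mem_erase he))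
      ⟨min ε 1, lt_min hε one_pos, fun κ'' hκ'' hd M => by
        obtain ⟨D, hD⟩ := hdec κ'' hκ'' (hd.trans_le (min_le_left _ _)) M
        refine ⟨D, fun x hx => le_of_eq_of_le ?_ (hD x hx)⟩
        change ‖∑ e ∈ F.erase e₀, Complex.exp (e * (x * κ'')) * B e (x * κ'')‖ =
          ‖∑ e ∈ F, Complex.exp (e * (x * κ'')) * B e (x * κ'')‖
        rw [← Finset.add_sum_erase F _ he₀, hzero _ (ray_mem_halfPlane hκ hκ''
          (hd.trans_le (min_le_right _ _)) (by linarith)), mul_zero, zero_add]⟩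
    intro e he
    by_cases h : e = e₀
    · rw [h]; exact hzero
    · exact hrest e (Finset.mem_erase.2 ⟨h, he⟩)

/-- The algebra of tame functions. -/
def tame (κ : ℂ) : Subalgebra ℂ (ℂ → ℂ) where
  carrier := {B | IsTame κ B}
  mul_mem' := IsTame.mul
  add_mem' := IsTame.add
  algebraMap_mem' a := IsTame.const κ a

/-- The exponential functions `z ↦ exp (e z)`, as a homomorphism in `e`. -/
def expChar : Multiplicative ℂ →* (ℂ → ℂ) where
  toFun e z := Complex.exp (Multiplicative.toAdd e * z)
  map_one' := by funext z; simp
  map_mul' a b := by funext z; simp [add_mul, Complex.exp_add]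

/-- Exponential sums with tame coefficients, as functions. -/
def expSum (κ : ℂ) : AddMonoidAlgebra (tame κ) ℂ →+* (ℂ → ℂ) :=
  AddMonoidAlgebra.liftNCRingHom (tame κ).val.toRingHom expChar fun _ _ => Commute.all _ _

theorem expSum_single (κ e : ℂ) (B : tame κ) (z : ℂ) :
    expSum κ (AddMonoidAlgebra.single e B) z = Complex.exp (e * z) * (B : ℂ → ℂ) z := by
  have : expSum κ (AddMonoidAlgebra.single e B) = (B : ℂ → ℂ) * expChar (Multiplicative.ofAdd e) :=
    AddMonoidAlgebra.liftNC_single _ _ _ _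
  rw [this]
  exact mul_comm _ _

theorem expSum_apply (κ : ℂ) (Q : AddMonoidAlgebra (tame κ) ℂ) (z : ℂ) :
    expSum κ Q z = ∑ e ∈ Q.coeff.support, Complex.exp (e * z) * (Q.coeff e : ℂ → ℂ) z := by
  conv_lhs => rw [← AddMonoidAlgebra.sum_coeff_single Q, Finsupp.sum, map_sum, Finset.sum_apply]
  exact Finset.sum_congr rfl fun e _ => expSum_single _ _ _ _

theorem coeff_eq_zero_of_superDecay {κ : ℂ} (hκ : ‖κ‖ = 1) (Q : AddMonoidAlgebra (tame κ) ℂ)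
    (h : SuperDecay κ (expSum κ Q)) (e : ℂ) : ∀ z ∈ halfPlane κ, (Q.coeff e : ℂ → ℂ) z = 0 := by
  by_cases he : e ∈ Q.coeff.support
  · refine IsTame.eq_zero_of_superDecay hκ (fun e => (Q.coeff e : ℂ → ℂ)) Q.coeff.support
      (fun e _ => (Q.coeff e).2) ?_ e he
    have : expSum κ Q = fun z => ∑ e ∈ Q.coeff.support,
      Complex.exp (e * z) * (Q.coeff e : ℂ → ℂ) z := funext (expSum_apply κ Q)
    rwa [this] at h
  · intro z _
    rw [Finsupp.notMem_support_iff.1 he]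
    rfl

theorem superDecay_of_eqOn_zero {κ : ℂ} (hκ : ‖κ‖ = 1) {f : ℂ → ℂ} (h : ∀ z ∈ halfPlane κ, f z = 0) :
    SuperDecay κ f := by
  refine ⟨1, one_pos, fun κ' hκ' hd M => ⟨0, fun x hx => ?_⟩⟩
  rw [h _ (ray_mem_halfPlane hκ hκ' hd (by linarith)), norm_zero, zero_mul]

/-! ### Asymptotics of products of reciprocal Gamma functions along a direction -/

/-- Distance to the negative axis: | |y| + a y | = | ā|y| + y | ≥ (Re a - c)|y|. Squaring turns this
into a lower bound for Re(a y). -/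
theorem sector_unit_mul {a y : ℂ} (ha : ‖a‖ = 1) {c : ℝ} (hca : c < a.re)
    (hy : -c * ‖y‖ ≤ y.re) : -(1 - (a.re - c) ^ 2 / 2) * ‖a * y‖ ≤ (a * y).re := by
  rw [norm_mul, ha, one_mul]
  rcases eq_or_ne y 0 with rfl | hy0
  · simp
  have hr : 0 < ‖y‖ := norm_pos_iff.2 hy0
  have hconj : (starRingEnd ℂ) a * a = 1 := by
    rw [mul_comm, Complex.mul_conj, Complex.normSq_eq_norm_sq, ha]
    norm_num
  have h1 : (a.re - c) * ‖y‖ ≤ ‖(‖y‖ : ℂ) + a * y‖ := by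
    have h2 : ‖(‖y‖ : ℂ) + a * y‖ = ‖(starRingEnd ℂ) a * ‖y‖ + y‖ := by
      have : (starRingEnd ℂ) a * ‖y‖ + y = (starRingEnd ℂ) a * (‖y‖ + a * y) := by
        rw [mul_add, ← mul_assoc, hconj, one_mul]
      rw [this, norm_mul, Complex.norm_conj, ha, one_mul]
    rw [h2]
    refine le_trans ?_ (Complex.re_le_norm _)
    rw [Complex.add_re, Complex.re_mul_ofReal, Complex.conj_re]
    linarith
  have h3 : ‖(‖y‖ : ℂ) + a * y‖ ^ 2 = 2 * ‖y‖ ^ 2 + 2 * ‖y‖ * (a * y).re := by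
    have h4 : ‖a * y‖ ^ 2 = ‖y‖ ^ 2 := by rw [norm_mul, ha, one_mul]
    rw [← Complex.normSq_eq_norm_sq, Complex.normSq_add, Complex.normSq_ofReal,
      Complex.normSq_eq_norm_sq, h4, Complex.re_ofReal_mul, Complex.conj_re]
    ring
  have h5 := pow_le_pow_left₀ (mul_nonneg (by linarith) hr.le) h1 2
  rw [h3] at h5
  have h6 : 0 ≤ 2 * ‖y‖ * ((a * y).re + (1 - (a.re - c) ^ 2 / 2) * ‖y‖) := by
    nlinarith
  have h7 := nonneg_of_mul_nonneg_right h6 (by positivity)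
  linarith

/-- The hypotheses bound the two arguments so that their absolute values add up to less than π, and
no branch is crossed. -/
theorem log_unit_mul {a y : ℂ} (ha : ‖a‖ = 1) {c : ℝ} (hca : c < a.re) (hy0 : y ≠ 0)
    (hy : -c * ‖y‖ ≤ y.re) : Complex.log (a * y) = Complex.log a + Complex.log y := by
  have ha0 : a ≠ 0 := norm_ne_zero_iff.1 (by rw [ha]; exact one_ne_zero)
  have hr : 0 < ‖y‖ := norm_pos_iff.2 hy0
  have h : |Complex.arg a| + |Complex.arg y| < Real.pi := by
    by_contra! h
    have h1 : Real.cos |Complex.arg y| ≤ Real.cos (Real.pi - |Complex.arg a|) :=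
      Real.cos_le_cos_of_nonneg_of_le_pi (by linarith [Complex.abs_arg_le_pi a])
        (Complex.abs_arg_le_pi y) (by linarith)
    rw [Real.cos_pi_sub, Real.cos_abs, Real.cos_abs, Complex.cos_arg ha0, Complex.cos_arg hy0, ha,
      div_one, div_le_iff₀ hr] at h1
    nlinarith
  refine Complex.log_mul ha0 hy0 ⟨?_, ?_⟩
  · linarith [neg_abs_le (Complex.arg a), neg_abs_le (Complex.arg y)]
  · linarith [le_abs_self (Complex.arg a), le_abs_self (Complex.arg y)]

theorem rGamma_ne_zero {u : ℂ} (hu : u ∈ Complex.slitPlane) : rGamma u ≠ 0 := by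
  refine inv_ne_zero (Complex.Gamma_ne_zero fun m h => ?_)
  have h1 := Stirling.add_mem_slitPlane hu (zero_le_one (α := ℝ))
  rw [Complex.ofReal_one, add_comm, h] at h1
  rcases h1 with h1 | h1
  · simp only [Complex.neg_re, Complex.natCast_re] at h1
    linarith [(Nat.cast_nonneg m : (0 : ℝ) ≤ m)]
  · simp at h1

theorem unit_mul_mem_slitPlane {a y : ℂ} (ha : ‖a‖ = 1) {c : ℝ} (hca : c < a.re) (hy0 : y ≠ 0)
    (hy : -c * ‖y‖ ≤ y.re) : a * y ∈ Complex.slitPlane := by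
  have hr : 0 < ‖a * y‖ := by rw [norm_mul, ha, one_mul]; exact norm_pos_iff.2 hy0
  refine Stirling.mem_slitPlane_of_sector ?_ hr (sector_unit_mul ha hca hy)
  have : 0 < (a.re - c) ^ 2 := pow_pos (by linarith) 2
  linarith

/-- Stirling at u = ay with Γ(1+u) = uΓ(u). The factor u^(-1/2) in Stirling's formula and the factor
u are absorbed into a power of |y|, as only polynomial accuracy is needed. -/
theorem exists_norm_rGamma_bounds {a : ℂ} (ha : ‖a‖ = 1) {c : ℝ} (hc0 : 0 ≤ c) (hca : c < a.re) :
    ∃ K : ℝ, 0 < K ∧ ∀ y : ℂ, 1 ≤ ‖y‖ → -c * ‖y‖ ≤ y.re →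
      ‖rGamma (a * y)‖ ≤ K * ‖Complex.exp (-(a * y * (Complex.log a + Complex.log y - 1)))‖ ∧
      ‖(rGamma (a * y))⁻¹‖ ≤
        K * ‖y‖ * ‖Complex.exp (a * y * (Complex.log a + Complex.log y - 1))‖ := by
  have hlt : (0 : ℝ) < (a.re - c) ^ 2 := pow_pos (by linarith) 2
  have hle : (a.re - c) ^ 2 ≤ 1 := by
    refine pow_le_one₀ (by linarith) ?_
    linarith [(Complex.re_le_norm a).trans_eq ha]
  obtain ⟨K, hK, hG⟩ := Stirling.exists_norm_Gamma_bounds (c := 1 - (a.re - c) ^ 2 / 2)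
    (by linarith) (by linarith)
  refine ⟨K, hK, fun y hy1 hy => ?_⟩
  have hy0 : y ≠ 0 := norm_pos_iff.1 (by linarith)
  have hun : ‖a * y‖ = ‖y‖ := by rw [norm_mul, ha, one_mul]
  have hu0 : a * y ≠ 0 := norm_pos_iff.1 (by rw [hun]; linarith)
  obtain ⟨h1, h2⟩ := hG (a * y) (by rw [hun]; exact hy1) (sector_unit_mul ha hca hy)
  set W := ‖Complex.exp (a * y * (Complex.log a + Complex.log y - 1))‖ with hW
  have hWpos : 0 < W := norm_pos_iff.2 (Complex.exp_ne_zero _)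
  have hWinv : ‖Complex.exp (-(a * y * (Complex.log a + Complex.log y - 1)))‖ = W⁻¹ := by
    rw [Complex.exp_neg, norm_inv]
  have hpsi : ‖Complex.exp (Stirling.psi (a * y))‖ = W * Real.exp (-(1 / 2 * Real.log ‖y‖)) := by
    have e : Stirling.psi (a * y) = a * y * (Complex.log a + Complex.log y - 1) +
        -((1 / 2 : ℝ) * Complex.log (a * y)) := by
      rw [Stirling.psi, log_unit_mul ha hca hy0 hy]
      push_cast
      ring
    rw [e, Complex.exp_add, norm_mul, Complex.norm_exp (-_), Complex.neg_re, Complex.re_ofReal_mul,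
      Complex.log_re, hun]
  have hlog : 0 ≤ Real.log ‖y‖ := Real.log_nonneg hy1
  set t := Real.exp (-(1 / 2 * Real.log ‖y‖)) with ht
  have ht1 : t ≤ 1 := by rw [ht, Real.exp_le_one_iff]; linarith
  have ht2 : 1 ≤ ‖y‖ * t := by
    rw [ht]
    nth_rewrite 1 [← Real.exp_log (by linarith : 0 < ‖y‖)]
    rw [← Real.exp_add]
    exact Real.one_le_exp (by linarith)
  rw [hpsi] at h1 h2
  have ht0 : 0 < t := Real.exp_pos _
  have hr : rGamma (a * y) = (a * y * Complex.Gamma (a * y))⁻¹ := by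
    rw [rGamma, add_comm, Complex.Gamma_add_one _ hu0]
  have hGpos : 0 < ‖Complex.Gamma (a * y)‖ := by
    by_contra! h
    have := mul_nonpos_of_nonneg_of_nonpos hK.le h
    have := mul_pos hWpos ht0
    linarith
  constructor
  · rw [hr, hWinv, norm_inv, norm_mul, hun, ← div_eq_mul_inv, inv_le_comm₀ (by positivity)
      (by positivity), inv_div, div_le_iff₀ hK]
    calc W ≤ W * (‖y‖ * t) := le_mul_of_one_le_right hWpos.le ht2
      _ = ‖y‖ * (W * t) := by ring
      _ ≤ ‖y‖ * (K * ‖Complex.Gamma (a * y)‖) := by gcongr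
      _ = _ := by ring
  · rw [hr, inv_inv, norm_mul, hun]
    calc ‖y‖ * ‖Complex.Gamma (a * y)‖ ≤ ‖y‖ * (K * (W * t)) := by gcongr
      _ ≤ ‖y‖ * (K * (W * 1)) := by gcongr
      _ = _ := by ring

/-- `1 / Γ(1 + ρz)` if `ρκ` lies in the right half-plane, and its approximate inverse
`Γ(1 - ρz)` otherwise. -/
def gammaFactor (κ ρ z : ℂ) : ℂ :=
  if 0 < (ρ * κ).re then rGamma (ρ * z) else (rGamma (-(ρ * z)))⁻¹

/-- The logarithm of the one of `±ρκ` that lies in the right half-plane. -/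
def dirLog (κ ρ : ℂ) : ℂ := Complex.log (if 0 < (ρ * κ).re then ρ * κ else -(ρ * κ))

/-- Apply `exists_norm_rGamma_bounds` to y = z/κ with a = ±ρκ in the right half-plane. The inversion
in the second case of `gammaFactor` compensates the sign of a, so one formula covers both. -/
theorem gammaFactor_bound {κ ρ : ℂ} (hκ : ‖κ‖ = 1) (hρ : ‖ρ‖ = 1) (h : (ρ * κ).re ≠ 0) :
    ∃ c > 0, ∃ K : ℝ, 0 ≤ K ∧ ∀ z : ℂ, z ≠ 0 → -c * ‖z‖ ≤ (z / κ).re →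
      DifferentiableAt ℂ (gammaFactor κ ρ) z ∧ gammaFactor κ ρ z ≠ 0 ∧ (1 ≤ ‖z‖ →
        ‖gammaFactor κ ρ z‖ ≤ K * ‖z‖ *
          ‖Complex.exp (-(ρ * z * (dirLog κ ρ + Complex.log (z / κ) - 1)))‖) := by
  have hκ0 : κ ≠ 0 := norm_ne_zero_iff.1 (by rw [hκ]; exact one_ne_zero)
  have hn : ∀ z : ℂ, ‖z / κ‖ = ‖z‖ := fun z => by rw [norm_div, hκ, div_one]
  have hd : ∀ a z : ℂ, DifferentiableAt ℂ (fun z => rGamma (a * z)) z := fun a z =>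
    (differentiable_rGamma.comp (differentiable_id.const_mul a)) z
  rcases lt_or_gt_of_ne h with hneg | hpos
  · have hif : ¬ 0 < (ρ * κ).re := not_lt.2 hneg.le
    set a := -(ρ * κ) with ha
    have ha1 : ‖a‖ = 1 := by rw [ha, norm_neg, norm_mul, hρ, hκ, one_mul]
    have har : 0 < a.re := by rw [ha, Complex.neg_re]; linarith
    obtain ⟨K, hK, hb⟩ := exists_norm_rGamma_bounds ha1 (half_pos har).le (half_lt_self har)
    refine ⟨a.re / 2, half_pos har, K, hK.le, fun z hz0 hz => ?_⟩
    have e : ∀ z : ℂ, a * (z / κ) = -(ρ * z) := fun z => by rw [ha]; field_simp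
    have hz0' : z / κ ≠ 0 := div_ne_zero hz0 hκ0
    have hz' : -(a.re / 2) * ‖z / κ‖ ≤ (z / κ).re := by rw [hn]; exact hz
    have hne := rGamma_ne_zero (unit_mul_mem_slitPlane ha1 (half_lt_self har) hz0' hz')
    rw [e] at hne
    have hfun : gammaFactor κ ρ = fun z => (rGamma (-(ρ * z)))⁻¹ := by
      funext z
      rw [gammaFactor, if_neg hif]
    rw [hfun]
    refine ⟨?_, inv_ne_zero hne, fun h1 => ?_⟩
    · have h2 : DifferentiableAt ℂ (fun z => rGamma (-(ρ * z))) z := by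
        simpa only [neg_mul] using hd (-ρ) z
      exact h2.inv hne
    · have h3 := (hb (z / κ) (by rw [hn]; exact h1) hz').2
      rw [hn, e] at h3
      rw [dirLog, if_neg hif, ← ha]
      rwa [neg_mul] at h3
  · set a := ρ * κ with ha
    have ha1 : ‖a‖ = 1 := by rw [ha, norm_mul, hρ, hκ, one_mul]
    obtain ⟨K, hK, hb⟩ := exists_norm_rGamma_bounds ha1 (half_pos hpos).le (half_lt_self hpos)
    refine ⟨a.re / 2, half_pos hpos, K, hK.le, fun z hz0 hz => ?_⟩
    have e : ∀ z : ℂ, a * (z / κ) = ρ * z := fun z => by rw [ha]; field_simp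
    have hz0' : z / κ ≠ 0 := div_ne_zero hz0 hκ0
    have hz' : -(a.re / 2) * ‖z / κ‖ ≤ (z / κ).re := by rw [hn]; exact hz
    have hne := rGamma_ne_zero (unit_mul_mem_slitPlane ha1 (half_lt_self hpos) hz0' hz')
    rw [e] at hne
    have hfun : gammaFactor κ ρ = fun z => rGamma (ρ * z) := by
      funext z
      rw [gammaFactor, if_pos hpos]
    rw [hfun]
    refine ⟨hd ρ z, hne, fun h1 => ?_⟩
    have h3 := (hb (z / κ) (by rw [hn]; exact h1) hz').1
    rw [e] at h3
    rw [dirLog, if_pos hpos, ← ha]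
    refine h3.trans (mul_le_mul_of_nonneg_right ?_ (norm_nonneg _))
    exact le_mul_of_one_le_right hK.le h1

theorem prod_gammaFactor_bound {κ : ℂ} (hκ : ‖κ‖ = 1) (S : Finset ℂ) (hS : ∀ ρ ∈ S, ‖ρ‖ = 1)
    (h : ∀ ρ ∈ S, (ρ * κ).re ≠ 0) :
    ∃ c > 0, ∃ K : ℝ, 0 ≤ K ∧ ∀ z : ℂ, z ≠ 0 → -c * ‖z‖ ≤ (z / κ).re →
      DifferentiableAt ℂ (fun z => ∏ ρ ∈ S, gammaFactor κ ρ z) z ∧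
      ∏ ρ ∈ S, gammaFactor κ ρ z ≠ 0 ∧ (1 ≤ ‖z‖ →
        ‖∏ ρ ∈ S, gammaFactor κ ρ z‖ ≤ K * ‖z‖ ^ S.card *
          ‖Complex.exp (-(∑ ρ ∈ S, ρ * z * (dirLog κ ρ + Complex.log (z / κ) - 1)))‖) := by
  classical
  induction S using Finset.induction_on with
  | empty => exact ⟨1, one_pos, 1, zero_le_one, fun z _ _ => by simp⟩
  | insert ρ S hρ ih =>
    obtain ⟨c, hc, K, hK, hb⟩ := ih (fun ρ hρ => hS ρ (Finset.mem_insert_of_mem hρ))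
      (fun ρ hρ => h ρ (Finset.mem_insert_of_mem hρ))
    obtain ⟨c', hc', K', hK', hb'⟩ := gammaFactor_bound hκ (hS ρ (Finset.mem_insert_self _ _))
      (h ρ (Finset.mem_insert_self _ _))
    refine ⟨min c c', lt_min hc hc', K' * K, mul_nonneg hK' hK, fun z hz0 hz => ?_⟩
    obtain ⟨h1, h2, h3⟩ := hb z hz0 (IsTame.sector_mono (min_le_left _ _) hz)
    obtain ⟨h1', h2', h3'⟩ := hb' z hz0 (IsTame.sector_mono (min_le_right _ _) hz)
    simp only [Finset.prod_insert hρ, Finset.sum_insert hρ, Finset.card_insert_of_notMem hρ]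
    refine ⟨h1'.mul h1, mul_ne_zero h2' h2, fun h4 => ?_⟩
    rw [norm_mul, neg_add, Complex.exp_add, norm_mul]
    refine (mul_le_mul (h3' h4) (h3 h4) (norm_nonneg _) (by positivity)).trans_eq ?_
    ring

/-- The exponential rate of `∏ gammaFactor κ ρ` over the roots `ρ ∈ signedRoots r`. -/
def dirRate (κ : ℂ) (r : ℕ+) : ℂ := -∑ ρ ∈ signedRoots r, ρ * dirLog κ ρ

/-- The variant of `eulerian r` adapted to the direction `κ`. -/
def dirGamma (κ : ℂ) (r : ℕ+) (z : ℂ) : ℂ := ∏ ρ ∈ signedRoots r, gammaFactor κ ρ z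

theorem sum_signedRoots {r : ℕ+} (hr : 1 < r) : ∑ ρ ∈ signedRoots r, ρ = 0 := by
  have h := sum_pow_signedRoots r 1
  have h1 : 1 < (r : ℕ) := by exact_mod_cast hr
  rw [if_neg (fun h => by have := Nat.le_of_dvd one_pos h; omega)] at h
  simpa using h

/-- For r > 1 the roots add up to zero, so the contributions ρ z (log(z/κ) - 1) cancel in the
product and only the exponential with rate `dirRate` remains. -/
theorem isTame_dirGamma {κ : ℂ} (hκ : ‖κ‖ = 1) {r : ℕ+} (hr : 1 < r)
    (h : ∀ ρ ∈ signedRoots r, (ρ * κ).re ≠ 0) :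
    IsTame κ fun z => Complex.exp (-(dirRate κ r * z)) * dirGamma κ r z := by
  obtain ⟨c, hc, K, hK, hb⟩ := prod_gammaFactor_bound hκ (signedRoots r)
    (fun ρ hρ => norm_of_mem_signedRoots hρ) h
  refine ⟨c, hc, K, (signedRoots r).card, fun z hz0 hz => ?_⟩
  obtain ⟨h1, h2, h3⟩ := hb z hz0 hz
  refine ⟨DifferentiableAt.mul (by fun_prop) h1, fun h4 => ?_⟩
  have e : -(∑ ρ ∈ signedRoots r, ρ * z * (dirLog κ ρ + Complex.log (z / κ) - 1)) =
      dirRate κ r * z := by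
    have : ∀ ρ : ℂ, ρ * z * (dirLog κ ρ + Complex.log (z / κ) - 1) =
        ρ * dirLog κ ρ * z + ρ * (z * (Complex.log (z / κ) - 1)) := fun ρ => by ring
    simp only [this]
    rw [Finset.sum_add_distrib, ← Finset.sum_mul, ← Finset.sum_mul, sum_signedRoots hr, zero_mul,
      add_zero, dirRate, neg_mul]
  rw [norm_mul]
  refine (mul_le_mul_of_nonneg_left (h3 h4) (norm_nonneg _)).trans_eq ?_
  rw [e, mul_left_comm, ← norm_mul, ← Complex.exp_add, neg_add_cancel, Complex.exp_zero, norm_one,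
    mul_one]

theorem dirGamma_spec {κ : ℂ} (hκ : ‖κ‖ = 1) {r : ℕ+} (h : ∀ ρ ∈ signedRoots r, (ρ * κ).re ≠ 0)
    {z : ℂ} (hz : z ∈ halfPlane κ) :
    DifferentiableAt ℂ (dirGamma κ r) z ∧ dirGamma κ r z ≠ 0 := by
  obtain ⟨c, hc, K, hK, hb⟩ := prod_gammaFactor_bound hκ (signedRoots r)
    (fun ρ hρ => norm_of_mem_signedRoots hρ) h
  have h0 := mem_halfPlane.1 hz
  obtain ⟨h1, h2, -⟩ := hb z (ne_zero_of_mem_halfPlane hz) (by nlinarith [norm_nonneg z])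
  exact ⟨h1, h2⟩

theorem rGamma_mul_rGamma_neg {u : ℂ} (hu : u ≠ 0) :
    rGamma u * rGamma (-u) = Complex.sin (Real.pi * u) / (Real.pi * u) := by
  rw [rGamma, rGamma, add_comm, Complex.Gamma_add_one u hu, ← mul_inv, ← sub_eq_add_neg, mul_assoc,
    Complex.Gamma_mul_Gamma_one_sub, mul_div_assoc', inv_div, mul_comm u]

/-- By Stirling the modulus is at most exp(-Re(z log z) + O(|z|)), and on rays in the right
half-plane x log x beats every multiple of x. -/
theorem superDecay_rGamma {κ : ℂ} (hre : 0 < κ.re) : SuperDecay κ rGamma := by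
  obtain ⟨K, hK, hb⟩ := exists_norm_rGamma_bounds (a := 1) norm_one le_rfl (by simp)
  refine ⟨κ.re, hre, fun κ' hκ' hd M => ?_⟩
  have hκ0 : κ' ≠ 0 := norm_ne_zero_iff.1 (by rw [hκ']; exact one_ne_zero)
  have hb0 : 0 < κ'.re := by
    have h1 := neg_le_of_abs_le (Complex.abs_re_le_norm (κ' - κ))
    rw [Complex.sub_re] at h1
    linarith
  -- Beyond X the logarithm makes the total exponent nonpositive; before X the exponent is bounded
  -- by the constant built into D.
  set X := Real.exp ((M + Real.pi + κ'.re) / κ'.re) with hX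
  refine ⟨K * Real.exp (X * |M + Real.pi + κ'.re|), fun x hx => ?_⟩
  have hx0 : 0 < x := by linarith
  have h1 := (hb (x * κ') (by rw [norm_mul, hκ', mul_one, Complex.norm_real,
    Real.norm_of_nonneg hx0.le]; exact hx) (by
      rw [Complex.re_ofReal_mul, neg_zero, zero_mul]; positivity)).1
  rw [one_mul, Complex.log_one, zero_add] at h1
  refine h1.trans ?_
  rw [mul_assoc K, ← Real.exp_add, Complex.norm_exp]
  refine mul_le_mul_of_nonneg_left (Real.exp_le_exp.2 ?_) hK.le
  have hlog : Complex.log (x * κ') = Real.log x + Complex.log κ' :=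
    Complex.log_ofReal_mul hx0 hκ0
  have e : (-((x : ℂ) * κ' * (Complex.log (x * κ') - 1))).re =
      -(x * (κ'.re * (Real.log x - 1) - κ'.im * Complex.arg κ')) := by
    rw [hlog, Complex.neg_re, mul_assoc, Complex.re_ofReal_mul, Complex.mul_re, Complex.sub_re,
      Complex.add_re, Complex.sub_im, Complex.add_im, Complex.log_re, Complex.log_im, hκ',
      Real.log_one, Complex.ofReal_re, Complex.ofReal_im, Complex.one_re, Complex.one_im]
    ring
  rw [e]
  have him : κ'.im * Complex.arg κ' ≤ Real.pi := by
    refine (le_abs_self _).trans ?_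
    rw [abs_mul]
    have h2 := (Complex.abs_im_le_norm κ').trans_eq hκ'
    have h3 := Complex.abs_arg_le_pi κ'
    nlinarith [abs_nonneg κ'.im, abs_nonneg (Complex.arg κ'), Real.pi_pos]
  have key : x * (M + Real.pi + κ'.re - κ'.re * Real.log x) ≤ X * |M + Real.pi + κ'.re| := by
    by_cases hxX : X ≤ x
    · have h4 : (M + Real.pi + κ'.re) / κ'.re ≤ Real.log x := by
        rw [← Real.log_exp ((M + Real.pi + κ'.re) / κ'.re)]
        exact Real.log_le_log (Real.exp_pos _) hxX
      rw [div_le_iff₀ hb0] at h4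
      refine (mul_nonpos_of_nonneg_of_nonpos hx0.le (by linarith)).trans ?_
      exact mul_nonneg (Real.exp_pos _).le (abs_nonneg _)
    · have h5 : M + Real.pi + κ'.re - κ'.re * Real.log x ≤ |M + Real.pi + κ'.re| := by
        have := mul_nonneg hb0.le (Real.log_nonneg hx)
        linarith [le_abs_self (M + Real.pi + κ'.re)]
      calc x * (M + Real.pi + κ'.re - κ'.re * Real.log x) ≤ x * |M + Real.pi + κ'.re| :=
            mul_le_mul_of_nonneg_left h5 hx0.le
        _ ≤ _ := mul_le_mul_of_nonneg_right (not_le.1 hxX).le (abs_nonneg _)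
  nlinarith

/-! ### Exponential polynomials -/

/-- Formal exponential polynomials: the coefficient of `λ` stands for the Laurent polynomial in `z`
that multiplies `exp (λ z)`. -/
abbrev ExpPoly : Type := AddMonoidAlgebra (AddMonoidAlgebra ℂ ℤ) ℂ

/-- The powers `z ^ k` (for `z ≠ 0`), as a homomorphism in `k`. -/
def powChar (z : ℂ) : Multiplicative ℤ →* ℂ where
  toFun k := Complex.exp ((Multiplicative.toAdd k : ℤ) * Complex.log z)
  map_one' := by simp
  map_mul' a b := by simp [add_mul, Complex.exp_add]

theorem powChar_apply {z : ℂ} (hz : z ≠ 0) (k : ℤ) : powChar z (Multiplicative.ofAdd k) = z ^ k := by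
  change Complex.exp ((k : ℂ) * Complex.log z) = z ^ k
  rw [Complex.exp_int_mul, Complex.exp_log hz]

/-- Evaluation of Laurent polynomials. -/
def laurentEval (z : ℂ) : AddMonoidAlgebra ℂ ℤ →ₐ[ℂ] ℂ := AddMonoidAlgebra.lift ℂ ℂ ℤ (powChar z)

theorem laurentEval_single {z : ℂ} (hz : z ≠ 0) (k : ℤ) (c : ℂ) :
    laurentEval z (AddMonoidAlgebra.single k c) = c * z ^ k := by
  rw [laurentEval, AddMonoidAlgebra.lift_single, powChar_apply hz, smul_eq_mul]

/-- The exponentials `exp (Φ λ z)`, as a homomorphism in `λ`. -/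
def twistedExpChar (Φ : ℂ →+ ℂ) (z : ℂ) : Multiplicative ℂ →* ℂ where
  toFun e := Complex.exp (Φ (Multiplicative.toAdd e) * z)
  map_one' := by simp
  map_mul' a b := by simp [add_mul, Complex.exp_add]

/-- Evaluation of exponential polynomials after the substitution `exp (λ z) ↦ exp (Φ(λ) z)`. -/
def twistedEval (Φ : ℂ →+ ℂ) (z : ℂ) : ExpPoly →ₐ[ℂ] ℂ :=
  AddMonoidAlgebra.liftNCAlgHom (laurentEval z) (twistedExpChar Φ z) fun _ _ => Commute.all _ _

theorem twistedEval_single (Φ : ℂ →+ ℂ) (z e : ℂ) (p : AddMonoidAlgebra ℂ ℤ) :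
    twistedEval Φ z (AddMonoidAlgebra.single e p) = laurentEval z p * Complex.exp (Φ e * z) :=
  AddMonoidAlgebra.liftNC_single _ _ _ _

/-- Evaluation of exponential polynomials. -/
def expEval (z : ℂ) : ExpPoly →ₐ[ℂ] ℂ := twistedEval (AddMonoidHom.id ℂ) z

theorem expEval_single (z e : ℂ) (p : AddMonoidAlgebra ℂ ℤ) :
    expEval z (AddMonoidAlgebra.single e p) = laurentEval z p * Complex.exp (e * z) :=
  twistedEval_single _ _ _ _

/-- The powers of `z`, as tame functions. -/
def tamePow (κ : ℂ) : Multiplicative ℤ →* tame κ where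
  toFun k := ⟨fun z => powChar z k, (IsTame.zpow κ (Multiplicative.toAdd k)).congr fun _ hz =>
    (powChar_apply hz _).symm⟩
  map_one' := Subtype.ext (funext fun _ => map_one (powChar _))
  map_mul' a b := Subtype.ext (funext fun z => map_mul (powChar z) a b)

/-- Laurent polynomials as tame functions. -/
def laurentTame (κ : ℂ) : AddMonoidAlgebra ℂ ℤ →ₐ[ℂ] tame κ :=
  AddMonoidAlgebra.lift ℂ (tame κ) ℤ (tamePow κ)

theorem laurentTame_apply (κ z : ℂ) (p : AddMonoidAlgebra ℂ ℤ) :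
    (laurentTame κ p : ℂ → ℂ) z = laurentEval z p := by
  have : ((Pi.evalAlgHom ℂ (fun _ : ℂ => ℂ) z).comp (tame κ).val).comp (laurentTame κ) =
      laurentEval z := by
    refine AddMonoidAlgebra.algHom_ext (fun k => ?_) (Subsingleton.elim _ _)
    change (laurentTame κ (AddMonoidAlgebra.single k 1) : ℂ → ℂ) z = _
    rw [laurentTame, laurentEval, AddMonoidAlgebra.lift_single, AddMonoidAlgebra.lift_single]
    rfl
  exact DFunLike.congr_fun this p

/-- Exponential polynomials as exponential sums with tame coefficients. -/
def expTame (κ : ℂ) : ExpPoly →ₐ[ℂ] AddMonoidAlgebra (tame κ) ℂ :=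
  AddMonoidAlgebra.mapAlgHom ℂ (laurentTame κ)

theorem expSum_expTame (κ z : ℂ) (A : ExpPoly) : expSum κ (expTame κ A) z = expEval z A := by
  have : ((Pi.evalRingHom (fun _ : ℂ => ℂ) z).comp (expSum κ)).comp (expTame κ).toRingHom =
      (expEval z).toRingHom := by
    refine AddMonoidAlgebra.ringHom_ext (fun p => ?_) (fun e => ?_)
    · change expSum κ (AddMonoidAlgebra.mapAlgHom ℂ (laurentTame κ) _) z = expEval z _
      rw [AddMonoidAlgebra.mapAlgHom_single, expSum_single, expEval_single, laurentTame_apply,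
        mul_comm]
    · change expSum κ (AddMonoidAlgebra.mapAlgHom ℂ (laurentTame κ) _) z = expEval z _
      rw [AddMonoidAlgebra.mapAlgHom_single, expSum_single, expEval_single, laurentTame_apply,
        mul_comm]
  exact DFunLike.congr_fun this A

theorem laurentEval_eq_sum (z : ℂ) (hz : z ≠ 0) (p : AddMonoidAlgebra ℂ ℤ) :
    laurentEval z p = ∑ k ∈ p.coeff.support, p.coeff k * z ^ k := by
  conv_lhs => rw [← AddMonoidAlgebra.sum_coeff_single p, Finsupp.sum, map_sum]
  exact Finset.sum_congr rfl fun k _ => laurentEval_single hz _ _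

/-- The characters `x ↦ exp (k x)` of `ℝ`. -/
def realExpChar (k : ℤ) : Multiplicative ℝ →* ℂ where
  toFun x := Complex.exp (k * (Multiplicative.toAdd x : ℝ))
  map_one' := by simp
  map_mul' a b := by simp [mul_add, Complex.exp_add]

theorem realExpChar_injective : Function.Injective realExpChar := by
  intro k l h
  have h1 : Complex.exp (k * (1 : ℝ)) = Complex.exp (l * (1 : ℝ)) :=
    DFunLike.congr_fun h (Multiplicative.ofAdd 1)
  have h2 := congrArg norm h1
  rw [Complex.norm_exp, Complex.norm_exp, Real.exp_eq_exp] at h2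
  simpa using h2

/-- On the ray z = e^x κ the powers of z become distinct characters of ℝ, which are linearly
independent. -/
theorem laurent_eq_zero {κ : ℂ} (hκ : ‖κ‖ = 1) {p : AddMonoidAlgebra ℂ ℤ}
    (h : ∀ z ∈ halfPlane κ, laurentEval z p = 0) : p = 0 := by
  have hκ0 : κ ≠ 0 := norm_ne_zero_iff.1 (by rw [hκ]; exact one_ne_zero)
  have hli := (linearIndependent_monoidHom (Multiplicative ℝ) ℂ).comp realExpChar
    realExpChar_injective
  rw [linearIndependent_iff'] at hli
  have h1 : ∑ k ∈ p.coeff.support, (p.coeff k * κ ^ k) • (realExpChar k : Multiplicative ℝ → ℂ) =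
      0 := by
    funext x
    have hz : (Real.exp (Multiplicative.toAdd x) : ℂ) * κ ∈ halfPlane κ := by
      have := ray_mem_halfPlane hκ hκ (by simp) (Real.exp_pos (Multiplicative.toAdd x))
      simpa using this
    rw [Pi.zero_apply, ← h _ hz, laurentEval_eq_sum _ (ne_zero_of_mem_halfPlane hz), Finset.sum_apply]
    refine Finset.sum_congr rfl fun k _ => ?_
    rw [Pi.smul_apply, smul_eq_mul, mul_zpow, Complex.ofReal_exp, ← Complex.exp_int_mul, mul_assoc, mul_comm (κ ^ k)]
    rfl
  refine AddMonoidAlgebra.coeff_injective (Finsupp.ext fun k => ?_)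
  by_cases hk : k ∈ p.coeff.support
  · exact (mul_eq_zero.1 (hli _ _ h1 k hk)).resolve_right (zpow_ne_zero _ hκ0)
  · exact Finsupp.notMem_support_iff.1 hk

theorem expPoly_eq_zero {κ : ℂ} (hκ : ‖κ‖ = 1) {A : ExpPoly}
    (h : ∀ z ∈ halfPlane κ, expEval z A = 0) : A = 0 := by
  refine AddMonoidAlgebra.coeff_injective (Finsupp.ext fun e => laurent_eq_zero hκ fun z hz => ?_)
  have h1 := coeff_eq_zero_of_superDecay hκ (expTame κ A)
    (superDecay_of_eqOn_zero hκ fun z hz => by rw [expSum_expTame, h z hz]) e z hz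
  rwa [expTame, AddMonoidAlgebra.coeff_mapAlgHom, laurentTame_apply] at h1

theorem differentiableAt_expEval (A : ExpPoly) {z : ℂ} (hz : z ≠ 0) :
    DifferentiableAt ℂ (fun z => expEval z A) z := by
  have h1 : ∀ p : AddMonoidAlgebra ℂ ℤ, DifferentiableAt ℂ (fun z => laurentEval z p) z := by
    intro p
    have h2 : (fun z => laurentEval z p) =ᶠ[𝓝 z]
        fun z => ∑ k ∈ p.coeff.support, p.coeff k * z ^ k := by
      filter_upwards [isOpen_ne.mem_nhds hz] with w hw using laurentEval_eq_sum w hw p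
    refine DifferentiableAt.congr_of_eventuallyEq ?_ h2
    exact DifferentiableAt.fun_sum fun k _ =>
      (differentiableAt_zpow.2 (Or.inl hz)).const_mul _
  have h3 : (fun z => expEval z A) =
      fun z => ∑ e ∈ A.coeff.support, laurentEval z (A.coeff e) * Complex.exp (e * z) := by
    funext z
    conv_lhs => rw [← AddMonoidAlgebra.sum_coeff_single A, Finsupp.sum, map_sum]
    exact Finset.sum_congr rfl fun e _ => expEval_single _ _ _
  rw [h3]
  exact DifferentiableAt.fun_sum fun e _ => (h1 _).mul (by fun_prop)

/-- `sin (π ρ z) / (π ρ z)` as an exponential polynomial. -/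
def sincPoly (ρ : ℂ) : ExpPoly :=
  AddMonoidAlgebra.single (Complex.I * Real.pi * ρ)
      (AddMonoidAlgebra.single (-1 : ℤ) (2 * Complex.I * Real.pi * ρ)⁻¹) +
    AddMonoidAlgebra.single (-(Complex.I * Real.pi * ρ))
      (AddMonoidAlgebra.single (-1 : ℤ) (-(2 * Complex.I * Real.pi * ρ)⁻¹))

theorem twistedEval_sincPoly (Φ : ℂ →+ ℂ) {z : ℂ} (hz : z ≠ 0) (ρ : ℂ) :
    twistedEval Φ z (sincPoly ρ) =
      Complex.sinh (Φ (Complex.I * Real.pi * ρ) * z) / (Complex.I * Real.pi * ρ * z) := by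
  rw [sincPoly, map_add, twistedEval_single, twistedEval_single, laurentEval_single hz,
    laurentEval_single hz, map_neg, neg_mul (Φ _), Complex.sinh, zpow_neg_one, mul_inv, mul_inv,
    mul_inv, div_div, div_eq_mul_inv, mul_inv, mul_inv, mul_inv, mul_inv]
  ring

theorem expEval_sincPoly {z : ℂ} (hz : z ≠ 0) (ρ : ℂ) :
    expEval z (sincPoly ρ) = Complex.sin (Real.pi * (ρ * z)) / (Real.pi * (ρ * z)) := by
  rw [expEval, twistedEval_sincPoly _ hz]
  have h1 : (AddMonoidHom.id ℂ) (Complex.I * Real.pi * ρ) * z = (Real.pi * (ρ * z)) * Complex.I := by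
    rw [AddMonoidHom.id_apply]
    ring
  rw [h1, Complex.sinh_mul_I, show Complex.I * Real.pi * ρ * z = (Real.pi * (ρ * z)) * Complex.I by
    ring, mul_div_mul_right _ _ Complex.I_ne_zero]

theorem sincPoly_ne_zero {ρ : ℂ} (hρ : ρ ≠ 0) : sincPoly ρ ≠ 0 := by
  intro h
  have hpi : (Real.pi : ℂ) ≠ 0 := Complex.ofReal_ne_zero.2 Real.pi_ne_zero
  have hz : (2 * ρ)⁻¹ ≠ 0 := inv_ne_zero (mul_ne_zero two_ne_zero hρ)
  have h1 := expEval_sincPoly hz ρ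
  rw [h, map_zero, show (Real.pi : ℂ) * (ρ * (2 * ρ)⁻¹) = Real.pi / 2 by field_simp,
    Complex.sin_pi_div_two] at h1
  exact one_div_ne_zero (div_ne_zero hpi two_ne_zero) h1.symm

theorem card_support_sum_single {ι : Type*} (J : Finset ι) {f : ι → ℂ} (hf : Function.Injective f)
    {c : ι → AddMonoidAlgebra ℂ ℤ} (hc : ∀ j ∈ J, c j ≠ 0) :
    (∑ j ∈ J, AddMonoidAlgebra.single (f j) (c j) : ExpPoly).coeff.support.card = J.card := by
  classical
  have : (∑ j ∈ J, AddMonoidAlgebra.single (f j) (c j) : ExpPoly).coeff.support = J.image f := by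
    ext e
    rw [Finsupp.mem_support_iff, Finset.mem_image, AddMonoidAlgebra.coeff_sum, Finsupp.finsetSum_apply]
    simp only [AddMonoidAlgebra.coeff_single, Finsupp.single_apply]
    constructor
    · intro h
      obtain ⟨j, hj, h1⟩ := Finset.exists_ne_zero_of_sum_ne_zero h
      exact ⟨j, hj, by_contra fun h2 => h1 (if_neg h2)⟩
    · rintro ⟨j, hj, rfl⟩
      rw [Finset.sum_eq_single j (fun i _ hij => if_neg fun h => hij (hf h))
        (fun h => absurd hj h), if_pos rfl]
      exact hc j hj
  rw [this, Finset.card_image_of_injective _ hf]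

/-- The binomial expansion has the k + 1 distinct frequencies e + (2j - k)iπρ with nonzero
coefficients. The number of frequencies thus reveals the exponent k. -/
theorem card_support_single_mul_sincPoly_pow {ρ : ℂ} (hρ : ρ ≠ 0) (e : ℂ)
    {p : AddMonoidAlgebra ℂ ℤ} (hp : p ≠ 0) (k : ℕ) :
    (AddMonoidAlgebra.single e p * sincPoly ρ ^ k : ExpPoly).coeff.support.card = k + 1 := by
  have hpi : (Real.pi : ℂ) ≠ 0 := Complex.ofReal_ne_zero.2 Real.pi_ne_zero
  set μ : ℂ := Complex.I * Real.pi * ρ with hμ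
  have hμ0 : μ ≠ 0 := mul_ne_zero (mul_ne_zero Complex.I_ne_zero hpi) hρ
  set a : AddMonoidAlgebra ℂ ℤ :=
    AddMonoidAlgebra.single (-1 : ℤ) (2 * Complex.I * Real.pi * ρ)⁻¹ with ha
  set b : AddMonoidAlgebra ℂ ℤ :=
    AddMonoidAlgebra.single (-1 : ℤ) (-(2 * Complex.I * Real.pi * ρ)⁻¹) with hb
  have hc0 : (2 * Complex.I * Real.pi * ρ)⁻¹ ≠ 0 :=
    inv_ne_zero (mul_ne_zero (mul_ne_zero (mul_ne_zero two_ne_zero Complex.I_ne_zero) hpi) hρ)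
  have ha0 : a ≠ 0 := by
    rw [ha, Ne, AddMonoidAlgebra.single_eq_zero]
    exact hc0
  have hb0 : b ≠ 0 := by
    rw [hb, Ne, AddMonoidAlgebra.single_eq_zero]
    exact neg_ne_zero.2 hc0
  have hexp : AddMonoidAlgebra.single e p * sincPoly ρ ^ k =
      ∑ j ∈ Finset.range (k + 1), (AddMonoidAlgebra.single (e + (2 * (j : ℂ) - k) * μ)
        (p * (a ^ j * b ^ (k - j) * (k.choose j : AddMonoidAlgebra ℂ ℤ))) : ExpPoly) := by
    have hs : sincPoly ρ = AddMonoidAlgebra.single μ a + AddMonoidAlgebra.single (-μ) b := rfl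
    clear_value μ a b
    rw [hs, add_pow, Finset.mul_sum]
    refine Finset.sum_congr rfl fun j hj => ?_
    have hjk : j ≤ k := Nat.lt_succ_iff.1 (Finset.mem_range.1 hj)
    rw [AddMonoidAlgebra.single_pow, AddMonoidAlgebra.single_pow, AddMonoidAlgebra.single_mul_single,
      AddMonoidAlgebra.natCast_def, AddMonoidAlgebra.single_mul_single,
      AddMonoidAlgebra.single_mul_single, add_zero]
    congr 1
    rw [nsmul_eq_mul, nsmul_eq_mul, Nat.cast_sub hjk]
    ring
  rw [hexp, card_support_sum_single, Finset.card_range]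
  · intro i j hij
    have h1 := mul_right_cancel₀ hμ0 (add_left_cancel hij)
    have h2 : (i : ℂ) = j := by linear_combination h1 / 2
    exact_mod_cast h2
  · intro j hj
    have hjk : j ≤ k := Nat.lt_succ_iff.1 (Finset.mem_range.1 hj)
    refine mul_ne_zero hp (mul_ne_zero (mul_ne_zero (pow_ne_zero _ ha0) (pow_ne_zero _ hb0)) ?_)
    have : CharZero (AddMonoidAlgebra ℂ ℤ) := algebraRat.charZero _
    exact Nat.cast_ne_zero.2 (Nat.choose_pos hjk).ne'

/-! ### Relations between the functions `eulerian r` for odd `r` -/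

theorem eq_zero_of_eqOn_halfPlane {κ : ℂ} (hκ : ‖κ‖ = 1) {f : ℂ → ℂ}
    (hf : ∀ z, z ≠ 0 → DifferentiableAt ℂ f z) (h : ∀ z ∈ halfPlane κ, f z = 0) {z : ℂ} (hz : z ≠ 0) :
    f z = 0 := by
  have hmem : κ ∈ halfPlane κ := by
    have := ray_mem_halfPlane hκ hκ (by simp) one_pos
    simpa using this
  have hd : DifferentiableOn ℂ f {0}ᶜ := fun w hw => (hf w hw).differentiableWithinAt
  have hpre : IsPreconnected ({0}ᶜ : Set ℂ) :=
    (isConnected_compl_singleton_of_one_lt_rank (by simp) 0).isPreconnected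
  exact (hd.analyticOnNhd isOpen_compl_singleton).eqOn_zero_of_preconnected_of_eventuallyEq_zero hpre
    (ne_zero_of_mem_halfPlane hmem)
    (Filter.eventuallyEq_of_mem ((isOpen_halfPlane κ).mem_nhds hmem) h) hz

theorem gammaFactor_congr {κ κ' ρ : ℂ} (h : 0 < (ρ * κ).re ↔ 0 < (ρ * κ').re) (z : ℂ) :
    gammaFactor κ ρ z = gammaFactor κ' ρ z := by
  by_cases h1 : 0 < (ρ * κ).re
  · rw [gammaFactor, gammaFactor, if_pos h1, if_pos (h.1 h1)]
  · rw [gammaFactor, gammaFactor, if_neg h1, if_neg (fun h2 => h1 (h.2 h2))]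

theorem gammaFactor_ne_zero {κ ρ : ℂ} (hκ : ‖κ‖ = 1) (hρ : ‖ρ‖ = 1) (h : (ρ * κ).re ≠ 0) {z : ℂ}
    (hz : z ∈ halfPlane κ) : gammaFactor κ ρ z ≠ 0 := by
  obtain ⟨c, hc, K, hK, hb⟩ := gammaFactor_bound hκ hρ h
  have h0 := mem_halfPlane.1 hz
  exact (hb z (ne_zero_of_mem_halfPlane hz) (by nlinarith [norm_nonneg z])).2.1

/-- Reflection formula: 1/Γ(1+ρz) is a sinc times Γ(1-ρz). -/
theorem rGamma_eq_sinc_mul {κ ρ : ℂ} (hκ : ‖κ‖ = 1) (hρ : ‖ρ‖ = 1) (h : (ρ * κ).re ≠ 0)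
    (hneg : ¬ 0 < (ρ * κ).re) {z : ℂ} (hz : z ∈ halfPlane κ) :
    rGamma (ρ * z) = expEval z (sincPoly ρ) * gammaFactor κ ρ z := by
  have hz0 := ne_zero_of_mem_halfPlane hz
  have hρ0 : ρ ≠ 0 := norm_ne_zero_iff.1 (by rw [hρ]; exact one_ne_zero)
  have h1 := gammaFactor_ne_zero hκ hρ h hz
  rw [gammaFactor, if_neg hneg] at h1 ⊢
  rw [expEval_sincPoly hz0, ← rGamma_mul_rGamma_neg (mul_ne_zero hρ0 hz0),
    mul_inv_cancel_right₀ (fun h2 => h1 (by rw [h2, inv_zero]))]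

/-- The quotient of `eulerian r` and `dirGamma κ r`. -/
def dirSinc (κ : ℂ) (r : ℕ+) : ExpPoly :=
  ∏ ρ ∈ signedRoots r, if 0 < (ρ * κ).re then 1 else sincPoly ρ

theorem dirSinc_ne_zero (κ : ℂ) (r : ℕ+) : dirSinc κ r ≠ 0 := by
  refine Finset.prod_ne_zero_iff.2 fun ρ hρ => ?_
  split_ifs
  · exact one_ne_zero
  · exact sincPoly_ne_zero (norm_ne_zero_iff.1 (by
      rw [norm_of_mem_signedRoots hρ]; exact one_ne_zero))

theorem eulerian_eq_dirSinc_mul {κ : ℂ} (hκ : ‖κ‖ = 1) {r : ℕ+}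
    (h : ∀ ρ ∈ signedRoots r, (ρ * κ).re ≠ 0) {z : ℂ} (hz : z ∈ halfPlane κ) :
    eulerian r z = expEval z (dirSinc κ r) * dirGamma κ r z := by
  rw [eulerian, dirSinc, dirGamma, map_prod, ← Finset.prod_mul_distrib]
  refine Finset.prod_congr rfl fun ρ hρ => ?_
  split_ifs with hpos
  · rw [map_one, one_mul, gammaFactor, if_pos hpos]
  · exact rGamma_eq_sinc_mul hκ (norm_of_mem_signedRoots hρ) (h ρ hρ) hpos hz

section Relations

variable {σ : Type} [Fintype σ]

/-- No root involved is purely imaginary after rotation by `κ`. -/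
def Admissible (o : σ → ℕ+) (κ : ℂ) : Prop := ∀ s, ∀ ρ ∈ signedRoots (o s), (ρ * κ).re ≠ 0

/-- A linear relation, with coefficients `A`, between monomials in the `dirGamma κ (o s)`. -/
def DirRelation (κ : ℂ) (o : σ → ℕ+) (S : Finset (σ → ℕ)) (A : (σ → ℕ) → ExpPoly) : Prop :=
  ∀ z ∈ halfPlane κ, ∑ β ∈ S, expEval z (A β) * ∏ s, dirGamma κ (o s) z ^ β s = 0

/-- A linear relation, with coefficients `A`, between monomials in the `eulerian (o s)`. -/
def EulerRelation (o : σ → ℕ+) (S : Finset (σ → ℕ)) (A : (σ → ℕ) → ExpPoly) : Prop :=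
  ∀ z, z ≠ 0 → ∑ β ∈ S, expEval z (A β) * ∏ s, eulerian (o s) z ^ β s = 0

/-- The exponential rate of the monomial with exponents `β` in the `dirGamma κ (o s)`. -/
def monomialRate (κ : ℂ) (o : σ → ℕ+) (β : σ → ℕ) : ℂ := ∑ s, β s * dirRate κ (o s)

theorem prod_normalized (κ : ℂ) (o : σ → ℕ+) (β : σ → ℕ) (z : ℂ) :
    ∏ s, (Complex.exp (-(dirRate κ (o s) * z)) * dirGamma κ (o s) z) ^ β s =
      Complex.exp (-(monomialRate κ o β * z)) * ∏ s, dirGamma κ (o s) z ^ β s := by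
  simp only [mul_pow, Finset.prod_mul_distrib, ← Complex.exp_nat_mul, ← Complex.exp_sum]
  congr 2
  rw [monomialRate, Finset.sum_mul, ← Finset.sum_neg_distrib]
  exact Finset.sum_congr rfl fun s _ => by ring

/-- The part of a relation that has exponential rate `e`. -/
def slice (κ : ℂ) (o : σ → ℕ+) (e : ℂ) (A : (σ → ℕ) → ExpPoly) (β : σ → ℕ) : ExpPoly :=
  AddMonoidAlgebra.single (e - monomialRate κ o β) ((A β).coeff (e - monomialRate κ o β))

theorem slice_eq_zero {κ : ℂ} {o : σ → ℕ+} {e : ℂ} {A : (σ → ℕ) → ExpPoly} {β : σ → ℕ} :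
    slice κ o e A β = 0 ↔ (A β).coeff (e - monomialRate κ o β) = 0 :=
  AddMonoidAlgebra.single_eq_zero

/-- Each `dirGamma` is its exponential times a tame function, so the relation is an exponential sum
with tame coefficients. Uniqueness makes the coefficient of every exponential vanish separately. -/
theorem DirRelation.slice {κ : ℂ} (hκ : ‖κ‖ = 1) {o : σ → ℕ+} (ho : ∀ s, 1 < o s)
    (hadm : Admissible o κ) {S : Finset (σ → ℕ)} {A : (σ → ℕ) → ExpPoly}
    (h : DirRelation κ o S A) (e : ℂ) : DirRelation κ o S (slice κ o e A) := by
  classical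
  set T : σ → tame κ := fun s => ⟨_, isTame_dirGamma hκ (ho s) (hadm s)⟩ with hT
  have hTz : ∀ (β : σ → ℕ) (z : ℂ), ((∏ s, T s ^ β s : tame κ) : ℂ → ℂ) z =
      Complex.exp (-(monomialRate κ o β * z)) * ∏ s, dirGamma κ (o s) z ^ β s := fun β z => by
    rw [← prod_normalized]
    have := map_prod ((Pi.evalAlgHom ℂ (fun _ : ℂ => ℂ) z).comp (tame κ).val)
      (fun s => T s ^ β s) Finset.univ
    simp only [map_pow] at this
    exact this
  set Q : AddMonoidAlgebra (tame κ) ℂ := ∑ β ∈ S,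
    expTame κ (A β) * AddMonoidAlgebra.single (monomialRate κ o β) (∏ s, T s ^ β s) with hQ
  have hQz : ∀ z ∈ halfPlane κ, expSum κ Q z = 0 := fun z hz => by
    rw [hQ, map_sum, Finset.sum_apply, ← h z hz]
    refine Finset.sum_congr rfl fun β _ => ?_
    rw [map_mul, Pi.mul_apply, expSum_expTame, expSum_single, hTz, ← mul_assoc (Complex.exp _),
      ← Complex.exp_add, add_neg_cancel, Complex.exp_zero, one_mul]
  intro z hz
  have h1 := coeff_eq_zero_of_superDecay hκ Q (superDecay_of_eqOn_zero hκ hQz) e z hz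
  have h2 : (Q.coeff e : ℂ → ℂ) z = ∑ β ∈ S,
      laurentEval z ((A β).coeff (e - monomialRate κ o β)) *
        (Complex.exp (-(monomialRate κ o β * z)) * ∏ s, dirGamma κ (o s) z ^ β s) := by
    have h3 : Q.coeff e = ∑ β ∈ S,
        laurentTame κ ((A β).coeff (e - monomialRate κ o β)) * ∏ s, T s ^ β s := by
      rw [hQ, AddMonoidAlgebra.coeff_sum, Finsupp.finsetSum_apply]
      refine Finset.sum_congr rfl fun β _ => ?_
      rw [AddMonoidAlgebra.coeff_mul_single_eq_coeff_mul (e - monomialRate κ o β)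
        (fun m _ => eq_sub_iff_add_eq.symm), expTame, AddMonoidAlgebra.coeff_mapAlgHom]
    have h4 := map_sum ((Pi.evalAlgHom ℂ (fun _ : ℂ => ℂ) z).comp (tame κ).val)
      (fun β => laurentTame κ ((A β).coeff (e - monomialRate κ o β)) * ∏ s, T s ^ β s) S
    rw [h3]
    refine Eq.trans h4 (Finset.sum_congr rfl fun β _ => ?_)
    rw [map_mul]
    exact congrArg₂ (· * ·) (laurentTame_apply _ _ _) (hTz β z)
  rw [h2] at h1
  calc ∑ β ∈ S, expEval z (_root_.slice κ o e A β) * ∏ s, dirGamma κ (o s) z ^ β s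
      = Complex.exp (e * z) * ∑ β ∈ S, laurentEval z ((A β).coeff (e - monomialRate κ o β)) *
        (Complex.exp (-(monomialRate κ o β * z)) * ∏ s, dirGamma κ (o s) z ^ β s) := by
        rw [Finset.mul_sum]
        refine Finset.sum_congr rfl fun β _ => ?_
        rw [_root_.slice, expEval_single, sub_mul, sub_eq_add_neg (e * z), Complex.exp_add]
        ring
    _ = 0 := by rw [h1, mul_zero]

theorem EulerRelation.of_halfPlane {κ : ℂ} (hκ : ‖κ‖ = 1) {o : σ → ℕ+} {S : Finset (σ → ℕ)}
    {A : (σ → ℕ) → ExpPoly}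
    (h : ∀ z ∈ halfPlane κ, ∑ β ∈ S, expEval z (A β) * ∏ s, eulerian (o s) z ^ β s = 0) :
    EulerRelation o S A := by
  refine fun z hz => eq_zero_of_eqOn_halfPlane hκ (f := fun z => ∑ β ∈ S,
    expEval z (A β) * ∏ s, eulerian (o s) z ^ β s) (fun z hz => ?_) h hz
  refine DifferentiableAt.fun_sum fun β _ => (differentiableAt_expEval _ hz).mul ?_
  exact DifferentiableAt.fun_finsetProd fun s _ => ((differentiable_eulerian _) z).pow _

/-- `eulerian` is `dirSinc` times `dirGamma`; multiplying by a common power N of the `dirSinc`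
avoids dividing by them and, in a domain, does not change which coefficients vanish. -/
theorem DirRelation.toEuler {κ : ℂ} (hκ : ‖κ‖ = 1) {o : σ → ℕ+}
    (hadm : Admissible o κ) {S : Finset (σ → ℕ)} {A : (σ → ℕ) → ExpPoly}
    (h : DirRelation κ o S A) :
    ∃ A' : (σ → ℕ) → ExpPoly, EulerRelation o S A' ∧ ∀ β, A' β = 0 ↔ A β = 0 := by
  set N := S.sup fun β => Finset.univ.sup β with hN
  have hle : ∀ β ∈ S, ∀ s, β s ≤ N := fun β hβ s =>
    (Finset.le_sup (f := β) (Finset.mem_univ s)).trans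
      (Finset.le_sup (f := fun β : σ → ℕ => Finset.univ.sup β) hβ)
  refine ⟨fun β => A β * ∏ s, dirSinc κ (o s) ^ (N - β s), ?_, fun β => ?_⟩
  · refine EulerRelation.of_halfPlane hκ fun z hz => ?_
    · have : ∀ β ∈ S, expEval z (A β * ∏ s, dirSinc κ (o s) ^ (N - β s)) *
          ∏ s, eulerian (o s) z ^ β s = (∏ s, expEval z (dirSinc κ (o s)) ^ N) *
            (expEval z (A β) * ∏ s, dirGamma κ (o s) z ^ β s) := fun β hβ => by
        rw [map_mul, map_prod, mul_assoc, ← Finset.prod_mul_distrib, mul_left_comm,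
          ← Finset.prod_mul_distrib]
        congr 1
        refine Finset.prod_congr rfl fun s _ => ?_
        rw [eulerian_eq_dirSinc_mul hκ (hadm s) hz, map_pow, mul_pow, ← mul_assoc, ← pow_add,
          Nat.sub_add_cancel (hle β hβ s)]
      rw [Finset.sum_congr rfl this, ← Finset.mul_sum, h z hz, mul_zero]
  · refine ⟨fun h0 => (mul_eq_zero.1 h0).resolve_right ?_, fun h0 => mul_eq_zero_of_left h0 _⟩
    exact Finset.prod_ne_zero_iff.2 fun s _ => pow_ne_zero _ (dirSinc_ne_zero _ _)

theorem EulerRelation.toDir {κ : ℂ} (hκ : ‖κ‖ = 1) {o : σ → ℕ+}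
    (hadm : Admissible o κ) {S : Finset (σ → ℕ)} {A : (σ → ℕ) → ExpPoly}
    (h : EulerRelation o S A) :
    DirRelation κ o S fun β => A β * ∏ s, dirSinc κ (o s) ^ β s := by
  intro z hz
  rw [← h z (ne_zero_of_mem_halfPlane hz)]
  refine Finset.sum_congr rfl fun β _ => ?_
  rw [map_mul, map_prod, mul_assoc, ← Finset.prod_mul_distrib]
  congr 1
  refine Finset.prod_congr rfl fun s _ => ?_
  rw [eulerian_eq_dirSinc_mul hκ (hadm s) hz, map_pow, mul_pow]

end Relations

/-! ### Crossing a wall -/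

theorem re_mul_exp (d : ℂ) (θ : ℝ) :
    (d * Complex.exp (θ * Complex.I)).re = d.re * Real.cos θ - d.im * Real.sin θ := by
  rw [Complex.mul_re, Complex.exp_ofReal_mul_I_re, Complex.exp_ofReal_mul_I_im]

theorem eventually_re_mul_exp_neg_ne_zero {d : ℂ} (hd : d ≠ 0) :
    ∀ᶠ θ : ℝ in 𝓝[>] 0, (d * Complex.exp ((-θ : ℝ) * Complex.I)).re ≠ 0 := by
  have h := eventually_re_mul_exp_ne_zero ((map_ne_zero (starRingEnd ℂ)).2 hd)
  filter_upwards [h] with θ hθ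
  rw [re_mul_exp, Complex.conj_re, Complex.conj_im] at hθ
  rwa [re_mul_exp, Real.cos_neg, Real.sin_neg, mul_neg, ← neg_mul]

theorem eventually_re_mul_exp_pos_iff {d : ℂ} (hd : d.re ≠ 0) :
    ∀ᶠ θ : ℝ in 𝓝 0, 0 < (d * Complex.exp (θ * Complex.I)).re ↔ 0 < d.re := by
  have hc : Continuous fun θ : ℝ => (d * Complex.exp (θ * Complex.I)).re := by
    simp only [re_mul_exp]
    fun_prop
  have ht := hc.tendsto 0
  simp only [Complex.ofReal_zero, zero_mul, Complex.exp_zero, mul_one] at ht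
  rcases lt_or_gt_of_ne hd with h | h
  · filter_upwards [ht.eventually_lt_const h] with θ hθ
    exact iff_of_false (not_lt.2 hθ.le) (not_lt.2 h.le)
  · filter_upwards [ht.eventually_const_lt h] with θ hθ
    exact iff_of_true hθ h

/-- The quotient ρ/ρ₀ is a real root of unity of odd order, hence 1. Oddness excludes -1, so the
wall of ρ₀ belongs to no other root. -/
theorem eq_of_re_mul_I_eq_zero {ρ ρ₀ : ℂ} {r n : ℕ} (hr : Odd r) (hn : Odd n) (hρ : ρ ^ r = 1)
    (hρ₀ : ρ₀ ^ n = 1) (h : (ρ * (Complex.I * ρ₀⁻¹)).re = 0) : ρ = ρ₀ := by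
  have h0 : ρ₀ ≠ 0 := fun h => by
    rw [h, zero_pow (by rintro rfl; simp at hn)] at hρ₀
    exact zero_ne_one hρ₀
  set w := ρ * ρ₀⁻¹ with hw
  have hwp : w ^ (r * n) = 1 := by
    rw [hw, mul_pow, inv_pow, pow_mul, hρ, one_pow, mul_comm r n, pow_mul, hρ₀, one_pow, inv_one,
      one_mul]
  have him : w.im = 0 := by
    have : ρ * (Complex.I * ρ₀⁻¹) = w * Complex.I := by rw [hw]; ring
    rw [this] at h
    simpa using h
  have hwr : w = (w.re : ℂ) := Complex.ext rfl (by simpa using him)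
  have hodd : Odd (r * n) := hr.mul hn
  have h1 : w.re ^ (r * n) = 1 := by
    rw [hwr] at hwp
    exact_mod_cast hwp
  have h2 : w.re = 1 := by
    have h3 := hodd.strictMono_pow (R := ℝ) |>.injective
    exact h3 (h1.trans (one_pow _).symm)
  have h3 : w = 1 := by rw [hwr, h2, Complex.ofReal_one]
  rw [hw, ← div_eq_mul_inv, div_eq_one_iff_eq h0] at h3
  exact h3

/-- Rotating the direction `κ` through the wall of `ρ` multiplies the factor of `ρ` by a sinc. -/
theorem gammaFactor_cross {κ κ' ρ : ℂ} (hκ' : ‖κ'‖ = 1) (hρ : ‖ρ‖ = 1) (hpos : 0 < (ρ * κ).re)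
    (hneg : (ρ * κ').re < 0) {z : ℂ} (hz : z ∈ halfPlane κ') :
    gammaFactor κ ρ z = expEval z (sincPoly ρ) * gammaFactor κ' ρ z := by
  rw [gammaFactor, if_pos hpos]
  exact rGamma_eq_sinc_mul hκ' hρ hneg.ne (not_lt.2 hneg.le) hz

theorem dirGamma_cross {κ κ' ρ₀ : ℂ} {r : ℕ+} (hκ' : ‖κ'‖ = 1)
    (hsame : ∀ ρ ∈ signedRoots r, ρ ≠ ρ₀ → (0 < (ρ * κ).re ↔ 0 < (ρ * κ').re))
    (hpos : 0 < (ρ₀ * κ).re) (hneg : (ρ₀ * κ').re < 0) {z : ℂ} (hz : z ∈ halfPlane κ') :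
    dirGamma κ r z = (if ρ₀ ∈ signedRoots r then expEval z (sincPoly ρ₀) else 1) *
      dirGamma κ' r z := by
  classical
  rw [dirGamma, dirGamma]
  have : ∀ ρ ∈ signedRoots r, gammaFactor κ ρ z =
      (if ρ = ρ₀ then expEval z (sincPoly ρ₀) else 1) * gammaFactor κ' ρ z := fun ρ hρ => by
    split_ifs with h
    · subst h
      exact gammaFactor_cross hκ' (norm_of_mem_signedRoots hρ) hpos hneg hz
    · rw [one_mul, gammaFactor_congr (hsame ρ hρ h)]
  rw [Finset.prod_congr rfl this, Finset.prod_mul_distrib, Finset.prod_ite_eq']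

section Relations

variable {σ : Type} [Fintype σ]

/-- The wall is the direction κ₀ = i/ρ₀; the two directions are κ₀ turned by a small angle either
way, so that only ρ₀ changes side. -/
theorem exists_wall_crossing {o : σ → ℕ+} (ho : ∀ s, Odd (o s : ℕ)) {n : ℕ} (hn : Odd n) {ρ₀ : ℂ}
    (hρ₀ : ρ₀ ^ n = 1) : ∃ κ κ' : ℂ, ‖κ‖ = 1 ∧ ‖κ'‖ = 1 ∧ Admissible o κ ∧ Admissible o κ' ∧
      (∃ κ₀ : ℂ, κ₀ ∈ halfPlane κ ∧ κ₀ ∈ halfPlane κ') ∧ 0 < (ρ₀ * κ).re ∧ (ρ₀ * κ').re < 0 ∧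
      ∀ s, ∀ ρ ∈ signedRoots (o s), ρ ≠ ρ₀ → (0 < (ρ * κ).re ↔ 0 < (ρ * κ').re) := by
  have hn0 : n ≠ 0 := by rintro rfl; simp at hn
  have hρn : ‖ρ₀‖ = 1 := Complex.norm_eq_one_of_pow_eq_one hρ₀ hn0
  have hρ0 : ρ₀ ≠ 0 := norm_ne_zero_iff.1 (by rw [hρn]; exact one_ne_zero)
  set κ₀ := Complex.I * ρ₀⁻¹ with hκ₀
  have hκ₀n : ‖κ₀‖ = 1 := by rw [hκ₀, norm_mul, norm_inv, hρn, Complex.norm_I, inv_one, one_mul]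
  have hκ₀0 : κ₀ ≠ 0 := norm_ne_zero_iff.1 (by rw [hκ₀n]; exact one_ne_zero)
  have hroot : ∀ s, ∀ ρ ∈ signedRoots (o s), ρ ≠ 0 ∧ (ρ ≠ ρ₀ → (ρ * κ₀).re ≠ 0) := by
    intro s ρ hρ
    refine ⟨norm_ne_zero_iff.1 (by rw [norm_of_mem_signedRoots hρ]; exact one_ne_zero),
      fun hne h => hne (eq_of_re_mul_I_eq_zero (ho s) hn ?_ hρ₀ h)⟩
    rw [mem_signedRoots.1 hρ, (Nat.Odd.sub_odd (ho s) odd_one).neg_one_pow]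
  have hev : ∀ᶠ θ : ℝ in 𝓝[>] 0,
      (∀ s, ∀ ρ ∈ signedRoots (o s), (ρ * κ₀ * Complex.exp ((-θ : ℝ) * Complex.I)).re ≠ 0) ∧
      (∀ s, ∀ ρ ∈ signedRoots (o s), (ρ * κ₀ * Complex.exp (θ * Complex.I)).re ≠ 0) ∧
      (∀ s, ∀ ρ ∈ signedRoots (o s), ρ ≠ ρ₀ →
        (0 < (ρ * κ₀ * Complex.exp ((-θ : ℝ) * Complex.I)).re ↔
          0 < (ρ * κ₀ * Complex.exp (θ * Complex.I)).re)) ∧ θ ∈ Set.Ioo 0 (Real.pi / 2) := by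
    refine Eventually.and ?_ (Eventually.and ?_ (Eventually.and ?_ ?_))
    · rw [eventually_all]
      intro s
      rw [eventually_all_finset]
      exact fun ρ hρ => eventually_re_mul_exp_neg_ne_zero (mul_ne_zero (hroot s ρ hρ).1 hκ₀0)
    · rw [eventually_all]
      intro s
      rw [eventually_all_finset]
      exact fun ρ hρ => eventually_re_mul_exp_ne_zero (mul_ne_zero (hroot s ρ hρ).1 hκ₀0)
    · rw [eventually_all]
      intro s
      rw [eventually_all_finset]
      intro ρ hρ
      by_cases h : ρ = ρ₀
      · exact Eventually.of_forall fun _ h' => absurd h h'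
      have h1 := eventually_re_mul_exp_pos_iff ((hroot s ρ hρ).2 h)
      have hneg : Tendsto (fun θ : ℝ => -θ) (𝓝 0) (𝓝 0) := by
        simpa using (continuous_neg (G := ℝ)).tendsto 0
      refine nhdsWithin_le_nhds ?_
      filter_upwards [h1, hneg.eventually h1] with θ h2 h3 _
      exact h3.trans h2.symm
    · exact Ioo_mem_nhdsGT (by positivity)
  obtain ⟨θ, h1, h2, h3, h4, h5⟩ := hev.exists
  have hsin : 0 < Real.sin θ := Real.sin_pos_of_pos_of_lt_pi h4 (by linarith [Real.pi_pos])
  have hcos : 0 < Real.cos θ := Real.cos_pos_of_mem_Ioo ⟨by linarith, h5⟩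
  have hI : ρ₀ * κ₀ = Complex.I := by rw [hκ₀, mul_left_comm, mul_inv_cancel₀ hρ0, mul_one]
  have hnorm : ∀ θ : ℝ, ‖κ₀ * Complex.exp (θ * Complex.I)‖ = 1 := fun θ => by
    rw [norm_mul, hκ₀n, Complex.norm_exp_ofReal_mul_I, one_mul]
  have hdiv : ∀ θ : ℝ, κ₀ / (κ₀ * Complex.exp (θ * Complex.I)) =
      Complex.exp ((-θ : ℝ) * Complex.I) := fun θ => by
    rw [div_mul_cancel_left₀ hκ₀0, ← Complex.exp_neg, Complex.ofReal_neg, neg_mul]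
  refine ⟨κ₀ * Complex.exp ((-θ : ℝ) * Complex.I), κ₀ * Complex.exp (θ * Complex.I), hnorm _,
    hnorm _, fun s ρ hρ => ?_, fun s ρ hρ => ?_, ⟨κ₀, ?_, ?_⟩, ?_, ?_, fun s ρ hρ hne => ?_⟩
  · rw [← mul_assoc]
    exact h1 s ρ hρ
  · rw [← mul_assoc]
    exact h2 s ρ hρ
  · rw [mem_halfPlane, hdiv, Complex.exp_ofReal_mul_I_re, neg_neg]
    exact hcos
  · rw [mem_halfPlane, hdiv, Complex.exp_ofReal_mul_I_re, Real.cos_neg]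
    exact hcos
  · rw [← mul_assoc, hI, re_mul_exp, Real.sin_neg]
    simpa using hsin
  · rw [← mul_assoc, hI, re_mul_exp]
    simpa using hsin
  · rw [← mul_assoc ρ κ₀, ← mul_assoc ρ κ₀]
    exact h3 s ρ hρ hne

theorem exists_admissible (o : σ → ℕ+) : ∃ κ : ℂ, ‖κ‖ = 1 ∧ 0 < κ.re ∧ Admissible o κ := by
  have hev : ∀ᶠ θ : ℝ in 𝓝[>] 0,
      (∀ s, ∀ ρ ∈ signedRoots (o s), (ρ * Complex.exp (θ * Complex.I)).re ≠ 0) ∧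
        θ ∈ Set.Ioo 0 (Real.pi / 2) := by
    refine Eventually.and ?_ (Ioo_mem_nhdsGT (by positivity))
    rw [eventually_all]
    intro s
    rw [eventually_all_finset]
    intro ρ hρ
    exact eventually_re_mul_exp_ne_zero (norm_ne_zero_iff.1 (by
      rw [norm_of_mem_signedRoots hρ]; exact one_ne_zero))
  obtain ⟨θ, h1, h2, h3⟩ := hev.exists
  refine ⟨Complex.exp (θ * Complex.I), Complex.norm_exp_ofReal_mul_I θ, ?_, h1⟩
  rw [Complex.exp_ofReal_mul_I_re]
  exact Real.cos_pos_of_mem_Ioo ⟨by linarith [Real.pi_pos], h3⟩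

/-- Orders below o s₀ do not have ρ₀ among their roots and are unaffected. Order o s₀ contributes a
sinc to the power β s₀. In higher orders all monomials of S have the same exponents, so whatever
happens there is a common nonzero factor. The new relation first holds where the half-planes meet
and then extends analytically. -/
theorem DirRelation.cross {o : σ → ℕ+} (ho : Function.Injective o) {κ κ' ρ₀ : ℂ} (hκ : ‖κ‖ = 1)
    (hκ' : ‖κ'‖ = 1) (hadm : Admissible o κ) (hadm' : Admissible o κ')
    (hmeet : ∃ κ₀ : ℂ, κ₀ ∈ halfPlane κ ∧ κ₀ ∈ halfPlane κ')
    (hpos : 0 < (ρ₀ * κ).re) (hneg : (ρ₀ * κ').re < 0)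
    (hsame : ∀ s, ∀ ρ ∈ signedRoots (o s), ρ ≠ ρ₀ → (0 < (ρ * κ).re ↔ 0 < (ρ * κ').re))
    {s₀ : σ} (hs₀ : ρ₀ ∈ signedRoots (o s₀)) (hlow : ∀ s, o s < o s₀ → ρ₀ ∉ signedRoots (o s))
    {S : Finset (σ → ℕ)} (hconst : ∀ s, o s₀ < o s → ∀ β ∈ S, ∀ β' ∈ S, β s = β' s)
    {A : (σ → ℕ) → ExpPoly} (h : DirRelation κ o S A) :
    DirRelation κ' o S fun β => A β * sincPoly ρ₀ ^ β s₀ := by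
  classical
  rcases S.eq_empty_or_nonempty with rfl | ⟨β₀, hβ₀⟩
  · intro z _
    simp
  obtain ⟨κ₀, hκ₀, hκ₀'⟩ := hmeet
  have hd : DifferentiableOn ℂ (fun z => ∑ β ∈ S, expEval z (A β * sincPoly ρ₀ ^ β s₀) *
      ∏ s, dirGamma κ' (o s) z ^ β s) (halfPlane κ') := fun z hz => by
    refine (DifferentiableAt.fun_sum fun β _ =>
      (differentiableAt_expEval _ (ne_zero_of_mem_halfPlane hz)).mul ?_).differentiableWithinAt
    exact DifferentiableAt.fun_finsetProd fun s _ => (dirGamma_spec hκ' (hadm' s) hz).1.pow _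
  refine fun z hz => (hd.analyticOnNhd
    (isOpen_halfPlane κ')).eqOn_zero_of_preconnected_of_eventuallyEq_zero
    (convex_halfPlane κ').isPreconnected hκ₀' ?_ hz
  refine Filter.eventuallyEq_of_mem (((isOpen_halfPlane κ).inter (isOpen_halfPlane κ')).mem_nhds
    ⟨hκ₀, hκ₀'⟩) ?_
  rintro w ⟨hw, hw'⟩
  -- a and b collect the common factors of higher order before and after crossing;
  -- cross-multiplication avoids dividing by them.
  set a : ℂ := ∏ s, if o s₀ < o s then dirGamma κ (o s) w ^ β₀ s else 1 with ha
  set b : ℂ := ∏ s, if o s₀ < o s then dirGamma κ' (o s) w ^ β₀ s else 1 with hb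
  have ha0 : a ≠ 0 := by
    refine Finset.prod_ne_zero_iff.2 fun s _ => ?_
    split_ifs
    · exact pow_ne_zero _ (dirGamma_spec hκ (hadm s) hw).2
    · exact one_ne_zero
  have key : ∀ β ∈ S, a * (expEval w (A β * sincPoly ρ₀ ^ β s₀) *
      ∏ s, dirGamma κ' (o s) w ^ β s) =
      b * (expEval w (A β) * ∏ s, dirGamma κ (o s) w ^ β s) := fun β hβ => by
    have hq : expEval w (sincPoly ρ₀) ^ β s₀ =
        ∏ s, if s = s₀ then expEval w (sincPoly ρ₀) ^ β s else 1 := by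
      rw [Finset.prod_ite_eq' Finset.univ s₀ fun s => expEval w (sincPoly ρ₀) ^ β s,
        if_pos (Finset.mem_univ _)]
    have hprod : a * (expEval w (sincPoly ρ₀) ^ β s₀ * ∏ s, dirGamma κ' (o s) w ^ β s) =
        b * ∏ s, dirGamma κ (o s) w ^ β s := by
      rw [hq, ha, hb, ← Finset.prod_mul_distrib, ← Finset.prod_mul_distrib, ← Finset.prod_mul_distrib]
      refine Finset.prod_congr rfl fun s _ => ?_
      rcases lt_trichotomy (o s) (o s₀) with hlt | heq | hgt
      · have hne : s ≠ s₀ := fun h => by rw [h] at hlt; exact lt_irrefl _ hlt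
        have := dirGamma_cross hκ' (hsame s) hpos hneg hw'
        rw [if_neg (hlow s hlt), one_mul] at this
        rw [if_neg (not_lt.2 hlt.le), if_neg (not_lt.2 hlt.le), if_neg hne, one_mul, one_mul, this,
          one_mul]
      · have heq' : s = s₀ := ho heq
        subst heq'
        have := dirGamma_cross hκ' (hsame s) hpos hneg hw'
        rw [if_pos hs₀] at this
        rw [if_neg (lt_irrefl _), if_neg (lt_irrefl _), if_pos rfl, one_mul, one_mul, this, mul_pow]
      · have hne : s ≠ s₀ := fun h => by rw [h] at hgt; exact lt_irrefl _ hgt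
        rw [if_pos hgt, if_pos hgt, if_neg hne, one_mul, hconst s hgt β hβ β₀ hβ₀, mul_comm]
    rw [map_mul, map_pow]
    calc _ = expEval w (A β) * (a * (expEval w (sincPoly ρ₀) ^ β s₀ *
          ∏ s, dirGamma κ' (o s) w ^ β s)) := by ring
      _ = _ := by rw [hprod]; ring
  have h1 := h w hw
  have h2 : a * ∑ β ∈ S, expEval w (A β * sincPoly ρ₀ ^ β s₀) * ∏ s, dirGamma κ' (o s) w ^ β s =
      0 := by
    rw [Finset.mul_sum, Finset.sum_congr rfl key, ← Finset.mul_sum, h1, mul_zero]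
  exact (mul_eq_zero.1 h2).resolve_left ha0

/-- Induction on the number of monomials: a relation in which one coefficient vanishes is shorter,
hence trivial. Applied to slices, this forces all coefficients of a relation to have equally many
frequencies. If the monomials differ, let s₀ carry the largest order at which their exponents vary,
cut down to one frequency per coefficient, and cross the wall of a primitive root of order o s₀. The
coefficients then have β s₀ + 1 frequencies, which varies with β: a contradiction. A single monomial
does not vanish on the half-plane, so its coefficient is zero. -/
theorem EulerRelation.eq_zero {o : σ → ℕ+} (hinj : Function.Injective o) (ho : ∀ s, 1 < o s)
    (hodd : ∀ s, Odd (o s : ℕ)) {S : Finset (σ → ℕ)} {A : (σ → ℕ) → ExpPoly}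
    (h : EulerRelation o S A) : ∀ β ∈ S, A β = 0 := by
  classical
  induction hn : S.card using Nat.strong_induction_on generalizing S A with
  | _ n ih =>
    have hallE : ∀ A' : (σ → ℕ) → ExpPoly, EulerRelation o S A' → (∃ β ∈ S, A' β = 0) →
        ∀ β ∈ S, A' β = 0 := by
      rintro A' hA' ⟨β₁, hβ₁, h1⟩ β hβ
      by_contra hne
      have hlt : (S.filter fun β => A' β ≠ 0).card < n := by
        rw [← hn]
        refine Finset.card_lt_card (Finset.filter_ssubset.2 ⟨β₁, hβ₁, ?_⟩)
        exact fun h => h h1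
      refine hne (ih _ hlt (A := A') (fun z hz => ?_) rfl β (Finset.mem_filter.2 ⟨hβ, hne⟩))
      rw [← hA' z hz, Finset.sum_filter]
      refine Finset.sum_congr rfl fun β _ => ?_
      split_ifs with h2
      · rfl
      · rw [not_not.1 h2, map_zero, zero_mul]
    have hall : ∀ κ : ℂ, ‖κ‖ = 1 → Admissible o κ → ∀ A' : (σ → ℕ) → ExpPoly,
        DirRelation κ o S A' → (∃ β ∈ S, A' β = 0) → ∀ β ∈ S, A' β = 0 := by
      rintro κ hκ hadm A' hA' ⟨β₁, hβ₁, h1⟩ β hβ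
      obtain ⟨A'', hA'', hiff⟩ := hA'.toEuler hκ hadm
      exact (hiff β).1 (hallE A'' hA'' ⟨β₁, hβ₁, (hiff β₁).2 h1⟩ β hβ)
    intro β₀ hβ₀
    by_contra hne
    have hnz : ∀ β ∈ S, A β ≠ 0 := fun β hβ h0 => hne (hallE A h ⟨β, hβ, h0⟩ β₀ hβ₀)
    -- A frequency of A' β, moved by the difference of the two monomial rates, must be a frequency
    -- of A' β'; otherwise the corresponding slice would have one zero coefficient and be trivial.
    have hslice : ∀ κ : ℂ, ‖κ‖ = 1 → Admissible o κ → ∀ A' : (σ → ℕ) → ExpPoly,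
        DirRelation κ o S A' → ∀ β ∈ S, ∀ β' ∈ S,
          (A' β).coeff.support.card ≤ (A' β').coeff.support.card := by
      intro κ hκ hadm A' hA' β hβ β' hβ'
      refine Finset.card_le_card_of_injOn
        (fun l => l + monomialRate κ o β - monomialRate κ o β') (fun l hl => ?_)
        (fun l _ l' _ hll => add_right_cancel (sub_left_injective hll))
      have hl' : (A' β).coeff l ≠ 0 := Finsupp.mem_support_iff.1 hl
      refine Finset.mem_coe.2 (Finsupp.mem_support_iff.2 fun h0 => hl' ?_)
      have h1 := hall κ hκ hadm _ (hA'.slice hκ ho hadm (l + monomialRate κ o β))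
        ⟨β', hβ', slice_eq_zero.2 h0⟩ β hβ
      rw [slice_eq_zero, add_sub_cancel_right] at h1
      exact h1
    have hconst : ∀ s, ∀ β ∈ S, ∀ β' ∈ S, β s = β' s := by
      by_contra! hex
      obtain ⟨s₁, hs₁⟩ := hex
      obtain ⟨s₀, hs₀, hmax⟩ := (Finset.univ.filter fun s => ∃ β ∈ S, ∃ β' ∈ S, β s ≠ β' s)
        |>.exists_max_image o ⟨s₁, Finset.mem_filter.2 ⟨Finset.mem_univ _, hs₁⟩⟩
      have hhigh : ∀ s, o s₀ < o s → ∀ β ∈ S, ∀ β' ∈ S, β s = β' s := by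
        intro s hs β hβ β' hβ'
        by_contra hne'
        exact absurd (hmax s (Finset.mem_filter.2 ⟨Finset.mem_univ _, β, hβ, β', hβ', hne'⟩))
          (not_le.2 hs)
      obtain ⟨β₁, hβ₁, β₂, hβ₂, h12⟩ := (Finset.mem_filter.1 hs₀).2
      set ρ₀ := Complex.exp (2 * Real.pi * Complex.I / (o s₀ : ℕ)) with hρ₀
      have hprim : IsPrimitiveRoot ρ₀ (o s₀ : ℕ) := Complex.isPrimitiveRoot_exp _ (o s₀).ne_zero
      have hρ₀0 : ρ₀ ≠ 0 := Complex.exp_ne_zero _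
      have hmem : ∀ s, ρ₀ ∈ signedRoots (o s) ↔ ρ₀ ^ (o s : ℕ) = 1 := fun s => by
        rw [mem_signedRoots, (Nat.Odd.sub_odd (hodd s) odd_one).neg_one_pow]
      obtain ⟨κ, κ', hκ, hκ', hadm, hadm', hmeet, hpos, hneg, hsame⟩ :=
        exists_wall_crossing hodd (hodd s₀) hprim.pow_eq_one
      have hR1 := h.toDir hκ hadm
      set A₁ : (σ → ℕ) → ExpPoly := fun β => A β * ∏ s, dirSinc κ (o s) ^ β s with hA₁
      have hA₁0 : A₁ β₀ ≠ 0 := mul_ne_zero (hnz β₀ hβ₀)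
        (Finset.prod_ne_zero_iff.2 fun s _ => pow_ne_zero _ (dirSinc_ne_zero _ _))
      obtain ⟨l, hl⟩ : ∃ l, (A₁ β₀).coeff l ≠ 0 := by
        by_contra! h0
        exact hA₁0 (AddMonoidAlgebra.coeff_injective (Finsupp.ext h0))
      set e := l + monomialRate κ o β₀ with he
      have hR2 := hR1.slice hκ ho hadm e
      have hA₂ : ∀ β ∈ S, (A₁ β).coeff (e - monomialRate κ o β) ≠ 0 := fun β hβ h0 => by
        have h1 := hall κ hκ hadm _ hR2 ⟨β, hβ, slice_eq_zero.2 h0⟩ β₀ hβ₀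
        rw [slice_eq_zero, he, add_sub_cancel_right] at h1
        exact hl h1
      have hR3 := hR2.cross hinj hκ hκ' hadm hadm' hmeet hpos hneg hsame
        ((hmem s₀).2 hprim.pow_eq_one) (fun s hs h1 => by
          have h2 := Nat.le_of_dvd (o s).pos (hprim.dvd_of_pow_eq_one _ ((hmem s).1 h1))
          exact absurd hs (not_lt.2 h2)) hhigh
      have hcard : ∀ β ∈ S, (slice κ o e A₁ β * sincPoly ρ₀ ^ β s₀).coeff.support.card = β s₀ + 1 :=
        fun β hβ => card_support_single_mul_sincPoly_pow hρ₀0 _ (hA₂ β hβ) _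
      have h3 := hslice κ' hκ' hadm' _ hR3 β₁ hβ₁ β₂ hβ₂
      have h4 := hslice κ' hκ' hadm' _ hR3 β₂ hβ₂ β₁ hβ₁
      simp only [hcard β₁ hβ₁, hcard β₂ hβ₂] at h3 h4
      omega
    have hS : S = {β₀} := Finset.eq_singleton_iff_unique_mem.2
      ⟨hβ₀, fun β hβ => funext fun s => hconst s β hβ β₀ hβ₀⟩
    obtain ⟨κ, hκ, -, hadm⟩ := exists_admissible o
    have hR := h.toDir hκ hadm
    have h0 : A β₀ * ∏ s, dirSinc κ (o s) ^ β₀ s = 0 := by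
      refine expPoly_eq_zero hκ fun z hz => ?_
      have h1 := hR z hz
      rw [hS, Finset.sum_singleton] at h1
      exact (mul_eq_zero.1 h1).resolve_right
        (Finset.prod_ne_zero_iff.2 fun s _ => pow_ne_zero _ (dirGamma_spec hκ (hadm s) hz).2)
    exact hne ((mul_eq_zero.1 h0).resolve_right
      (Finset.prod_ne_zero_iff.2 fun s _ => pow_ne_zero _ (dirSinc_ne_zero _ _)))

end Relations

/-! ### Algebraic independence of the functions `eulerian r` for even `r` -/

theorem totalDegree_pderiv_le {M : Type*} {n : ℕ} {P : MvPolynomial M ℂ}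
    (hP : P.totalDegree ≤ n + 1) (m : M) : (MvPolynomial.pderiv m P).totalDegree ≤ n := by
  refine Finset.sup_le fun d hd => ?_
  rw [MvPolynomial.mem_support_iff, MvPolynomial.coeff_pderiv] at hd
  have h1 := MvPolynomial.le_totalDegree (MvPolynomial.mem_support_iff.2 (left_ne_zero_of_mul hd))
  rw [Finsupp.sum_add_index' (fun _ => rfl) (fun _ _ _ => rfl), Finsupp.sum_single_index rfl] at h1
  omega

theorem eq_C_of_pderiv_eq_zero {M : Type*} {P : MvPolynomial M ℂ}
    (h : ∀ m, MvPolynomial.pderiv m P = 0) : P = MvPolynomial.C (MvPolynomial.coeff 0 P) := by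
  classical
  ext d
  rw [MvPolynomial.coeff_C]
  split_ifs with hd
  · rw [hd]
  · obtain ⟨i, hi⟩ := Finsupp.ne_iff.1 (Ne.symm hd)
    have h1 := congrArg (MvPolynomial.coeff (d - Finsupp.single i 1)) (h i)
    have hle : Finsupp.single i 1 ≤ d :=
      Finsupp.single_le_iff.2 (Nat.one_le_iff_ne_zero.2 hi)
    rw [MvPolynomial.coeff_pderiv, MvPolynomial.coeff_zero, tsub_add_cancel_of_le hle] at h1
    exact (mul_eq_zero.1 h1).resolve_right (Nat.cast_add_one_ne_zero _)

theorem pderiv_aeval {M : Type*} [Fintype M] (X : M → MvPolynomial M ℂ) (k : M)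
    (P : MvPolynomial M ℂ) : MvPolynomial.pderiv k (MvPolynomial.aeval X P) =
      ∑ m, MvPolynomial.aeval X (MvPolynomial.pderiv m P) * MvPolynomial.pderiv k (X m) := by
  classical
  induction P using MvPolynomial.induction_on with
  | C a => simp [MvPolynomial.algebraMap_eq]
  | add p q hp hq => simp only [map_add, hp, hq, add_mul, Finset.sum_add_distrib]
  | mul_X p n hp =>
    have h1 : ∀ m, MvPolynomial.aeval X (MvPolynomial.pderiv m (p * MvPolynomial.X n)) *
        MvPolynomial.pderiv k (X m) = (if n = m then
          MvPolynomial.aeval X p * MvPolynomial.pderiv k (X m) else 0) +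
        X n * (MvPolynomial.aeval X (MvPolynomial.pderiv m p) * MvPolynomial.pderiv k (X m)) := by
      intro m
      rw [Derivation.leibniz, smul_eq_mul, smul_eq_mul, map_add, map_mul, map_mul,
        MvPolynomial.aeval_X]
      split_ifs with h
      · rw [h, MvPolynomial.pderiv_X_self, map_one]
        ring
      · rw [MvPolynomial.pderiv_X_of_ne h, map_zero]
        ring
    rw [Finset.sum_congr rfl fun m _ => h1 m, Finset.sum_add_distrib, Finset.sum_ite_eq,
      if_pos (Finset.mem_univ _), ← Finset.mul_sum, ← hp, map_mul, MvPolynomial.aeval_X,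
      Derivation.leibniz, smul_eq_mul, smul_eq_mul]

/-- Polynomials whose Jacobian matrix is invertible at the origin satisfy no relation. -/
theorem algebraicIndependent_of_jacobian {M : Type*} [Fintype M] [DecidableEq M]
    (X : M → MvPolynomial M ℂ)
    (hdet : (Matrix.of fun m k => MvPolynomial.eval 0 (MvPolynomial.pderiv k (X m))).det ≠ 0)
    {P : MvPolynomial M ℂ} (hP : MvPolynomial.aeval X P = 0) : P = 0 := by
  set J : Matrix M M (MvPolynomial M ℂ) := Matrix.of fun m k => MvPolynomial.pderiv k (X m) with hJ
  have hJdet : J.det ≠ 0 := fun h0 => hdet (by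
    have h1 := RingHom.map_det (MvPolynomial.eval (0 : M → ℂ)) J
    rw [h0, map_zero] at h1
    exact h1.symm)
  -- By the chain rule the vector of partial derivatives of a relation is annihilated by the
  -- Jacobian, so each of them is again a relation, of smaller degree.
  have hder : ∀ Q : MvPolynomial M ℂ, MvPolynomial.aeval X Q = 0 →
      ∀ m, MvPolynomial.aeval X (MvPolynomial.pderiv m Q) = 0 := fun Q hQ => by
    have h1 : Matrix.vecMul (fun m => MvPolynomial.aeval X (MvPolynomial.pderiv m Q)) J = 0 := by
      funext k
      have h2 := pderiv_aeval X k Q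
      rw [hQ, map_zero] at h2
      exact h2.symm
    exact fun m => congrFun (Matrix.eq_zero_of_vecMul_eq_zero hJdet h1) m
  have hC : ∀ Q : MvPolynomial M ℂ, MvPolynomial.aeval X Q = 0 → ∀ a, Q = MvPolynomial.C a →
      Q = 0 := fun Q hQ a ha => by
    rw [ha, MvPolynomial.aeval_C, MvPolynomial.algebraMap_eq, MvPolynomial.C_eq_zero] at hQ
    rw [ha, hQ, MvPolynomial.C_0]
  have main : ∀ n : ℕ, ∀ Q : MvPolynomial M ℂ, Q.totalDegree ≤ n → MvPolynomial.aeval X Q = 0 →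
      Q = 0 := fun n => by
    induction n with
    | zero =>
      intro Q hn hQ
      exact hC Q hQ _ (MvPolynomial.totalDegree_eq_zero_iff_eq_C.1 (Nat.le_zero.1 hn))
    | succ n ih =>
      intro Q hn hQ
      exact hC Q hQ _ (eq_C_of_pderiv_eq_zero fun m =>
        ih _ (totalDegree_pderiv_le hn m) (hder Q hQ m))
  exact main _ P le_rfl hP

theorem eval_pderiv_prod {M : Type*} {ι : Type*} (W : Finset ι) (f : ι → MvPolynomial M ℂ)
    (hf : ∀ w ∈ W, MvPolynomial.eval 0 (f w) = 1) (k : M) :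
    MvPolynomial.eval 0 (MvPolynomial.pderiv k (∏ w ∈ W, f w)) =
      ∑ w ∈ W, MvPolynomial.eval 0 (MvPolynomial.pderiv k (f w)) := by
  classical
  induction W using Finset.induction_on with
  | empty => simp
  | insert a W ha ih =>
    have h1 : ∀ w ∈ W, MvPolynomial.eval 0 (f w) = 1 := fun w hw =>
      hf w (Finset.mem_insert_of_mem hw)
    rw [Finset.prod_insert ha, Finset.sum_insert ha, Derivation.leibniz, smul_eq_mul, smul_eq_mul,
      map_add, map_mul, map_mul, ih h1, hf a (Finset.mem_insert_self _ _), map_prod,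
      Finset.prod_eq_one h1]
    ring

/-- Galois conjugation of roots of unity extends to an additive map. -/
theorem exists_additive_pow {N b : ℕ} (hN : 0 < N) (hb : Nat.Coprime b N) :
    ∃ φ : ℂ →+ ℂ, ∀ w : ℂ, w ^ N = 1 → φ w = w ^ b := by
  set ζ := Complex.exp (2 * Real.pi * Complex.I / N) with hζdef
  have hζ : IsPrimitiveRoot ζ N := Complex.isPrimitiveRoot_exp N hN.ne'
  have hζb : IsPrimitiveRoot (ζ ^ b) N := hζ.pow_of_coprime b hb
  have hint : IsIntegral ℚ ζ := (hζ.isIntegral hN).tower_top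
  set pb := IntermediateField.adjoin.powerBasis hint with hpb
  have hgen : pb.gen = IntermediateField.AdjoinSimple.gen ℚ ζ :=
    IntermediateField.adjoin.powerBasis_gen hint
  -- ζ and ζ^b are both primitive, so they share the same cyclotomic polynomial.
  have hy : Polynomial.aeval (ζ ^ b) (minpoly ℚ pb.gen) = 0 := by
    have hmin : minpoly ℚ pb.gen = minpoly ℚ ζ := by
      rw [hgen]
      exact IntermediateField.minpoly_gen ℚ ζ
    rw [hmin, ← Polynomial.cyclotomic_eq_minpoly_rat hζ hN,
      Polynomial.cyclotomic_eq_minpoly_rat hζb hN]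
    exact minpoly.aeval _ _
  set f := pb.lift (ζ ^ b) hy with hf
  have hfg : f (IntermediateField.AdjoinSimple.gen ℚ ζ) = ζ ^ b := by
    rw [← hgen]
    exact pb.lift_gen _ hy
  -- Only additivity is needed outside ℚ(ζ), so a ℚ-linear extension suffices.
  obtain ⟨g, hg⟩ := LinearMap.exists_extend
    (p := Subalgebra.toSubmodule (IntermediateField.adjoin ℚ {ζ}).toSubalgebra) f.toLinearMap
  refine ⟨g.toAddMonoidHom, fun w hw => ?_⟩
  have : NeZero N := ⟨hN.ne'⟩
  obtain ⟨i, -, rfl⟩ := hζ.eq_pow_of_pow_eq_one hw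
  have h1 := LinearMap.congr_fun hg (IntermediateField.AdjoinSimple.gen ℚ ζ ^ i)
  have h2 : f (IntermediateField.AdjoinSimple.gen ℚ ζ ^ i) = (ζ ^ i) ^ b := by
    rw [map_pow, hfg, pow_right_comm]
  exact h1.trans h2

/-- The first property makes the sums of ρ^(2j) detect divisibility of k; the second makes w ↦
w^(1+2j) a Galois conjugation on the roots involved. -/
theorem exists_exponent (R : ℕ) {k : ℕ} (hk : 0 < k) :
    ∃ j : ℕ, (∀ m, 0 < m → m ≤ R → (m ∣ j ↔ m ∣ k)) ∧ Nat.Coprime (1 + 2 * j) (4 * R.factorial) := by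
  set s := (Finset.range (R + 1)).filter fun p => p.Prime ∧ ¬ p ∣ 2 * k with hs
  set Q := ∏ p ∈ s, p with hQ
  have hQpos : 0 < Q := Finset.prod_pos fun p hp => (Finset.mem_filter.1 hp).2.1.pos
  have hco : Nat.Coprime Q (2 * k * k) := by
    refine Nat.Coprime.prod_left fun p hp => ?_
    obtain ⟨-, hp1, hp2⟩ := Finset.mem_filter.1 hp
    refine (Nat.Prime.coprime_iff_not_dvd hp1).2 fun h => ?_
    rcases (Nat.Prime.dvd_mul hp1).1 h with h | h
    · exact hp2 h
    · exact hp2 (h.mul_left 2)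
  -- j ≡ k mod 2k² gives j = kc with c ≡ 1 mod 2k, so primes dividing 2k do not divide c. j ≡ -1
  -- modulo the remaining primes up to R keeps them away from j and makes 1 + 2j ≡ -1.
  obtain ⟨j, hj1, hj2⟩ := Nat.chineseRemainder hco (Q - 1) k
  have hj1' : Q ∣ j + 1 := by
    have h1 : j + 1 ≡ Q - 1 + 1 [MOD Q] := hj1.add_right 1
    rw [Nat.sub_add_cancel hQpos] at h1
    exact (Nat.modEq_zero_iff_dvd).1 (h1.trans (by simp [Nat.ModEq]))
  have hkj : k ∣ j := by
    have h1 := hj2.dvd_iff (d := k) (Dvd.intro_left _ rfl)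
    exact h1.2 dvd_rfl
  obtain ⟨c, rfl⟩ := hkj
  have hc2 : c ≡ 1 [MOD 2 * k] := by
    have h1 : k * c ≡ k * 1 [MOD k * (2 * k)] := by
      rw [mul_one, mul_comm k (2 * k)]
      exact hj2
    exact Nat.ModEq.mul_left_cancel' hk.ne' h1
  have hprime : ∀ p, p.Prime → p ≤ R ∨ p = 2 → ¬ p ∣ 2 * k → p ∣ k * c + 1 := fun p hp hR h => by
    refine dvd_trans (Finset.dvd_prod_of_mem (fun p => p) (Finset.mem_filter.2 ⟨?_, hp, h⟩)) hj1'
    rcases hR with hR | rfl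
    · exact Finset.mem_range.2 (Nat.lt_succ_of_le hR)
    · exact absurd (Dvd.intro _ rfl) h
  have hcp : ∀ p, p.Prime → p ∣ 2 * k → ¬ p ∣ c := fun p hp h hc => by
    have h1 := (hc2.dvd_iff h).1 hc
    exact hp.one_lt.ne' (Nat.dvd_one.1 h1)
  refine ⟨k * c, fun m hm hmR => ⟨fun h => ?_, fun h => h.mul_right c⟩, ?_⟩
  · refine Nat.Coprime.dvd_of_dvd_mul_right (n := c) (Nat.Coprime.symm ?_) h
    refine Nat.coprime_of_dvd fun p hp hpc hpm => ?_
    have hpR : p ≤ R := (Nat.le_of_dvd hm hpm).trans hmR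
    by_cases h2 : p ∣ 2 * k
    · exact hcp p hp h2 hpc
    · have h3 := hprime p hp (Or.inl hpR) h2
      have h4 := (Nat.dvd_add_right (hpc.mul_left k)).1 h3
      exact hp.one_lt.ne' (Nat.dvd_one.1 h4)
  · refine Nat.coprime_of_dvd fun p hp hpb hpN => ?_
    have hpR : p ≤ R ∨ p = 2 := by
      rcases (Nat.Prime.dvd_mul hp).1 hpN with h | h
      · right
        have : p ∣ 2 ^ 2 := by simpa using h
        exact (Nat.prime_dvd_prime_iff_eq hp Nat.prime_two).1 (hp.dvd_of_dvd_pow this)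
      · exact Or.inl ((Nat.Prime.dvd_factorial hp).1 h)
    by_cases h2 : p ∣ 2 * k
    · have h3 : p ∣ 2 * (k * c) := by
        rw [← mul_assoc]
        exact h2.mul_right c
      have h4 := (Nat.dvd_add_left h3).1 hpb
      exact hp.one_lt.ne' (Nat.dvd_one.1 h4)
    · have h3 := hprime p hp hpR h2
      have h4 : p ∣ 2 * (k * c + 1) := h3.mul_left 2
      have h5 : 2 * (k * c + 1) = 1 + 2 * (k * c) + 1 := by ring
      rw [h5] at h4
      have h6 := (Nat.dvd_add_right hpb).1 h4
      exact hp.one_lt.ne' (Nat.dvd_one.1 h6)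

/-! ### Functions of even order as products of sincs -/

/-- The half of `signedRoots r` in the half-plane rotated by `κ`. -/
def halfRoots (κ : ℂ) (r : ℕ+) : Finset ℂ := (signedRoots r).filter fun ρ => 0 < (ρ * κ).re

theorem neg_mem_signedRoots {r : ℕ+} (hr : Even (r : ℕ)) {ρ : ℂ} (h : ρ ∈ signedRoots r) :
    -ρ ∈ signedRoots r := by
  rw [mem_signedRoots] at h ⊢
  rw [hr.neg_pow, h]

/-- The roots outside `halfRoots κ r` are the opposites of those inside. -/
theorem neg_mem_compl_halfRoots {κ : ℂ} {r : ℕ+} (hr : Even (r : ℕ))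
    (h : ∀ ρ ∈ signedRoots r, (ρ * κ).re ≠ 0) {ρ : ℂ} :
    -ρ ∈ (signedRoots r).filter (fun ρ => ¬ 0 < (ρ * κ).re) ↔ ρ ∈ halfRoots κ r := by
  rw [halfRoots, Finset.mem_filter, Finset.mem_filter, neg_mul, Complex.neg_re]
  constructor
  · rintro ⟨h1, h2⟩
    have h3 : ρ ∈ signedRoots r := by simpa using neg_mem_signedRoots hr h1
    exact ⟨h3, lt_of_le_of_ne (by linarith) (h ρ h3).symm⟩
  · rintro ⟨h1, h2⟩
    exact ⟨neg_mem_signedRoots hr h1, by linarith⟩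

theorem sum_halfRoots {κ : ℂ} {r : ℕ+} (hr : Even (r : ℕ))
    (h : ∀ ρ ∈ signedRoots r, (ρ * κ).re ≠ 0) (f : ℂ → ℂ) :
    ∑ ρ ∈ signedRoots r, f ρ = ∑ ρ ∈ halfRoots κ r, (f ρ + f (-ρ)) := by
  rw [← Finset.sum_filter_add_sum_filter_not (signedRoots r) fun ρ => 0 < (ρ * κ).re,
    Finset.sum_add_distrib]
  refine congrArg₂ (· + ·) rfl ?_
  symm
  refine Finset.sum_nbij' (fun ρ => -ρ) (fun ρ => -ρ) (fun ρ hρ =>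
    (neg_mem_compl_halfRoots hr h).2 hρ) (fun ρ hρ => ?_) (fun ρ _ => neg_neg ρ)
    (fun ρ _ => neg_neg ρ) (fun ρ _ => rfl)
  rw [← neg_mem_compl_halfRoots hr h, neg_neg]
  exact hρ

theorem prod_halfRoots {κ : ℂ} {r : ℕ+} (hr : Even (r : ℕ))
    (h : ∀ ρ ∈ signedRoots r, (ρ * κ).re ≠ 0) (f : ℂ → ℂ) :
    ∏ ρ ∈ signedRoots r, f ρ = ∏ ρ ∈ halfRoots κ r, (f ρ * f (-ρ)) := by
  rw [← Finset.prod_filter_mul_prod_filter_not (signedRoots r) fun ρ => 0 < (ρ * κ).re,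
    Finset.prod_mul_distrib]
  refine congrArg₂ (· * ·) rfl ?_
  symm
  refine Finset.prod_nbij' (fun ρ => -ρ) (fun ρ => -ρ) (fun ρ hρ =>
    (neg_mem_compl_halfRoots hr h).2 hρ) (fun ρ hρ => ?_) (fun ρ _ => neg_neg ρ)
    (fun ρ _ => neg_neg ρ) (fun ρ _ => rfl)
  rw [← neg_mem_compl_halfRoots hr h, neg_neg]
  exact hρ

theorem ne_zero_of_mem_signedRoots {r : ℕ+} {ρ : ℂ} (h : ρ ∈ signedRoots r) : ρ ≠ 0 :=
  norm_ne_zero_iff.1 (by rw [norm_of_mem_signedRoots h]; exact one_ne_zero)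

/-- `eulerian r` for even `r`, as an exponential polynomial. -/
def evenPoly (κ : ℂ) (r : ℕ+) : ExpPoly := ∏ ρ ∈ halfRoots κ r, sincPoly ρ

theorem eulerian_eq_evenPoly {κ : ℂ} {r : ℕ+} (hr : Even (r : ℕ))
    (h : ∀ ρ ∈ signedRoots r, (ρ * κ).re ≠ 0) {z : ℂ} (hz : z ≠ 0) :
    eulerian r z = expEval z (evenPoly κ r) := by
  rw [eulerian, prod_halfRoots hr h fun ρ => rGamma (ρ * z), evenPoly, map_prod]
  refine Finset.prod_congr rfl fun ρ hρ => ?_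
  have hρ0 := ne_zero_of_mem_signedRoots (Finset.mem_filter.1 hρ).1
  rw [expEval_sincPoly hz, neg_mul, rGamma_mul_rGamma_neg (mul_ne_zero hρ0 hz)]

/-- The twisted sinc is sinh(iπφ(ρ)z)/(iπρz), whose limit at 0 is a quotient of slopes. -/
theorem tendsto_twistedEval_sincPoly (φ Φ : ℂ →+ ℂ)
    (hΦ : ∀ x, Φ (Complex.I * Real.pi * x) = Complex.I * Real.pi * φ x) {ρ : ℂ} (hρ : ρ ≠ 0) :
    Tendsto (fun z => twistedEval Φ z (sincPoly ρ)) (𝓝[≠] 0) (𝓝 (φ ρ / ρ)) := by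
  have hpi : (Real.pi : ℂ) ≠ 0 := Complex.ofReal_ne_zero.2 Real.pi_ne_zero
  set a := Complex.I * Real.pi * φ ρ with ha
  have hd : HasDerivAt (fun z => Complex.sinh (a * z)) a 0 := by
    have h1 : HasDerivAt (fun z : ℂ => a * z) a 0 := by
      simpa using (hasDerivAt_id (0 : ℂ)).const_mul a
    simpa using h1.csinh
  have h2 := (hasDerivAt_iff_tendsto_slope_zero.1 hd).div_const (Complex.I * Real.pi * ρ)
  have h3 : a / (Complex.I * Real.pi * ρ) = φ ρ / ρ := by
    rw [ha, mul_div_mul_left _ _ (mul_ne_zero Complex.I_ne_zero hpi)]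
  rw [h3] at h2
  refine h2.congr' ?_
  filter_upwards [self_mem_nhdsWithin] with z hz
  rw [twistedEval_sincPoly Φ hz, hΦ, ← ha, mul_zero, Complex.sinh_zero, sub_zero, zero_add,
    smul_eq_mul]
  field_simp

/-- The relation is formal, in the group algebra, so it survives the substitution of frequencies by
any additive map; then z → 0. Conjugating φ by multiplication with iπ makes it act on the roots ρ
themselves. -/
theorem eval_eq_zero_of_aeval_evenPoly {M : Type} [Fintype M] {r : M → ℕ+} {κ : ℂ}
    {P : MvPolynomial M ℂ} (hP : MvPolynomial.aeval (fun m => evenPoly κ (r m)) P = 0) (φ : ℂ →+ ℂ) :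
    MvPolynomial.eval (fun m => ∏ ρ ∈ halfRoots κ (r m), φ ρ / ρ) P = 0 := by
  have hpi : (Real.pi : ℂ) ≠ 0 := Complex.ofReal_ne_zero.2 Real.pi_ne_zero
  set a := Complex.I * (Real.pi : ℂ) with ha
  have ha0 : a ≠ 0 := mul_ne_zero Complex.I_ne_zero hpi
  set Φ : ℂ →+ ℂ := (AddMonoidHom.mulLeft a).comp (φ.comp (AddMonoidHom.mulLeft a⁻¹)) with hΦdef
  have hΦ : ∀ x, Φ (a * x) = a * φ x := fun x => by
    change a * φ (a⁻¹ * (a * x)) = a * φ x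
    rw [inv_mul_cancel_left₀ ha0]
  have hlim : Tendsto (fun z => fun m => twistedEval Φ z (evenPoly κ (r m))) (𝓝[≠] 0)
      (𝓝 fun m => ∏ ρ ∈ halfRoots κ (r m), φ ρ / ρ) := by
    refine tendsto_pi_nhds.2 fun m => ?_
    simp only [evenPoly, map_prod]
    exact tendsto_finsetProd _ fun ρ hρ => tendsto_twistedEval_sincPoly φ Φ hΦ
      (ne_zero_of_mem_signedRoots (Finset.mem_filter.1 hρ).1)
  have h1 := ((MvPolynomial.continuous_eval P).tendsto _).comp hlim
  refine tendsto_nhds_unique h1 (tendsto_const_nhds.congr fun z => ?_)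
  have h2 := congrArg (twistedEval Φ z) hP
  rw [map_zero, MvPolynomial.comp_aeval_apply] at h2
  exact h2.symm

/-- Taking φ(w) = w + ∑ ε_k w^(1+2j_k) on roots of unity, a relation must vanish at the products of
1 + ∑ ε_k ρ^(2j_k) for all ε. The Jacobian of these products at ε = 0 has entries ∑ ρ^(2j_k), which
are nonzero exactly when m_i divides m_k; since m is increasing, the matrix is triangular with
nonzero diagonal. -/
theorem algebraicIndependent_evenPoly {M : Type} [Fintype M] [LinearOrder M] {m : M → ℕ+}
    (hm : StrictMono m) {κ : ℂ} (h : ∀ i, ∀ ρ ∈ signedRoots (2 * m i), (ρ * κ).re ≠ 0) :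
    AlgebraicIndependent ℂ fun i => evenPoly κ (2 * m i) := by
  rw [algebraicIndependent_iff]
  intro P hP
  set R := Finset.univ.sup fun i => (m i : ℕ) with hR
  have hmR : ∀ i, (m i : ℕ) ≤ R := fun i =>
    Finset.le_sup (f := fun i => (m i : ℕ)) (Finset.mem_univ i)
  choose j hj hco using fun i => exists_exponent R (m i).pos
  have hN : 0 < 4 * R.factorial := Nat.mul_pos (by norm_num) R.factorial_pos
  choose g hg using fun i => exists_additive_pow hN (hco i)
  have hroot : ∀ i, ∀ ρ ∈ signedRoots (2 * m i), ρ ^ (4 * R.factorial) = 1 := fun i ρ hρ => by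
    obtain ⟨c, hc⟩ := Nat.dvd_factorial (m i).pos (hmR i)
    have h1 : 4 * R.factorial = ((2 * m i : ℕ+) : ℕ) * (2 * c) := by
      rw [hc, PNat.mul_coe]
      change 4 * ((m i : ℕ) * c) = 2 * (m i : ℕ) * (2 * c)
      ring
    rw [h1, pow_mul, mem_signedRoots.1 hρ, pow_right_comm, (even_two_mul c).neg_one_pow, one_pow]
  set X : M → MvPolynomial M ℂ := fun i => ∏ ρ ∈ halfRoots κ (2 * m i),
    (1 + ∑ k, MvPolynomial.C (ρ ^ (2 * j k)) * MvPolynomial.X k) with hX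
  have hXP : MvPolynomial.aeval X P = 0 := by
    refine MvPolynomial.funext fun ε => ?_
    set φ : ℂ →+ ℂ := AddMonoidHom.id ℂ + ∑ k, (AddMonoidHom.mulLeft (ε k)).comp (g k) with hφ
    have h1 := eval_eq_zero_of_aeval_evenPoly hP φ
    have h2 : (fun i => ∏ ρ ∈ halfRoots κ (2 * m i), φ ρ / ρ) =
        fun i => MvPolynomial.eval ε (X i) := by
      funext i
      rw [hX, map_prod]
      refine Finset.prod_congr rfl fun ρ hρ => ?_
      have hρ' := (Finset.mem_filter.1 hρ).1
      have hρ0 := ne_zero_of_mem_signedRoots hρ'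
      have h3 : φ ρ = ρ + ∑ k, ε k * ρ ^ (1 + 2 * j k) := by
        rw [hφ, AddMonoidHom.add_apply, AddMonoidHom.finsetSum_apply]
        refine congrArg₂ (· + ·) rfl (Finset.sum_congr rfl fun k _ => ?_)
        exact congrArg (ε k * ·) (hg k ρ (hroot i ρ hρ'))
      rw [h3, map_add, map_one, map_sum, add_div, div_self hρ0, Finset.sum_div]
      congr 1
      refine Finset.sum_congr rfl fun k _ => ?_
      rw [map_mul, MvPolynomial.eval_C, MvPolynomial.eval_X, pow_add, pow_one]
      field_simp
    rw [h2] at h1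
    rw [map_zero, ← h1, ← MvPolynomial.coe_aeval_eq_eval, ← MvPolynomial.coe_aeval_eq_eval]
    exact MvPolynomial.comp_aeval_apply X (MvPolynomial.aeval ε) P
  refine algebraicIndependent_of_jacobian X ?_ hXP
  have hJ : ∀ i k, MvPolynomial.eval 0 (MvPolynomial.pderiv k (X i)) =
      ∑ ρ ∈ halfRoots κ (2 * m i), ρ ^ (2 * j k) := fun i k => by
    rw [hX, eval_pderiv_prod _ _ (fun ρ _ => by simp)]
    refine Finset.sum_congr rfl fun ρ _ => ?_
    have h1 : ∀ l, MvPolynomial.pderiv k (MvPolynomial.C (ρ ^ (2 * j l)) * MvPolynomial.X l) =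
        (if k = l then MvPolynomial.C (ρ ^ (2 * j l)) else 0 : MvPolynomial M ℂ) := fun l => by
      rw [MvPolynomial.pderiv_C_mul]
      split_ifs with hkl
      · rw [hkl, MvPolynomial.pderiv_X_self, mul_one]
      · rw [MvPolynomial.pderiv_X_of_ne (Ne.symm hkl), mul_zero]
    rw [map_add, MvPolynomial.pderiv_one, zero_add, map_sum, Finset.sum_congr rfl fun l _ => h1 l,
      Finset.sum_ite_eq, if_pos (Finset.mem_univ _), MvPolynomial.eval_C]
  have heven : ∀ i, Even ((2 * m i : ℕ+) : ℕ) := fun i => ⟨m i, by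
    rw [PNat.mul_coe]
    change 2 * (m i : ℕ) = _
    ring⟩
  have hhalf : ∀ i k, 2 * ∑ ρ ∈ halfRoots κ (2 * m i), ρ ^ (2 * j k) =
      ∑ ρ ∈ signedRoots (2 * m i), ρ ^ (2 * j k) := fun i k => by
    rw [sum_halfRoots (heven i) (h i) fun ρ => ρ ^ (2 * j k), Finset.mul_sum]
    refine Finset.sum_congr rfl fun ρ _ => ?_
    rw [(even_two_mul (j k)).neg_pow]
    ring
  have hdvd : ∀ i k, ((2 * m i : ℕ+) : ℕ) ∣ 2 * j k ↔ (m i : ℕ) ∣ (m k : ℕ) := fun i k => by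
    rw [← hj k (m i) (m i).pos (hmR i), PNat.mul_coe]
    exact Nat.mul_dvd_mul_iff_left two_pos
  have hzero : ∀ i k, k < i → ∑ ρ ∈ halfRoots κ (2 * m i), ρ ^ (2 * j k) = 0 := fun i k hki => by
    have h1 := hhalf i k
    rw [sum_pow_signedRoots, if_neg] at h1
    · exact (mul_eq_zero.1 h1).resolve_left two_ne_zero
    · rw [hdvd]
      intro h2
      have h3 := Nat.le_of_dvd (m k).pos h2
      exact absurd (hm hki) (not_lt.2 h3)
  have hdiag : ∀ i, ∑ ρ ∈ halfRoots κ (2 * m i), ρ ^ (2 * j i) ≠ 0 := fun i h0 => by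
    have h1 := hhalf i i
    rw [sum_pow_signedRoots, if_pos ((hdvd i i).2 dvd_rfl), h0, mul_zero] at h1
    refine mul_ne_zero (Nat.cast_ne_zero.2 (2 * m i).ne_zero) (pow_ne_zero _ (pow_ne_zero _ ?_))
      h1.symm
    norm_num
  have htri : (Matrix.of fun i k => MvPolynomial.eval 0
      (MvPolynomial.pderiv k (X i))).IsUpperTriangular :=
    fun i k hki => (hJ i k).trans (hzero i k hki)
  rw [Matrix.det_of_isUpperTriangular htri]
  exact Finset.prod_ne_zero_iff.2 fun i _ => by
    rw [Matrix.of_apply, hJ]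
    exact hdiag i

/-! ### Exponential growth of exponential sums -/

/-- At most exponential growth, on all rays close to the direction `κ`. -/
def ExpGrowth (κ : ℂ) (f : ℂ → ℂ) : Prop :=
  ∃ ε > 0, ∀ κ' : ℂ, ‖κ'‖ = 1 → ‖κ' - κ‖ < ε → ∃ M D : ℝ, ∀ x : ℝ, 1 ≤ x →
    ‖f (x * κ')‖ ≤ D * Real.exp (M * x)

theorem SuperDecay.expGrowth {κ : ℂ} {f : ℂ → ℂ} (hf : SuperDecay κ f) : ExpGrowth κ f := by
  obtain ⟨ε, hε, h⟩ := hf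
  refine ⟨ε, hε, fun κ' hκ' hd => ?_⟩
  obtain ⟨D, hD⟩ := h κ' hκ' hd 0
  exact ⟨-0, D, hD⟩

theorem ExpGrowth.add {κ : ℂ} {f g : ℂ → ℂ} (hf : ExpGrowth κ f) (hg : ExpGrowth κ g) :
    ExpGrowth κ fun z => f z + g z := by
  obtain ⟨ε, hε, hf⟩ := hf
  obtain ⟨ε', hε', hg⟩ := hg
  refine ⟨min ε ε', lt_min hε hε', fun κ' hκ' hd => ?_⟩
  obtain ⟨M, D, h⟩ := hf κ' hκ' (hd.trans_le (min_le_left _ _))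
  obtain ⟨M', D', h'⟩ := hg κ' hκ' (hd.trans_le (min_le_right _ _))
  refine ⟨max M M', |D| + |D'|, fun x hx => (norm_add_le _ _).trans ?_⟩
  rw [add_mul]
  refine add_le_add ((h x hx).trans ?_) ((h' x hx).trans ?_)
  · refine mul_le_mul (le_abs_self _) (Real.exp_le_exp.2 ?_) (Real.exp_pos _).le (abs_nonneg _)
    nlinarith [le_max_left M M']
  · refine mul_le_mul (le_abs_self _) (Real.exp_le_exp.2 ?_) (Real.exp_pos _).le (abs_nonneg _)
    nlinarith [le_max_right M M']

theorem ExpGrowth.mul {κ : ℂ} {f g : ℂ → ℂ} (hf : ExpGrowth κ f) (hg : ExpGrowth κ g) :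
    ExpGrowth κ fun z => f z * g z := by
  obtain ⟨ε, hε, hf⟩ := hf
  obtain ⟨ε', hε', hg⟩ := hg
  refine ⟨min ε ε', lt_min hε hε', fun κ' hκ' hd => ?_⟩
  obtain ⟨M, D, h⟩ := hf κ' hκ' (hd.trans_le (min_le_left _ _))
  obtain ⟨M', D', h'⟩ := hg κ' hκ' (hd.trans_le (min_le_right _ _))
  refine ⟨M + M', D * D', fun x hx => ?_⟩
  rw [norm_mul, add_mul, Real.exp_add, mul_mul_mul_comm]
  exact mul_le_mul (h x hx) (h' x hx) (norm_nonneg _) ((norm_nonneg _).trans (h x hx))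

theorem SuperDecay.mul_expGrowth {κ : ℂ} {f g : ℂ → ℂ} (hf : SuperDecay κ f) (hg : ExpGrowth κ g) :
    SuperDecay κ fun z => f z * g z := by
  obtain ⟨ε, hε, hf⟩ := hf
  obtain ⟨ε', hε', hg⟩ := hg
  refine ⟨min ε ε', lt_min hε hε', fun κ' hκ' hd M => ?_⟩
  obtain ⟨M', D', h'⟩ := hg κ' hκ' (hd.trans_le (min_le_right _ _))
  obtain ⟨D, h⟩ := hf κ' hκ' (hd.trans_le (min_le_left _ _)) (M + M')
  refine ⟨D * D', fun x hx => ?_⟩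
  rw [norm_mul]
  refine (mul_le_mul (h x hx) (h' x hx) (norm_nonneg _)
    ((norm_nonneg _).trans (h x hx))).trans_eq ?_
  rw [mul_mul_mul_comm, ← Real.exp_add]
  congr 2
  ring

theorem SuperDecay.congr {κ : ℂ} (hκ : ‖κ‖ = 1) {f g : ℂ → ℂ} (hf : SuperDecay κ f)
    (h : ∀ z ∈ halfPlane κ, f z = g z) : SuperDecay κ g := by
  obtain ⟨ε, hε, hf⟩ := hf
  refine ⟨min ε 1, lt_min hε one_pos, fun κ' hκ' hd M => ?_⟩
  obtain ⟨D, hD⟩ := hf κ' hκ' (hd.trans_le (min_le_left _ _)) M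
  refine ⟨D, fun x hx => ?_⟩
  rw [← h _ (ray_mem_halfPlane hκ hκ' (hd.trans_le (min_le_right _ _)) (by linarith))]
  exact hD x hx

theorem expGrowth_const (κ a : ℂ) : ExpGrowth κ fun _ => a :=
  ⟨1, one_pos, fun _ _ _ => ⟨0, ‖a‖, fun _ _ => by simp⟩⟩

theorem expGrowth_exp (κ e : ℂ) : ExpGrowth κ fun z => Complex.exp (e * z) := by
  refine ⟨1, one_pos, fun κ' _ _ => ⟨(e * κ').re, 1, fun x _ => ?_⟩⟩
  rw [Complex.norm_exp, mul_left_comm, Complex.re_ofReal_mul, mul_comm x, one_mul]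

theorem IsTame.expGrowth {κ : ℂ} (hκ : ‖κ‖ = 1) {B : ℂ → ℂ} (hB : IsTame κ B) : ExpGrowth κ B := by
  obtain ⟨c, hc, C, k, h⟩ := hB
  refine ⟨1, one_pos, fun κ' hκ' hd => ⟨1, |C| * (Nat.factorial k / 1 ^ k), fun x hx => ?_⟩⟩
  have hx0 : 0 < x := by linarith
  have hnorm : ‖(x : ℂ) * κ'‖ = x := by
    rw [norm_mul, hκ', mul_one, Complex.norm_real, Real.norm_of_nonneg hx0.le]
  have hray := ray_mem_halfPlane hκ hκ' hd hx0
  have h1 := (h _ (ne_zero_of_mem_halfPlane hray) (by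
    have h4 := mem_halfPlane.1 hray
    have h5 := mul_nonneg hc.le (norm_nonneg ((x : ℂ) * κ'))
    linarith)).2 (by rw [hnorm]; exact hx)
  rw [hnorm] at h1
  refine h1.trans ?_
  rw [mul_assoc]
  exact mul_le_mul (le_abs_self C) (pow_le_mul_exp one_pos k hx0.le) (by positivity) (abs_nonneg _)

theorem expGrowth_expSum {κ : ℂ} (hκ : ‖κ‖ = 1) (Q : AddMonoidAlgebra (tame κ) ℂ) :
    ExpGrowth κ (expSum κ Q) := by
  classical
  have h : ∀ F : Finset ℂ, ExpGrowth κ fun z => ∑ e ∈ F,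
      Complex.exp (e * z) * (Q.coeff e : ℂ → ℂ) z := fun F => by
    induction F using Finset.induction_on with
    | empty => simpa using expGrowth_const κ 0
    | insert a F ha ih =>
      simp only [Finset.sum_insert ha]
      exact ((expGrowth_exp κ a).mul (IsTame.expGrowth hκ (Q.coeff a).2)).add ih
  have h1 : expSum κ Q = fun z => ∑ e ∈ Q.coeff.support,
      Complex.exp (e * z) * (Q.coeff e : ℂ → ℂ) z := funext (expSum_apply κ Q)
  rw [h1]
  exact h _

/-- A function that decays faster than any exponential is transcendental over exponential sums with
tame coefficients. -/
theorem expSum_eq_zero_of_polynomial {κ : ℂ} (hκ : ‖κ‖ = 1) {f : ℂ → ℂ} (hf : SuperDecay κ f)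
    (hf0 : ∀ z ∈ halfPlane κ, f z ≠ 0) (n : ℕ) (Q : ℕ → AddMonoidAlgebra (tame κ) ℂ)
    (h : ∀ z ∈ halfPlane κ, ∑ j ∈ Finset.range n, expSum κ (Q j) z * f z ^ j = 0) :
    ∀ j < n, ∀ z ∈ halfPlane κ, expSum κ (Q j) z = 0 := by
  induction n generalizing Q with
  | zero => exact fun j hj => absurd hj (Nat.not_lt_zero j)
  | succ n ih =>
    have hsum : ∀ z, ∑ j ∈ Finset.range (n + 1), expSum κ (Q j) z * f z ^ j =
        f z * (∑ j ∈ Finset.range n, expSum κ (Q (j + 1)) z * f z ^ j) + expSum κ (Q 0) z := by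
      intro z
      rw [Finset.sum_range_succ', pow_zero, mul_one, Finset.mul_sum]
      congr 1
      exact Finset.sum_congr rfl fun j _ => by rw [pow_succ]; ring
    have hgrow : ∀ m, ExpGrowth κ fun z =>
        ∑ j ∈ Finset.range m, expSum κ (Q (j + 1)) z * f z ^ j := fun m => by
      have hpow : ∀ j : ℕ, ExpGrowth κ fun z => f z ^ j := fun j => by
        induction j with
        | zero => simpa using expGrowth_const κ 1
        | succ j ihj =>
          simp only [pow_succ]
          exact ihj.mul hf.expGrowth
      induction m with
      | zero => simpa using expGrowth_const κ 0
      | succ m ihm =>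
        simp only [Finset.sum_range_succ]
        exact ihm.add ((expGrowth_expSum hκ _).mul (hpow m))
    -- The constant coefficient is -f times a function of at most exponential growth, so it decays
    -- superexponentially and vanishes; f is then divided out.
    have h0 : ∀ z ∈ halfPlane κ, expSum κ (Q 0) z = 0 := by
      have hdec : SuperDecay κ (expSum κ (Q 0)) := by
        refine (hf.mul_expGrowth ((expGrowth_const κ (-1)).mul (hgrow n))).congr hκ fun z hz => ?_
        have h1 := h z hz
        rw [hsum] at h1
        linear_combination -h1
      intro z hz
      rw [expSum_apply]
      exact Finset.sum_eq_zero fun e _ => by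
        rw [coeff_eq_zero_of_superDecay hκ _ hdec e z hz, mul_zero]
    have hrest := ih (fun j => Q (j + 1)) fun z hz => by
      have h1 := h z hz
      rw [hsum, h0 z hz, add_zero] at h1
      exact (mul_eq_zero.1 h1).resolve_left (hf0 z hz)
    intro j hj
    rcases j with _ | j
    · exact h0
    · exact hrest j (Nat.lt_of_succ_lt_succ hj)

/-! ### Algebraic independence of the functions `eulerian r` -/

/-- Exponential polynomials act on the functions on a half-plane. -/
instance expPolyAlgebra (κ : ℂ) : Algebra ExpPoly (halfPlane κ → ℂ) :=
  (RingHom.pi fun z : halfPlane κ => (expEval (z : ℂ)).toRingHom).toAlgebra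

theorem algebraMap_expPoly (κ : ℂ) (A : ExpPoly) (z : halfPlane κ) :
    algebraMap ExpPoly (halfPlane κ → ℂ) A z = expEval (z : ℂ) A := rfl

instance expPoly_isScalarTower (κ : ℂ) : IsScalarTower ℂ ExpPoly (halfPlane κ → ℂ) :=
  IsScalarTower.of_algebraMap_eq fun c => funext fun z =>
    ((expEval (z : ℂ)).commutes c).symm

/-- The restriction of `eulerian r` to a half-plane. -/
def eulerianOn (κ : ℂ) (r : ℕ+) : halfPlane κ → ℂ := fun z => eulerian r z

/-- All functions of order r > 1 are exponential sums with tame coefficients in an admissible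
direction, so everything generated by them is covered by the transcendence criterion for 1/Γ(1+z).
-/
theorem mem_range_expSum_of_mem_adjoin {σ : Type} {o : σ → ℕ+} (ho : ∀ s, 1 < o s) {κ : ℂ} (hκ : ‖κ‖ = 1)
    (hadm : Admissible o κ) {a : halfPlane κ → ℂ}
    (ha : a ∈ Algebra.adjoin ExpPoly (Set.range fun s => eulerianOn κ (o s))) :
    ∃ Q : AddMonoidAlgebra (tame κ) ℂ, ∀ z : halfPlane κ, a z = expSum κ Q z := by
  induction ha using Algebra.adjoin_induction with
  | mem a h =>
    obtain ⟨s, rfl⟩ := h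
    refine ⟨expTame κ (dirSinc κ (o s)) * AddMonoidAlgebra.single (dirRate κ (o s))
      ⟨_, isTame_dirGamma hκ (ho s) (hadm s)⟩, fun z => ?_⟩
    rw [map_mul, Pi.mul_apply, expSum_expTame, expSum_single, ← mul_assoc (Complex.exp _),
      ← Complex.exp_add, add_neg_cancel, Complex.exp_zero, one_mul]
    exact eulerian_eq_dirSinc_mul hκ (hadm s) z.2
  | algebraMap A => exact ⟨expTame κ A, fun z => (expSum_expTame κ z A).symm⟩
  | add a b _ _ ha hb =>
    obtain ⟨Q, hQ⟩ := ha
    obtain ⟨Q', hQ'⟩ := hb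
    exact ⟨Q + Q', fun z => by rw [map_add, Pi.add_apply, Pi.add_apply, hQ, hQ']⟩
  | mul a b _ _ ha hb =>
    obtain ⟨Q, hQ⟩ := ha
    obtain ⟨Q', hQ'⟩ := hb
    exact ⟨Q * Q', fun z => by rw [map_mul, Pi.mul_apply, Pi.mul_apply, hQ, hQ']⟩

section Relations

variable {σ : Type} [Fintype σ]

theorem algebraicIndependent_odd {o : σ → ℕ+} (hinj : Function.Injective o) (ho : ∀ s, 1 < o s)
    (hodd : ∀ s, Odd (o s : ℕ)) {κ : ℂ} (hκ : ‖κ‖ = 1) :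
    AlgebraicIndependent ExpPoly fun s => eulerianOn κ (o s) := by
  classical
  rw [algebraicIndependent_iff]
  intro p hp
  set S : Finset (σ → ℕ) := p.support.map ⟨_, DFunLike.coe_injective⟩ with hS
  set A : (σ → ℕ) → ExpPoly := fun β => p.coeff (Finsupp.equivFunOnFinite.symm β) with hA
  have hrel : EulerRelation o S A := EulerRelation.of_halfPlane hκ fun z hz => by
    have h1 := congrFun hp ⟨z, hz⟩
    rw [MvPolynomial.aeval_def, MvPolynomial.eval₂_eq', Finset.sum_apply] at h1
    rw [hS, Finset.sum_map]
    refine Eq.trans (Finset.sum_congr rfl fun d _ => ?_) h1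
    rw [Pi.mul_apply, Finset.prod_apply]
    refine congrArg₂ (· * ·) ?_ rfl
    rw [algebraMap_expPoly]
    congr 1
    rw [hA]
    exact congrArg p.coeff (Finsupp.equivFunOnFinite.symm_apply_apply d)
  refine MvPolynomial.ext _ _ fun d => ?_
  by_cases hd : d ∈ p.support
  · have h1 := hrel.eq_zero hinj ho hodd d (Finset.mem_map_of_mem _ hd)
    rw [hA] at h1
    rw [MvPolynomial.coeff_zero, ← h1]
    exact congrArg p.coeff (Finsupp.equivFunOnFinite.symm_apply_apply d).symm
  · rw [MvPolynomial.coeff_zero]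
    exact MvPolynomial.notMem_support_iff.1 hd

theorem signedRoots_one : signedRoots 1 = {1} := by
  ext ρ
  rw [mem_signedRoots, Finset.mem_singleton]
  simp

theorem eulerian_one (z : ℂ) : eulerian 1 z = rGamma z := by
  rw [eulerian, signedRoots_one, Finset.prod_singleton, one_mul]

/-- 1/Γ(1+z) decays superexponentially when Re κ > 0, hence is transcendental over the algebra
generated by the other functions. -/
theorem algebraicIndependent_odd_one {o : σ → ℕ+} (hinj : Function.Injective o) (ho : ∀ s, 1 < o s)
    (hodd : ∀ s, Odd (o s : ℕ)) {κ : ℂ} (hκ : ‖κ‖ = 1) (hre : 0 < κ.re) (hadm : Admissible o κ) :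
    AlgebraicIndependent ExpPoly
      fun s : Option σ => s.elim (eulerianOn κ 1) fun s => eulerianOn κ (o s) := by
  refine ((algebraicIndependent_odd hinj ho hodd hκ).option_iff_transcendental _).2 ?_
  rw [transcendental_iff]
  intro p hp
  choose Q hQ using fun j => mem_range_expSum_of_mem_adjoin ho hκ hadm (p.coeff j).2
  have hf0 : ∀ z ∈ halfPlane κ, rGamma z ≠ 0 := fun z hz => by
    have h1 : ((1 : ℂ) * κ).re ≠ 0 := by rw [one_mul]; exact hre.ne'
    have h2 := gammaFactor_ne_zero hκ norm_one h1 hz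
    rwa [gammaFactor, if_pos (by rwa [one_mul]), one_mul] at h2
  have hzero := expSum_eq_zero_of_polynomial hκ (superDecay_rGamma hre) hf0 (p.natDegree + 1) Q
    fun z hz => by
      have h1 := congrFun hp ⟨z, hz⟩
      rw [Polynomial.aeval_eq_sum_range, Finset.sum_apply] at h1
      refine Eq.trans (Finset.sum_congr rfl fun j _ => ?_) h1
      rw [Algebra.smul_def, Pi.mul_apply, Pi.pow_apply]
      refine congrArg₂ (· * ·) (hQ j ⟨z, hz⟩).symm ?_
      exact congrArg (· ^ j) (eulerian_one z).symm
  refine Polynomial.ext fun j => Subtype.ext (funext fun z => ?_)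
  rw [hQ j z]
  by_cases hj : j < p.natDegree + 1
  · exact hzero j hj z z.2
  · have h1 : p.coeff j = 0 := Polynomial.coeff_eq_zero_of_natDegree_lt (by omega)
    rw [← hQ j z, h1]
    rfl

end Relations

/-- A tower: the even orders are independent inside the exponential polynomials, and the odd orders,
including 1, are independent over them. One direction κ is chosen admissible for all orders at once;
the even orders 2m with m ≤ R are more than needed, which is harmless. -/
theorem algebraicIndependent_eulerianOn (R : ℕ+) : ∃ κ : ℂ, ‖κ‖ = 1 ∧
    AlgebraicIndependent ℂ fun r : Set.Iic R => eulerianOn κ r := by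
  classical
  let O : Finset ℕ+ := (Finset.Icc 1 R).filter fun r : ℕ+ => Odd (r : ℕ) ∧ 1 < r
  let M : Finset ℕ+ := Finset.Icc 1 R
  obtain ⟨κ, hκ, hre, hadm⟩ := exists_admissible
    (Sum.elim (fun s : O => s.1) fun m : M => 2 * m.1)
  have h1 := algebraicIndependent_odd_one (o := fun s : O => s.1) Subtype.val_injective
    (fun s => (Finset.mem_filter.1 s.2).2.2) (fun s => (Finset.mem_filter.1 s.2).2.1) hκ hre
    fun s => hadm (Sum.inl s)
  have h2 := algebraicIndependent_evenPoly (m := fun m : M => m.1) (fun _ _ h => h)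
    (κ := κ) fun m => hadm (Sum.inr m)
  have h3 := AlgebraicIndependent.sumElim_comp h2 h1
  have h4 : ∀ r : Set.Iic R, ∃ i : Option O ⊕ M,
      Sum.elim (fun o : Option O => o.elim 1 fun s : O => s.1) (fun m : M => 2 * m.1) i = r := by
    rintro ⟨r, hr⟩
    have hrR : r ≤ R := hr
    rcases Nat.even_or_odd (r : ℕ) with he | hodd
    · obtain ⟨c, hc⟩ := he
      lift c to ℕ+ using by have := r.pos; omega
      have hrc : r = 2 * c := PNat.coe_injective (by
        rw [PNat.mul_coe]
        change (r : ℕ) = 2 * (c : ℕ)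
        omega)
      have hcR : c ≤ R := by
        rw [← PNat.coe_le_coe] at hrR ⊢
        omega
      exact ⟨Sum.inr ⟨c, Finset.mem_Icc.2 ⟨one_le, hcR⟩⟩, hrc.symm⟩
    · rcases eq_or_ne r 1 with h | h
      · exact ⟨Sum.inl none, h.symm⟩
      · refine ⟨Sum.inl (some ⟨r, Finset.mem_filter.2 ⟨Finset.mem_Icc.2 ⟨one_le, hrR⟩, hodd,
          lt_of_le_of_ne one_le (Ne.symm h)⟩⟩), rfl⟩
  choose i hi using h4
  have hinj : Function.Injective i := fun r r' h => Subtype.ext (by rw [← hi r, ← hi r', h])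
  refine ⟨κ, hκ, ?_⟩
  have h5 := h3.comp i hinj
  have h6 : (fun r : Set.Iic R => eulerianOn κ r) = (Sum.elim
      (fun s : Option O => s.elim (eulerianOn κ 1) fun s : O => eulerianOn κ s.1)
      (algebraMap ExpPoly (halfPlane κ → ℂ) ∘ fun m : M => evenPoly κ (2 * m.1))) ∘ i := by
    funext r
    have h7 := hi r
    rw [Function.comp_apply, ← h7]
    rcases i r with (_ | s) | m
    · rfl
    · rfl
    · funext z
      have he : Even ((2 * m.1 : ℕ+) : ℕ) := ⟨m.1, by
        rw [PNat.mul_coe]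
        change 2 * (m.1 : ℕ) = _
        ring⟩
      exact eulerian_eq_evenPoly he (hadm (Sum.inr m)) (ne_zero_of_mem_halfPlane z.2)
  rw [h6]
  exact h5

/-! ### The algebra generated by the `y_r^*` -/

/-- A relation involves finitely many r. It holds on the disc between entire functions, hence on all
of ℂ, and in particular on the half-plane where independence is known. -/
theorem algebraicIndependent_invGammaY : AlgebraicIndependent ℂ invGammaY := by
  refine algebraicIndependent_of_finite_type fun t ht => ?_
  obtain ⟨R, hR⟩ := ht.bddAbove
  obtain ⟨κ, -, hind⟩ := algebraicIndependent_eulerianOn R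
  have hind' := hind.comp (Set.inclusion fun r hr => hR hr) (Set.inclusion_injective _)
  refine algebraicIndependent_iff.2 fun P hP => algebraicIndependent_iff.1 hind' P ?_
  set F : ℂ → ℂ := fun z => MvPolynomial.aeval (fun r : t => eulerian r z) P with hF
  have hdiff : Differentiable ℂ F := by
    have h1 : F = fun z => ∑ d ∈ P.support, P.coeff d * ∏ r ∈ d.support, eulerian r z ^ d r := by
      funext z
      exact MvPolynomial.eval₂_eq _ _ _
    rw [h1]
    intro z
    refine DifferentiableAt.fun_sum fun d _ => (differentiableAt_const _).mul ?_
    exact DifferentiableAt.fun_finsetProd fun r _ => (differentiable_eulerian _ z).pow _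
  have hdisc : ∀ z ∈ Metric.ball (0 : ℂ) 1, F z = 0 := fun z hz => by
    have h1 := MvPolynomial.comp_aeval_apply (fun r : t => invGammaY r)
      (Pi.evalAlgHom ℂ (fun _ : Metric.ball (0 : ℂ) 1 => ℂ) ⟨z, hz⟩) P
    rw [hP, map_zero] at h1
    refine Eq.trans ?_ h1.symm
    exact congrArg (fun f => MvPolynomial.aeval f P)
      (funext fun r : t => (invGammaY_eq_eulerian r ⟨z, hz⟩).symm)
  have hzero : ∀ z, F z = 0 := fun z =>
    (Complex.analyticOnNhd_univ_iff_differentiable.2 hdiff).eqOn_zero_of_preconnected_of_eventuallyEq_zero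
      isPreconnected_univ (Set.mem_univ 0)
      (Filter.eventually_of_mem (Metric.ball_mem_nhds 0 one_pos) hdisc) (Set.mem_univ z)
  funext z
  refine Eq.trans ?_ (hzero z)
  exact MvPolynomial.comp_aeval_apply _ (Pi.evalAlgHom ℂ (fun _ : halfPlane κ => ℂ) z) P

theorem aeval_yStar_monomial (d : ℕ+ →₀ ℕ) (c : ℂ) :
    MvPolynomial.aeval yStar (MvPolynomial.monomial d c) =
      algebraMap ℂ (ShuffleSeries ℕ+) c *
        QSeries.charSeries (noContraction ℕ+) fun r => (d r : ℂ) := by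
  classical
  have h1 : ∀ r, yStar r = Shuffle.charHom ℕ+ (Multiplicative.ofAdd (Pi.single r 1)) := fun r => by
    refine (QSeries.of_letterStar 1 r).trans ?_
    refine congrArg (QSeries.charSeries _) (funext fun s => ?_)
    rw [toAdd_ofAdd, Pi.single_apply]
    congr
  rw [MvPolynomial.aeval_monomial]
  congr 1
  simp only [Finsupp.prod, h1, ← map_pow, ← map_prod, ← ofAdd_nsmul, ← ofAdd_sum]
  refine congrArg (QSeries.charSeries _) (funext fun s => ?_)
  rw [toAdd_ofAdd, Finset.sum_apply]
  simp +contextual [Pi.single_apply]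

/-- The monomial with exponents d is the multiplicative series with coefficients d(r). Distinct d
give distinct families over ℂ, and distinct multiplicative series are linearly independent. -/
theorem algebraicIndependent_yStar : AlgebraicIndependent ℂ yStar := by
  classical
  refine algebraicIndependent_iff.2 fun P hP => ?_
  let e : (ℕ+ →₀ ℕ) → ℕ+ → ℂ := fun d r => d r
  have he : Function.Injective e := fun d d' h =>
    Finsupp.ext fun r => Nat.cast_injective (congrFun h r)
  let c : (ℕ+ → ℂ) → ℂ := fun χ => P.coeff (Function.invFun e χ)
  have hc : ∀ d, c (e d) = P.coeff d := fun d => by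
    change P.coeff (Function.invFun e (e d)) = _
    rw [Function.leftInverse_invFun he]
  have h1 : ∑ χ ∈ P.support.image e,
      algebraMap ℂ (ShuffleSeries ℕ+) (c χ) * QSeries.charSeries (noContraction ℕ+) χ = 0 := by
    rw [Finset.sum_image fun _ _ _ _ h => he h, ← hP]
    conv_rhs => rw [P.as_sum, map_sum]
    exact Finset.sum_congr rfl fun d _ => by rw [hc, aeval_yStar_monomial]
  have h2 := Shuffle.charSeries_independent _ _ (fun χ => Subalgebra.algebraMap_mem _ _) h1
  refine MvPolynomial.ext _ _ fun d => ?_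
  rw [MvPolynomial.coeff_zero]
  by_contra hd
  have h3 := h2 (e d) (Finset.mem_image_of_mem _ (MvPolynomial.mem_support_iff.2 hd))
  rw [hc] at h3
  rw [Algebra.algebraMap_eq_smul_one] at h3
  have h4 := congrFun h3 []
  rw [QSeries.smul_apply'] at h4
  exact hd ((mul_one _).symm.trans h4)

/-- Independence of the y_r^* makes the source a polynomial algebra, so the morphism exists;
independence of the functions makes it injective. -/
theorem exists_yStar_embedding : ∃ Φ : yStarAlgebra →ₐ[ℂ] algE,
    (∀ r : ℕ+, Φ ⟨yStar r, yStar_mem r⟩ = ⟨invGammaY r, invGammaY_mem r⟩) ∧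
      Function.Injective Φ := by
  let A : MvPolynomial ℕ+ ℂ ≃ₐ[ℂ] yStarAlgebra := algebraicIndependent_yStar.aevalEquiv
  let B : MvPolynomial ℕ+ ℂ →ₐ[ℂ] algE :=
    MvPolynomial.aeval fun r => ⟨invGammaY r, invGammaY_mem r⟩
  have hB : Function.Injective B := by
    have h1 : AlgebraicIndependent ℂ fun r => (⟨invGammaY r, invGammaY_mem r⟩ : algE) :=
      AlgebraicIndependent.of_comp algE.val algebraicIndependent_invGammaY
    exact h1
  refine ⟨B.comp A.symm.toAlgHom, fun r => ?_, hB.comp A.symm.injective⟩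
  have h2 : A (MvPolynomial.X r) = ⟨yStar r, yStar_mem r⟩ :=
    Subtype.ext (algebraicIndependent_yStar.aevalEquiv_apply_coe _ |>.trans
      (MvPolynomial.aeval_X _ _))
  rw [← h2]
  change B (A.symm (A (MvPolynomial.X r))) = _
  rw [AlgEquiv.symm_apply_apply]
  exact MvPolynomial.aeval_X _ _

end

theorem mainTheorem7 :
    (∃ Z : extendedDomain (noContraction (Fin 2)) →ₐ[ℂ] ℂ,
      (∀ w : List (Fin 2), IsZetaShuffleValue w (Z (wordElt _ w))) ∧
      ∀ t : ℂ, ‖t‖ < 1 → Z (starElt _ t 0) = 1 ∧ Z (starElt _ t 1) = 1) ∧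
    (∃ G : extendedDomain addContraction →ₐ[ℂ] ℂ,
      (∀ w : List ℕ+, IsGammaValue w (G (wordElt _ w))) ∧
      ∀ (r : ℕ+) (t : ℂ), ‖t‖ < 1 → G (starElt _ (t ^ (r : ℕ)) r) = (GammaY r (1 + t))⁻¹) ∧
    (∃ Φ : yStarAlgebra →ₐ[ℂ] algE,
      (∀ r : ℕ+, Φ ⟨yStar r, yStar_mem r⟩ = ⟨invGammaY r, invGammaY_mem r⟩) ∧
      Function.Injective Φ) ∧
    (∀ (r : ℕ+) (ξ η t : ℂ), ξ ^ (2 * (r : ℕ)) = -1 → η ^ (r : ℕ) = -1 → ‖t‖ < 1 →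
      GammaY (2 * r) (1 + ξ * t) = GammaY r (1 + t) * GammaY r (1 + η * t)) := by
  exact ⟨exists_zeta_extension, exists_gamma_extension, exists_yStar_embedding, GammaY_two_mul⟩
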